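/- **Setup.** Let $S$ be a noetherian scheme and $S\hookrightarrow\widetilde S$ a closed immersion whose ideal sheaf $\mathfrak a$ satisfies $\mathfrak a^2=0$. Let $(\widetilde X,\widetilde D)$ be a smooth pair over $\widetilde S$: $\widetilde X$ is a smooth $\widetilde S$-scheme and $\widetilde D=\sum_a\widetilde D_a$ is a relative simple normal crossings divisor, i.e. every point of $\widetilde X$ has an affine open neighbourhood $U$ with functions $x_1,\dots,x_n$ defining an étale map $U\to\mathbb A^n_{\widetilde S}$ such that the components $\widetilde D_a$ that meet $U$ are the loci $x_k=0$ for certain distinct $k$. Assume that the intersection of two affine open subsets of $\widetilde X$ is affine (i.e. $\widetilde X$ has affine diagonal). Let $(X,D)=(\widetilde X\times_{\widetilde S}S,\widetilde D\times_{\widetilde S}S)$ and $\mathcal I=\mathcal O_{\widetilde X}\cdot\mathfrak a=\ker(\mathcal O_{\widetilde X}\to\mathcal O_X)$, so $\mathcal I^2=0$ and $\mathcal I$ is an $\mathcal O_X$-module. A graded Higgs bundle $(E,\theta,\mathrm{Gr})$ over $(X,D)/S$ is a vector bundle $E$ of finite rank with a grading $E=\bigoplus_{\ell\in\mathbb Z}\mathrm{Gr}^\ell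 E$ by subbundles and an $\mathcal O_X$-linear map $\theta:E\to E\otimes\Omega^1_{X/S}(\log D)$ with $\theta(\mathrm{Gr}^\ell E)\subset\mathrm{Gr}^{\ell-1}E\otimes\Omega^1_{X/S}(\log D)$ and $\theta\wedge\theta=0$; similarly over $(\widetilde X,\widetilde D)/\widetilde S$. A graded lifting of $(E,\theta,\mathrm{Gr})$ is a graded Higgs bundle over $(\widetilde X,\widetilde D)/\widetilde S$ together with an isomorphism of its restriction to $X$ with $(E,\theta,\mathrm{Gr})$; isomorphisms of liftings are those that restrict to the identity of $E$. The complex $\mathrm{Gr}^0\mathrm{DR}(\mathscr End(E,\theta))_{\mathcal I}$ has the term $\mathrm{Gr}^{-k}\mathscr End(E)\otimes\mathcal I\otimes\Omega^k_{X/S}(\log D)$ in degree $k\ge 0$, and differential $\theta^{\mathrm{End}}(g\otimes\omega)=[\theta,g]\wedge\omega$. Its hypercohomology $\mathbb H^n$ is the colimit over the open coverings $\mathfrak U$ of the cohomology of the total complex of the double complex of Čech cochains $C^p(\mathfrak U,-^q)$, with differential $\delta+(-1)^p\theta^{\mathrm{End}}$. For $E',E''$ local liftings of $E$, homomorphisms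 $E'\to E''\otimes\Omega^k_{\widetilde X/\widetilde S}(\log\widetilde D)$ that vanish modulo $\mathcal I$ are identified with sections of $\mathscr End(E)\otimes\mathcal I\otimes\Omega^k_{X/S}(\log D)$ via $g\otimes r\otimes\omega\mapsto r\,g'\otimes\omega'$ for any lifts $g',\omega'$ of $g,\omega$. **Theorem.** Let $(E,\theta,\mathrm{Gr})$ be a graded Higgs bundle over $(X,D)/S$. 1. There is a class $c\in\mathbb H^2\big(\mathrm{Gr}^0\mathrm{DR}(\mathscr End(E,\theta))_{\mathcal I}\big)$ such that $c=0$ if and only if $(E,\theta,\mathrm{Gr})$ has a graded lifting. There exist systems of local data, consisting of a covering $\{U_i\}$ by affine open sets (each mapping into an affine open subset of $\widetilde S$, with each $\widetilde D_a$ principal on it), liftings $(\widetilde E_i,\widetilde\theta_i,\widetilde{\mathrm{Gr}}_i)$ of $(E,\theta,\mathrm{Gr})|_{U_i}$ with $\widetilde\theta_i$ graded and $\mathcal O$-linear but not necessarily integrable, and isomorphisms of graded bundles $f_{ij}:\widetilde E_i\to\widetilde E_j$ over $U_{ij}$ restricting to the identity of $E$. For each such system, $\big(-(f_{jk}f_{ij}-f_{ik}),\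 \widetilde\theta_jf_{ij}-f_{ij}\widetilde\theta_i,\ \widetilde\theta_i\circ\widetilde\theta_i\big)$ is a $2$-cocycle, and its class is $c$. 2. If $(E,\theta,\mathrm{Gr})$ has a graded lifting, then the set of isomorphism classes of graded liftings is a torsor under $\mathbb H^1\big(\mathrm{Gr}^0\mathrm{DR}(\mathscr End(E,\theta))_{\mathcal I}\big)$. The difference of the classes of $(\widetilde E',\widetilde\theta',\widetilde{\mathrm{Gr}}')$ and $(\widetilde E,\widetilde\theta,\widetilde{\mathrm{Gr}})$ is the class of the $1$-cocycle $(f_j-f_i,\ \widetilde\theta'f_i-f_i\widetilde\theta)$, for any isomorphisms of graded bundles $f_i:\widetilde E|_{U_i}\to\widetilde E'|_{U_i}$ restricting to the identity of $E$, on the members of a covering as in 1; such local isomorphisms exist. 3. For every graded lifting, the group of its automorphisms restricting to the identity of $(E,\theta,\mathrm{Gr})$ is isomorphic to $\mathbb H^0\big(\mathrm{Gr}^0\mathrm{DR}(\mathscr End(E,\theta))_{\mathcal I}\big)$, by $\varepsilon\mapsto\mathrm{id}+\varepsilon$. -/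

import Mathlib

open CategoryTheory CategoryTheory.Limits AlgebraicGeometry TopologicalSpace
open scoped TensorProduct

universe u

namespace HiggsDeformation

noncomputable section


section Algebra

variable {A B : Type u} [CommRing A] [CommRing B]

/-- Functoriality of Kähler differentials along a ring homomorphism `h : A → B` that carries the
subring `C` of constants of `A` into the subring `C'` of constants of `B`. -/
def kaehlerMap (h : A →+* B) {C : Subring A} {C' : Subring B} (hC : ∀ c ∈ C, h c ∈ C') :
    Ω[A⁄C] →ₛₗ[h] Ω[B⁄C'] :=
  letI : Module A Ω[B⁄C'] := Module.compHom _ h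
  let δ : Derivation C A Ω[B⁄C'] := Derivation.mk'
    { toFun := fun a => KaehlerDifferential.D C' B (h a)
      map_add' := fun a b => by simp
      map_smul' := fun c a => by
        have h0 : KaehlerDifferential.D C' B (h c) = 0 :=
          (KaehlerDifferential.D C' B).map_algebraMap ⟨h c, hC c c.2⟩
        have : h (c • a) = h c * h a := by rw [Subring.smul_def, smul_eq_mul, map_mul]
        rw [this, Derivation.leibniz, h0, smul_zero, add_zero]
        rfl }
    (fun a b => by
      change KaehlerDifferential.D C' B (h (a * b)) = _
      rw [map_mul, Derivation.leibniz]
      rfl)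
  { toFun := δ.liftKaehlerDifferential
    map_add' := map_add _
    map_smul' := fun a w => (δ.liftKaehlerDifferential.map_smul a w).trans rfl }

theorem kaehlerMap_D (h : A →+* B) {C : Subring A} {C' : Subring B} (hC : ∀ c ∈ C, h c ∈ C')
    (a : A) : kaehlerMap h hC (KaehlerDifferential.D C A a) = KaehlerDifferential.D C' B (h a) := by
  let m : Module A Ω[B⁄C'] := Module.compHom _ h
  exact Derivation.liftKaehlerDifferential_comp_D _ a

variable {I : Type u}

/-- A pair consisting of an index `a` and a generator `f` of the principal ideal `J a`. -/
def LogGen (J : I → Ideal A) : Type u := Σ a : I, {f : A // J a = Ideal.span {f}}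

variable (C : Subring A) (J : I → Ideal A)

/-- The relations defining logarithmic differentials: `f • dlog f = d f` for a generator `f` of
`J a`, and `u • dlog (u f) = u • dlog f + d u` for a unit `u`. -/
def logRel : Submodule A (Ω[A⁄C] × (LogGen J →₀ A)) :=
  Submodule.span A
    ({z | ∃ p : LogGen J, z = (KaehlerDifferential.D C A p.2.1, - Finsupp.single p p.2.1)} ∪
     {z | ∃ (p q : LogGen J) (v : A), p.1 = q.1 ∧ IsUnit v ∧ q.2.1 = v * p.2.1 ∧
        z = (KaehlerDifferential.D C A v, Finsupp.single p v - Finsupp.single q v)})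

/-- The `A`-module of Kähler differentials of `A` relative to the subring `C`, with logarithmic
poles along the principal ideals `J a`: it is generated by the `d x`, for `x ∈ A`, and by symbols
`dlog f`, for `f` a generator of one of the ideals `J a`.  (These are the logarithmic differentials
of the log structure generated by local equations of the `J a`.) -/
def LogDiff : Type u := (Ω[A⁄C] × (LogGen J →₀ A)) ⧸ logRel C J

instance : AddCommGroup (LogDiff C J) :=
  inferInstanceAs (AddCommGroup ((Ω[A⁄C] × (LogGen J →₀ A)) ⧸ logRel C J))

instance : Module A (LogDiff C J) :=
  inferInstanceAs (Module A ((Ω[A⁄C] × (LogGen J →₀ A)) ⧸ logRel C J))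

variable {C J} {C' : Subring B} {J' : I → Ideal B}

/-- The image of a generator of `J a` as a generator of `J' a`. -/
def LogGen.map (h : A →+* B) (hJ : ∀ a f, J a = Ideal.span {f} → J' a = Ideal.span {h f})
    (p : LogGen J) : LogGen J' := ⟨p.1, h p.2.1, hJ _ _ p.2.2⟩

/-- The map on generators of the module of logarithmic differentials. -/
def logPreMap (h : A →+* B) (hC : ∀ c ∈ C, h c ∈ C')
    (hJ : ∀ a f, J a = Ideal.span {f} → J' a = Ideal.span {h f}) :
    (Ω[A⁄C] × (LogGen J →₀ A)) →ₛₗ[h] (Ω[B⁄C'] × (LogGen J' →₀ B)) where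
  toFun z := (kaehlerMap h hC z.1,
    Finsupp.mapDomain (LogGen.map h hJ) (Finsupp.mapRange h (map_zero h) z.2))
  map_add' x y := by
    refine Prod.ext (by simp) ?_
    simp [Finsupp.mapRange_add (map_add h), Finsupp.mapDomain_add]
  map_smul' a x := by
    refine Prod.ext (by simp) ?_
    have : Finsupp.mapRange h (map_zero h) (a • x.2) = h a • Finsupp.mapRange h (map_zero h) x.2 := by
      ext; simp
    simp [this, Finsupp.mapDomain_smul]

/-- Functoriality of logarithmic differentials. -/
def logMap (h : A →+* B) (hC : ∀ c ∈ C, h c ∈ C')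
    (hJ : ∀ a f, J a = Ideal.span {f} → J' a = Ideal.span {h f}) :
    LogDiff C J →ₛₗ[h] LogDiff C' J' :=
  Submodule.mapQ (logRel C J) (logRel C' J') (logPreMap h hC hJ) (by
    rw [logRel, Submodule.span_le]
    rintro z (⟨p, rfl⟩ | ⟨p, q, v, hpq, hv, hq, rfl⟩)
    · refine Submodule.subset_span (Or.inl ⟨LogGen.map h hJ p, ?_⟩)
      refine Prod.ext (kaehlerMap_D h hC _) ?_
      simp only [logPreMap, LinearMap.coe_mk, AddHom.coe_mk]
      rw [← Finsupp.single_neg, Finsupp.mapRange_single, Finsupp.mapDomain_single, map_neg,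
        Finsupp.single_neg]
      rfl
    · refine Submodule.subset_span (Or.inr ⟨LogGen.map h hJ p, LogGen.map h hJ q, h v, hpq,
        hv.map h, ?_, ?_⟩)
      · change h q.2.1 = h v * h p.2.1
        rw [hq, map_mul]
      · refine Prod.ext (kaehlerMap_D h hC _) ?_
        simp only [logPreMap, LinearMap.coe_mk, AddHom.coe_mk]
        rw [sub_eq_add_neg, ← Finsupp.single_neg, Finsupp.mapRange_add (map_add h),
          Finsupp.mapRange_single, Finsupp.mapRange_single, Finsupp.mapDomain_add,
          Finsupp.mapDomain_single, Finsupp.mapDomain_single, map_neg, Finsupp.single_neg,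
          sub_eq_add_neg])

/-- Two semilinear maps out of the logarithmic differentials agree if they do on the symbols. -/
theorem logMap_comp {D : Type u} [CommRing D] {C'' : Subring D} {J'' : I → Ideal D}
    (h : A →+* B) (hC : ∀ c ∈ C, h c ∈ C')
    (hJ : ∀ a f, J a = Ideal.span {f} → J' a = Ideal.span {h f})
    (k : B →+* D) (kC : ∀ c ∈ C', k c ∈ C'')
    (kJ : ∀ a f, J' a = Ideal.span {f} → J'' a = Ideal.span {k f})
    (l : A →+* D) (lC : ∀ c ∈ C, l c ∈ C'')
    (lJ : ∀ a f, J a = Ideal.span {f} → J'' a = Ideal.span {l f})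
    (hl : ∀ a, l a = k (h a)) (w : LogDiff C J) :
    logMap k kC kJ (logMap h hC hJ w) = logMap l lC lJ w := by
  obtain rfl : l = k.comp h := RingHom.ext hl
  obtain ⟨⟨w, g⟩, rfl⟩ := Submodule.Quotient.mk_surjective _ w
  refine congrArg (Submodule.Quotient.mk (p := logRel C'' J'')) (Prod.ext ?_ ?_)
  · change kaehlerMap k kC (kaehlerMap h hC w) = kaehlerMap (k.comp h) lC w
    have hw : w ∈ Submodule.span A (Set.range (KaehlerDifferential.D C A)) := by
      rw [KaehlerDifferential.span_range_derivation]; trivial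
    induction hw using Submodule.span_induction with
    | mem x hx => obtain ⟨a, rfl⟩ := hx; simp only [kaehlerMap_D]; rfl
    | zero => simp
    | add x y _ _ hx hy => simp [hx, hy]
    | smul a x _ hx => simp [hx]
  · change Finsupp.mapDomain _ (Finsupp.mapRange k _ (Finsupp.mapDomain _ (Finsupp.mapRange h _ g)))
      = Finsupp.mapDomain _ (Finsupp.mapRange (k.comp h) _ g)
    induction g using Finsupp.induction_linear with
    | zero => simp
    | add f g hf hg =>
      rw [Finsupp.mapRange_add (map_add h), Finsupp.mapDomain_add, Finsupp.mapRange_add (map_add k),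
        Finsupp.mapDomain_add, Finsupp.mapRange_add (map_add (k.comp h)), Finsupp.mapDomain_add, hf,
        hg]
    | single p a =>
      rw [Finsupp.mapRange_single, Finsupp.mapDomain_single, Finsupp.mapRange_single,
        Finsupp.mapDomain_single, Finsupp.mapRange_single, Finsupp.mapDomain_single]
      rfl

variable {M N : Type u} [AddCommGroup M] [AddCommGroup N] [Module A M] [Module B N]

/-- Functoriality of exterior powers along semilinear maps. -/
def extMap {h : A →+* B} (m : M →ₛₗ[h] N) (k : ℕ) : ⋀[A]^k M →ₛₗ[h] ⋀[B]^k N :=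
  letI : Module A (⋀[B]^k N) := Module.compHom _ h
  let α : M [⋀^Fin k]→ₗ[A] ⋀[B]^k N :=
    { toFun := fun v => exteriorPower.ιMulti B k (fun t => m (v t))
      map_update_add' := fun v t x y => by
        have e (z : M) : (fun s => m (Function.update v t z s)) =
            Function.update (fun s => m (v s)) t (m z) := by
          funext s
          by_cases hs : s = t
          · subst hs; simp
          · simp [Function.update_of_ne hs]
        have : ‹DecidableEq (Fin k)› = instDecidableEqFin k := Subsingleton.elim _ _
        subst this
        simp only [e, map_add, AlternatingMap.map_update_add]
      map_update_smul' := fun v t a x => by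
        have e (z : M) : (fun s => m (Function.update v t z s)) =
            Function.update (fun s => m (v s)) t (m z) := by
          funext s
          by_cases hs : s = t
          · subst hs; simp
          · simp [Function.update_of_ne hs]
        have : ‹DecidableEq (Fin k)› = instDecidableEqFin k := Subsingleton.elim _ _
        subst this
        simp only [e, LinearMap.map_smulₛₗ, AlternatingMap.map_update_smul]
        rfl
      map_eq_zero_of_eq' := fun v s t hv hst =>
        AlternatingMap.map_eq_zero_of_eq _ _ (congrArg m hv) hst }
  { toFun := exteriorPower.alternatingMapLinearEquiv α
    map_add' := map_add _
    map_smul' := fun a w => ((exteriorPower.alternatingMapLinearEquiv α).map_smul a w).trans rfl }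

theorem extMap_ιMulti {h : A →+* B} (m : M →ₛₗ[h] N) (k : ℕ) (v : Fin k → M) :
    extMap m k (exteriorPower.ιMulti A k v) = exteriorPower.ιMulti B k (fun t => m (v t)) := by
  let i : Module A (⋀[B]^k N) := Module.compHom _ h
  exact exteriorPower.alternatingMapLinearEquiv_apply_ιMulti _ v

theorem extMap_comp {D : Type u} [CommRing D] {K : Type u} [AddCommGroup K] [Module D K]
    {h : A →+* B} {k : B →+* D} {l : A →+* D} (m : M →ₛₗ[h] N) (n : N →ₛₗ[k] K) (q : M →ₛₗ[l] K)
    (hl : ∀ a, l a = k (h a)) (hq : ∀ x, q x = n (m x)) (d : ℕ) (w : ⋀[A]^d M) :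
    extMap n d (extMap m d w) = extMap q d w := by
  have hw : w ∈ Submodule.span A (Set.range (exteriorPower.ιMulti A d (M := M))) := by
    rw [exteriorPower.ιMulti_span]; trivial
  induction hw using Submodule.span_induction with
  | mem x hx => obtain ⟨v, rfl⟩ := hx; simp only [extMap_ιMulti, hq]
  | zero => simp
  | add x y _ _ hx hy => simp [hx, hy]
  | smul a x _ hx => simp [hx, hl]

/-- Left exterior multiplication `M × ⋀^k M → ⋀^(k+1) M`. -/
def wedge (A : Type u) [CommRing A] (M : Type u) [AddCommGroup M] [Module A M] (k : ℕ) :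
    M →ₗ[A] ⋀[A]^k M →ₗ[A] ⋀[A]^(k + 1) M :=
  LinearMap.mk₂ A (fun x w => ⟨ExteriorAlgebra.ι A x * w.1, by
      change _ ∈ LinearMap.range (ExteriorAlgebra.ι A : M →ₗ[A] ExteriorAlgebra A M) ^ (k + 1)
      rw [pow_succ']
      exact Submodule.mul_mem_mul (LinearMap.mem_range_self _ x) w.2⟩)
    (fun x y w => Subtype.ext (by simp [add_mul]))
    (fun a x w => Subtype.ext (by simp))
    (fun x v w => Subtype.ext (by simp [mul_add]))
    (fun a x w => Subtype.ext (by simp))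

theorem wedge_ιMulti (x : M) (k : ℕ) (v : Fin k → M) :
    wedge A M k x (exteriorPower.ιMulti A k v) = exteriorPower.ιMulti A (k + 1) (Fin.cons x v) := by
  apply Subtype.ext
  simp only [wedge, LinearMap.mk₂_apply, exteriorPower.ιMulti_apply_coe,
    ExteriorAlgebra.ιMulti_apply, List.ofFn_succ, List.prod_cons, Fin.cons_zero, Fin.cons_succ]

theorem extMap_wedge {h : A →+* B} (m : M →ₛₗ[h] N) (k : ℕ) (x : M) (w : ⋀[A]^k M) :
    extMap m (k + 1) (wedge A M k x w) = wedge B N k (m x) (extMap m k w) := by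
  have hw : w ∈ Submodule.span A (Set.range (exteriorPower.ιMulti A k (M := M))) := by
    rw [exteriorPower.ιMulti_span]; trivial
  induction hw using Submodule.span_induction with
  | mem y hy =>
    obtain ⟨v, rfl⟩ := hy
    rw [wedge_ιMulti, extMap_ιMulti, extMap_ιMulti, wedge_ιMulti]
    congr 1
    funext t
    refine Fin.cases ?_ (fun s => ?_) t <;> simp
  | zero => simp
  | add x y _ _ hx hy => simp [hx, hy]
  | smul a x _ hx => simp [hx]

/-- For a ring homomorphism `f : R → A` with kernel `K`, the `A`-module `A ⊗_R K`.  When `f` is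
surjective and `K ^ 2 = 0`, this is `K` with its natural structure of `A`-module. -/
def KerModule {R : Type u} [CommRing R] (f : R →+* A) : Type u :=
  @TensorProduct R _ A (RingHom.ker f) _ _ f.toAlgebra.toModule _

section KerModule

variable {R R' : Type u} [CommRing R] [CommRing R'] (f : R →+* A) (f' : R' →+* B)

instance : AddCommGroup (KerModule f) :=
  @TensorProduct.addCommGroup R _ A (RingHom.ker f) _ _ f.toAlgebra.toModule _

instance : Module A (KerModule f) :=
  @TensorProduct.leftModule R A _ _ A (RingHom.ker f) _ _ _ f.toAlgebra.toModule _
    (@Algebra.to_smulCommClass R A _ _ f.toAlgebra)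

/-- The element of `A ⊗_R K` given by `a ⊗ r`. -/
def KerModule.mk (a : A) (r : RingHom.ker f) : KerModule f :=
  @TensorProduct.tmul R _ A (RingHom.ker f) _ _ f.toAlgebra.toModule _ a r

variable {f f'}

theorem KerModule.induction {p : KerModule f → Prop} (h0 : p 0) (hm : ∀ a r, p (KerModule.mk f a r))
    (ha : ∀ x y, p x → p y → p (x + y)) (x : KerModule f) : p x :=
  @TensorProduct.induction_on R _ A (RingHom.ker f) _ _ f.toAlgebra.toModule _ p x h0 hm ha

theorem KerModule.smul_mk (b a : A) (r : RingHom.ker f) :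
    b • KerModule.mk f a r = KerModule.mk f (b * a) r := rfl

/-- Functoriality of `A ⊗_R K`, as an additive map. -/
def KerModule.mapAux (h' : R →+* R') (h : A →+* B) (comm : ∀ r, h (f r) = f' (h' r)) :
    KerModule f →+ KerModule f' :=
  letI := f.toAlgebra
  letI := f'.toAlgebra
  (TensorProduct.map
    ({ toFun := h, map_add' := map_add h
       map_smul' := fun r a => by
        change h (f r * a) = f' (h' r) * h a
        rw [map_mul, comm] } : A →ₛₗ[h'] B)
    ({ toFun := fun r => ⟨h' r.1, by
        have := r.2
        rw [RingHom.mem_ker] at this ⊢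
        rw [← comm, this, map_zero]⟩
       map_add' := fun r s => Subtype.ext (by simp)
       map_smul' := fun r s => Subtype.ext (by simp) } :
        RingHom.ker f →ₛₗ[h'] RingHom.ker f')).toAddMonoidHom

theorem KerModule.mapAux_mk (h' : R →+* R') (h : A →+* B) (comm : ∀ r, h (f r) = f' (h' r)) (a : A)
    (r : RingHom.ker f) (hr : h' r.1 ∈ RingHom.ker f') :
    KerModule.mapAux h' h comm (KerModule.mk f a r) = KerModule.mk f' (h a) ⟨h' r.1, hr⟩ := rfl

/-- Functoriality of `A ⊗_R K`. -/
def KerModule.map (h' : R →+* R') (h : A →+* B) (comm : ∀ r, h (f r) = f' (h' r)) :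
    KerModule f →ₛₗ[h] KerModule f' where
  toFun := KerModule.mapAux h' h comm
  map_add' := map_add _
  map_smul' a x := by
    induction x using KerModule.induction with
    | h0 => simp
    | hm b r =>
      have hr : h' r.1 ∈ RingHom.ker f' := by
        have := r.2
        rw [RingHom.mem_ker] at this ⊢
        rw [← comm, this, map_zero]
      rw [KerModule.smul_mk, KerModule.mapAux_mk _ _ _ _ _ hr, KerModule.mapAux_mk _ _ _ _ _ hr,
        KerModule.smul_mk, map_mul]
    | ha x y hx hy => rw [smul_add, map_add, hx, hy, map_add, smul_add]

theorem KerModule.map_comp {D R'' : Type u} [CommRing D] [CommRing R''] {f'' : R'' →+* D}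
    (h' : R →+* R') (h : A →+* B) (comm : ∀ r, h (f r) = f' (h' r))
    (k' : R' →+* R'') (k : B →+* D) (comm' : ∀ r, k (f' r) = f'' (k' r))
    (l' : R →+* R'') (l : A →+* D) (comm'' : ∀ r, l (f r) = f'' (l' r))
    (hl : ∀ a, l a = k (h a)) (hl' : ∀ a, l' a = k' (h' a)) (x : KerModule f) :
    KerModule.map k' k comm' (KerModule.map h' h comm x) = KerModule.map l' l comm'' x := by
  obtain rfl : l = k.comp h := RingHom.ext hl
  obtain rfl : l' = k'.comp h' := RingHom.ext hl'
  induction x using KerModule.induction with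
  | h0 => simp
  | hm b r => rfl
  | ha x y hx hy => simp only [map_add, hx, hy]

end KerModule

/-- The canonical map `End(M) ⊗ W → Hom(M, M ⊗ W)`, `g ⊗ w ↦ (e ↦ g e ⊗ w)`, where `End(M)` may be
any module `G` that is given with a linear map to the endomorphisms of `M`. -/
def evalMap {G M W : Type u} [AddCommGroup G] [Module A G] [AddCommGroup M] [Module A M]
    [AddCommGroup W] [Module A W] (ev : G →ₗ[A] M →ₗ[A] M) : G ⊗[A] W →ₗ[A] (M →ₗ[A] M ⊗[A] W) :=
  TensorProduct.lift
    (LinearMap.mk₂ A (fun g w => (TensorProduct.mk A M W).flip w ∘ₗ ev g)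
      (fun g g' w => by ext; simp)
      (fun a g w => by ext; simp [TensorProduct.smul_tmul'])
      (fun g w w' => by ext; simp)
      (fun a g w => by ext; simp))

end Algebra


section Sheaves

variable {Y : Scheme.{u}}

/-- Restriction of functions. -/
abbrev rres {U V : Y.Opens} (h : U ≤ V) : Γ(Y, V) →+* Γ(Y, U) :=
  (Y.presheaf.map (homOfLE h).op).hom

theorem rres_rres {U V W : Y.Opens} (h : U ≤ V) (h' : V ≤ W) (r : Γ(Y, W)) :
    rres h (rres h' r) = rres (h.trans h') r := by
  change (Y.presheaf.map _ ≫ Y.presheaf.map _).hom r = _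
  rw [← Functor.map_comp]
  rfl

theorem rres_self {U : Y.Opens} (r : Γ(Y, U)) : rres le_rfl r = r := by
  change (Y.presheaf.map (𝟙 _)).hom r = r
  rw [CategoryTheory.Functor.map_id]
  rfl

/-- Restriction of sections of a sheaf of modules. -/
def mres (M : Y.Modules) {U V : Y.Opens} (h : U ≤ V) : Γ(M, V) →ₛₗ[rres h] Γ(M, U) where
  toFun := M.presheaf.map (homOfLE h).op
  map_add' := map_add _
  map_smul' r e := Scheme.Modules.map_smul M (homOfLE h) r e

theorem mres_mres (M : Y.Modules) {U V W : Y.Opens} (h : U ≤ V) (h' : V ≤ W) (e : Γ(M, W)) :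
    mres M h (mres M h' e) = mres M (h.trans h') e := by
  change (M.presheaf.map _ ≫ M.presheaf.map _) e = _
  rw [← Functor.map_comp]
  rfl

theorem mres_self (M : Y.Modules) {U : Y.Opens} (e : Γ(M, U)) : mres M le_rfl e = e := by
  change M.presheaf.map (𝟙 _) e = e
  rw [CategoryTheory.Functor.map_id]
  rfl

/-- Sections over `U` of the sheaf of homomorphisms `M → N`: families of linear maps on the
sections over all `V ≤ U` that commute with restriction. -/
@[ext]
structure HomSec (M N : Y.Modules) (U : Y.Opens) : Type u where
  app : ∀ V, V ≤ U → (Γ(M, V) →ₗ[Γ(Y, V)] Γ(N, V))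
  naturality : ∀ V W (hV : V ≤ U) (h : W ≤ V) (e : Γ(M, V)),
    mres N h (app V hV e) = app W (h.trans hV) (mres M h e)

namespace HomSec

variable {M N K : Y.Modules} {U V W : Y.Opens}

instance : Zero (HomSec M N U) := ⟨⟨fun _ _ => 0, fun _ _ _ _ _ => by simp⟩⟩

instance : Add (HomSec M N U) :=
  ⟨fun f g => ⟨fun V h => f.app V h + g.app V h, fun V W hV h e => by
    simp [f.naturality V W hV h, g.naturality V W hV h]⟩⟩

instance : Neg (HomSec M N U) :=
  ⟨fun f => ⟨fun V h => - f.app V h, fun V W hV h e => by simp [f.naturality V W hV h]⟩⟩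

instance : SMul Γ(Y, U) (HomSec M N U) :=
  ⟨fun r f => ⟨fun V h => rres h r • f.app V h, fun V W hV h e => by
    simp only [LinearMap.smul_apply, LinearMap.map_smulₛₗ, f.naturality V W hV h, rres_rres]⟩⟩

@[simp] theorem zero_app (h : V ≤ U) : (0 : HomSec M N U).app V h = 0 := rfl

@[simp] theorem add_app (f g : HomSec M N U) (h : V ≤ U) :
    (f + g).app V h = f.app V h + g.app V h := rfl

@[simp] theorem neg_app (f : HomSec M N U) (h : V ≤ U) : (-f).app V h = - f.app V h := rfl

@[simp] theorem smul_app (r : Γ(Y, U)) (f : HomSec M N U) (h : V ≤ U) :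
    (r • f).app V h = rres h r • f.app V h := rfl

theorem ext' {f g : HomSec M N U} (h : ∀ V hV e, f.app V hV e = g.app V hV e) : f = g :=
  HomSec.ext (funext fun V => funext fun hV => LinearMap.ext (h V hV))

instance : AddCommGroup (HomSec M N U) where
  add_assoc f g h := ext' fun V hV e => by simp [add_assoc]
  zero_add f := ext' fun V hV e => by simp
  add_zero f := ext' fun V hV e => by simp
  neg_add_cancel f := ext' fun V hV e => by simp
  add_comm f g := ext' fun V hV e => by simp [add_comm]
  nsmul := nsmulRec
  zsmul := zsmulRec

@[simp] theorem sub_app (f g : HomSec M N U) (h : V ≤ U) :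
    (f - g).app V h = f.app V h - g.app V h := by
  rw [sub_eq_add_neg, sub_eq_add_neg]; rfl

instance : Module Γ(Y, U) (HomSec M N U) where
  one_smul f := ext' fun V hV e => by simp
  mul_smul r s f := ext' fun V hV e => by simp [mul_smul]
  smul_zero r := ext' fun V hV e => by simp
  smul_add r f g := ext' fun V hV e => by simp
  add_smul r s f := ext' fun V hV e => by simp [add_smul]
  zero_smul f := ext' fun V hV e => by simp

/-- Restriction of homomorphisms. -/
def res (h : V ≤ U) : HomSec M N U →ₛₗ[rres h] HomSec M N V where
  toFun f := ⟨fun W hW => f.app W (hW.trans h), fun W W' hW h' e => f.naturality W W' _ h' e⟩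
  map_add' _ _ := rfl
  map_smul' r f := ext' fun W hW e => by
    simp only [smul_app, rres_rres]

/-- Composition of homomorphisms. -/
def comp (g : HomSec N K U) (f : HomSec M N U) : HomSec M K U :=
  ⟨fun V h => g.app V h ∘ₗ f.app V h, fun V W hV h e => by
    simp only [LinearMap.comp_apply, f.naturality V W hV h, g.naturality V W hV h]⟩

/-- The identity. -/
def id (M : Y.Modules) (U : Y.Opens) : HomSec M M U := ⟨fun _ _ => LinearMap.id, fun _ _ _ _ _ => rfl⟩

/-- Composition as a bilinear map. -/
def compₗ : HomSec N K U →ₗ[Γ(Y, U)] HomSec M N U →ₗ[Γ(Y, U)] HomSec M K U :=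
  LinearMap.mk₂ _ comp
    (fun g g' f => ext' fun V hV e => by simp [comp])
    (fun r g f => ext' fun V hV e => by simp [comp])
    (fun g f f' => ext' fun V hV e => by simp [comp])
    (fun r g f => ext' fun V hV e => by simp [comp])

/-- The action on sections over `U`. -/
def toLin : HomSec M N U →ₗ[Γ(Y, U)] (Γ(M, U) →ₗ[Γ(Y, U)] Γ(N, U)) where
  toFun f := f.app U le_rfl
  map_add' _ _ := rfl
  map_smul' r f := by rw [smul_app, rres_self]; rfl

end HomSec

/-- A vector bundle `M` with a grading `M = ⨁ Gr ℓ` by subbundles, over the open set `U₀`.  All the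
conditions concern only the open sets contained in `U₀`: locally `M` has a basis `b` of sections,
with degrees `deg`, such that `Gr ℓ` is spanned by the basis sections of degree `ℓ`.  (A bundle on
`U₀` is regarded as a module on `Y` by direct image; no use is made of other open sets.) -/
structure GradedBundle (Y : Scheme.{u}) (U₀ : Y.Opens) where
  M : Y.Modules
  Gr : ∀ (_ : ℤ) (V : Y.Opens), Submodule Γ(Y, V) Γ(M, V)
  res_mem : ∀ (ℓ : ℤ) (V W : Y.Opens) (h : W ≤ V), V ≤ U₀ → ∀ e ∈ Gr ℓ V, mres M h e ∈ Gr ℓ W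
  of_locally_mem : ∀ (ℓ : ℤ) (V : Y.Opens), V ≤ U₀ → ∀ e : Γ(M, V),
    (∀ x ∈ V, ∃ (W : Y.Opens) (h : W ≤ V), x ∈ W ∧ mres M h e ∈ Gr ℓ W) → e ∈ Gr ℓ V
  locally_basis : ∀ x ∈ U₀, ∃ (V : Y.Opens), x ∈ V ∧ V ≤ U₀ ∧
    ∃ (n : ℕ) (b : Fin n → Γ(M, V)) (deg : Fin n → ℤ), ∀ (W : Y.Opens) (h : W ≤ V),
      Function.Bijective (fun c : Fin n → Γ(Y, W) => ∑ k, c k • mres M h (b k)) ∧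
      ∀ ℓ : ℤ, Gr ℓ W = Submodule.span Γ(Y, W) {e | ∃ k, deg k = ℓ ∧ e = mres M h (b k)}

variable {U₀ : Y.Opens}

/-- Homomorphisms `g : E → E'` over `U` that are homogeneous of degree `ℓ` for the gradings, that
is, `g (Gr m) ⊆ Gr (m + ℓ)` for all `m`. -/
def HomGr {U₁ U₂ : Y.Opens} (E : GradedBundle Y U₁) (E' : GradedBundle Y U₂) (ℓ : ℤ) (U : Y.Opens) :
    Submodule Γ(Y, U) (HomSec E.M E'.M U) where
  carrier := {g | ∀ (m : ℤ) (V : Y.Opens) (h : V ≤ U), ∀ e ∈ E.Gr m V, g.app V h e ∈ E'.Gr (m + ℓ) V}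
  add_mem' hf hg m V h e he := add_mem (hf m V h e he) (hg m V h e he)
  zero_mem' _ _ _ _ _ := zero_mem _
  smul_mem' _ _ hf m V h e he := Submodule.smul_mem _ _ (hf m V h e he)

/-- Sections over `U` of `Gr^ℓ End(E)`. -/
abbrev EndGr (E : GradedBundle Y U₀) (ℓ : ℤ) (U : Y.Opens) : Type u := HomGr E E ℓ U

variable (E : GradedBundle Y U₀)

/-- Restriction of homogeneous endomorphisms. -/
def EndGr.res (ℓ : ℤ) {U V : Y.Opens} (h : U ≤ V) : EndGr E ℓ V →ₛₗ[rres h] EndGr E ℓ U where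
  toFun g := ⟨HomSec.res h g.1, fun m W hW e he => g.2 m W (hW.trans h) e he⟩
  map_add' _ _ := rfl
  map_smul' r g := Subtype.ext ((HomSec.res h).map_smulₛₗ r g.1)

/-- Composition of homogeneous endomorphisms. -/
def EndGr.mul {ℓ m n : ℤ} (hn : n = ℓ + m) (U : Y.Opens) :
    EndGr E ℓ U →ₗ[Γ(Y, U)] EndGr E m U →ₗ[Γ(Y, U)] EndGr E n U :=
  LinearMap.mk₂ _ (fun g f => ⟨g.1.comp f.1, fun d V h e he => by
      have := g.2 _ V h _ (f.2 _ V h e he)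
      rwa [add_assoc, add_comm m, ← hn] at this⟩)
    (fun g g' f => Subtype.ext (LinearMap.map_add₂ HomSec.compₗ g.1 g'.1 f.1))
    (fun r g f => Subtype.ext (LinearMap.map_smul₂ HomSec.compₗ r g.1 f.1))
    (fun g f f' => Subtype.ext ((HomSec.compₗ g.1).map_add f.1 f'.1))
    (fun r g f => Subtype.ext ((HomSec.compₗ g.1).map_smul r f.1))

/-- The commutator `[g, f] = g f - f g`. -/
def EndGr.bracket {ℓ m n : ℤ} (hn : n = ℓ + m) (U : Y.Opens) :
    EndGr E ℓ U →ₗ[Γ(Y, U)] EndGr E m U →ₗ[Γ(Y, U)] EndGr E n U :=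
  EndGr.mul E hn U - (EndGr.mul E (hn.trans (add_comm _ _)) U).flip

theorem EndGr.res_bracket {ℓ m n : ℤ} (hn : n = ℓ + m) {U V : Y.Opens} (h : U ≤ V)
    (g : EndGr E ℓ V) (f : EndGr E m V) :
    EndGr.res E n h (EndGr.bracket E hn V g f) =
      EndGr.bracket E hn U (EndGr.res E ℓ h g) (EndGr.res E m h f) := by
  apply Subtype.ext
  apply HomSec.ext'
  intro W hW e
  simp only [EndGr.bracket, LinearMap.sub_apply, map_sub, LinearMap.flip_apply]
  rfl

/-- The action of an endomorphism on sections over `U`. -/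
def EndGr.toLin (ℓ : ℤ) (U : Y.Opens) :
    EndGr E ℓ U →ₗ[Γ(Y, U)] (Γ(E.M, U) →ₗ[Γ(Y, U)] Γ(E.M, U)) :=
  HomSec.toLin ∘ₗ (HomGr E E ℓ U).subtype

end Sheaves


section Pairs

/-- A morphism of schemes `π : Y ⟶ T` together with closed subschemes `D a` of `Y`, the components
of a divisor `D = ∑ D a`. -/
structure LogPair where
  Y : Scheme.{u}
  T : Scheme.{u}
  π : Y ⟶ T
  ι : Type u
  D : ι → Y.IdealSheafData

/-- `(Y, D)` is a smooth pair over `T`: the morphism `Y ⟶ T` is smooth and `D` is a relative simple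
normal crossings divisor.  The latter means that each point of `Y` has an affine open neighbourhood
`U` with functions `x k`, `k ∈ n`, defining an étale map from `U` to affine `n`-space over `T`, such
that the components of `D` that are non-empty on `U` are the loci `x k = 0` for certain distinct
indices `k`. -/
structure LogPair.IsSmoothPair (P : LogPair.{u}) : Prop where
  smooth : Smooth P.π
  coordinates : ∀ y : P.Y, ∃ U : P.Y.affineOpens, y ∈ U.1 ∧
    ∃ (n : Type u) (_ : Finite n) (x : n → Γ(P.Y, U.1)) (c : P.ι → Option n),
      Etale (AffineSpace.homOfVector (U.1.ι ≫ P.π) fun k => U.1.topIso.inv.hom (x k)) ∧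
      (∀ a b k, c a = some k → c b = some k → a = b) ∧
      (∀ a, c a = none → (P.D a).ideal U = ⊤) ∧
      ∀ a k, c a = some k → (P.D a).ideal U = Ideal.span {x k}

variable (P : LogPair.{u})

/-- An affine open subset of `Y` that is mapped into an affine open subset of `T`, and on which the
components of `D` are defined by one equation each. -/
structure AOpen where
  U : P.Y.Opens
  isAffine : IsAffineOpen U
  base : ∃ V : P.T.Opens, IsAffineOpen V ∧ U ≤ P.π ⁻¹ᵁ V
  principal : ∀ a, ∃ f, (P.D a).ideal ⟨U, isAffine⟩ = Ideal.span {f}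

variable {P}

instance : PartialOrder (AOpen P) :=
  PartialOrder.lift (fun U => U.U) (fun U V h => by cases U; cases V; simp_all)

variable (P)

/-- The functions on `U` that come from the base `T`. -/
def consts (U : P.Y.Opens) : Subring Γ(P.Y, U) :=
  Subring.closure {r | ∃ (V : P.T.Opens) (h : U ≤ P.π ⁻¹ᵁ V) (s : Γ(P.T, V)),
    r = (P.π.appLE V U h).hom s}

theorem rres_consts {U V : P.Y.Opens} (h : U ≤ V) (r : Γ(P.Y, V)) (hr : r ∈ consts P V) :
    rres h r ∈ consts P U := by
  suffices consts P V ≤ (consts P U).comap (rres h) from this hr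
  rw [consts, Subring.closure_le]
  rintro _ ⟨W, hW, s, rfl⟩
  refine Subring.subset_closure ⟨W, h.trans hW, s, ?_⟩
  change (P.π.appLE W V hW ≫ P.Y.presheaf.map (homOfLE h).op).hom s = _
  rw [Scheme.Hom.appLE_map]

variable {P}

theorem rres_ideal (a : P.ι) {U V : AOpen P} (h : U ≤ V) (f : Γ(P.Y, V.U))
    (hf : (P.D a).ideal ⟨V.U, V.isAffine⟩ = Ideal.span {f}) :
    (P.D a).ideal ⟨U.U, U.isAffine⟩ = Ideal.span {rres (U := U.U) (V := V.U) h f} := by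
  have h' : (⟨U.U, U.isAffine⟩ : P.Y.affineOpens) ≤ ⟨V.U, V.isAffine⟩ := h
  rw [← (P.D a).map_ideal h', hf, Ideal.map_span, Set.image_singleton]
  rfl

/-- Sections over `U` of the sheaf `Ω¹_{Y/T}(log D)`. -/
abbrev Om (U : AOpen P) : Type u :=
  LogDiff (consts P U.U) (fun a => (P.D a).ideal ⟨U.U, U.isAffine⟩)

/-- Restriction of logarithmic differentials. -/
def Om.res {U V : AOpen P} (h : U ≤ V) : Om V →ₛₗ[rres (U := U.U) (V := V.U) h] Om U :=
  logMap (rres (U := U.U) (V := V.U) h) (rres_consts P h) fun a f hf => rres_ideal a h f hf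

theorem Om.res_res {U V W : AOpen P} (h : U ≤ V) (h' : V ≤ W) (w : Om W) :
    Om.res h (Om.res h' w) = Om.res (h.trans h') w :=
  logMap_comp _ _ _ _ _ _ _ _ _ (fun a => (rres_rres _ _ a).symm) w

/-- Sections over `U` of the sheaf `Ω^k_{Y/T}(log D)`. -/
abbrev OmExt (k : ℕ) (U : AOpen P) : Type u := ⋀[Γ(P.Y, U.U)]^k (Om U)

/-- Restriction of logarithmic differential forms. -/
def OmExt.res (k : ℕ) {U V : AOpen P} (h : U ≤ V) :
    OmExt k V →ₛₗ[rres (U := U.U) (V := V.U) h] OmExt k U :=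
  extMap (Om.res h) k

theorem OmExt.res_res (k : ℕ) {U V W : AOpen P} (h : U ≤ V) (h' : V ≤ W) (w : OmExt k W) :
    OmExt.res k h (OmExt.res k h' w) = OmExt.res k (h.trans h') w :=
  extMap_comp _ _ _ (fun a => (rres_rres _ _ a).symm) (fun x => (Om.res_res _ _ x).symm) k w

/-- Logarithmic `1`-forms as elements of the first exterior power. -/
def oneForm (U : AOpen P) : Om U →ₗ[Γ(P.Y, U.U)] OmExt 1 U :=
  (exteriorPower.oneEquiv Γ(P.Y, U.U) (Om U)).symm.toLinearMap

/-- The constant `1` as an element of the zeroth exterior power. -/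
def zeroForm (U : AOpen P) : OmExt 0 U := (exteriorPower.zeroEquiv Γ(P.Y, U.U) (Om U)).symm 1

/-- A graded bundle over `U₀` with an `𝒪`-linear map `θ : E → E ⊗ Ω¹(log D)` over `U₀` such that
`θ (Gr ℓ) ⊆ Gr (ℓ - 1) ⊗ Ω¹(log D)`, given as a section of `Gr^{-1} End(E) ⊗ Ω¹(log D)`. -/
structure GradedField (P : LogPair.{u}) (U₀ : P.Y.Opens) extends GradedBundle P.Y U₀ where
  θ : ∀ V : AOpen P, V.U ≤ U₀ → EndGr toGradedBundle (-1) V.U ⊗[Γ(P.Y, V.U)] Om V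
  θ_res : ∀ (V W : AOpen P) (hV : V.U ≤ U₀) (h : W ≤ V),
    TensorProduct.map (EndGr.res toGradedBundle (-1) (U := W.U) (V := V.U) h) (Om.res h) (θ V hV) =
      θ W (le_trans (b := V.U) h hV)

namespace GradedField

variable {U₀ : P.Y.Opens} (E : GradedField P U₀)

/-- The map `θ : E → E ⊗ Ω¹(log D)` on sections over `V`. -/
def lin (V : AOpen P) (h : V.U ≤ U₀) :
    Γ(E.M, V.U) →ₗ[Γ(P.Y, V.U)] Γ(E.M, V.U) ⊗[Γ(P.Y, V.U)] Om V :=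
  evalMap (EndGr.toLin E.toGradedBundle (-1) V.U) (E.θ V h)

/-- The section `θ ∧ θ` of `Gr^{-2} End(E) ⊗ Ω²(log D)`. -/
def sq (V : AOpen P) (h : V.U ≤ U₀) :
    EndGr E.toGradedBundle (-2) V.U ⊗[Γ(P.Y, V.U)] OmExt 2 V :=
  TensorProduct.map₂ (EndGr.mul E.toGradedBundle (by norm_num) V.U)
    ((wedge Γ(P.Y, V.U) (Om V) 1).compl₂ (oneForm V)) (E.θ V h) (E.θ V h)

/-- The integrability condition `θ ∧ θ = 0`. -/
def Integrable : Prop := ∀ (V : AOpen P) (h : V.U ≤ U₀), E.sq V h = 0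

end GradedField

/-- `f : E → E'` over `V` satisfies `θ' ∘ f = (f ⊗ 1) ∘ θ`. -/
def Commutes {U₁ U₂ : P.Y.Opens} (E : GradedField P U₁) (E' : GradedField P U₂) (V : AOpen P)
    (h₁ : V.U ≤ U₁) (h₂ : V.U ≤ U₂) (f : Γ(E.M, V.U) →ₗ[Γ(P.Y, V.U)] Γ(E'.M, V.U)) : Prop :=
  E'.lin V h₂ ∘ₗ f = f.rTensor (Om V) ∘ₗ E.lin V h₁

end Pairs

section Intersections

/-- The intersection of two affine open subsets is affine; equivalently, the diagonal is affine. -/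
class SemiSeparated (Y : Scheme.{u}) : Prop where
  inter : ∀ U V : Y.Opens, IsAffineOpen U → IsAffineOpen V → IsAffineOpen (U ⊓ V)

variable {P : LogPair.{u}} [SemiSeparated P.Y]

/-- An affine open subset of an open subset of this kind is again of this kind. -/
def AOpen.sub (V : AOpen P) (U : P.Y.Opens) (hU : IsAffineOpen U) (h : U ≤ V.U) : AOpen P where
  U := U
  isAffine := hU
  base := let ⟨W, hW, hV⟩ := V.base; ⟨W, hW, h.trans hV⟩
  principal a := by
    obtain ⟨f, hf⟩ := V.principal a
    have h' : (⟨U, hU⟩ : P.Y.affineOpens) ≤ ⟨V.U, V.isAffine⟩ := h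
    exact ⟨rres h f, by
      rw [← (P.D a).map_ideal h', hf, Ideal.map_span, Set.image_singleton]
      rfl⟩

instance : SemilatticeInf (AOpen P) where
  inf U V := U.sub (U.U ⊓ V.U) (SemiSeparated.inter _ _ U.isAffine V.isAffine) inf_le_left
  inf_le_left U V := inf_le_left (a := U.U) (b := V.U)
  inf_le_right U V := inf_le_right (a := U.U) (b := V.U)
  le_inf _ _ _ h h' := _root_.le_inf (α := P.Y.Opens) h h'

end Intersections


section Thickenings

/-- The ideal of the inverse image of a closed subscheme under a closed immersion. -/
theorem ideal_comap_closedImmersion {X Y : Scheme.{u}} (i : X ⟶ Y) [IsClosedImmersion i]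
    (K : Y.IdealSheafData) (U : Y.affineOpens) (hU : IsAffineOpen (i ⁻¹ᵁ U.1)) :
    (K.comap i).ideal ⟨i ⁻¹ᵁ U.1, hU⟩ = (K.ideal U).map (i.app U.1).hom := by
  apply le_antisymm
  · let L : Y.IdealSheafData := K ⊔ i.ker
    have hL : i.ker ≤ L.subschemeι.ker := by
      rw [Scheme.IdealSheafData.ker_subschemeι]; exact le_sup_right
    let g := IsClosedImmersion.lift i L.subschemeι hL
    have hg : g ≫ i = L.subschemeι := IsClosedImmersion.lift_fac _ _ _
    have hgL : (Scheme.Hom.ker g).map i = L := by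
      rw [Scheme.IdealSheafData.map_ker, hg, Scheme.IdealSheafData.ker_subschemeι]
    have h1 : K.comap i ≤ Scheme.Hom.ker g :=
      Scheme.IdealSheafData.le_map_iff_comap_le.mp (by rw [hgL]; exact le_sup_left)
    have h2 : (K.comap i).map i ≤ L := by
      rw [← hgL]; exact Scheme.IdealSheafData.map_mono i h1
    intro x hx
    obtain ⟨y, rfl⟩ := i.app_surjective U.1 U.2 x
    have h3 := h2 U
    rw [Scheme.IdealSheafData.ideal_map_of_isAffineHom] at h3
    have hy : y ∈ K.ideal U ⊔ i.ker.ideal U := h3 hx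
    rw [Scheme.Hom.ker_apply] at hy
    obtain ⟨k, hk, z, hz, rfl⟩ := Submodule.mem_sup.mp hy
    have hz' : (i.app U.1).hom z = 0 := hz
    change (i.app U.1).hom (k + z) ∈ _
    rw [map_add, hz', add_zero]
    exact Ideal.mem_map_of_mem _ hk
  · rw [Ideal.map_le_iff_le_comap, ← Scheme.IdealSheafData.ideal_map_of_isAffineHom]
    exact Scheme.IdealSheafData.le_map_comap _ _ U

/-- A smooth pair `pair = (X', D')` over `S'`, a closed immersion `j : S ⟶ S'` with ideal of square
zero, and the base change `X = X' ×_{S'} S`. -/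
structure Thickening where
  pair : LogPair.{u}
  smoothPair : pair.IsSmoothPair
  S : Scheme.{u}
  X : Scheme.{u}
  π : X ⟶ S
  i : X ⟶ pair.Y
  j : S ⟶ pair.T
  isPullback : IsPullback i π pair.π j
  closedImmersion : IsClosedImmersion j
  squareZero : j.ker ^ 2 = ⊥

variable (P : Thickening.{u})

instance : IsClosedImmersion P.j := P.closedImmersion

instance : IsClosedImmersion P.i := MorphismProperty.of_isPullback P.isPullback.flip P.closedImmersion

/-- The base change `(X, D)` over `S` of the pair `(X', D')`. -/
abbrev Thickening.red : LogPair.{u} where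
  Y := P.X
  T := P.S
  π := P.π
  ι := P.pair.ι
  D a := (P.pair.D a).comap P.i

variable {P}

/-- The inverse image in `X` of an open subset of `X'`. -/
abbrev Thickening.inv (U : P.pair.Y.Opens) : P.red.Y.Opens := P.i ⁻¹ᵁ U

/-- The homomorphism from functions on `U` to functions on the inverse image of `U` in `X`. -/
abbrev Thickening.redHom (U : P.pair.Y.Opens) : Γ(P.pair.Y, U) →+* Γ(P.red.Y, P.inv U) :=
  (P.i.app U).hom

theorem inv_mono {U V : P.pair.Y.Opens} (h : U ≤ V) : P.inv U ≤ P.inv V := fun _ hx => h hx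

theorem redHom_rres {U V : P.pair.Y.Opens} (h : U ≤ V) (r : Γ(P.pair.Y, V)) :
    P.redHom U (rres h r) = rres (inv_mono h) (P.redHom V r) := by
  change (P.pair.Y.presheaf.map (homOfLE h).op ≫ P.i.app U).hom r = _
  rw [Scheme.Hom.naturality]
  rfl

theorem redHom_ideal (a : P.pair.ι) (U : AOpen P.pair) (hU : IsAffineOpen (P.inv U.U))
    (f : Γ(P.pair.Y, U.U)) (hf : (P.pair.D a).ideal ⟨U.U, U.isAffine⟩ = Ideal.span {f}) :
    (P.red.D a).ideal ⟨P.inv U.U, hU⟩ = Ideal.span {P.redHom U.U f} := by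
  refine (ideal_comap_closedImmersion P.i (P.pair.D a) ⟨U.U, U.isAffine⟩ hU).trans ?_
  rw [hf, Ideal.map_span, Set.image_singleton]

theorem redHom_consts (U : P.pair.Y.Opens) (r : Γ(P.pair.Y, U)) (hr : r ∈ consts P.pair U) :
    P.redHom U r ∈ consts P.red (P.inv U) := by
  suffices consts P.pair U ≤ (consts P.red (P.inv U)).comap (P.redHom U) from this hr
  rw [consts, Subring.closure_le]
  rintro _ ⟨V, h, s, rfl⟩
  have e : P.inv U ≤ P.π ⁻¹ᵁ (P.j ⁻¹ᵁ V) := by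
    have : P.π ⁻¹ᵁ (P.j ⁻¹ᵁ V) = P.i ⁻¹ᵁ (P.pair.π ⁻¹ᵁ V) := by
      rw [← Scheme.Hom.comp_preimage, ← Scheme.Hom.comp_preimage, P.isPullback.w]
    rw [this]
    exact inv_mono h
  refine Subring.subset_closure ⟨P.j ⁻¹ᵁ V, e, (P.j.app V).hom s, ?_⟩
  change (P.pair.π.appLE V U h ≫ P.i.app U).hom s = (P.j.app V ≫ P.π.appLE (P.j ⁻¹ᵁ V) _ e).hom s
  have e1 : P.pair.π.appLE V U h ≫ P.i.app U =
      (P.i ≫ P.pair.π).appLE V (P.inv U) (inv_mono h) := by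
    rw [Scheme.Hom.app_eq_appLE, Scheme.Hom.appLE_comp_appLE]
  have e2 : P.j.app V ≫ P.π.appLE (P.j ⁻¹ᵁ V) (P.inv U) e =
      (P.π ≫ P.j).appLE V (P.inv U) e := by
    rw [Scheme.Hom.app_eq_appLE, Scheme.Hom.appLE_comp_appLE]
  rw [e1, e2]
  simp only [P.isPullback.w]

/-- The inverse image in `X`, as an open subset of the same kind. -/
abbrev AOpen.pre (U : AOpen P.pair) : AOpen P.red where
  U := P.inv U.U
  isAffine := U.isAffine.preimage P.i
  base := by
    obtain ⟨V, hV, h⟩ := U.base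
    refine ⟨P.j ⁻¹ᵁ V, hV.preimage P.j, ?_⟩
    have : P.π ⁻¹ᵁ (P.j ⁻¹ᵁ V) = P.i ⁻¹ᵁ (P.pair.π ⁻¹ᵁ V) := by
      rw [← Scheme.Hom.comp_preimage, ← Scheme.Hom.comp_preimage, P.isPullback.w]
    exact (inv_mono h).trans_eq this.symm
  principal a := by
    obtain ⟨f, hf⟩ := U.principal a
    exact ⟨_, redHom_ideal a U (U.isAffine.preimage P.i) f hf⟩

theorem AOpen.pre_mono {U V : AOpen P.pair} (h : U ≤ V) : U.pre ≤ V.pre := inv_mono h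

/-- The restriction to `X` of logarithmic differentials on `X'`. -/
def Om.red (U : AOpen P.pair) : Om U →ₛₗ[P.redHom U.U] Om U.pre :=
  logMap (P.redHom U.U) (redHom_consts U.U) fun a f hf =>
    redHom_ideal a U (U.isAffine.preimage P.i) f hf

/-- The restriction to `X` of logarithmic differential forms on `X'`. -/
def OmExt.red (k : ℕ) (U : AOpen P.pair) : OmExt k U →ₛₗ[P.redHom U.U] OmExt k U.pre :=
  extMap (Om.red U) k

end Thickenings

section Lifts

variable {P : Thickening.{u}}

/-- A graded field `(E', θ', Gr')` over the open subset `U₀` of `X'` that lifts the graded field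
`(E, θ, Gr)` on `X`, without integrability condition.  The map `φ : E' → E` identifies the
restriction of `E'` to `X` with `E` over `U₀`, that is, it is locally surjective with kernel
`I E'`. -/
structure LiftData (E : GradedField P.red ⊤) (U₀ : P.pair.Y.Opens) extends
    GradedField P.pair U₀ where
  φ : ∀ V : P.pair.Y.Opens, V ≤ U₀ → (Γ(M, V) →ₛₗ[P.redHom V] Γ(E.M, P.inv V))
  φ_res : ∀ (V W : P.pair.Y.Opens) (hV : V ≤ U₀) (h : W ≤ V) (e : Γ(M, V)),
    mres E.M (inv_mono h) (φ V hV e) = φ W (h.trans hV) (mres M h e)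
  φ_Gr : ∀ (ℓ : ℤ) (V : P.pair.Y.Opens) (hV : V ≤ U₀), ∀ e ∈ Gr ℓ V, φ V hV e ∈ E.Gr ℓ (P.inv V)
  φ_iso : ∀ x ∈ U₀, ∃ (V : P.pair.Y.Opens) (hV : V ≤ U₀), x ∈ V ∧
    ∀ (W : P.pair.Y.Opens) (h : W ≤ V), IsAffineOpen W →
      Function.Surjective (φ W (h.trans hV)) ∧
      ∀ e, φ W (h.trans hV) e = 0 →
        e ∈ RingHom.ker (P.redHom W) • (⊤ : Submodule Γ(P.pair.Y, W) Γ(M, W))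
  φ_θ : ∀ (V : AOpen P.pair) (hV : V.U ≤ U₀) (e : Γ(M, V.U)),
    TensorProduct.map (φ V.U hV) (Om.red V) (toGradedField.lin V hV e) =
      E.lin V.pre le_top (φ V.U hV e)

/-- A lift of the graded Higgs bundle `(E, θ, Gr)` to a graded Higgs bundle over `(X', D')`. -/
structure Lift (E : GradedField P.red ⊤) extends LiftData E ⊤ where
  integrable : toGradedField.Integrable

variable {E : GradedField P.red ⊤}

/-- An isomorphism over `U` of the graded bundles underlying two lifts, reducing to the identity
on `E`. -/
@[ext]
structure GrIso {U₁ U₂ : P.pair.Y.Opens} (L : LiftData E U₁) (L' : LiftData E U₂)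
    (U : P.pair.Y.Opens) (h₁ : U ≤ U₁) (h₂ : U ≤ U₂) where
  hom : HomSec L.M L'.M U
  inv : HomSec L'.M L.M U
  hom_inv : hom.comp inv = HomSec.id _ _
  inv_hom : inv.comp hom = HomSec.id _ _
  hom_mem : hom ∈ HomGr L.toGradedBundle L'.toGradedBundle 0 U
  inv_mem : inv ∈ HomGr L'.toGradedBundle L.toGradedBundle 0 U
  φ_hom : ∀ (V : P.pair.Y.Opens) (h : V ≤ U) (e : Γ(L.M, V)),
    L'.φ V (h.trans h₂) (hom.app V h e) = L.φ V (h.trans h₁) e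

/-- An isomorphism of lifts: an isomorphism of graded Higgs bundles that reduces to the identity on
`E`. -/
@[ext]
structure LiftIso (L L' : Lift E) extends
    GrIso L.toLiftData L'.toLiftData ⊤ le_rfl le_rfl where
  commutes : ∀ V : AOpen P.pair,
    Commutes L.toGradedField L'.toGradedField V le_top le_top (hom.app V.U le_top)

namespace LiftIso

theorem φ_inv {L L' : Lift E} (f : LiftIso L L') (V : P.pair.Y.Opens) (h : V ≤ ⊤) (e : Γ(L'.M, V)) :
    L.φ V h (f.inv.app V h e) = L'.φ V h e := by
  rw [← f.φ_hom V h]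
  exact congrArg (L'.φ V h) (congrArg (fun g : HomSec L'.M L'.M ⊤ => g.app V h e) f.hom_inv)

/-- The identity. -/
def refl (L : Lift E) : LiftIso L L where
  hom := HomSec.id _ _
  inv := HomSec.id _ _
  hom_inv := rfl
  inv_hom := rfl
  hom_mem m V h e he := by rwa [add_zero]
  inv_mem m V h e he := by rwa [add_zero]
  φ_hom V h e := rfl
  commutes V := by
    change _ ∘ₗ LinearMap.id = LinearMap.rTensor _ LinearMap.id ∘ₗ _
    rw [LinearMap.rTensor_id]
    rfl

/-- The inverse isomorphism. -/
def symm {L L' : Lift E} (f : LiftIso L L') : LiftIso L' L where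
  hom := f.inv
  inv := f.hom
  hom_inv := f.inv_hom
  inv_hom := f.hom_inv
  hom_mem := f.inv_mem
  inv_mem := f.hom_mem
  φ_hom V h e := f.φ_inv V h e
  commutes V := by
    have h1 : f.inv.app V.U le_top ∘ₗ f.hom.app V.U le_top = LinearMap.id :=
      congrArg (fun g : HomSec L.M L.M ⊤ => g.app V.U le_top) f.inv_hom
    have h2 : f.hom.app V.U le_top ∘ₗ f.inv.app V.U le_top = LinearMap.id :=
      congrArg (fun g : HomSec L'.M L'.M ⊤ => g.app V.U le_top) f.hom_inv
    have h3 := f.commutes V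
    unfold Commutes at h3 ⊢
    calc _ = ((f.inv.app V.U le_top).rTensor (Om V) ∘ₗ (f.hom.app V.U le_top).rTensor (Om V)) ∘ₗ
          L.lin V le_top ∘ₗ f.inv.app V.U le_top := by
          rw [← LinearMap.rTensor_comp, h1, LinearMap.rTensor_id, LinearMap.id_comp]
      _ = (f.inv.app V.U le_top).rTensor (Om V) ∘ₗ (L'.lin V le_top ∘ₗ f.hom.app V.U le_top) ∘ₗ
          f.inv.app V.U le_top := by rw [h3]; rfl
      _ = _ := by rw [LinearMap.comp_assoc, h2, LinearMap.comp_id]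

/-- Composition. -/
def trans {L L' L'' : Lift E} (f : LiftIso L L') (g : LiftIso L' L'') : LiftIso L L'' where
  hom := g.hom.comp f.hom
  inv := f.inv.comp g.inv
  hom_inv := HomSec.ext' fun V h e => by
    have h1 := congrArg (fun k : HomSec L'.M L'.M ⊤ => k.app V h (g.inv.app V h e)) f.hom_inv
    have h2 := congrArg (fun k : HomSec L''.M L''.M ⊤ => k.app V h e) g.hom_inv
    exact (congrArg (g.hom.app V h) h1).trans h2
  inv_hom := HomSec.ext' fun V h e => by
    have h1 := congrArg (fun k : HomSec L'.M L'.M ⊤ => k.app V h (f.hom.app V h e)) g.inv_hom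
    have h2 := congrArg (fun k : HomSec L.M L.M ⊤ => k.app V h e) f.inv_hom
    exact (congrArg (f.inv.app V h) h1).trans h2
  hom_mem m V h e he := by
    have := g.hom_mem _ V h _ (f.hom_mem m V h e he)
    rwa [add_zero] at this
  inv_mem m V h e he := by
    have := f.inv_mem _ V h _ (g.inv_mem m V h e he)
    rwa [add_zero] at this
  φ_hom V h e := (g.φ_hom V h _).trans (f.φ_hom V h e)
  commutes V := by
    have h1 := f.commutes V
    have h2 := g.commutes V
    unfold Commutes at h1 h2 ⊢
    change _ ∘ₗ g.hom.app V.U le_top ∘ₗ f.hom.app V.U le_top =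
      (g.hom.app V.U le_top ∘ₗ f.hom.app V.U le_top).rTensor (Om V) ∘ₗ _
    rw [← LinearMap.comp_assoc, h2, LinearMap.comp_assoc, h1, LinearMap.rTensor_comp]
    rfl

/-- The group of infinitesimal automorphisms of a lift, that is, of the automorphisms of the graded
Higgs bundle that reduce to the identity on `E`. -/
instance (L : Lift E) : Group (LiftIso L L) where
  mul f g := g.trans f
  one := refl L
  inv := symm
  mul_assoc _ _ _ := rfl
  one_mul _ := rfl
  mul_one _ := rfl
  inv_mul_cancel f := LiftIso.ext f.inv_hom f.inv_hom

end LiftIso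

/-- The equivalence relation of isomorphism of lifts. -/
def liftSetoid (E : GradedField P.red ⊤) : Setoid (Lift E) where
  r L L' := Nonempty (LiftIso L L')
  iseqv := ⟨fun L => ⟨.refl L⟩, fun ⟨f⟩ => ⟨f.symm⟩, fun ⟨f⟩ ⟨g⟩ => ⟨f.trans g⟩⟩

/-- The set of isomorphism classes of lifts. -/
abbrev LiftClass (E : GradedField P.red ⊤) : Type _ := Quotient (liftSetoid E)

end Lifts


section Complex

variable {P : Thickening.{u}} (E : GradedField P.red ⊤)

/-- Sections over `U` of the ideal `I` of `X` in `X'`, as an `𝒪_X`-module. -/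
abbrev Ideal_I (U : AOpen P.pair) : Type u := KerModule (P.redHom U.U)

/-- Restriction of sections of `I`. -/
def Ideal_I.res {U V : AOpen P.pair} (h : U ≤ V) :
    Ideal_I V →ₛₗ[rres (U := U.pre.U) (V := V.pre.U) (AOpen.pre_mono h)] Ideal_I U :=
  KerModule.map (rres (U := U.U) (V := V.U) h) _ fun r => (redHom_rres (U := U.U) (V := V.U) h r).symm

/-- Sections over `U` of the term `Gr^{-k} End(E) ⊗ I ⊗ Ω^k(log D)` of degree `k` of the complex
`Gr⁰ DR(End(E, θ))_I`. -/
def DRTerm (k : ℕ) (U : AOpen P.pair) : Type u :=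
  (EndGr E.toGradedBundle (-(k : ℤ)) U.pre.U ⊗[Γ(P.red.Y, U.pre.U)] Ideal_I U)
    ⊗[Γ(P.red.Y, U.pre.U)] OmExt k U.pre

instance (k : ℕ) (U : AOpen P.pair) : AddCommGroup (DRTerm E k U) :=
  inferInstanceAs (AddCommGroup (_ ⊗[Γ(P.red.Y, U.pre.U)] OmExt k U.pre))

instance (k : ℕ) (U : AOpen P.pair) : Module Γ(P.red.Y, U.pre.U) (DRTerm E k U) :=
  inferInstanceAs (Module Γ(P.red.Y, U.pre.U) (_ ⊗[Γ(P.red.Y, U.pre.U)] OmExt k U.pre))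

variable {E} in
/-- The section `g ⊗ r ⊗ ω`. -/
def DRTerm.tmul {k : ℕ} {U : AOpen P.pair} (g : EndGr E.toGradedBundle (-(k : ℤ)) U.pre.U)
    (r : Ideal_I U) (ω : OmExt k U.pre) : DRTerm E k U :=
  (g ⊗ₜ[Γ(P.red.Y, U.pre.U)] r) ⊗ₜ[Γ(P.red.Y, U.pre.U)] ω

theorem DRTerm.induction {k : ℕ} {U : AOpen P.pair} {p : DRTerm E k U → Prop} (h0 : p 0)
    (ht : ∀ g r ω, p (DRTerm.tmul g r ω)) (ha : ∀ x y, p x → p y → p (x + y)) (x : DRTerm E k U) :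
    p x := by
  induction x using TensorProduct.induction_on with
  | zero => exact h0
  | add x y hx hy => exact ha x y hx hy
  | tmul x w =>
    induction x using TensorProduct.induction_on with
    | zero => rw [TensorProduct.zero_tmul]; exact h0
    | add x y hx hy => rw [TensorProduct.add_tmul]; exact ha _ _ hx hy
    | tmul g r => exact ht g r w

/-- Restriction of sections of the terms of the complex. -/
def DRTerm.res (k : ℕ) {U V : AOpen P.pair} (h : U ≤ V) :
    DRTerm E k V →ₛₗ[rres (U := U.pre.U) (V := V.pre.U) (AOpen.pre_mono h)] DRTerm E k U :=
  TensorProduct.map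
    (TensorProduct.map (EndGr.res E.toGradedBundle _ (AOpen.pre_mono h)) (Ideal_I.res h))
    (OmExt.res k (AOpen.pre_mono h))

theorem DRTerm.res_tmul {k : ℕ} {U V : AOpen P.pair} (h : U ≤ V)
    (g : EndGr E.toGradedBundle (-(k : ℤ)) V.pre.U) (r : Ideal_I V) (ω : OmExt k V.pre) :
    DRTerm.res E k h (DRTerm.tmul g r ω) =
      DRTerm.tmul (EndGr.res E.toGradedBundle _ (AOpen.pre_mono h) g) (Ideal_I.res h r)
        (OmExt.res k (AOpen.pre_mono h) ω) := rfl

theorem DRTerm.res_res (k : ℕ) {U V W : AOpen P.pair} (h : U ≤ V) (h' : V ≤ W) (x : DRTerm E k W) :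
    DRTerm.res E k h (DRTerm.res E k h' x) = DRTerm.res E k (h.trans h') x := by
  induction x using DRTerm.induction with
  | h0 => simp
  | ha x y hx hy => simp only [map_add, hx, hy]
  | ht g r ω =>
    have hr : Ideal_I.res h (Ideal_I.res h' r) = Ideal_I.res (h.trans h') r :=
      KerModule.map_comp _ _ _ _ _ _ _ _ _ (fun a => (rres_rres _ _ a).symm)
        (fun a => (rres_rres _ _ a).symm) r
    have hw := OmExt.res_res k (AOpen.pre_mono h) (AOpen.pre_mono h') ω
    rw [DRTerm.res_tmul, DRTerm.res_tmul, DRTerm.res_tmul, hr, hw]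
    rfl

theorem neg_degree (k : ℕ) : -((k + 1 : ℕ) : ℤ) = -1 + -(k : ℤ) := by push_cast; ring

/-- The bilinear map `(A ⊗ η, g ⊗ r ⊗ ω) ↦ [A, g] ⊗ r ⊗ (η ∧ ω)`. -/
def wedgeBracket (k : ℕ) (U : AOpen P.pair) :
    EndGr E.toGradedBundle (-1) U.pre.U ⊗[Γ(P.red.Y, U.pre.U)] Om U.pre →ₗ[Γ(P.red.Y, U.pre.U)]
      DRTerm E k U →ₗ[Γ(P.red.Y, U.pre.U)] DRTerm E (k + 1) U :=
  TensorProduct.map₂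
    (LinearMap.rTensorHom (Ideal_I U) ∘ₗ EndGr.bracket E.toGradedBundle (neg_degree k) U.pre.U)
    (wedge Γ(P.red.Y, U.pre.U) (Om U.pre) k)

theorem wedgeBracket_tmul (k : ℕ) (U : AOpen P.pair) (A : EndGr E.toGradedBundle (-1) U.pre.U)
    (η : Om U.pre) (g : EndGr E.toGradedBundle (-(k : ℤ)) U.pre.U) (r : Ideal_I U)
    (ω : OmExt k U.pre) :
    wedgeBracket E k U (A ⊗ₜ η) (DRTerm.tmul g r ω) =
      DRTerm.tmul (EndGr.bracket E.toGradedBundle (neg_degree k) U.pre.U A g) r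
        (wedge Γ(P.red.Y, U.pre.U) (Om U.pre) k η ω) := rfl

/-- The differential `θ^End` of the complex: for `θ = ∑ A ⊗ η` it maps `g ⊗ r ⊗ ω` to
`∑ [A, g] ⊗ r ⊗ (η ∧ ω)`. -/
def thetaEnd (k : ℕ) (U : AOpen P.pair) :
    DRTerm E k U →ₗ[Γ(P.red.Y, U.pre.U)] DRTerm E (k + 1) U :=
  wedgeBracket E k U (E.θ U.pre le_top)

theorem res_thetaEnd (k : ℕ) {U V : AOpen P.pair} (h : U ≤ V) (x : DRTerm E k V) :
    DRTerm.res E (k + 1) h (thetaEnd E k V x) = thetaEnd E k U (DRTerm.res E k h x) := by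
  have key (t : EndGr E.toGradedBundle (-1) V.pre.U ⊗[Γ(P.red.Y, V.pre.U)] Om V.pre) :
      DRTerm.res E (k + 1) h (wedgeBracket E k V t x) = wedgeBracket E k U
          (TensorProduct.map (EndGr.res E.toGradedBundle (-1) (AOpen.pre_mono h))
            (Om.res (AOpen.pre_mono h)) t) (DRTerm.res E k h x) := by
    induction t using TensorProduct.induction_on with
    | zero => simp
    | add s t hs ht => simp only [map_add, LinearMap.add_apply, hs, ht]
    | tmul A η =>
      induction x using DRTerm.induction with
      | h0 => simp
      | ha x y hx hy => simp only [map_add, hx, hy]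
      | ht g r ω =>
        rw [TensorProduct.map_tmul, wedgeBracket_tmul, DRTerm.res_tmul, DRTerm.res_tmul,
          wedgeBracket_tmul, EndGr.res_bracket]
        exact congrArg (DRTerm.tmul _ _) (extMap_wedge _ _ _ _)
  exact (key _).trans (by rw [E.θ_res]; rfl)

end Complex

section Cech

variable {P : Thickening.{u}} [SemiSeparated P.pair.Y]

variable (P) in
/-- Open coverings of `X'` (equivalently, of `X`), indexed by the points: an affine open
neighbourhood `U x` of each point `x`.  Every open covering is refined by one of this form. -/
structure Cover where
  U : P.pair.Y → AOpen P.pair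
  mem : ∀ x, x ∈ (U x).U

instance : PartialOrder (Cover P) :=
  PartialOrder.lift (fun 𝔘 => OrderDual.toDual 𝔘.U) (fun 𝔘 𝔙 h => by
    cases 𝔘; cases 𝔙; simp_all)

/-- The intersection `U_{s 0} ∩ … ∩ U_{s p}`. -/
def Cover.inter (𝔘 : Cover P) {p : ℕ} (s : Fin (p + 1) → P.pair.Y) : AOpen P.pair :=
  Finset.univ.inf' Finset.univ_nonempty fun t => 𝔘.U (s t)

theorem Cover.inter_le (𝔘 : Cover P) {p : ℕ} (s : Fin (p + 1) → P.pair.Y) (t : Fin (p + 1)) :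
    𝔘.inter s ≤ 𝔘.U (s t) :=
  Finset.inf'_le _ (Finset.mem_univ t)

theorem Cover.inter_le_inter (𝔘 : Cover P) {p q : ℕ} (s : Fin (p + 1) → P.pair.Y)
    (m : Fin (q + 1) → Fin (p + 1)) : 𝔘.inter s ≤ 𝔘.inter fun t => s (m t) :=
  Finset.le_inf' _ _ fun t _ => 𝔘.inter_le s (m t)

theorem Cover.inter_mono {𝔘 𝔙 : Cover P} (h : 𝔘 ≤ 𝔙) {p : ℕ} (s : Fin (p + 1) → P.pair.Y) :
    𝔙.inter s ≤ 𝔘.inter s :=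
  Finset.le_inf' _ _ fun t _ => (𝔙.inter_le s t).trans (h (s t))

variable (E : GradedField P.red ⊤)

/-- The cochains of degree `n` of the total complex of the Čech double complex of
`Gr⁰ DR(End(E, θ))_I` for the covering `𝔘`; `z ⟨(p, q), _⟩` is the component in
`C^p(𝔘, DR^q)`. -/
abbrev Cochain (𝔘 : Cover P) (n : ℕ) : Type u :=
  ∀ (x : {x : ℕ × ℕ // x.1 + x.2 = n}) (s : Fin (x.1.1 + 1) → P.pair.Y), DRTerm E x.1.2 (𝔘.inter s)

variable {E}

/-- The Čech part of the differential. -/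
def cechPart {𝔘 : Cover P} {n : ℕ} (z : Cochain E 𝔘 n) : Cochain E 𝔘 (n + 1)
  | ⟨(0, _), _⟩, _ => 0
  | ⟨(p + 1, q), h⟩, s => ∑ t : Fin (p + 2), (-1 : ℤ) ^ (t : ℕ) •
      DRTerm.res E q (𝔘.inter_le_inter s t.succAbove)
        (z ⟨(p, q), by change p + q = n; change p + 1 + q = n + 1 at h; omega⟩ fun r => s (t.succAbove r))

/-- The part of the differential given by `(-1) ^ p θ^End`. -/
def higgsPart {𝔘 : Cover P} {n : ℕ} (z : Cochain E 𝔘 n) : Cochain E 𝔘 (n + 1)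
  | ⟨(_, 0), _⟩, _ => 0
  | ⟨(p, q + 1), h⟩, s => (-1 : ℤ) ^ p • thetaEnd E q (𝔘.inter s) (z ⟨(p, q), by change p + q = n; change p + (q + 1) = n + 1 at h; omega⟩ s)

variable (E)

/-- The differential of the total complex. -/
def totalD (𝔘 : Cover P) (n : ℕ) : Cochain E 𝔘 n →+ Cochain E 𝔘 (n + 1) where
  toFun z := cechPart z + higgsPart z
  map_zero' := by
    funext ⟨⟨p, q⟩, h⟩ s
    rcases p with _ | p <;> rcases q with _ | q <;>
      simp [cechPart, higgsPart]
  map_add' z w := by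
    funext ⟨⟨p, q⟩, h⟩ s
    rcases p with _ | p <;> rcases q with _ | q <;>
      simp only [cechPart, higgsPart, Pi.add_apply, map_add, smul_add, Finset.sum_add_distrib,
        add_zero, zero_add]
    abel

/-- Refinement of cochains. -/
def refineC {𝔘 𝔙 : Cover P} (h : 𝔘 ≤ 𝔙) (n : ℕ) : Cochain E 𝔘 n →+ Cochain E 𝔙 n where
  toFun z x s := DRTerm.res E x.1.2 (Cover.inter_mono h s) (z x s)
  map_zero' := by funext x s; simp
  map_add' z w := by funext x s; simp

theorem refineC_totalD {𝔘 𝔙 : Cover P} (h : 𝔘 ≤ 𝔙) (n : ℕ) (z : Cochain E 𝔘 n) :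
    refineC E h (n + 1) (totalD E 𝔘 n z) = totalD E 𝔙 n (refineC E h n z) := by
  funext ⟨⟨p, q⟩, e⟩ s
  change DRTerm.res E q _ (cechPart z ⟨(p, q), e⟩ s + higgsPart z ⟨(p, q), e⟩ s) =
    cechPart (refineC E h n z) ⟨(p, q), e⟩ s + higgsPart (refineC E h n z) ⟨(p, q), e⟩ s
  rw [map_add]
  congr 1
  · rcases p with _ | p
    · simp [cechPart]
    · simp only [cechPart, map_sum, map_zsmul, refineC, AddMonoidHom.coe_mk, ZeroHom.coe_mk]
      exact Finset.sum_congr rfl fun t _ => congrArg (fun y => (-1 : ℤ) ^ (t : ℕ) • y)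
        ((DRTerm.res_res E q _ _ _).trans (DRTerm.res_res E q _ _ _).symm)
  · rcases q with _ | q
    · simp [higgsPart]
    · simp only [higgsPart, map_zsmul, refineC, AddMonoidHom.coe_mk, ZeroHom.coe_mk]
      exact congrArg (fun y => (-1 : ℤ) ^ p • y) (res_thetaEnd E q _ _)

/-- Cocycles of degree `n`. -/
def cocycles (𝔘 : Cover P) (n : ℕ) : AddSubgroup (Cochain E 𝔘 n) := (totalD E 𝔘 n).ker

/-- Coboundaries of degree `n`. -/
def coboundaries (𝔘 : Cover P) : (n : ℕ) → AddSubgroup (Cochain E 𝔘 n)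
  | 0 => ⊥
  | n + 1 => (totalD E 𝔘 n).range

/-- The Čech hypercohomology of the complex `Gr⁰ DR(End(E, θ))_I` for the covering `𝔘`. -/
abbrev CechH (𝔘 : Cover P) (n : ℕ) : Type u :=
  cocycles E 𝔘 n ⧸ (coboundaries E 𝔘 n).addSubgroupOf (cocycles E 𝔘 n)

/-- Refinement of cocycles. -/
def refineZ {𝔘 𝔙 : Cover P} (h : 𝔘 ≤ 𝔙) (n : ℕ) : cocycles E 𝔘 n →+ cocycles E 𝔙 n :=
  ((refineC E h n).comp (cocycles E 𝔘 n).subtype).codRestrict _ fun z => by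
    have hz : totalD E 𝔘 n z.1 = 0 := z.2
    change totalD E 𝔙 n (refineC E h n z.1) = 0
    rw [← refineC_totalD, hz, map_zero]

/-- Refinement of cohomology classes. -/
def refineH {𝔘 𝔙 : Cover P} (h : 𝔘 ≤ 𝔙) (n : ℕ) : CechH E 𝔘 n →+ CechH E 𝔙 n :=
  QuotientAddGroup.map _ _ (refineZ E h n) (by
    rintro z hz
    rcases n with _ | n
    · have : z.1 = 0 := hz
      change refineC E h 0 z.1 = 0
      rw [this, map_zero]
    · obtain ⟨w, hw⟩ := hz
      refine ⟨refineC E h n w, ?_⟩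
      rw [← refineC_totalD, hw]
      rfl)

open Classical in
/-- The hypercohomology of `Gr⁰ DR(End(E, θ))_I`: the colimit over all coverings of the Čech
hypercohomology groups. -/
abbrev HypH (n : ℕ) : Type u :=
  AddCommGroup.DirectLimit (fun 𝔘 : Cover P => CechH E 𝔘 n) fun _ _ h => refineH E h n

open Classical in
/-- The class of a cocycle in hypercohomology. -/
def HypH.cls (𝔘 : Cover P) (n : ℕ) (z : Cochain E 𝔘 n) (hz : z ∈ cocycles E 𝔘 n) : HypH E n :=
  AddCommGroup.DirectLimit.of (fun 𝔘 : Cover P => CechH E 𝔘 n) (fun _ _ h => refineH E h n) 𝔘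
    (QuotientAddGroup.mk ⟨z, hz⟩)

end Cech


section Classes

variable {P : Thickening.{u}} {E : GradedField P.red ⊤}

/-- Linear maps `E' → E'' ⊗ Ω^k(log D')` over `U` between the bundles underlying two lifts. -/
abbrev FormHom {U₁ U₂ : P.pair.Y.Opens} (L : LiftData E U₁) (L' : LiftData E U₂) (k : ℕ)
    (U : AOpen P.pair) : Type u :=
  Γ(L.M, U.U) →ₗ[Γ(P.pair.Y, U.U)] Γ(L'.M, U.U) ⊗[Γ(P.pair.Y, U.U)] OmExt k U

/-- The graph of the canonical injection `Gr^{-k} End(E) ⊗ I ⊗ Ω^k(log D) → Hom(E', E'' ⊗ Ω^k(log D'))`,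
where `E'` and `E''` are lifts of `E`.  It maps `g ⊗ r ⊗ ω` to `e ↦ r g' e ⊗ ω'`, where
`g' : E' → E''` is any homomorphism lifting `g` and `ω'` is any form lifting `ω`. -/
def iotaGraph {U₁ U₂ : P.pair.Y.Opens} (L : LiftData E U₁) (L' : LiftData E U₂) (k : ℕ)
    (U : AOpen P.pair) (h₁ : U.U ≤ U₁) (h₂ : U.U ≤ U₂) :
    AddSubgroup (DRTerm E k U × FormHom L L' k U) :=
  AddSubgroup.closure
    {x | ∃ (g : EndGr E.toGradedBundle (-(k : ℤ)) U.pre.U) (g' : HomSec L.M L'.M U.U)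
        (r : RingHom.ker (P.redHom U.U)) (ω : OmExt k U),
      (∀ (V : P.pair.Y.Opens) (h : V ≤ U.U) (e : Γ(L.M, V)),
        L'.φ V (h.trans h₂) (g'.app V h e) =
          g.1.app (P.inv V) (inv_mono h) (L.φ V (h.trans h₁) e)) ∧
      x = (DRTerm.tmul g (KerModule.mk _ 1 r) (OmExt.red k U ω),
        r.1 • ((TensorProduct.mk Γ(P.pair.Y, U.U) Γ(L'.M, U.U) (OmExt k U)).flip ω ∘ₗ
          g'.app U.U le_rfl))}

/-- A homomorphism regarded as a homomorphism with values in `0`-forms. -/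
def toForm₀ {U₁ U₂ : P.pair.Y.Opens} {L : LiftData E U₁} {L' : LiftData E U₂} {U : AOpen P.pair}
    (f : HomSec L.M L'.M U.U) : FormHom L L' 0 U :=
  (TensorProduct.mk Γ(P.pair.Y, U.U) Γ(L'.M, U.U) (OmExt 0 U)).flip (zeroForm U) ∘ₗ
    f.app U.U le_rfl

/-- The homomorphism `θ'' ∘ f - (f ⊗ 1) ∘ θ'` for a homomorphism `f : E' → E''`. -/
def higgsDefect {U₁ U₂ : P.pair.Y.Opens} (L : LiftData E U₁) (L' : LiftData E U₂) (U : AOpen P.pair)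
    (h₁ : U.U ≤ U₁) (h₂ : U.U ≤ U₂) (f : HomSec L.M L'.M U.U) : FormHom L L' 1 U :=
  (oneForm U).lTensor Γ(L'.M, U.U) ∘ₗ
    (L'.lin U h₂ ∘ₗ f.app U.U le_rfl - (f.app U.U le_rfl).rTensor (Om U) ∘ₗ L.lin U h₁)

/-- The homomorphism `θ' ∘ θ' : E' → E' ⊗ Ω²(log D')`. -/
def higgsSquare {U₁ : P.pair.Y.Opens} (L : LiftData E U₁) (U : AOpen P.pair) (h₁ : U.U ≤ U₁) :
    FormHom L L 2 U :=
  evalMap (EndGr.toLin L.toGradedBundle (-2) U.U) (L.sq U h₁)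

variable [SemiSeparated P.pair.Y]

/-- A system of local data for the lifting problem: a covering, local lifts `(E_x, θ_x, Gr_x)` where
`θ_x` need not be integrable, and isomorphisms `f x y : E_x → E_y` of graded bundles over the
intersections that reduce to the identity; the `f x y` need not satisfy the cocycle condition and
need not be compatible with the `θ_x`. -/
structure LocalData (E : GradedField P.red ⊤) where
  cover : Cover P
  lift : ∀ x, LiftData E (cover.U x).U
  f : ∀ x y, GrIso (lift x) (lift y) ((cover.U x).U ⊓ (cover.U y).U) inf_le_left inf_le_right

/-- The transition isomorphism between the lifts with indices `s a` and `s b` over the intersection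
of all the open sets with indices in `s`. -/
def LocalData.hom (𝔇 : LocalData E) {p : ℕ} (s : Fin (p + 1) → P.pair.Y) (a b : Fin (p + 1)) :
    HomSec (𝔇.lift (s a)).M (𝔇.lift (s b)).M (𝔇.cover.inter s).U :=
  HomSec.res (le_inf (𝔇.cover.inter_le s a) (𝔇.cover.inter_le s b)) (𝔇.f (s a) (s b)).hom

/-- The cochain `z` is the obstruction cochain
`(-(f_{jk} f_{ij} - f_{ik}), θ_j f_{ij} - f_{ij} θ_i, θ_i θ_i)` of a system of local data. -/
structure LocalData.Represents (𝔇 : LocalData E) (z : Cochain E 𝔇.cover 2) : Prop where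
  comp₂₀ : ∀ s : Fin 3 → P.pair.Y,
    (z ⟨(2, 0), rfl⟩ s, toForm₀ (-((𝔇.hom s 1 2).comp (𝔇.hom s 0 1) - 𝔇.hom s 0 2))) ∈
      iotaGraph (𝔇.lift (s 0)) (𝔇.lift (s 2)) 0 (𝔇.cover.inter s)
        (𝔇.cover.inter_le s 0) (𝔇.cover.inter_le s 2)
  comp₁₁ : ∀ s : Fin 2 → P.pair.Y,
    (z ⟨(1, 1), rfl⟩ s, higgsDefect (𝔇.lift (s 0)) (𝔇.lift (s 1)) (𝔇.cover.inter s)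
        (𝔇.cover.inter_le s 0) (𝔇.cover.inter_le s 1) (𝔇.hom s 0 1)) ∈
      iotaGraph (𝔇.lift (s 0)) (𝔇.lift (s 1)) 1 (𝔇.cover.inter s)
        (𝔇.cover.inter_le s 0) (𝔇.cover.inter_le s 1)
  comp₀₂ : ∀ s : Fin 1 → P.pair.Y,
    (z ⟨(0, 2), rfl⟩ s, higgsSquare (𝔇.lift (s 0)) (𝔇.cover.inter s) (𝔇.cover.inter_le s 0)) ∈
      iotaGraph (𝔇.lift (s 0)) (𝔇.lift (s 0)) 2 (𝔇.cover.inter s)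
        (𝔇.cover.inter_le s 0) (𝔇.cover.inter_le s 0)

/-- Local isomorphisms `f x : E' → E''` of the graded bundles underlying two lifts, reducing to
the identity. -/
structure LocalIsos (L L' : Lift E) where
  cover : Cover P
  f : ∀ x, GrIso L.toLiftData L'.toLiftData (cover.U x).U le_top le_top

/-- The local isomorphism with index `s a` over the intersection. -/
def LocalIsos.hom {L L' : Lift E} (𝔇 : LocalIsos L L') {p : ℕ} (s : Fin (p + 1) → P.pair.Y)
    (a : Fin (p + 1)) : HomSec L.M L'.M (𝔇.cover.inter s).U :=
  HomSec.res (𝔇.cover.inter_le s a) (𝔇.f (s a)).hom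

/-- The cochain `z` is the difference cochain `(f_j - f_i, θ'' f_i - f_i θ')` of two lifts. -/
structure LocalIsos.Represents {L L' : Lift E} (𝔇 : LocalIsos L L') (z : Cochain E 𝔇.cover 1) :
    Prop where
  comp₁₀ : ∀ s : Fin 2 → P.pair.Y,
    (z ⟨(1, 0), rfl⟩ s, toForm₀ (𝔇.hom s 1 - 𝔇.hom s 0)) ∈
      iotaGraph L.toLiftData L'.toLiftData 0 (𝔇.cover.inter s) le_top le_top
  comp₀₁ : ∀ s : Fin 1 → P.pair.Y,
    (z ⟨(0, 1), rfl⟩ s, higgsDefect L.toLiftData L'.toLiftData (𝔇.cover.inter s) le_top le_top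
        (𝔇.hom s 0)) ∈
      iotaGraph L.toLiftData L'.toLiftData 1 (𝔇.cover.inter s) le_top le_top

/-- The automorphism `f` is `id + ε`, where `ε` is given by the cochain `z` of degree `0`. -/
def IsIdAdd {L : Lift E} (f : LiftIso L L) {𝔘 : Cover P} (z : Cochain E 𝔘 0) : Prop :=
  ∀ s : Fin 1 → P.pair.Y,
    (z ⟨(0, 0), rfl⟩ s, toForm₀ (HomSec.res le_top (f.hom - HomSec.id L.M ⊤))) ∈
      iotaGraph L.toLiftData L.toLiftData 0 (𝔘.inter s) le_top le_top

end Classes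

end

end HiggsDeformation

open HiggsDeformation

namespace HiggsDeformation

noncomputable section


section Gluing

variable {Y : Scheme.{u}}

theorem mres_eq_of_locally_eq (M : Y.Modules) {V : Y.Opens} {s t : Γ(M, V)}
    (h : ∀ x ∈ V, ∃ (W : Y.Opens) (hW : W ≤ V), x ∈ W ∧ mres M hW s = mres M hW t) : s = t := by
  choose! W hW hx e using h
  exact TopCat.Sheaf.eq_of_locally_eq' (⟨M.presheaf, M.isSheaf⟩ : TopCat.Sheaf Ab Y)
    (fun x : V => W x) V (fun x => homOfLE (hW x x.2))
    (fun x hxV => Opens.mem_iSup.mpr ⟨⟨x, hxV⟩, hx x hxV⟩) s t fun x => e x x.2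

theorem exists_mres_eq (M : Y.Modules) {V : Y.Opens} {ι : Type*} (W : ι → Y.Opens)
    (hW : ∀ i, W i ≤ V) (hV : ∀ x ∈ V, ∃ i, x ∈ W i) (s : ∀ i, Γ(M, W i))
    (hs : ∀ i j, mres M (inf_le_left : W i ⊓ W j ≤ W i) (s i) = mres M inf_le_right (s j)) :
    ∃ t : Γ(M, V), ∀ i, mres M (hW i) t = s i := by
  obtain ⟨t, ht, -⟩ := TopCat.Sheaf.existsUnique_gluing'
    (⟨M.presheaf, M.isSheaf⟩ : TopCat.Sheaf Ab Y) W V (fun i => homOfLE (hW i))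
    (fun x hxV => Opens.mem_iSup.mpr (hV x hxV)) s fun i j => hs i j
  exact ⟨t, ht⟩

theorem rres_eq_of_locally_eq {V : Y.Opens} {s t : Γ(Y, V)}
    (h : ∀ x ∈ V, ∃ (W : Y.Opens) (hW : W ≤ V), x ∈ W ∧ rres hW s = rres hW t) : s = t := by
  choose! W hW hx e using h
  exact TopCat.Sheaf.eq_of_locally_eq' Y.sheaf
    (fun x : V => W x) V (fun x => homOfLE (hW x x.2))
    (fun x hxV => Opens.mem_iSup.mpr ⟨⟨x, hxV⟩, hx x hxV⟩) s t fun x => e x x.2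

theorem exists_rres_eq {V : Y.Opens} {ι : Type*} (W : ι → Y.Opens)
    (hW : ∀ i, W i ≤ V) (hV : ∀ x ∈ V, ∃ i, x ∈ W i) (s : ∀ i, Γ(Y, W i))
    (hs : ∀ i j, rres (inf_le_left : W i ⊓ W j ≤ W i) (s i) = rres inf_le_right (s j)) :
    ∃ t : Γ(Y, V), ∀ i, rres (hW i) t = s i := by
  obtain ⟨t, ht, -⟩ := TopCat.Sheaf.existsUnique_gluing' Y.sheaf W V (fun i => homOfLE (hW i))
    (fun x hxV => Opens.mem_iSup.mpr (hV x hxV)) s hs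
  exact ⟨t, ht⟩

variable (Y) in
/-- Concrete data defining a sheaf of modules. -/
structure SheafData where
  obj : Y.Opens → Type u
  [grp : ∀ V, AddCommGroup (obj V)]
  [mod : ∀ V, Module Γ(Y, V) (obj V)]
  res : ∀ {U V : Y.Opens} (h : U ≤ V), obj V →ₛₗ[rres h] obj U
  res_self : ∀ {U : Y.Opens} (e : obj U), res le_rfl e = e
  res_res : ∀ {U V W : Y.Opens} (h : U ≤ V) (h' : V ≤ W) (e : obj W),
    res h (res h' e) = res (h.trans h') e
  ext : ∀ {V : Y.Opens} (s t : obj V), (∀ x ∈ V, ∃ (W : Y.Opens) (hW : W ≤ V), x ∈ W ∧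
    res hW s = res hW t) → s = t
  glue : ∀ {V : Y.Opens} {ι : Type u} (W : ι → Y.Opens) (hW : ∀ i, W i ≤ V)
    (_ : ∀ x ∈ V, ∃ i, x ∈ W i) (s : ∀ i, obj (W i))
    (_ : ∀ i j, res (inf_le_left : W i ⊓ W j ≤ W i) (s i) = res inf_le_right (s j)),
    ∃ t : obj V, ∀ i, res (hW i) t = s i

namespace SheafData

attribute [instance] grp mod

variable (D : SheafData Y)

def presheafAb : TopCat.Presheaf Ab.{u} Y where
  obj V := AddCommGrpCat.of (D.obj V.unop)
  map f := AddCommGrpCat.ofHom (D.res f.unop.le).toAddMonoidHom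
  map_id V := by ext e; exact D.res_self e
  map_comp f g := by ext e; exact (D.res_res _ _ e).symm

theorem presheafAb_isSheaf : D.presheafAb.IsSheaf := by
  rw [TopCat.Presheaf.isSheaf_iff_isSheafUniqueGluing]
  intro ι U s hs
  obtain ⟨t, ht⟩ := D.glue U (fun i => le_iSup U i) (fun x hx => Opens.mem_iSup.mp hx) s hs
  refine ⟨t, ht, fun t' ht' => D.ext _ _ fun x hx => ?_⟩
  obtain ⟨i, hi⟩ := Opens.mem_iSup.mp hx
  exact ⟨U i, le_iSup U i, hi, (ht' i).trans (ht i).symm⟩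

instance (V : (Opens Y)ᵒᵖ) : Module (Y.ringCatSheaf.obj.obj V) (D.presheafAb.obj V) :=
  D.mod V.unop

/-- The sheaf of modules defined by concrete data. -/
def toModules : Y.Modules :=
  (⟨PresheafOfModules.ofPresheaf (R := Y.ringCatSheaf.obj) D.presheafAb
    (fun _ _ f r m => (D.res f.unop.le).map_smulₛₗ r m), D.presheafAb_isSheaf⟩ :
    SheafOfModules Y.ringCatSheaf)

def equiv (V : Y.Opens) : Γ(D.toModules, V) ≃ₗ[Γ(Y, V)] D.obj V where
  toFun x := x
  invFun x := x
  map_add' _ _ := rfl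
  map_smul' _ _ := rfl

end SheafData
end Gluing

section FreeMod

variable {Y : Scheme.{u}}

variable (Y) in
/-- The free sheaf of modules with basis `κ`. -/
def freeData (κ : Type) : SheafData Y where
  obj V := κ → Γ(Y, V)
  res h :=
    { toFun := fun c k => rres h (c k)
      map_add' := fun c d => by ext; simp
      map_smul' := fun c d => by ext; simp }
  res_self e := funext fun k => rres_self _
  res_res h h' e := funext fun k => rres_rres h h' _
  ext s t h := funext fun k => rres_eq_of_locally_eq fun x hx => by
    obtain ⟨W, hW, hxW, e⟩ := h x hx
    exact ⟨W, hW, hxW, congrFun e k⟩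
  glue W hW hV s hs := by
    choose t ht using fun k => exists_rres_eq W hW hV (fun i => s i k)
      fun i j => congrFun (hs i j) k
    exact ⟨t, fun i => funext fun k => ht k i⟩

variable (Y) in
abbrev freeMod (κ : Type) : Y.Modules := (freeData Y κ).toModules

/-- The coordinates of a section of a free sheaf of modules. -/
def freeCoord (κ : Type) (V : Y.Opens) : Γ(freeMod Y κ, V) ≃ₗ[Γ(Y, V)] (κ → Γ(Y, V)) :=
  (freeData Y κ).equiv V

theorem freeCoord_mres {κ : Type} {U V : Y.Opens} (h : U ≤ V) (e : Γ(freeMod Y κ, V)) (k : κ) :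
    freeCoord κ U (mres _ h e) k = rres h (freeCoord κ V e k) := rfl

theorem mres_freeCoord_symm {κ : Type} {U V : Y.Opens} (h : U ≤ V) (c : κ → Γ(Y, V)) :
    mres _ h ((freeCoord κ V).symm c) = (freeCoord κ U).symm fun k => rres h (c k) := rfl

end FreeMod

namespace HomSec

variable {Y : Scheme.{u}} {M N : Y.Modules}

theorem eq_of_locally_eq {U : Y.Opens} {f g : HomSec M N U}
    (h : ∀ x ∈ U, ∃ (W : Y.Opens) (hW : W ≤ U), x ∈ W ∧ HomSec.res hW f = HomSec.res hW g) :
    f = g := by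
  refine ext' fun V hV e => mres_eq_of_locally_eq N fun x hx => ?_
  obtain ⟨W, hW, hxW, e'⟩ := h x (hV hx)
  refine ⟨V ⊓ W, inf_le_left, ⟨hx, hxW⟩, ?_⟩
  rw [f.naturality, g.naturality]
  exact congrArg (fun k : HomSec M N W => k.app (V ⊓ W) inf_le_right _) e'

theorem exists_res_eq {U : Y.Opens} {ι : Type*} (W : ι → Y.Opens) (hW : ∀ i, W i ≤ U)
    (hU : ∀ x ∈ U, ∃ i, x ∈ W i) (f : ∀ i, HomSec M N (W i))
    (hf : ∀ i j, HomSec.res (inf_le_left : W i ⊓ W j ≤ W i) (f i) =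
      HomSec.res inf_le_right (f j)) :
    ∃ g : HomSec M N U, ∀ i, HomSec.res (hW i) g = f i := by
  have key (V : Y.Opens) (hV : V ≤ U) (e : Γ(M, V)) : ∃ t : Γ(N, V), ∀ i,
      mres N (inf_le_left : V ⊓ W i ≤ V) t = (f i).app (V ⊓ W i) inf_le_right
        (mres M inf_le_left e) := by
    refine exists_mres_eq N (fun i => V ⊓ W i) (fun i => inf_le_left)
      (fun x hx => (hU x (hV hx)).imp fun i hi => ⟨hx, hi⟩) _ fun i j => ?_
    rw [(f i).naturality, (f j).naturality, mres_mres, mres_mres]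
    have h1 : (V ⊓ W i) ⊓ (V ⊓ W j) ≤ W i ⊓ W j := inf_le_inf inf_le_right inf_le_right
    exact congrArg (fun k : HomSec M N (W i ⊓ W j) => k.app _ h1 _) (hf i j)
  choose t ht using key
  have uniq (V : Y.Opens) (hV : V ≤ U) (a b : Γ(N, V)) (hab : ∀ i,
      mres N (inf_le_left : V ⊓ W i ≤ V) a = mres N inf_le_left b) : a = b :=
    mres_eq_of_locally_eq N fun x hx => by
      obtain ⟨i, hi⟩ := hU x (hV hx)
      exact ⟨V ⊓ W i, inf_le_left, ⟨hx, hi⟩, hab i⟩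
  refine ⟨⟨fun V hV => ⟨⟨t V hV, fun a b => ?_⟩, fun r a => ?_⟩, fun V V' hV h e => ?_⟩, fun i => ?_⟩
  · exact uniq V hV _ _ fun i => by simp only [map_add, ht]
  · exact uniq V hV _ _ fun i => by simp only [LinearMap.map_smulₛₗ, ht, RingHom.id_apply,
      map_smul]
  · refine uniq V' (h.trans hV) _ _ fun i => ?_
    change mres N _ (mres N h (t V hV e)) = mres N _ (t V' _ _)
    have h1 : V' ⊓ W i ≤ V ⊓ W i := inf_le_inf_right _ h
    rw [ht, mres_mres, mres_mres, ← mres_mres N h1 inf_le_left, ht, (f i).naturality, mres_mres]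
  · refine ext' fun V hV e => ?_
    refine uniq V (hV.trans (hW i)) _ _ fun j => ?_
    change mres N _ (t V _ e) = _
    rw [ht, (f i).naturality]
    have h1 : V ⊓ W j ≤ W i ⊓ W j := inf_le_inf_right _ hV
    exact (congrArg (fun k : HomSec M N (W i ⊓ W j) => k.app _ h1 _) (hf i j)).symm

end HomSec


section Quasicoherence

variable {Y : Scheme.{u}}

theorem IsAffineOpen.exists_finset_cover {W : Y.Opens} (hW : IsAffineOpen W) (p : Γ(Y, W) → Prop)
    (hp : ∀ x ∈ W, ∃ g, x ∈ Y.basicOpen g ∧ p g) :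
    ∃ s : Finset Γ(Y, W), (∀ g ∈ s, p g) ∧ ∀ x ∈ W, ∃ g ∈ s, x ∈ Y.basicOpen g := by
  classical
  choose! g hg hpg using hp
  obtain ⟨t, ht⟩ := hW.isCompact.elim_finite_subcover (fun x : W => (Y.basicOpen (g x) : Set Y))
    (fun x => (Y.basicOpen (g x)).isOpen) fun x hx => Set.mem_iUnion.mpr ⟨⟨x, hx⟩, hg x hx⟩
  refine ⟨t.image fun x : W => g x.1, fun a ha => ?_, fun x hx => ?_⟩
  · obtain ⟨x, -, rfl⟩ := Finset.mem_image.mp ha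
    exact hpg x.1 x.2
  · obtain ⟨y, hy, hxy⟩ := Set.mem_iUnion₂.mp (ht hx)
    exact ⟨g y.1, Finset.mem_image.mpr ⟨y, hy, rfl⟩, hxy⟩

theorem IsAffineOpen.ideal_eq_top {W : Y.Opens} (hW : IsAffineOpen W) (I : Ideal Γ(Y, W))
    (h : ∀ x ∈ W, ∃ g ∈ I, x ∈ Y.basicOpen g) : I = ⊤ := by
  rw [← Ideal.span_eq I]
  refine hW.self_le_iSup_basicOpen_iff.mp fun x hx => ?_
  obtain ⟨g, hg, hx⟩ := h x hx
  exact Opens.mem_iSup.mpr ⟨⟨g, hg⟩, hx⟩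

theorem rres_basicOpen {U V : Y.Opens} (h : U ≤ V) (g : Γ(Y, V)) :
    Y.basicOpen (rres h g) = U ⊓ Y.basicOpen g := Scheme.basicOpen_res _ _ _

namespace SheafData

/-- On affine open subsets of `V`, sections over basic open sets are obtained by localization. -/
def QC (F : SheafData Y) (V : Y.Opens) : Prop :=
  ∀ (W W' : Y.Opens) (_ : W ≤ V) (_ : IsAffineOpen W) (g : Γ(Y, W)) (h : W' ≤ W)
    (_ : W' = Y.basicOpen g),
    (∀ s : F.obj W, F.res h s = 0 → ∃ n : ℕ, g ^ n • s = 0) ∧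
    ∀ t : F.obj W', ∃ (n : ℕ) (s : F.obj W), F.res h s = rres h g ^ n • t

theorem QC.mono {F : SheafData Y} {U V : Y.Opens} (h : U ≤ V) (hF : F.QC V) : F.QC U :=
  fun W W' hW => hF W W' (hW.trans h)

theorem QC.of_local {F : SheafData Y} {U : Y.Opens}
    (hF : ∀ x ∈ U, ∃ V : Y.Opens, x ∈ V ∧ F.QC V) : F.QC U := by
  classical
  intro W W' hWU hW g h e
  subst e
  obtain ⟨S, hS, hc⟩ := IsAffineOpen.exists_finset_cover hW (fun f => F.QC (Y.basicOpen f))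
    fun x hx => by
      obtain ⟨V, hxV, hV⟩ := hF x (hWU hx)
      obtain ⟨f, hf, hxf⟩ := hW.exists_basicOpen_le ⟨x, hxV⟩ hx
      exact ⟨f, hxf, hV.mono hf⟩
  have hle (f : Γ(Y, W)) : Y.basicOpen f ≤ W := Y.basicOpen_le f
  have inf_eq (f : Γ(Y, W)) : Y.basicOpen f ⊓ Y.basicOpen g = Y.basicOpen (rres (hle f) g) :=
    (rres_basicOpen _ _).symm
  have eq_loc (V : Y.Opens) (hV : V ≤ W) (s t : F.obj V) (hst : ∀ f ∈ S,
      F.res (inf_le_left : V ⊓ Y.basicOpen f ≤ V) s = F.res inf_le_left t) : s = t :=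
    F.ext _ _ fun x hx => by
      obtain ⟨f, hf, hxf⟩ := hc x (hV hx)
      exact ⟨V ⊓ Y.basicOpen f, inf_le_left, ⟨hx, hxf⟩, hst f hf⟩
  -- torsion on an affine open subset of one of the members of the covering
  have tors' (V : Y.Opens) (hV : V ≤ W) (hVa : IsAffineOpen V) (f : Γ(Y, W)) (hf : f ∈ S)
      (hVf : V ≤ Y.basicOpen f) (s : F.obj V)
      (hs : F.res (inf_le_left : V ⊓ Y.basicOpen g ≤ V) s = 0) :
      ∃ n : ℕ, ∀ m ≥ n, rres hV g ^ m • s = 0 := by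
    obtain ⟨n, hn⟩ := (hS f hf V (V ⊓ Y.basicOpen g) hVf hVa (rres hV g) inf_le_left
      (rres_basicOpen _ _).symm).1 s hs
    refine ⟨n, fun m hm => ?_⟩
    rw [← Nat.sub_add_cancel hm, pow_add, mul_smul, hn, smul_zero]
  refine ⟨fun s hs => ?_, fun t => ?_⟩
  · have key (f : Γ(Y, W)) (hf : f ∈ S) := tors' (Y.basicOpen f) (hle f) (hW.basicOpen f) f hf
      le_rfl (F.res (hle f) s) (by
        rw [F.res_res, ← F.res_res inf_le_right h, hs, map_zero])
    choose! n hn using key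
    refine ⟨S.sup n, eq_loc W le_rfl _ _ fun f hf => ?_⟩
    have e1 : F.res (inf_le_left : W ⊓ Y.basicOpen f ≤ W) (g ^ S.sup n • s) =
        F.res inf_le_right (F.res (hle f) (g ^ S.sup n • s)) := (F.res_res _ _ _).symm
    rw [e1, LinearMap.map_smulₛₗ, map_pow, hn f hf _ (Finset.le_sup hf), map_zero, map_zero]
  · have key (f : S) : ∃ (n : ℕ) (s : F.obj (Y.basicOpen f.1)),
        F.res (inf_le_left : Y.basicOpen f.1 ⊓ Y.basicOpen g ≤ _) s =
          rres (inf_le_left.trans (hle f.1) : Y.basicOpen f.1 ⊓ Y.basicOpen g ≤ W) g ^ n •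
            F.res (inf_le_right : Y.basicOpen f.1 ⊓ Y.basicOpen g ≤ _) t := by
      obtain ⟨n, s, hs⟩ := (hS f.1 f.2 (Y.basicOpen f.1) (Y.basicOpen f.1 ⊓ Y.basicOpen g) le_rfl
        (hW.basicOpen f.1) (rres (hle f.1) g) inf_le_left (inf_eq f.1)).2 (F.res inf_le_right t)
      exact ⟨n, s, by rw [hs, rres_rres]⟩
    choose n s hs using key
    let N := Finset.univ.sup n
    let s' (f : S) : F.obj (Y.basicOpen f.1) := rres (hle f.1) g ^ (N - n f) • s f
    have hs' (f : S) : F.res (inf_le_left : Y.basicOpen f.1 ⊓ Y.basicOpen g ≤ _) (s' f) =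
          rres (inf_le_left.trans (hle f.1) : Y.basicOpen f.1 ⊓ Y.basicOpen g ≤ W) g ^ N •
            F.res (inf_le_right : Y.basicOpen f.1 ⊓ Y.basicOpen g ≤ _) t := by
      have : n f ≤ N := Finset.le_sup (Finset.mem_univ f)
      simp only [s', LinearMap.map_smulₛₗ, map_pow, hs, rres_rres]
      rw [smul_smul, ← pow_add, Nat.sub_add_cancel this]
    have key2 (p : S × S) : ∃ n : ℕ, ∀ m ≥ n,
        rres (inf_le_left.trans (hle p.1.1) : Y.basicOpen p.1.1 ⊓ Y.basicOpen p.2.1 ≤ W) g ^ m •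
          (F.res inf_le_left (s' p.1) - F.res inf_le_right (s' p.2)) = 0 := by
      refine tors' _ _ ?_ p.1.1 p.1.2 inf_le_left _ ?_
      · have := (hW.basicOpen p.1.1).basicOpen (rres (hle p.1.1) p.2.1)
        rwa [rres_basicOpen] at this
      · rw [map_sub, sub_eq_zero, F.res_res, F.res_res,
          ← F.res_res (show (Y.basicOpen p.1.1 ⊓ Y.basicOpen p.2.1) ⊓ Y.basicOpen g ≤
            Y.basicOpen p.1.1 ⊓ Y.basicOpen g from inf_le_inf_right _ inf_le_left) inf_le_left,
          ← F.res_res (show (Y.basicOpen p.1.1 ⊓ Y.basicOpen p.2.1) ⊓ Y.basicOpen g ≤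
            Y.basicOpen p.2.1 ⊓ Y.basicOpen g from inf_le_inf_right _ inf_le_right) inf_le_left,
          hs', hs', LinearMap.map_smulₛₗ, LinearMap.map_smulₛₗ, map_pow, map_pow, rres_rres,
          rres_rres, F.res_res, F.res_res]
    choose m hm using key2
    let m' := Finset.univ.sup m
    obtain ⟨r, hr⟩ := F.glue (fun f : ULift.{u} S => Y.basicOpen f.down.1)
      (fun f => hle f.down.1)
      (fun x hx => by obtain ⟨f, hf, hxf⟩ := hc x hx; exact ⟨⟨⟨f, hf⟩⟩, hxf⟩)
      (fun f => rres (hle f.down.1) g ^ m' • s' f.down) (fun f f' => by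
        have h1 := hm (f.down, f'.down) m' (Finset.le_sup (Finset.mem_univ _))
        rw [smul_sub, sub_eq_zero] at h1
        simp only [LinearMap.map_smulₛₗ, map_pow, rres_rres]
        exact h1)
    refine ⟨m' + N, r, eq_loc _ h _ _ fun f hf => ?_⟩
    have h1 : F.res (hle f) r = rres (hle f) g ^ m' • s' ⟨f, hf⟩ := hr ⟨⟨f, hf⟩⟩
    have e1 : F.res (inf_le_left : Y.basicOpen g ⊓ Y.basicOpen f ≤ _) (F.res h r) =
        F.res (inf_comm (Y.basicOpen g) (Y.basicOpen f)).le
          (F.res inf_le_left (F.res (hle f) r)) := by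
      simp only [F.res_res]
    have e2 := congrArg (F.res (inf_le_left : Y.basicOpen f ⊓ Y.basicOpen g ≤ _)) h1
    have e3 : F.res (inf_le_left : Y.basicOpen f ⊓ Y.basicOpen g ≤ _) (s' ⟨f, hf⟩) =
        rres (inf_le_left.trans (hle f) : Y.basicOpen f ⊓ Y.basicOpen g ≤ W) g ^ N •
          F.res inf_le_right t := hs' ⟨f, hf⟩
    rw [LinearMap.map_smulₛₗ, e3, map_pow, rres_rres, smul_smul, ← pow_add] at e2
    rw [e1, e2]
    simp only [LinearMap.map_smulₛₗ, map_pow, rres_rres, F.res_res]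

/-- The concrete data of a sheaf of modules. -/
abbrev ofModules (M : Y.Modules) : SheafData Y where
  obj V := Γ(M, V)
  res := mres M
  res_self := mres_self M
  res_res := mres_mres M
  ext _ _ := mres_eq_of_locally_eq M
  glue := exists_mres_eq M

/-- The sheaf of homomorphisms. -/
abbrev hom (M N : Y.Modules) : SheafData Y where
  obj V := HomSec M N V
  res := HomSec.res
  res_self _ := rfl
  res_res _ _ _ := rfl
  ext _ _ := HomSec.eq_of_locally_eq
  glue := HomSec.exists_res_eq

/-- Quasi-coherence of a product, given by coordinates. -/
theorem QC.of_coord {F G : SheafData Y} {V : Y.Opens} {κ : Type} [Finite κ] (hG : G.QC V)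
    (c : ∀ W, W ≤ V → F.obj W → κ → G.obj W)
    (hc : ∀ W hW, Function.Bijective (c W hW))
    (hs : ∀ W hW (r : Γ(Y, W)) (s : F.obj W) k, c W hW (r • s) k = r • c W hW s k)
    (h0 : ∀ W hW k, c W hW 0 k = 0)
    (hr : ∀ W W' (hW : W ≤ V) (h : W' ≤ W) (s : F.obj W) k,
      c W' (h.trans hW) (F.res h s) k = G.res h (c W hW s k)) : F.QC V := by
  have := Fintype.ofFinite κ
  intro W W' hW hWa g h e
  refine ⟨fun s hs' => ?_, fun t => ?_⟩
  · have key (k : κ) : ∃ n : ℕ, g ^ n • c W hW s k = 0 :=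
      (hG W W' hW hWa g h e).1 _ (by rw [← hr, hs', h0])
    choose n hn using key
    refine ⟨Finset.univ.sup n, (hc W hW).1 (funext fun k => ?_)⟩
    have : n k ≤ Finset.univ.sup n := Finset.le_sup (Finset.mem_univ k)
    rw [hs, h0, ← Nat.sub_add_cancel this, pow_add, mul_smul, hn, smul_zero]
  · choose n s hs' using fun k => (hG W W' hW hWa g h e).2 (c W' (h.trans hW) t k)
    obtain ⟨r, hr'⟩ := (hc W hW).2 fun k => g ^ (Finset.univ.sup n - n k) • s k
    refine ⟨Finset.univ.sup n, r, (hc W' (h.trans hW)).1 (funext fun k => ?_)⟩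
    have : n k ≤ Finset.univ.sup n := Finset.le_sup (Finset.mem_univ k)
    rw [hr W W' hW h, hr', LinearMap.map_smulₛₗ, hs', smul_smul, hs W' (h.trans hW),
      map_pow, ← pow_add, Nat.sub_add_cancel this]

theorem qc_free (κ : Type) [Finite κ] (V : Y.Opens) : (ofModules (freeMod Y κ)).QC V := by
  have := Fintype.ofFinite κ
  intro W W' hW hWa g h e
  subst e
  have := hWa.isLocalization_basicOpen g
  refine ⟨fun (s : Γ(freeMod Y κ, W)) hs' => ?_, fun (t : Γ(freeMod Y κ, Y.basicOpen g)) => ?_⟩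
  · have key (k : κ) : ∃ n : ℕ, g ^ n * freeCoord κ W s k = 0 :=
      exists_of_res_zero_of_qcqs hWa.isCompact hWa.isQuasiSeparated
        (congrFun (congrArg (freeCoord κ (Y.basicOpen g)) hs') k)
    choose n hn using key
    refine ⟨Finset.univ.sup n, (freeCoord κ W).injective (funext fun k => ?_)⟩
    have : n k ≤ Finset.univ.sup n := Finset.le_sup (Finset.mem_univ k)
    change freeCoord κ W (g ^ _ • (s : Γ(freeMod Y κ, W))) k = freeCoord κ W 0 k
    rw [map_smul, map_zero, Pi.smul_apply, smul_eq_mul, ← Nat.sub_add_cancel this, pow_add,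
      mul_assoc, hn, mul_zero, Pi.zero_apply]
  · choose n s hs' using fun k =>
      exists_eq_pow_mul_of_isAffineOpen Y W hWa g (freeCoord κ (Y.basicOpen g) t k)
    refine ⟨Finset.univ.sup n, (freeCoord κ W).symm fun k => g ^ (Finset.univ.sup n - n k) * s k,
      (freeCoord κ _).injective (funext fun k => ?_)⟩
    have : n k ≤ Finset.univ.sup n := Finset.le_sup (Finset.mem_univ k)
    have h1 : rres h (s k) = rres h g ^ n k * freeCoord κ (Y.basicOpen g) t k := hs' k
    change rres h (g ^ _ * s k) = freeCoord κ _ (rres h g ^ _ • (t : Γ(freeMod Y κ, Y.basicOpen g))) k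
    rw [map_mul, h1, map_smul, Pi.smul_apply, smul_eq_mul, ← mul_assoc, map_pow, ← pow_add,
      Nat.sub_add_cancel this]

end SheafData

/-- `b` is a basis of `M` on all open subsets of `V`. -/
def IsLocalBasis (M : Y.Modules) {V : Y.Opens} {n : ℕ} (b : Fin n → Γ(M, V)) : Prop :=
  ∀ (W : Y.Opens) (h : W ≤ V),
    Function.Bijective (fun c : Fin n → Γ(Y, W) => ∑ k, c k • mres M h (b k))

namespace IsLocalBasis

variable {M N : Y.Modules} {V : Y.Opens} {n : ℕ} {b : Fin n → Γ(M, V)} (hb : IsLocalBasis M b)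
include hb

/-- The coordinates with respect to a local basis. -/
def coord {W : Y.Opens} (h : W ≤ V) : Γ(M, W) ≃ₗ[Γ(Y, W)] (Fin n → Γ(Y, W)) :=
  (LinearEquiv.ofBijective (Fintype.linearCombination Γ(Y, W) fun k => mres M h (b k))
    (hb W h)).symm

theorem sum_coord {W : Y.Opens} (h : W ≤ V) (e : Γ(M, W)) :
    ∑ k, hb.coord h e k • mres M h (b k) = e := (hb.coord h).symm_apply_apply e

theorem coord_sum {W : Y.Opens} (h : W ≤ V) (c : Fin n → Γ(Y, W)) :
    hb.coord h (∑ k, c k • mres M h (b k)) = c := (hb.coord h).apply_symm_apply c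

theorem coord_mres {W W' : Y.Opens} (h : W ≤ V) (h' : W' ≤ W) (e : Γ(M, W)) (k : Fin n) :
    hb.coord (h'.trans h) (mres M h' e) k = rres h' (hb.coord h e k) := by
  have : mres M h' e = ∑ k, rres h' (hb.coord h e k) • mres M (h'.trans h) (b k) := by
    conv_lhs => rw [← hb.sum_coord h e]
    simp only [map_sum, LinearMap.map_smulₛₗ, mres_mres]
  rw [this, coord_sum]

theorem qc : (SheafData.ofModules M).QC V :=
  (SheafData.qc_free PUnit V).of_coord (κ := Fin n)
    (fun W h e k => (freeCoord PUnit W).symm fun _ => hb.coord h e k)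
    (fun W h => by
      refine ⟨fun s t hst => (hb.coord h).injective (funext fun k => ?_), fun c => ?_⟩
      · exact congrFun ((freeCoord PUnit W).symm.injective (congrFun hst k)) ⟨⟩
      · refine ⟨(hb.coord h).symm fun k => freeCoord PUnit W (c k) ⟨⟩, funext fun k => ?_⟩
        change (freeCoord PUnit W).symm (fun _ => hb.coord h ((hb.coord h).symm _) k) = c k
        rw [LinearEquiv.apply_symm_apply, LinearEquiv.symm_apply_eq])
    (fun W h r s k => by rw [map_smul]; exact map_smul (freeCoord PUnit W).symm r _)
    (fun W h k => by rw [map_zero]; exact map_zero (freeCoord PUnit W).symm)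
    (fun W W' hW h s k => by
      simp only [coord_mres hb hW h]
      exact (mres_freeCoord_symm h _).symm)

/-- Homomorphisms are determined by the images of a basis. -/
theorem hom_ext {W : Y.Opens} (h : W ≤ V) {f g : HomSec M N W}
    (e : ∀ k, f.app W le_rfl (mres M h (b k)) = g.app W le_rfl (mres M h (b k))) : f = g := by
  refine HomSec.ext' fun W' hW' m => ?_
  rw [← hb.sum_coord (hW'.trans h) m]
  simp only [map_sum, map_smul]
  refine Finset.sum_congr rfl fun k _ => congrArg _ ?_
  rw [← mres_mres M hW' h, ← f.naturality W W' le_rfl, e, g.naturality W W' le_rfl]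

/-- The homomorphism with given values on a basis. -/
def homOf {W : Y.Opens} (h : W ≤ V) (c : Fin n → Γ(N, W)) : HomSec M N W where
  app W' hW' := (Fintype.linearCombination Γ(Y, W') fun k => mres N hW' (c k)) ∘ₗ
    (hb.coord (hW'.trans h)).toLinearMap
  naturality W' W'' hW' h' e := by
    simp only [LinearMap.comp_apply, LinearEquiv.coe_coe, Fintype.linearCombination_apply, map_sum,
      LinearMap.map_smulₛₗ, mres_mres]
    exact Finset.sum_congr rfl fun k _ => by rw [coord_mres hb (hW'.trans h) h']

theorem coord_basis {W : Y.Opens} (h : W ≤ V) (k : Fin n) :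
    hb.coord h (mres M h (b k)) = Pi.single k 1 := by
  have : mres M h (b k) = ∑ l, (Pi.single k 1 : Fin n → Γ(Y, W)) l • mres M h (b l) := by
    simp [Pi.single_apply, ite_smul]
  rw [this, coord_sum]

theorem homOf_app {W W' : Y.Opens} (h : W ≤ V) (h' : W' ≤ W) (c : Fin n → Γ(N, W)) (k : Fin n) :
    (hb.homOf h c).app W' h' (mres M (h'.trans h) (b k)) = mres N h' (c k) := by
  simp only [homOf, LinearMap.comp_apply, LinearEquiv.coe_coe]
  rw [coord_basis]
  simp [Fintype.linearCombination_apply, Pi.single_apply, ite_smul]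

theorem qc_hom (hN : (SheafData.ofModules N).QC V) : (SheafData.hom M N).QC V :=
  hN.of_coord (F := SheafData.hom M N) (κ := Fin n)
    (fun W h (f : HomSec M N W) k => f.app W le_rfl (mres M h (b k)))
    (fun W h => by
      refine ⟨fun f g hfg => hb.hom_ext h (congrFun hfg), fun c => ⟨hb.homOf h c, funext fun k => ?_⟩⟩
      have := hb.homOf_app h le_rfl c k
      rwa [mres_self] at this)
    (fun W h r f k => by
      change rres le_rfl r • f.app W le_rfl _ = r • f.app W le_rfl _
      rw [rres_self])
    (fun W h k => rfl)
    (fun W W' hW h f k => by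
      change f.app W' _ _ = mres N h (f.app W le_rfl _)
      rw [f.naturality W W' le_rfl h, mres_mres])

end IsLocalBasis
end Quasicoherence


section DualBases

variable {Y : Scheme.{u}}

/-- Linear functionals on a sheaf of modules over an open set. -/
abbrev Functional (M : Y.Modules) (U : Y.Opens) : Type u := HomSec M (freeMod Y PUnit) U

namespace Functional

variable {M N : Y.Modules} {U : Y.Opens}

/-- The value of a functional. -/
def val (f : Functional M U) (V : Y.Opens) (h : V ≤ U) : Γ(M, V) →ₗ[Γ(Y, V)] Γ(Y, V) :=
  LinearMap.proj (R := Γ(Y, V)) (φ := fun _ : PUnit => Γ(Y, V)) PUnit.unit ∘ₗ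
    (freeCoord PUnit V).toLinearMap ∘ₗ f.app V h

theorem rres_val (f : Functional M U) {V W : Y.Opens} (hV : V ≤ U) (h : W ≤ V) (m : Γ(M, V)) :
    rres h (f.val V hV m) = f.val W (h.trans hV) (mres M h m) := by
  change freeCoord PUnit W (mres _ h (f.app V hV m)) PUnit.unit = _
  rw [f.naturality]
  rfl

theorem val_smul (r : Γ(Y, U)) (f : Functional M U) (V : Y.Opens) (h : V ≤ U) (m : Γ(M, V)) :
    Functional.val (r • f) V h m = rres h r * f.val V h m := rfl

/-- The homomorphism `m ↦ f m • n`. -/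
def smulRight (f : Functional M U) (n : Γ(N, U)) : HomSec M N U where
  app V h := (f.val V h).smulRight (mres N h n)
  naturality V W hV h e := by simp [rres_val, mres_mres]

theorem smulRight_app (f : Functional M U) (n : Γ(N, U)) (V : Y.Opens) (h : V ≤ U) (m : Γ(M, V)) :
    (f.smulRight n).app V h m = f.val V h m • mres N h n := rfl

end Functional

theorem IsLocalBasis.exists_dual {M : Y.Modules} {V : Y.Opens} {n : ℕ} {b : Fin n → Γ(M, V)}
    (hb : IsLocalBasis M b) : ∃ f : Fin n → Functional M V,
      ∑ k, (f k).smulRight (b k) = HomSec.id M V := by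
  refine ⟨fun k => hb.homOf le_rfl fun l => (freeCoord PUnit V).symm fun _ => if l = k then 1 else 0,
    hb.hom_ext le_rfl fun l => ?_⟩
  have h (s : Finset (Fin n)) (f : Fin n → HomSec M M V) (m : Γ(M, V)) :
      (∑ k ∈ s, f k).app V le_rfl m = ∑ k ∈ s, (f k).app V le_rfl m := by
    change (HomSec.toLin (∑ k ∈ s, f k)) m = _
    rw [map_sum, LinearMap.sum_apply]
    rfl
  rw [h]
  simp only [Functional.smulRight_app]
  change _ = mres M le_rfl (b l)
  have h2 (k : Fin n) : Functional.val (hb.homOf le_rfl fun l => (freeCoord PUnit V).symm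
      fun _ => if l = k then (1 : Γ(Y, V)) else 0) V le_rfl (mres M le_rfl (b l)) =
        if l = k then 1 else 0 := by
    unfold Functional.val
    simp only [LinearMap.comp_apply]
    rw [hb.homOf_app le_rfl le_rfl, mres_self]
    simp
  simp only [h2, ite_smul, one_smul, zero_smul, Finset.sum_ite_eq, Finset.mem_univ, if_true]

theorem IsLocalBasis.res {M : Y.Modules} {V W : Y.Opens} {n : ℕ} {b : Fin n → Γ(M, V)}
    (hb : IsLocalBasis M b) (h : W ≤ V) : IsLocalBasis M fun k => mres M h (b k) := fun W' h' => by
  simpa only [mres_mres] using hb W' (h'.trans h)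

/-- `M` is locally free of finite rank over `U`. -/
def LocallyFree (M : Y.Modules) (U : Y.Opens) : Prop :=
  ∀ x ∈ U, ∃ (V : Y.Opens) (n : ℕ) (b : Fin n → Γ(M, V)), x ∈ V ∧ IsLocalBasis M b

theorem LocallyFree.qc {M : Y.Modules} {U : Y.Opens} (hM : LocallyFree M U) :
    (SheafData.ofModules M).QC U :=
  .of_local fun x hx => let ⟨V, _, _, hxV, hb⟩ := hM x hx; ⟨V, hxV, hb.qc⟩

theorem LocallyFree.qc_hom {M N : Y.Modules} {U : Y.Opens} (hM : LocallyFree M U)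
    (hN : (SheafData.ofModules N).QC U) : (SheafData.hom M N).QC U :=
  .of_local fun x hx => by
    obtain ⟨V, _, _, hxV, hb⟩ := hM x hx
    exact ⟨V ⊓ U, ⟨hxV, hx⟩, (hb.res inf_le_left).qc_hom (hN.mono inf_le_right)⟩

theorem HomSec.sum_app {M N : Y.Modules} {U : Y.Opens} {ι : Type*} (s : Finset ι)
    (f : ι → HomSec M N U) (V : Y.Opens) (h : V ≤ U) (m : Γ(M, V)) :
    (∑ k ∈ s, f k).app V h m = ∑ k ∈ s, (f k).app V h m := by
  change HomSec.toLin (HomSec.res h (∑ k ∈ s, f k)) m = _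
  rw [map_sum, map_sum, LinearMap.sum_apply]
  rfl

theorem LocallyFree.id_mem_span {M : Y.Modules} {U : Y.Opens} (hM : LocallyFree M U)
    (hU : IsAffineOpen U) :
    HomSec.id M U ∈ Submodule.span Γ(Y, U)
      (Set.range fun p : Functional M U × Γ(M, U) => p.1.smulRight p.2) := by
  set S := Submodule.span Γ(Y, U) (Set.range fun p : Functional M U × Γ(M, U) => p.1.smulRight p.2)
  let I : Ideal Γ(Y, U) := S.comap (LinearMap.toSpanSingleton Γ(Y, U) _ (HomSec.id M U))
  suffices I = ⊤ by
    have h1 : (1 : Γ(Y, U)) ∈ I := this ▸ Submodule.mem_top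
    simpa [I] using h1
  refine IsAffineOpen.ideal_eq_top hU I fun x hx => ?_
  obtain ⟨V, n, b, hxV, hb⟩ := hM x hx
  obtain ⟨g, hg, hxg⟩ := hU.exists_basicOpen_le ⟨x, hxV⟩ hx
  obtain ⟨f, hf⟩ := (hb.res hg).exists_dual
  have h := Y.basicOpen_le g
  have hFree : (SheafData.ofModules (freeMod Y PUnit)).QC U := SheafData.qc_free _ _
  have exF (k : Fin n) : ∃ (N : ℕ) (F : Functional M U), HomSec.res h F = rres h g ^ N • f k :=
    (hM.qc_hom hFree U _ le_rfl hU g h rfl).2 (f k)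
  choose N F hF using exF
  choose N' B hB using fun k => (hM.qc U _ le_rfl hU g h rfl).2 (mres M hg (b k))
  let T : HomSec M M U := ∑ k, g ^ (Finset.univ.sup N - N k + (Finset.univ.sup N' - N' k)) •
    (F k).smulRight (B k) - g ^ (Finset.univ.sup N + Finset.univ.sup N') • HomSec.id M U
  have hT : HomSec.res h T = 0 := by
    have e1 (k : Fin n) : HomSec.res h ((F k).smulRight (B k)) =
        rres h g ^ (N k + N' k) • (f k).smulRight (mres M hg (b k)) := by
      refine HomSec.ext' fun W hW m => ?_
      have e2 : (F k).val W (hW.trans h) m = rres hW (rres h g ^ N k) * (f k).val W hW m :=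
        congrArg (fun u : Functional M (Y.basicOpen g) => u.val W hW m) (hF k)
      have e3 : mres M (hW.trans h) (B k) = rres hW (rres h g ^ N' k) • mres M hW (mres M hg (b k)) := by
        rw [← mres_mres M hW h]
        exact (congrArg (mres M hW) (hB k)).trans ((mres M hW).map_smulₛₗ _ _)
      change (F k).val W (hW.trans h) m • mres M (hW.trans h) (B k) =
        rres hW (rres h g ^ (N k + N' k)) • (f k).val W hW m • mres M hW (mres M hg (b k))
      rw [e2, e3, pow_add, map_mul, smul_smul, smul_smul]
      congr 1
      ring
    simp only [T, map_sub, map_sum, LinearMap.map_smulₛₗ, e1]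
    have e4 (k : Fin n) : Finset.univ.sup N - N k + (Finset.univ.sup N' - N' k) + (N k + N' k) =
        Finset.univ.sup N + Finset.univ.sup N' := by
      have := Finset.le_sup (f := N) (Finset.mem_univ k)
      have := Finset.le_sup (f := N') (Finset.mem_univ k)
      omega
    simp only [map_pow, smul_smul, ← pow_add, e4, ← Finset.smul_sum, hf]
    exact sub_self _
  obtain ⟨K, hK⟩ := (hM.qc_hom hM.qc U _ le_rfl hU g h rfl).1 T hT
  refine ⟨g * (g ^ K * g ^ (Finset.univ.sup N + Finset.univ.sup N')), I.mul_mem_left _ ?_, ?_⟩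
  · change (g ^ K * g ^ (Finset.univ.sup N + Finset.univ.sup N')) • HomSec.id M U ∈ S
    have : (g ^ K * g ^ (Finset.univ.sup N + Finset.univ.sup N')) • HomSec.id M U =
        g ^ K • ∑ k, g ^ (Finset.univ.sup N - N k + (Finset.univ.sup N' - N' k)) •
          (F k).smulRight (B k) := by
      rw [smul_sub, sub_eq_zero] at hK
      rw [hK, smul_smul]
    rw [this]
    exact S.smul_mem _ (S.sum_mem fun k _ => S.smul_mem _ (Submodule.subset_span ⟨(F k, B k), rfl⟩))
  · rw [← pow_add, ← pow_succ', Y.basicOpen_pow _ (Nat.succ_pos _)]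
    exact hxg

variable {U₀ : Y.Opens}

namespace GradedBundle

variable (E : GradedBundle Y U₀)

theorem exists_localBasis {x : Y} (hx : x ∈ U₀) : ∃ (V : Y.Opens), x ∈ V ∧ V ≤ U₀ ∧
    ∃ (n : ℕ) (b : Fin n → Γ(E.M, V)) (deg : Fin n → ℤ), IsLocalBasis E.M b ∧
      ∀ (W : Y.Opens) (h : W ≤ V) (ℓ : ℤ),
        E.Gr ℓ W = Submodule.span Γ(Y, W) {e | ∃ k, deg k = ℓ ∧ e = mres E.M h (b k)} := by
  obtain ⟨V, hxV, hV, n, b, deg, h⟩ := E.locally_basis x hx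
  exact ⟨V, hxV, hV, n, b, deg, fun W hW => (h W hW).1, fun W hW => (h W hW).2⟩

theorem locallyFree : LocallyFree E.M U₀ := fun _ hx =>
  let ⟨V, hxV, _, n, b, _, hb, _⟩ := E.exists_localBasis hx
  ⟨V, n, b, hxV, hb⟩

/-- `p` is the projection onto `Gr ℓ`. -/
def IsProj (ℓ : ℤ) {U : Y.Opens} (p : HomSec E.M E.M U) : Prop :=
  ∀ (V : Y.Opens) (h : V ≤ U), (∀ e ∈ E.Gr ℓ V, p.app V h e = e) ∧
    ∀ m ≠ ℓ, ∀ e ∈ E.Gr m V, p.app V h e = 0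

variable {E} in
theorem IsProj.ext_of_basis {ℓ : ℤ} {V : Y.Opens} {n : ℕ} {b : Fin n → Γ(E.M, V)} {deg : Fin n → ℤ}
    (hb : IsLocalBasis E.M b) (hdeg : ∀ (W : Y.Opens) (h : W ≤ V) (ℓ : ℤ),
        E.Gr ℓ W = Submodule.span Γ(Y, W) {e | ∃ k, deg k = ℓ ∧ e = mres E.M h (b k)})
    {W : Y.Opens} (h : W ≤ V) {p q : HomSec E.M E.M W} (hp : E.IsProj ℓ p) (hq : E.IsProj ℓ q) :
    p = q := hb.hom_ext h fun k => by
  have hk : mres E.M h (b k) ∈ E.Gr (deg k) W := by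
    rw [hdeg W h]; exact Submodule.subset_span ⟨k, rfl, rfl⟩
  by_cases hd : deg k = ℓ
  · rw [(hp W le_rfl).1 _ (hd ▸ hk), (hq W le_rfl).1 _ (hd ▸ hk)]
  · rw [(hp W le_rfl).2 _ hd _ hk, (hq W le_rfl).2 _ hd _ hk]

theorem exists_isProj (ℓ : ℤ) : ∃ p : HomSec E.M E.M U₀, E.IsProj ℓ p := by
  choose V hxV hV n b deg hb hdeg using fun x : U₀ => E.exists_localBasis x.2
  let q (x : U₀) : HomSec E.M E.M (V x) :=
    (hb x).homOf le_rfl fun k => if deg x k = ℓ then b x k else 0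
  have hq (x : U₀) : E.IsProj ℓ (q x) := by
    refine fun W hW => ⟨fun e he => ?_, fun m hm e he => ?_⟩
    · rw [hdeg x W hW] at he
      have : Set.EqOn ((q x).app W hW) (LinearMap.id : Γ(E.M, W) →ₗ[Γ(Y, W)] _)
          {e | ∃ k, deg x k = ℓ ∧ e = mres E.M hW (b x k)} := by
        rintro _ ⟨k, hk, rfl⟩
        exact ((hb x).homOf_app le_rfl hW _ k).trans (by rw [if_pos hk]; rfl)
      exact LinearMap.eqOn_span this he
    · rw [hdeg x W hW] at he
      have : Set.EqOn ((q x).app W hW) (0 : Γ(E.M, W) →ₗ[Γ(Y, W)] _)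
          {e | ∃ k, deg x k = m ∧ e = mres E.M hW (b x k)} := by
        rintro _ ⟨k, hk, rfl⟩
        exact ((hb x).homOf_app le_rfl hW _ k).trans (by rw [if_neg (hk ▸ hm), map_zero]; rfl)
      exact LinearMap.eqOn_span this he
  have hres {W W' : Y.Opens} (h : W' ≤ W) {p : HomSec E.M E.M W} (hp : E.IsProj ℓ p) :
      E.IsProj ℓ (HomSec.res h p) := fun V hV => hp V (hV.trans h)
  obtain ⟨p, hp⟩ := HomSec.exists_res_eq V hV (fun x hx => ⟨⟨x, hx⟩, hxV ⟨x, hx⟩⟩) q fun x y =>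
    IsProj.ext_of_basis (hb x) (hdeg x) inf_le_left (hres _ (hq x)) (hres _ (hq y))
  have key (W : Y.Opens) (hW : W ≤ U₀) (e : Γ(E.M, W)) (x : U₀) :
      mres E.M (inf_le_left : W ⊓ V x ≤ W) (p.app W hW e) =
        (q x).app (W ⊓ V x) inf_le_right (mres E.M inf_le_left e) := by
    rw [p.naturality, ← hp x]
    rfl
  refine ⟨p, fun W hW => ⟨fun e he => ?_, fun m hm e he => ?_⟩⟩
  · refine mres_eq_of_locally_eq _ fun x hx => ⟨W ⊓ V ⟨x, hW hx⟩, inf_le_left, ⟨hx, hxV _⟩, ?_⟩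
    rw [key, (hq _ _ _).1 _ (E.res_mem _ _ _ _ hW _ he)]
  · refine mres_eq_of_locally_eq _ fun x hx => ⟨W ⊓ V ⟨x, hW hx⟩, inf_le_left, ⟨hx, hxV _⟩, ?_⟩
    rw [key, (hq _ _ _).2 _ hm _ (E.res_mem _ _ _ _ hW _ he), map_zero]

/-- The projection onto `Gr ℓ`. -/
def proj (ℓ : ℤ) : HomSec E.M E.M U₀ := (E.exists_isProj ℓ).choose

theorem isProj_proj (ℓ : ℤ) : E.IsProj ℓ (E.proj ℓ) := (E.exists_isProj ℓ).choose_spec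

theorem proj_of_mem {ℓ : ℤ} {V : Y.Opens} (h : V ≤ U₀) {e : Γ(E.M, V)} (he : e ∈ E.Gr ℓ V) :
    (E.proj ℓ).app V h e = e := (E.isProj_proj ℓ V h).1 e he

theorem proj_of_mem_ne {ℓ m : ℤ} (hm : m ≠ ℓ) {V : Y.Opens} (h : V ≤ U₀) {e : Γ(E.M, V)}
    (he : e ∈ E.Gr m V) : (E.proj ℓ).app V h e = 0 := (E.isProj_proj ℓ V h).2 m hm e he

theorem proj_mem (ℓ : ℤ) {V : Y.Opens} (h : V ≤ U₀) (e : Γ(E.M, V)) :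
    (E.proj ℓ).app V h e ∈ E.Gr ℓ V := by
  refine E.of_locally_mem ℓ V h _ fun x hx => ?_
  obtain ⟨W, hxW, hW, n, b, deg, hb, hdeg⟩ := E.exists_localBasis (h hx)
  refine ⟨V ⊓ W, inf_le_left, ⟨hx, hxW⟩, ?_⟩
  rw [(E.proj ℓ).naturality, ← hb.sum_coord (inf_le_right : V ⊓ W ≤ W) (mres E.M _ e)]
  simp only [map_sum, map_smul]
  refine Submodule.sum_mem _ fun k _ => Submodule.smul_mem _ _ ?_
  have hk : mres E.M (inf_le_right : V ⊓ W ≤ W) (b k) ∈ E.Gr (deg k) (V ⊓ W) := by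
    rw [hdeg _ inf_le_right]; exact Submodule.subset_span ⟨k, rfl, rfl⟩
  by_cases hd : deg k = ℓ
  · rw [E.proj_of_mem _ (hd ▸ hk)]
    exact hd ▸ hk
  · rw [E.proj_of_mem_ne hd _ hk]
    exact zero_mem _

theorem exists_sum_proj {U : Y.Opens} (hU : IsAffineOpen U) (hU₀ : U ≤ U₀) :
    ∃ Λ : Finset ℤ, ∀ (V : Y.Opens) (h : V ≤ U) (e : Γ(E.M, V)),
      ∑ ℓ ∈ Λ, (E.proj ℓ).app V (h.trans hU₀) e = e := by
  classical
  let P (g : Γ(Y, U)) (Λ : Finset ℤ) : Prop := ∀ Λ' : Finset ℤ, Λ ⊆ Λ' →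
    ∀ (V : Y.Opens) (h : V ≤ U) (_ : V ≤ Y.basicOpen g) (e : Γ(E.M, V)),
      ∑ ℓ ∈ Λ', (E.proj ℓ).app V (h.trans hU₀) e = e
  obtain ⟨S, hS, hc⟩ := IsAffineOpen.exists_finset_cover hU (fun g => ∃ Λ, P g Λ) fun x hx => by
    obtain ⟨W, hxW, hW, n, b, deg, hb, hdeg⟩ := E.exists_localBasis (hU₀ hx)
    obtain ⟨g, hg, hxg⟩ := hU.exists_basicOpen_le ⟨x, hxW⟩ hx
    refine ⟨g, hxg, Finset.univ.image deg, fun Λ' hΛ' V hV hVg e => ?_⟩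
    have hVW := hVg.trans hg
    rw [← hb.sum_coord hVW e]
    simp only [map_sum, map_smul]
    rw [Finset.sum_comm]
    refine Finset.sum_congr rfl fun k _ => ?_
    rw [← Finset.smul_sum]
    congr 1
    have hk : mres E.M hVW (b k) ∈ E.Gr (deg k) V := by
      rw [hdeg _ hVW]; exact Submodule.subset_span ⟨k, rfl, rfl⟩
    rw [Finset.sum_eq_single (deg k) (fun ℓ _ hℓ => E.proj_of_mem_ne hℓ.symm _ hk)
      (fun h => (h (hΛ' (Finset.mem_image_of_mem _ (Finset.mem_univ _)))).elim)]
    exact E.proj_of_mem _ hk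
  choose! Λ hΛ using hS
  refine ⟨S.biUnion Λ, fun V hV e => mres_eq_of_locally_eq _ fun x hx => ?_⟩
  obtain ⟨g, hg, hxg⟩ := hc x (hV hx)
  refine ⟨V ⊓ Y.basicOpen g, inf_le_left, ⟨hx, hxg⟩, ?_⟩
  rw [map_sum]
  simp only [HomSec.naturality]
  exact hΛ g hg _ (Finset.subset_biUnion_of_mem Λ hg) _ (inf_le_left.trans hV) inf_le_right _

/-- A finite system of homogeneous sections `e k` over `U` and of functionals `f k`, such that
`m = ∑ f k m • e k`. -/
structure DualBasis (U : Y.Opens) where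
  κ : Type
  [fintype : Fintype κ]
  deg : κ → ℤ
  e : κ → Γ(E.M, U)
  f : κ → Functional E.M U
  e_mem : ∀ k, e k ∈ E.Gr (deg k) U
  f_of_ne : ∀ k m, m ≠ deg k → ∀ (V : Y.Opens) (h : V ≤ U), ∀ s ∈ E.Gr m V, (f k).val V h s = 0
  sum_eq : ∀ (V : Y.Opens) (h : V ≤ U) (m : Γ(E.M, V)), ∑ k, (f k).val V h m • mres E.M h (e k) = m

attribute [instance] DualBasis.fintype

theorem nonempty_dualBasis {U : Y.Opens} (hU : IsAffineOpen U) (hU₀ : U ≤ U₀) :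
    Nonempty (E.DualBasis U) := by
  have h1 : LocallyFree E.M U := fun x hx => E.locallyFree x (hU₀ hx)
  obtain ⟨n, r, s, hs⟩ := Submodule.mem_span_set'.mp (h1.id_mem_span hU)
  choose p hp using fun k => (s k).2
  obtain ⟨Λ, hΛ⟩ := E.exists_sum_proj hU hU₀
  have hsum (V : Y.Opens) (h : V ≤ U) (m : Γ(E.M, V)) :
      ∑ k, (Functional.val (r k • (p k).1 : Functional E.M U) V h m) • mres E.M h (p k).2 = m := by
    have h2 := congrArg (fun u : HomSec E.M E.M U => u.app V h m) hs
    simp only [HomSec.sum_app, ← hp] at h2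
    refine Eq.trans (Finset.sum_congr rfl fun k _ => ?_) h2
    rw [Functional.val_smul, mul_smul]
    rfl
  refine ⟨{ κ := Fin n × Λ, deg := fun k => k.2, e := fun k => (E.proj k.2).app U hU₀ (p k.1).2,
            f := fun k => (HomSec.comp (r k.1 • (p k.1).1) (HomSec.res hU₀ (E.proj k.2)) :),
            e_mem := fun k => E.proj_mem _ _ _, f_of_ne := fun k m hm V h s hs => ?_,
            sum_eq := fun V h m => ?_ }⟩
  · change Functional.val (r k.1 • (p k.1).1) V h ((E.proj k.2).app V (h.trans hU₀) s) = 0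
    rw [E.proj_of_mem_ne hm _ hs, map_zero]
  · rw [Fintype.sum_prod_type_right]
    refine Eq.trans ?_ (hΛ V h m)
    rw [← Finset.sum_coe_sort Λ]
    refine Finset.sum_congr rfl fun ℓ _ => ?_
    have h3 := congrArg ((E.proj ℓ).app V (h.trans hU₀)) (hsum V h ((E.proj ℓ).app V (h.trans hU₀) m))
    rw [E.proj_of_mem (ℓ := ℓ) _ (E.proj_mem _ _ _)] at h3
    rw [← h3, map_sum]
    refine Finset.sum_congr rfl fun k _ => ?_
    rw [map_smul, ← (E.proj ℓ).naturality]
    rfl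

end GradedBundle
end DualBases


section Derivations

variable {A B Q : Type u} [CommRing A] [CommRing B] [AddCommGroup Q] [Module B Q]

/-- `D` is a derivation along the ring homomorphism `h`. -/
def IsDer (h : A →+* B) (D : A →+ Q) : Prop := ∀ a b, D (a * b) = h a • D b + h b • D a

namespace IsDer

theorem map_one {h : A →+* B} {D : A →+ Q} (hD : IsDer h D) : D 1 = 0 := by
  have := hD 1 1
  simpa using this

theorem exists_extension {h : A →+* B} (hh : h.Etale) {D : A →+ Q} (hD : IsDer h D) :
    ∃ D' : B →+ Q, IsDer (RingHom.id B) D' ∧ ∀ a, D' (h a) = D a := by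
  let : Algebra A B := h.toAlgebra
  have : Algebra.Etale A B := hh
  let : Module A Q := Module.compHom Q h
  have : IsScalarTower A B Q := ⟨fun a b q => mul_smul (h a) b q⟩
  let δ : Derivation ℤ A Q := Derivation.mk' D.toIntLinearMap fun a b => hD a b
  let l := (KaehlerDifferential.isBaseChange_of_formallyEtale ℤ A B).lift δ.liftKaehlerDifferential
  refine ⟨(l.toAddMonoidHom.comp (KaehlerDifferential.D ℤ B).toLinearMap.toAddMonoidHom :),
    fun a b => ?_, fun a => ?_⟩
  · change l (KaehlerDifferential.D ℤ B (a * b)) = a • l (KaehlerDifferential.D ℤ B b) +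
      b • l (KaehlerDifferential.D ℤ B a)
    rw [Derivation.leibniz, map_add, map_smul, map_smul]
  · change l (KaehlerDifferential.D ℤ B (algebraMap A B a)) = _
    rw [← KaehlerDifferential.map_D ℤ ℤ A B a, IsBaseChange.lift_eq,
      Derivation.liftKaehlerDifferential_comp_D]
    rfl

theorem eq_zero_of_comp {h : A →+* B} (hh : h.Etale) {D : B →+ Q} (hD : IsDer (RingHom.id B) D)
    (h0 : ∀ a, D (h a) = 0) (b : B) : D b = 0 := by
  let : Algebra A B := h.toAlgebra
  have : Algebra.Etale A B := hh
  let : Module A Q := Module.compHom Q h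
  have : IsScalarTower A B Q := ⟨fun a b q => mul_smul (h a) b q⟩
  let δ : Derivation A B Q := Derivation.mk' { D with
    map_smul' := fun a b => by
      change D (h a * b) = h a • D b
      rw [hD, h0, smul_zero, add_zero]
      rfl } fun a b => hD a b
  have : δ.liftKaehlerDifferential (KaehlerDifferential.D A B b) = 0 := by
    rw [Subsingleton.elim (KaehlerDifferential.D A B b) 0, map_zero]
  rwa [Derivation.liftKaehlerDifferential_comp_D] at this

theorem map_linear {R : Type u} [CommRing R] {Q' : Type u} [AddCommGroup Q'] [Module R Q']
    {h : A →+* B} {D : A →+ Q} (hD : IsDer h D) {k : B →+* R} (f : Q →ₛₗ[k] Q') :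
    IsDer (k.comp h) (f.toAddMonoidHom.comp D) := fun a b => by
  change f (D (a * b)) = k (h a) • f (D b) + k (h b) • f (D a)
  rw [hD, map_add, LinearMap.map_smulₛₗ, LinearMap.map_smulₛₗ]

end IsDer
end Derivations

section LogDiffs

variable {A B Q : Type u} [CommRing A] [CommRing B] [AddCommGroup Q] [Module B Q] {I : Type u}

variable (C : Subring A) (J : I → Ideal A)

/-- The universal derivation. -/
def LogDiff.d : A →+ LogDiff C J where
  toFun a := Submodule.Quotient.mk (KaehlerDifferential.D C A a, 0)
  map_zero' := by rw [map_zero]; exact map_zero (logRel C J).mkQ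
  map_add' a b := by
    rw [map_add, ← add_zero (0 : LogGen J →₀ A), ← Prod.mk_add_mk, add_zero]
    exact map_add (logRel C J).mkQ _ _

/-- The logarithmic differential of a generator. -/
def LogDiff.dlog (p : LogGen J) : LogDiff C J := Submodule.Quotient.mk (0, Finsupp.single p 1)

variable {C J}

namespace LogDiff

theorem isDer_d : IsDer (RingHom.id A) (d C J) := fun a b => by
  change (logRel C J).mkQ _ = a • (logRel C J).mkQ _ + b • (logRel C J).mkQ _
  rw [← map_smul, ← map_smul, ← map_add]
  congr 1
  exact Prod.ext (Derivation.leibniz _ _ _) (by simp)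

theorem d_const {c : A} (hc : c ∈ C) : d C J c = 0 := by
  change (logRel C J).mkQ _ = 0
  rw [show KaehlerDifferential.D C A c = 0 from
    (KaehlerDifferential.D C A).map_algebraMap ⟨c, hc⟩]
  exact map_zero (logRel C J).mkQ

theorem smul_dlog (p : LogGen J) : p.2.1 • dlog C J p = d C J p.2.1 := by
  refine ((Submodule.Quotient.eq (logRel C J)).mpr ?_ :
    (Submodule.Quotient.mk (p.2.1 • ((0 : Ω[A⁄C]), Finsupp.single p (1 : A))) : _ ⧸ logRel C J) = _)
  rw [← neg_mem_iff]
  refine Submodule.subset_span (Or.inl ⟨p, ?_⟩)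
  simp

theorem dlog_mul {p q : LogGen J} {v : A} (hpq : p.1 = q.1) (hv : IsUnit v) (hq : q.2.1 = v * p.2.1) :
    v • dlog C J q = v • dlog C J p + d C J v := by
  refine ((Submodule.Quotient.eq (logRel C J)).mpr ?_ :
    (Submodule.Quotient.mk (v • ((0 : Ω[A⁄C]), Finsupp.single q (1 : A))) : _ ⧸ logRel C J) =
      Submodule.Quotient.mk (v • ((0 : Ω[A⁄C]), Finsupp.single p (1 : A)) +
        (KaehlerDifferential.D C A v, 0)))
  rw [← neg_mem_iff]
  refine Submodule.subset_span (Or.inr ⟨p, q, v, hpq, hv, hq, ?_⟩)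
  simp

theorem span_eq_top : Submodule.span A (Set.range (d C J) ∪ Set.range (dlog C J)) = ⊤ := by
  refine eq_top_iff.mpr fun w _ => ?_
  obtain ⟨⟨w, g⟩, rfl⟩ := Submodule.Quotient.mk_surjective _ w
  clear * -
  have h1 : (Submodule.Quotient.mk (w, g) : LogDiff C J) =
      (logRel C J).mkQ (w, 0) + (logRel C J).mkQ (0, g) := by
    rw [← map_add, Prod.mk_add_mk, add_zero, zero_add]; rfl
  rw [h1]
  clear h1
  refine add_mem ?_ ?_
  · have hw : w ∈ Submodule.span A (Set.range (KaehlerDifferential.D C A)) := by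
      rw [KaehlerDifferential.span_range_derivation]; trivial
    induction hw using Submodule.span_induction with
    | mem x hx => obtain ⟨a, rfl⟩ := hx; exact Submodule.subset_span (Or.inl ⟨a, rfl⟩)
    | zero => exact zero_mem _
    | add x y _ _ hx hy =>
      have : ((x + y, 0) : Ω[A⁄C] × (LogGen J →₀ A)) = (x, 0) + (y, 0) := by simp
      rw [this, map_add]; exact add_mem hx hy
    | smul a x _ hx =>
      have : ((a • x, 0) : Ω[A⁄C] × (LogGen J →₀ A)) = a • (x, 0) := by simp
      rw [this, map_smul]; exact Submodule.smul_mem _ _ hx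
  · induction g using Finsupp.induction_linear with
    | zero => exact zero_mem _
    | add x y hx hy =>
      have : ((0, x + y) : Ω[A⁄C] × (LogGen J →₀ A)) = (0, x) + (0, y) := by simp
      rw [this, map_add]
      exact add_mem hx hy
    | single p a =>
      have : ((0, Finsupp.single p a) : Ω[A⁄C] × (LogGen J →₀ A)) = a • (0, Finsupp.single p 1) := by
        simp
      rw [this, map_smul]
      exact Submodule.smul_mem _ _ (Submodule.subset_span (Or.inr ⟨p, rfl⟩))

end LogDiff

/-- A choice of generators, which are non-zero-divisors. -/
structure LogGens (J : I → Ideal A) where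
  f : I → A
  span_eq : ∀ a, J a = Ideal.span {f a}
  regular : ∀ a b, f a * b = 0 → b = 0

namespace LogGens

variable (G : LogGens J)

/-- The chosen generator as a symbol. -/
def gen (a : I) : LogGen J := ⟨a, G.f a, G.span_eq a⟩

theorem exists_unit (p : LogGen J) : ∃ v : Aˣ, p.2.1 = v * G.f p.1 := by
  have h := p.2.2.symm.trans (G.span_eq p.1)
  obtain ⟨v, hv⟩ := Ideal.mem_span_singleton'.mp
    (h ▸ Ideal.mem_span_singleton_self p.2.1 : p.2.1 ∈ Ideal.span {G.f p.1})
  obtain ⟨w, hw⟩ := Ideal.mem_span_singleton'.mp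
    (h ▸ Ideal.mem_span_singleton_self (G.f p.1) : G.f p.1 ∈ Ideal.span {p.2.1})
  have h1 : v * w = 1 := by
    have h2 : G.f p.1 * (v * w - 1) = 0 := by
      have h3 : w * (v * G.f p.1) = G.f p.1 := by rw [hv, hw]
      linear_combination h3
    exact sub_eq_zero.mp (G.regular _ _ h2)
  exact ⟨⟨v, w, h1, by rw [mul_comm, h1]⟩, hv.symm⟩

theorem ext {h : A →+* B} {φ ψ : LogDiff C J →ₛₗ[h] Q}
    (hd : ∀ a, φ (LogDiff.d C J a) = ψ (LogDiff.d C J a))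
    (hf : ∀ a, φ (LogDiff.dlog C J (G.gen a)) = ψ (LogDiff.dlog C J (G.gen a))) : φ = ψ := by
  refine LinearMap.ext_on LogDiff.span_eq_top ?_
  rintro _ (⟨a, rfl⟩ | ⟨p, rfl⟩)
  · exact hd a
  · obtain ⟨v, hv⟩ := G.exists_unit p
    have h1 := LogDiff.dlog_mul (C := C) (p := G.gen p.1) (q := p) rfl v.isUnit hv
    have h2 := congrArg φ h1
    have h3 := congrArg ψ h1
    rw [map_add, LinearMap.map_smulₛₗ, LinearMap.map_smulₛₗ, hd, hf, ← LinearMap.map_smulₛₗ ψ,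
      ← map_add ψ, ← h1, LinearMap.map_smulₛₗ] at h2
    have hu := v.isUnit.map h
    obtain ⟨u, hu⟩ := hu
    rw [← hu] at h2
    exact smul_left_cancel u h2

theorem exists_lift {h : A →+* B} (D : A →+ Q) (hD : IsDer h D) (hC : ∀ c ∈ C, D c = 0)
    (w : I → Q) (hw : ∀ a, h (G.f a) • w a = D (G.f a)) :
    ∃ φ : LogDiff C J →ₛₗ[h] Q, (∀ a, φ (LogDiff.d C J a) = D a) ∧
      ∀ a, φ (LogDiff.dlog C J (G.gen a)) = w a := by
  let : Module A Q := Module.compHom Q h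
  have smul_def (a : A) (q : Q) : a • q = h a • q := rfl
  let δ : Derivation C A Q := Derivation.mk' { D with
    map_smul' := fun c a => by
      change D (c * a) = h c • D a
      rw [hD, hC c c.2, smul_zero, add_zero] } fun a b => hD a b
  have hδ (a : A) : δ.liftKaehlerDifferential (KaehlerDifferential.D C A a) = D a :=
    Derivation.liftKaehlerDifferential_comp_D _ a
  choose v hv using G.exists_unit
  let q (p : LogGen J) : Q := w p.1 + (↑(v p)⁻¹ : A) • D (v p)
  let ψ : (Ω[A⁄C] × (LogGen J →₀ A)) →ₗ[A] Q :=
    δ.liftKaehlerDifferential.coprod (Finsupp.linearCombination A q)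
  have hψ : logRel C J ≤ LinearMap.ker ψ := by
    rw [logRel, Submodule.span_le]
    rintro z (⟨p, rfl⟩ | ⟨p, p', u, hpp, hu, hq, rfl⟩)
    · change ψ _ = 0
      simp only [ψ, LinearMap.coprod_apply, hδ, map_neg, Finsupp.linearCombination_single, q]
      rw [← sub_eq_add_neg, sub_eq_zero, smul_add, hv p, hD, ← smul_def, ← smul_def, mul_smul,
        smul_def (G.f p.1) (w p.1), hw, smul_smul, mul_right_comm, Units.mul_inv, one_mul]
    · obtain ⟨u, rfl⟩ := hu
      change ψ _ = 0
      simp only [ψ, LinearMap.coprod_apply, hδ, map_sub, Finsupp.linearCombination_single]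
      obtain ⟨a, f, hf⟩ := p
      obtain ⟨a', f', hf'⟩ := p'
      obtain rfl : a = a' := hpp
      obtain rfl : f' = u * f := hq
      change D u + ((u : A) • (w a + (↑(v ⟨a, f, hf⟩)⁻¹ : A) • D (v ⟨a, f, hf⟩)) -
        (u : A) • (w a + (↑(v ⟨a, u * f, hf'⟩)⁻¹ : A) • D (v ⟨a, u * f, hf'⟩))) = 0
      have hvv : v ⟨a, u * f, hf'⟩ = u * v ⟨a, f, hf⟩ := by
        have h1 : u * f = v ⟨a, u * f, hf'⟩ * G.f a := hv ⟨a, u * f, hf'⟩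
        have h2 : f = v ⟨a, f, hf⟩ * G.f a := hv ⟨a, f, hf⟩
        refine Units.ext (sub_eq_zero.mp (G.regular a _ ?_))
        rw [Units.val_mul]
        linear_combination -h1 + u * h2
      rw [hvv]
      generalize v ⟨a, f, hf⟩ = v'
      rw [Units.val_mul, hD, ← smul_def, ← smul_def, mul_inv, Units.val_mul]
      simp only [smul_add, smul_smul]
      have e1 : (u : A) * (↑u⁻¹ * ↑v'⁻¹ * v') = 1 := by
        rw [mul_assoc, Units.inv_mul, mul_one, Units.mul_inv]
      have e2 : (u : A) * (↑u⁻¹ * ↑v'⁻¹ * u) = u * ↑v'⁻¹ := by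
        rw [mul_right_comm, ← mul_assoc, ← mul_assoc, Units.mul_inv, one_mul]
      rw [e1, e2, one_smul]
      abel
  refine ⟨{ toFun := (logRel C J).liftQ ψ hψ, map_add' := map_add _,
            map_smul' := fun a x => map_smul ((logRel C J).liftQ ψ hψ) a x },
    fun a => ?_, fun a => ?_⟩
  · change δ.liftKaehlerDifferential (KaehlerDifferential.D C A a) +
      Finsupp.linearCombination A q 0 = _
    rw [hδ, map_zero, add_zero]
  · change δ.liftKaehlerDifferential 0 + Finsupp.linearCombination A q (Finsupp.single _ 1) = _
    rw [map_zero, zero_add, Finsupp.linearCombination_single, one_smul]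
    have : v (G.gen a) = 1 := by
      refine Units.ext (sub_eq_zero.mp (G.regular a _ ?_))
      have h1 : G.f a = v (G.gen a) * G.f a := hv (G.gen a)
      rw [Units.val_one]
      linear_combination -h1
    change w a + (↑(v (G.gen a))⁻¹ : A) • D (v (G.gen a)) = w a
    rw [this, Units.val_one, hD.map_one, smul_zero, add_zero]

end LogGens
end LogDiffs

section BaseChange

variable {A B : Type u} [CommRing A] [CommRing B] {M N : Type u} [AddCommGroup M] [AddCommGroup N]
  [Module A M] [Module B N]

/-- The semilinear map `m` exhibits `N` as the base change of `M`. -/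
structure IsBC {h : A →+* B} (m : M →ₛₗ[h] N) : Prop where
  exists_ext : ∀ (Q : Type u) [AddCommGroup Q] [Module B Q] (g : M →ₛₗ[h] Q),
    ∃ g' : N →ₗ[B] Q, ∀ x, g' (m x) = g x
  span_eq : Submodule.span B (Set.range m) = ⊤

variable {I : Type u} {C : Subring A} {J : I → Ideal A} {C' : Subring B} {J' : I → Ideal B}

theorem logMap_d (h : A →+* B) (hC : ∀ c ∈ C, h c ∈ C')
    (hJ : ∀ a f, J a = Ideal.span {f} → J' a = Ideal.span {h f}) (a : A) :
    logMap h hC hJ (LogDiff.d C J a) = LogDiff.d C' J' (h a) := by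
  refine congrArg (Submodule.Quotient.mk (p := logRel C' J')) (Prod.ext (kaehlerMap_D h hC a) ?_)
  change Finsupp.mapDomain (LogGen.map h hJ) (Finsupp.mapRange h (map_zero h) 0) = 0
  rw [Finsupp.mapRange_zero, Finsupp.mapDomain_zero]

theorem logMap_dlog (h : A →+* B) (hC : ∀ c ∈ C, h c ∈ C')
    (hJ : ∀ a f, J a = Ideal.span {f} → J' a = Ideal.span {h f}) (p : LogGen J) :
    logMap h hC hJ (LogDiff.dlog C J p) = LogDiff.dlog C' J' (LogGen.map h hJ p) := by
  refine congrArg (Submodule.Quotient.mk (p := logRel C' J')) (Prod.ext (map_zero _) ?_)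
  change Finsupp.mapDomain _ (Finsupp.mapRange h _ (Finsupp.single p 1)) = Finsupp.single _ 1
  rw [Finsupp.mapRange_single, Finsupp.mapDomain_single, map_one]

/-- The image of a choice of generators. -/
def LogGens.map (G : LogGens J) (h : A →+* B)
    (hJ : ∀ a f, J a = Ideal.span {f} → J' a = Ideal.span {h f})
    (hG : ∀ a b, h (G.f a) * b = 0 → b = 0) : LogGens J' :=
  ⟨fun a => h (G.f a), fun a => hJ a _ (G.span_eq a), hG⟩

theorem logMap_isBC (h : A →+* B) (hC : ∀ c ∈ C, h c ∈ C')
    (hJ : ∀ a f, J a = Ideal.span {f} → J' a = Ideal.span {h f}) (G : LogGens J)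
    (hG : ∀ a b, h (G.f a) * b = 0 → b = 0)
    (hext : ∀ (Q : Type u) [AddCommGroup Q] [Module B Q] (D : A →+ Q), IsDer h D →
      (∀ c ∈ C, D c = 0) → ∃ D' : B →+ Q, IsDer (RingHom.id B) D' ∧ (∀ c ∈ C', D' c = 0) ∧
        ∀ a, D' (h a) = D a)
    (huniq : ∀ (Q : Type u) [AddCommGroup Q] [Module B Q] (D : B →+ Q), IsDer (RingHom.id B) D →
      (∀ c ∈ C', D c = 0) → (∀ a, D (h a) = 0) → ∀ b, D b = 0) :
    IsBC (logMap h hC hJ) where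
  exists_ext Q _ _ g := by
    obtain ⟨D', hD', hD'C, hD'h⟩ := hext Q (g.toAddMonoidHom.comp (LogDiff.d C J))
      (LogDiff.isDer_d.map_linear g) fun c hc => by
        change g (LogDiff.d C J c) = 0
        rw [LogDiff.d_const hc, map_zero]
    obtain ⟨φ, hφ, hφ'⟩ := (G.map h hJ hG).exists_lift D' hD' hD'C
      (fun a => g (LogDiff.dlog C J (G.gen a))) fun a => by
        change h (G.f a) • _ = D' (h (G.f a))
        rw [hD'h, ← LinearMap.map_smulₛₗ]
        exact congrArg g (LogDiff.smul_dlog (G.gen a))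
    refine ⟨φ, fun x => ?_⟩
    suffices φ.comp (logMap h hC hJ) = g from congrArg (fun k => k x) this
    refine G.ext (fun a => ?_) fun a => ?_
    · rw [LinearMap.comp_apply, logMap_d, hφ, hD'h]
      rfl
    · rw [LinearMap.comp_apply, logMap_dlog]
      exact hφ' a
  span_eq := by
    set N := Submodule.span B (Set.range (logMap h hC hJ))
    have h1 (w : LogDiff C J) : N.mkQ (logMap h hC hJ w) = 0 :=
      (Submodule.Quotient.mk_eq_zero N).mpr (Submodule.subset_span ⟨w, rfl⟩)
    have h2 : N.mkQ = 0 := by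
      refine (G.map h hJ hG).ext (huniq _ (N.mkQ.toAddMonoidHom.comp (LogDiff.d C' J'))
        (LogDiff.isDer_d.map_linear N.mkQ) (fun c hc => ?_) fun a => ?_) fun a => ?_
      · change N.mkQ (LogDiff.d C' J' c) = 0
        rw [LogDiff.d_const hc, map_zero]
      · change N.mkQ (LogDiff.d C' J' (h a)) = 0
        rw [← logMap_d h hC hJ, h1]
      · have := h1 (LogDiff.dlog C J (G.gen a))
        rw [logMap_dlog] at this
        exact this
    rw [← N.ker_mkQ, h2, LinearMap.ker_zero]

end BaseChange

section Charts

variable {A : Type u} [CommRing A] {I : Type u} {C : Subring A} {J : I → Ideal A}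

theorem nonempty_basis_logDiff {R : Type u} [CommRing R] (φ : R →+* A) (hφ : ∀ r, φ r ∈ C)
    (hC : ∀ (Q : Type u) [AddCommGroup Q] [Module A Q] (D : A →+ Q), IsDer (RingHom.id A) D →
      (∀ r, D (φ r) = 0) → ∀ c ∈ C, D c = 0)
    {n : Type u} (x : n → A) (hx : (MvPolynomial.eval₂Hom φ x).Etale)
    (hreg : ∀ k b, x k * b = 0 → b = 0) (c : I → Option n)
    (hc : ∀ a b k, c a = some k → c b = some k → a = b) (hc0 : ∀ a, c a = none → J a = ⊤)
    (hc1 : ∀ a k, c a = some k → J a = Ideal.span {x k}) :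
    Nonempty (Module.Basis n A (LogDiff C J)) := by
  classical
  let G : LogGens J :=
    { f := fun a => (c a).elim 1 x
      span_eq := fun a => by
        cases h : c a with
        | none => rw [hc0 a h]; simp
        | some k => exact hc1 a k h
      regular := fun a b => by
        cases h : c a with
        | none => simp
        | some k => exact hreg k b }
  have hGn {a} (h : c a = none) : G.f a = 1 := by change (c a).elim 1 x = 1; rw [h]; rfl
  have hGs {a k} (h : c a = some k) : G.f a = x k := by change (c a).elim 1 x = x k; rw [h]; rfl
  have hpd (k : n) : ∃ D : A →+ A, IsDer (RingHom.id A) D ∧ (∀ r, D (φ r) = 0) ∧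
      ∀ l, D (x l) = if l = k then 1 else 0 := by
    have h1 : IsDer (MvPolynomial.eval₂Hom φ x)
        ((MvPolynomial.eval₂Hom φ x).toAddMonoidHom.comp
          (MvPolynomial.pderiv (R := R) k).toLinearMap.toAddMonoidHom) := fun p q => by
      change MvPolynomial.eval₂Hom φ x (MvPolynomial.pderiv k (p * q)) = _
      rw [Derivation.leibniz, map_add, smul_eq_mul, smul_eq_mul, map_mul, map_mul]
      rfl
    obtain ⟨D, hD, hD'⟩ := h1.exists_extension hx
    refine ⟨D, hD, fun r => ?_, fun l => ?_⟩
    · have := hD' (MvPolynomial.C r)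
      rw [MvPolynomial.coe_eval₂Hom, MvPolynomial.eval₂_C] at this
      rw [this]
      change MvPolynomial.eval₂Hom φ x (MvPolynomial.pderiv k (MvPolynomial.C r)) = 0
      rw [MvPolynomial.pderiv_C, map_zero]
    · have := hD' (MvPolynomial.X l)
      rw [MvPolynomial.coe_eval₂Hom, MvPolynomial.eval₂_X] at this
      rw [this]
      change MvPolynomial.eval₂Hom φ x (MvPolynomial.pderiv k (MvPolynomial.X l)) = _
      rw [MvPolynomial.pderiv_X, Pi.single_apply]
      split_ifs with h1 <;> simp_all
  choose D hD hDφ hDx using hpd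
  let lam (k : n) : A := if ∃ a, c a = some k then x k else 1
  let D' (k : n) : A →+ A := (DistribSMul.toAddMonoidHom A (lam k)).comp (D k)
  have hD'a (k : n) (b : A) : D' k b = lam k * D k b := rfl
  have hD' (k : n) : IsDer (RingHom.id A) (D' k) := fun a b => by
    simp only [hD'a, hD k a b, RingHom.id_apply, smul_eq_mul]; ring
  have hf (k : n) := G.exists_lift (C := C) (D' k) (hD' k)
    (hC A (D' k) (hD' k) fun r => by rw [hD'a, hDφ, mul_zero])
    (fun a => if c a = some k then 1 else 0) fun a => by
      rw [RingHom.id_apply, smul_eq_mul]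
      cases h : c a with
      | none =>
        rw [hGn h, if_neg (by simp), mul_zero, (hD' k).map_one]
      | some l =>
        rw [hGs h, hD'a, hDx]
        by_cases hl : l = k
        · subst hl
          rw [if_pos rfl, if_pos rfl]
          congr 1
          exact (if_pos ⟨a, h⟩).symm
        · rw [if_neg (by simpa using hl), if_neg hl, mul_zero, mul_zero]
  choose f hfd hfl using hf
  let e (k : n) : LogDiff C J := if h : ∃ a, c a = some k then LogDiff.dlog C J (G.gen h.choose)
    else LogDiff.d C J (x k)
  have he {a k} (h : c a = some k) : e k = LogDiff.dlog C J (G.gen a) := by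
    have h1 : ∃ a, c a = some k := ⟨a, h⟩
    change dite _ _ _ = _
    rw [dif_pos h1, hc _ _ _ h1.choose_spec h]
  have he' {k} (h : ¬ ∃ a, c a = some k) : e k = LogDiff.d C J (x k) := dif_neg h
  have hfe (k l : n) : f k (e l) = if l = k then 1 else 0 := by
    by_cases h : ∃ a, c a = some l
    · obtain ⟨a, ha⟩ := h
      rw [he ha, hfl, ha]
      simp
    · rw [he' h, hfd, hD'a, hDx]
      by_cases hl : l = k
      · subst hl
        rw [if_pos rfl, mul_one]
        exact if_neg h
      · rw [if_neg hl, mul_zero]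
  have hli : LinearIndependent A e := by
    rw [linearIndependent_iff]
    intro g hg
    ext k
    have := congrArg (f k) hg
    rw [map_zero, Finsupp.apply_linearCombination, Finsupp.linearCombination_apply,
      Finsupp.sum] at this
    simp only [Function.comp_apply, hfe, smul_eq_mul, mul_ite, mul_one, mul_zero,
      Finset.sum_ite_eq', Finsupp.mem_support_iff] at this
    rw [Finsupp.zero_apply]
    by_contra h
    rw [if_pos h] at this
    exact h this
  refine ⟨Module.Basis.mk hli ?_⟩
  set N := Submodule.span A (Set.range e)
  have heN (k : n) : N.mkQ (e k) = 0 :=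
    (Submodule.Quotient.mk_eq_zero N).mpr (Submodule.subset_span ⟨k, rfl⟩)
  suffices N.mkQ = 0 by rw [← N.ker_mkQ, this, LinearMap.ker_zero]
  let Δ := N.mkQ.toAddMonoidHom.comp (LogDiff.d C J)
  have hΔ : IsDer (RingHom.id A) Δ := LogDiff.isDer_d.map_linear N.mkQ
  have hΔφ (r : R) : Δ (φ r) = 0 := by
    change N.mkQ (LogDiff.d C J (φ r)) = 0
    rw [LogDiff.d_const (hφ r), map_zero]
  have hΔx (k : n) : Δ (x k) = 0 := by
    change N.mkQ (LogDiff.d C J (x k)) = 0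
    by_cases h : ∃ a, c a = some k
    · obtain ⟨a, ha⟩ := h
      have h1 := LogDiff.smul_dlog (C := C) (G.gen a)
      have h2 : (G.gen a).2.1 = x k := hGs ha
      rw [h2, ← he ha] at h1
      rw [← h1, map_smul, heN, smul_zero]
    · rw [← he' h, heN]
  refine G.ext (fun b => ?_) fun a => ?_
  · refine hΔ.eq_zero_of_comp hx (fun p => ?_) b
    induction p using MvPolynomial.induction_on with
    | C r => rw [MvPolynomial.coe_eval₂Hom, MvPolynomial.eval₂_C, hΔφ]
    | add p q hp hq => rw [map_add, map_add, hp, hq, add_zero]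
    | mul_X p k hp =>
      rw [map_mul, hΔ, hp, smul_zero, add_zero, MvPolynomial.coe_eval₂Hom, MvPolynomial.eval₂_X,
        hΔx, smul_zero]
  · change N.mkQ _ = 0
    cases h : c a with
    | none =>
      have h1 := LogDiff.smul_dlog (C := C) (G.gen a)
      have h2 : (G.gen a).2.1 = 1 := hGn h
      rw [h2, one_smul, LogDiff.isDer_d.map_one] at h1
      rw [h1, map_zero]
    | some k => rw [← he h, heN]

end Charts


section EtaleCoordinates

variable {X T : Scheme.{u}} (f : X ⟶ T)

theorem etale_homOfVector_res {n : Type u} {U W : X.Opens} {V₀ : T.Opens}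
    (x : n → Γ(X, U)) (hx : Etale (AffineSpace.homOfVector (U.ι ≫ f) fun k => U.topIso.inv.hom (x k)))
    (hWU : W ≤ U) (h : W ≤ f ⁻¹ᵁ V₀) :
    Etale (AffineSpace.homOfVector (f.resLE V₀ W h) fun k => W.topIso.inv.hom (rres hWU (x k))) := by
  set g := AffineSpace.homOfVector (f.resLE V₀ W h) fun k => W.topIso.inv.hom (rres hWU (x k))
  have h1 : g ≫ AffineSpace.map n V₀.ι = X.homOfLE hWU ≫
      AffineSpace.homOfVector (U.ι ≫ f) fun k => U.topIso.inv.hom (x k) := by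
    refine AffineSpace.hom_ext ?_ fun k => ?_
    · rw [Category.assoc, AffineSpace.map_over, ← Category.assoc, AffineSpace.homOfVector_over,
        Category.assoc, AffineSpace.homOfVector_over, Scheme.Hom.resLE_comp_ι,
        Scheme.homOfLE_ι_assoc]
    · rw [Scheme.Hom.comp_appTop, Scheme.Hom.comp_appTop, CommRingCat.comp_apply,
        CommRingCat.comp_apply, AffineSpace.map_appTop_coord, AffineSpace.homOfVector_appTop_coord,
        AffineSpace.homOfVector_appTop_coord]
      change (X.presheaf.map _ ≫ W.topIso.inv).hom (x k) =
        (U.topIso.inv ≫ (X.homOfLE hWU).appTop).hom (x k)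
      congr 2
      simp only [Scheme.Opens.topIso, Scheme.homOfLE_appTop]
      change X.presheaf.map _ ≫ X.presheaf.map _ = X.presheaf.map _ ≫ X.presheaf.map _
      exact (X.presheaf.map_comp _ _).symm.trans
        ((congrArg X.presheaf.map (Subsingleton.elim _ _)).trans (X.presheaf.map_comp _ _))
  have h2 : IsOpenImmersion (AffineSpace.map n V₀.ι) :=
    MorphismProperty.of_isPullback (AffineSpace.isPullback_map V₀.ι).flip inferInstance
  have h3 : Etale (g ≫ AffineSpace.map n V₀.ι) := by rw [h1]; infer_instance
  exact Etale.of_comp g (AffineSpace.map n V₀.ι)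

theorem etale_eval₂Hom {n : Type u} {U W : X.Opens} {V₀ : T.Opens} (hV₀ : IsAffineOpen V₀)
    (hW : IsAffineOpen W)
    (x : n → Γ(X, U)) (hx : Etale (AffineSpace.homOfVector (U.ι ≫ f) fun k => U.topIso.inv.hom (x k)))
    (hWU : W ≤ U) (h : W ≤ f ⁻¹ᵁ V₀) :
    (MvPolynomial.eval₂Hom (f.appLE V₀ W h).hom fun k => rres hWU (x k)).Etale := by
  have h1 := etale_homOfVector_res f x hx hWU h
  set g := AffineSpace.homOfVector (f.resLE V₀ W h) fun k => W.topIso.inv.hom (rres hWU (x k))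
    with hg
  have : IsAffine V₀ := hV₀
  have : IsAffine W := hW
  have h2 : g.appTop.hom.Etale := HasRingHomProperty.appTop @Etale g h1
  let e := CommRingCat.ofHom (MvPolynomial.eval₂Hom
    ((𝔸(n; V₀.toScheme) ↘ V₀.toScheme).appTop).hom (AffineSpace.coord V₀.toScheme))
  have he : IsIso e := by
    have h3 := AffineSpace.isoOfIsAffine_hom_appTop (n := n) V₀.toScheme
    have h4 : IsIso ((Scheme.ΓSpecIso (CommRingCat.of (MvPolynomial n Γ(V₀.toScheme, ⊤)))).hom ≫ e) := by
      rw [← h3]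
      exact inferInstanceAs (IsIso ((AffineSpace.isoOfIsAffine n V₀.toScheme).hom.app ⊤))
    exact IsIso.of_isIso_comp_left
      (Scheme.ΓSpecIso (CommRingCat.of (MvPolynomial n Γ(V₀.toScheme, ⊤)))).hom e
  let m : MvPolynomial n Γ(T, V₀) →+* MvPolynomial n Γ(V₀.toScheme, ⊤) :=
    MvPolynomial.map V₀.topIso.inv.hom
  have hm : Function.Bijective m :=
    (MvPolynomial.mapEquiv n V₀.topIso.symm.commRingCatIsoToRingEquiv).bijective
  have h5 : (((W.topIso.hom.hom.comp g.appTop.hom).comp e.hom).comp m).Etale := by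
    refine RingHom.Etale.stableUnderComposition _ _ (.of_bijective hm)
      (RingHom.Etale.stableUnderComposition _ _ (.of_bijective ?_)
        (RingHom.Etale.stableUnderComposition _ _ h2 (.of_bijective ?_)))
    · exact ConcreteCategory.bijective_of_isIso e
    · exact ConcreteCategory.bijective_of_isIso W.topIso.hom
  convert! h5
  refine MvPolynomial.ringHom_ext (fun r => ?_) fun k => ?_
  · rw [MvPolynomial.coe_eval₂Hom, MvPolynomial.eval₂_C]
    simp only [RingHom.comp_apply, m, e, MvPolynomial.map_C, CommRingCat.hom_ofHom,
      MvPolynomial.coe_eval₂Hom, MvPolynomial.eval₂_C]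
    change _ = (V₀.topIso.inv ≫ (𝔸(n; V₀.toScheme) ↘ V₀.toScheme).appTop ≫ g.appTop ≫
      W.topIso.hom).hom r
    rw [← Category.assoc _ g.appTop, ← Scheme.Hom.comp_appTop, AffineSpace.homOfVector_over,
      show (f.resLE V₀ W h).appTop = _ from Scheme.Hom.resLE_app_top f h]
    simp only [Category.assoc, Iso.inv_hom_id_assoc, Iso.inv_hom_id, Category.comp_id]
  · rw [MvPolynomial.coe_eval₂Hom, MvPolynomial.eval₂_X]
    simp only [RingHom.comp_apply, m, e, MvPolynomial.map_X, CommRingCat.hom_ofHom,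
      MvPolynomial.coe_eval₂Hom, MvPolynomial.eval₂_X]
    have h6 : g.appTop.hom (AffineSpace.coord V₀.toScheme k) = W.topIso.inv.hom (rres hWU (x k)) :=
      AffineSpace.homOfVector_appTop_coord _ _ _
    rw [h6]
    change _ = (W.topIso.inv ≫ W.topIso.hom).hom _
    rw [Iso.inv_hom_id]
    rfl

end EtaleCoordinates

section SmoothPairs

variable {P : LogPair.{u}}

theorem der_consts {U : P.Y.Opens} (hU : IsAffineOpen U) {V₀ : P.T.Opens} (hV₀ : IsAffineOpen V₀)
    (h : U ≤ P.π ⁻¹ᵁ V₀) {Q : Type u} [AddCommGroup Q] [Module Γ(P.Y, U) Q] {D : Γ(P.Y, U) →+ Q}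
    (hD : IsDer (RingHom.id _) D) (h0 : ∀ r, D ((P.π.appLE V₀ U h).hom r) = 0) :
    ∀ c ∈ consts P U, D c = 0 := by
  have hpow {s : Γ(P.Y, U)} (hs : D s = 0) (n : ℕ) : D (s ^ n) = 0 := by
    induction n with
    | zero => rw [pow_zero, hD.map_one]
    | succ n ih => rw [pow_succ, hD, ih, hs, smul_zero, smul_zero, add_zero]
  intro c hc
  induction hc using Subring.closure_induction with
  | zero => exact map_zero D
  | one => exact hD.map_one
  | add x y _ _ hx hy => rw [map_add, hx, hy, add_zero]
  | neg x _ hx => rw [map_neg, hx, neg_zero]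
  | mul x y _ _ hx hy => rw [hD, hx, hy, smul_zero, smul_zero, add_zero]
  | mem c hc =>
    obtain ⟨V, hV, s, rfl⟩ := hc
    set c := (P.π.appLE V U hV).hom s
    let I : Ideal Γ(P.Y, U) := LinearMap.ker (LinearMap.toSpanSingleton Γ(P.Y, U) Q (D c))
    suffices I = ⊤ by
      have h1 : (1 : Γ(P.Y, U)) ∈ I := this ▸ Submodule.mem_top
      simpa [I] using h1
    refine IsAffineOpen.ideal_eq_top hU I fun x hx => ?_
    obtain ⟨g₀, hg₀, hxg₀⟩ := hV₀.exists_basicOpen_le ⟨P.π x, hV hx⟩ (h hx)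
    obtain ⟨m, t, ht⟩ := exists_eq_pow_mul_of_isAffineOpen P.T V₀ hV₀ g₀ (rres hg₀ s)
    change rres (P.T.basicOpen_le g₀) t = rres (P.T.basicOpen_le g₀) g₀ ^ m * rres hg₀ s at ht
    set g := (P.π.appLE V₀ U h).hom g₀
    have hgU : P.Y.basicOpen g = U ⊓ P.π ⁻¹ᵁ (P.T.basicOpen g₀) := Scheme.basicOpen_appLE _ _ _ _ _
    have hle : P.Y.basicOpen g ≤ P.π ⁻¹ᵁ (P.T.basicOpen g₀) := hgU.trans_le inf_le_right
    have e (V' : P.T.Opens) (hV' : U ≤ P.π ⁻¹ᵁ V') (hV₁ : P.T.basicOpen g₀ ≤ V') (r : Γ(P.T, V')) :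
        rres (P.Y.basicOpen_le g) ((P.π.appLE V' U hV').hom r) =
          (P.π.appLE (P.T.basicOpen g₀) _ hle).hom (rres hV₁ r) := by
      change (P.π.appLE V' U hV' ≫ P.Y.presheaf.map _).hom r =
        (P.T.presheaf.map _ ≫ P.π.appLE (P.T.basicOpen g₀) _ hle).hom r
      rw [Scheme.Hom.appLE_map, Scheme.Hom.map_appLE]
    obtain ⟨k, hk⟩ := exists_pow_mul_eq_zero_of_res_basicOpen_eq_zero_of_isAffineOpen P.Y hU
      (g ^ m * c - (P.π.appLE V₀ U h).hom t) g (by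
        change rres (P.Y.basicOpen_le g) _ = 0
        rw [map_sub, map_mul, map_pow, e V₀ h (P.T.basicOpen_le g₀), e V hV hg₀,
          e V₀ h (P.T.basicOpen_le g₀), ht, map_mul, map_pow, sub_self])
    refine ⟨g ^ k * g ^ m * g, I.mul_mem_right _ ?_, ?_⟩
    · rw [mul_sub, sub_eq_zero] at hk
      have h1 := congrArg D hk
      rw [hD, hD, hD, hpow (h0 g₀), hpow (h0 g₀), h0] at h1
      change (g ^ k * g ^ m) • D c = 0
      simpa [mul_smul] using h1
    · rw [← pow_add, ← pow_succ, P.Y.basicOpen_pow _ (Nat.succ_pos _), hgU]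
      exact ⟨hx, hxg₀⟩

/-- The basic open subset defined by a function. -/
def AOpen.basic (U : AOpen P) (g : Γ(P.Y, U.U)) : AOpen P where
  U := P.Y.basicOpen g
  isAffine := U.isAffine.basicOpen g
  base := let ⟨W, hW, hV⟩ := U.base; ⟨W, hW, (P.Y.basicOpen_le g).trans hV⟩
  principal a := by
    obtain ⟨f, hf⟩ := U.principal a
    have h' : (⟨P.Y.basicOpen g, U.isAffine.basicOpen g⟩ : P.Y.affineOpens) ≤ ⟨U.U, U.isAffine⟩ :=
      P.Y.basicOpen_le g
    exact ⟨rres (P.Y.basicOpen_le g) f, by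
      rw [← (P.D a).map_ideal h', hf, Ideal.map_span, Set.image_singleton]
      rfl⟩

theorem AOpen.basic_le (U : AOpen P) (g : Γ(P.Y, U.U)) : U.basic g ≤ U := P.Y.basicOpen_le g

/-- The base `V₀` and the functions `x k` define étale coordinates on `W` for which the components
of the divisor are coordinate hyperplanes. -/
structure IsChart (W : AOpen P) {V₀ : P.T.Opens} (h : W.U ≤ P.π ⁻¹ᵁ V₀) {n : Type u}
    (x : n → Γ(P.Y, W.U)) (c : P.ι → Option n) : Prop where
  etale : (MvPolynomial.eval₂Hom (P.π.appLE V₀ W.U h).hom x).Etale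
  inj : ∀ a b k, c a = some k → c b = some k → a = b
  eq_top : ∀ a, c a = none → (P.D a).ideal ⟨W.U, W.isAffine⟩ = ⊤
  eq_span : ∀ a k, c a = some k → (P.D a).ideal ⟨W.U, W.isAffine⟩ = Ideal.span {x k}

theorem LogPair.IsSmoothPair.exists_chart (hP : P.IsSmoothPair) (U : AOpen P) {V₀ : P.T.Opens}
    (hV₀ : IsAffineOpen V₀) (h : U.U ≤ P.π ⁻¹ᵁ V₀) {y : P.Y} (hy : y ∈ U.U) :
    ∃ g : Γ(P.Y, U.U), y ∈ P.Y.basicOpen g ∧ ∃ (n : Type u) (_ : Finite n)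
      (x : n → Γ(P.Y, (U.basic g).U)) (c : P.ι → Option n),
      IsChart (U.basic g) (le_trans (b := U.U) (U.basic_le g) h) x c := by
  obtain ⟨U₁, hy₁, n, hn, x, c, het, hinj, htop, hspan⟩ := hP.coordinates y
  obtain ⟨f, f₁, hff, hyf⟩ := exists_basicOpen_le_affine_inter U.isAffine U₁.2 y ⟨hy, hy₁⟩
  have hle : (U.basic f).U ≤ U₁.1 := hff.trans_le (P.Y.basicOpen_le f₁)
  have hle' : (⟨(U.basic f).U, (U.basic f).isAffine⟩ : P.Y.affineOpens) ≤ U₁ := hle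
  refine ⟨f, hyf, n, hn, fun k => rres hle (x k), c,
    etale_eval₂Hom P.π hV₀ (U.basic f).isAffine x het hle _, hinj, fun a ha => ?_, fun a k ha => ?_⟩
  · rw [← (P.D a).map_ideal hle', htop a ha, Ideal.map_top]
  · rw [← (P.D a).map_ideal hle', hspan a k ha, Ideal.map_span, Set.image_singleton]
    rfl

theorem regular_of_etale {R A : Type u} [CommRing R] [CommRing A] {φ : R →+* A} {n : Type u}
    {x : n → A} (hx : (MvPolynomial.eval₂Hom φ x).Etale) (k : n) (b : A) (h : x k * b = 0) :
    b = 0 := by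
  let : Algebra (MvPolynomial n R) A := (MvPolynomial.eval₂Hom φ x).toAlgebra
  have : Algebra.Etale (MvPolynomial n R) A := hx
  have hflat : Module.Flat (MvPolynomial n R) A := inferInstance
  have h1 : IsSMulRegular (MvPolynomial n R) (MvPolynomial.X (R := R) k) := by
    refine (isSMulRegular_iff_right_eq_zero_of_smul).mpr fun p hp => ?_
    rw [smul_eq_mul, mul_comm] at hp
    ext m
    have := congrArg (MvPolynomial.coeff (m + Finsupp.single k 1)) hp
    rwa [MvPolynomial.coeff_mul_X] at this
  have h2 : IsSMulRegular A (MvPolynomial.X (R := R) k) := by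
    intro a b hab
    have h3 := Module.Flat.lTensor_preserves_injective_linearMap (M := A)
      (LinearMap.lsmul (MvPolynomial n R) (MvPolynomial n R) (MvPolynomial.X k)) h1
    have h4 (a : A) : (LinearMap.lsmul (MvPolynomial n R) (MvPolynomial n R)
        (MvPolynomial.X k)).lTensor A (a ⊗ₜ[MvPolynomial n R] (1 : MvPolynomial n R)) =
          (MvPolynomial.X (R := R) k • a) ⊗ₜ[MvPolynomial n R] (1 : MvPolynomial n R) := by
      rw [LinearMap.lTensor_tmul, LinearMap.lsmul_apply, TensorProduct.tmul_smul,
        TensorProduct.smul_tmul']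
    have h5 := h3 ((h4 a).trans ((congrArg (· ⊗ₜ[MvPolynomial n R] (1 : MvPolynomial n R)) hab).trans
      (h4 b).symm))
    simpa using congrArg (TensorProduct.rid (MvPolynomial n R) A) h5
  refine (isSMulRegular_iff_right_eq_zero_of_smul).mp h2 b ?_
  rw [Algebra.smul_def]
  change MvPolynomial.eval₂Hom φ x (MvPolynomial.X k) * b = 0
  rwa [MvPolynomial.coe_eval₂Hom, MvPolynomial.eval₂_X]

theorem LogPair.IsSmoothPair.regular (hP : P.IsSmoothPair) (U : AOpen P) {a : P.ι} {f : Γ(P.Y, U.U)}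
    (hf : (P.D a).ideal ⟨U.U, U.isAffine⟩ = Ideal.span {f}) (b : Γ(P.Y, U.U)) (h : f * b = 0) :
    b = 0 := by
  obtain ⟨V₀, hV₀, hU⟩ := U.base
  refine rres_eq_of_locally_eq fun y hy => ?_
  obtain ⟨g, hyg, n, _, x, c, hc⟩ := hP.exists_chart U hV₀ hU hy
  refine ⟨_, U.basic_le g, hyg, ?_⟩
  have h1 := rres_ideal a (U.basic_le g) f hf
  have h2 : rres (U.basic_le g) f * rres (U.basic_le g) b = 0 := by rw [← map_mul, h, map_zero]
  rw [map_zero]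
  cases ha : c a with
  | none =>
    rw [hc.eq_top a ha, eq_comm, Ideal.span_singleton_eq_top] at h1
    exact (h1.mul_right_eq_zero).mp h2
  | some k =>
    rw [hc.eq_span a k ha] at h1
    obtain ⟨v, hv⟩ := Ideal.mem_span_singleton'.mp
      (h1 ▸ Ideal.mem_span_singleton_self (x k) : x k ∈ Ideal.span {rres (U.basic_le g) f})
    refine regular_of_etale hc.etale k _ ?_
    rw [← hv, mul_assoc]
    exact (congrArg (v * ·) h2).trans (mul_zero v)

/-- A choice of equations of the components of the divisor. -/
def LogPair.IsSmoothPair.gens (hP : P.IsSmoothPair) (U : AOpen P) :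
    LogGens fun a => (P.D a).ideal ⟨U.U, U.isAffine⟩ where
  f a := (U.principal a).choose
  span_eq a := (U.principal a).choose_spec
  regular a := hP.regular U (U.principal a).choose_spec

theorem etale_rres {X : Scheme.{u}} {U V : X.Opens} (hU : IsAffineOpen U) (hV : IsAffineOpen V)
    (h : U ≤ V) : (rres h).Etale := by
  have h1 := Etale.etale_appLE (𝟙 X) hV hU h
  convert! h1 using 2

theorem isBC_omRes (hP : P.IsSmoothPair) {U V : AOpen P} (h : U ≤ V) : IsBC (Om.res h) := by
  obtain ⟨V₀, hV₀, hV⟩ := V.base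
  have het := etale_rres U.isAffine V.isAffine h
  have hU : U.U ≤ P.π ⁻¹ᵁ V₀ := le_trans (b := V.U) h hV
  refine logMap_isBC _ _ _ (hP.gens V)
    (fun a => hP.regular U (rres_ideal a h _ ((hP.gens V).span_eq a)))
    (fun Q _ _ D hD hDC => ?_) fun Q _ _ D hD _ h0 => hD.eq_zero_of_comp het h0
  obtain ⟨D', hD', hD'h⟩ := hD.exists_extension het
  refine ⟨D', hD', der_consts U.isAffine hV₀ hU hD' fun r => ?_, hD'h⟩
  have h1 : (P.π.appLE V₀ U.U hU).hom r = rres h ((P.π.appLE V₀ V.U hV).hom r) := by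
    change _ = (P.π.appLE V₀ V.U hV ≫ P.Y.presheaf.map _).hom r
    rw [Scheme.Hom.appLE_map]
  rw [h1, hD'h]
  exact hDC _ (Subring.subset_closure (Set.mem_ofPred.mpr ⟨V₀, hV, r, rfl⟩))

theorem IsChart.nonempty_basis {W : AOpen P} {V₀ : P.T.Opens} (hV₀ : IsAffineOpen V₀)
    {h : W.U ≤ P.π ⁻¹ᵁ V₀} {n : Type u} {x : n → Γ(P.Y, W.U)} {c : P.ι → Option n}
    (hc : IsChart W h x c) : Nonempty (Module.Basis n Γ(P.Y, W.U) (Om W)) :=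
  nonempty_basis_logDiff _ (fun r => Subring.subset_closure (Set.mem_ofPred.mpr ⟨V₀, h, r, rfl⟩))
    (fun _ _ _ _ hD h0 => der_consts W.isAffine hV₀ h hD h0) x hc.etale
    (fun k => regular_of_etale hc.etale k) c hc.inj hc.eq_top hc.eq_span

theorem IsBC.isBaseChange {A B M N : Type u} [CommRing A] [CommRing B] [Algebra A B]
    [AddCommGroup M] [AddCommGroup N] [Module A M] [Module B N] [Module A N] [IsScalarTower A B N]
    {m : M →ₛₗ[algebraMap A B] N} (hm : IsBC m) (m' : M →ₗ[A] N) (h : ∀ x, m' x = m x) :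
    IsBaseChange B m' := by
  refine IsBaseChange.of_lift_unique _ fun Q _ _ _ _ g => ?_
  let : AddCommGroup Q := Module.addCommMonoidToAddCommGroup B
  obtain ⟨g', hg'⟩ := hm.exists_ext Q
    { toFun := g, map_add' := map_add g, map_smul' := fun a x => by
        rw [map_smul, algebraMap_smul] }
  refine ⟨g', LinearMap.ext fun x => ?_, fun g'' hg'' => ?_⟩
  · change g' (m' x) = g x
    rw [h, hg']
    rfl
  · refine LinearMap.ext_on hm.span_eq ?_
    rintro _ ⟨x, rfl⟩
    rw [hg', ← h]
    exact congrArg (fun k => k x) hg''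

theorem projective_of_isBC {A M : Type u} [CommRing A] [AddCommGroup M] [Module A M] (s : Set A)
    (hs : Ideal.span s = ⊤) (B N : s → Type u) [∀ g, CommRing (B g)] [∀ g, Algebra A (B g)]
    [∀ g, IsLocalization.Away g.1 (B g)] [∀ g, AddCommGroup (N g)] [∀ g, Module (B g) (N g)]
    (m : ∀ g, M →ₛₗ[algebraMap A (B g)] N g) (hm : ∀ g, IsBC (m g))
    (hN : ∀ g, Module.Free (B g) (N g) ∧ Module.Finite (B g) (N g)) :
    Module.Finite A M ∧ Module.Projective A M := by
  let (g : s) : Module A (N g) := Module.compHom _ (algebraMap A (B g))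
  have (g : s) : IsScalarTower A (B g) (N g) := ⟨fun a b x => by
    rw [Algebra.smul_def, mul_smul]; rfl⟩
  let m' (g : s) : M →ₗ[A] N g :=
    { toFun := m g, map_add' := map_add (m g), map_smul' := fun a x => (m g).map_smulₛₗ a x }
  have (g : s) : IsLocalizedModule (Submonoid.powers g.1) (m' g) :=
    (isLocalizedModule_iff_isBaseChange (Submonoid.powers g.1) (B g) (m' g)).mpr
      ((hm g).isBaseChange (m' g) fun _ => rfl)
  have (g : s) : Module.Free (B g) (N g) := (hN g).1
  have (g : s) : Module.Finite (B g) (N g) := (hN g).2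
  have h1 : Module.FinitePresentation A M :=
    Module.FinitePresentation.of_localizationSpan' s hs (Rₚ := B) m' fun g =>
      Module.finitePresentation_of_projective _ _
  have h2 : Module.Flat A M := Module.flat_of_isLocalized_span A M s hs N m' fun g => by
    have : Module.Flat A (B g) := IsLocalization.flat _ (Submonoid.powers g.1)
    exact Module.Flat.trans A (B g) (N g)
  exact ⟨inferInstance, Module.Flat.projective_of_finitePresentation⟩

theorem LogPair.IsSmoothPair.om_projective (hP : P.IsSmoothPair) (U : AOpen P) :
    Module.Finite Γ(P.Y, U.U) (Om U) ∧ Module.Projective Γ(P.Y, U.U) (Om U) := by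
  obtain ⟨V₀, hV₀, hU⟩ := U.base
  let s : Set Γ(P.Y, U.U) := {g | ∃ (n : Type u) (_ : Finite n)
      (x : n → Γ(P.Y, (U.basic g).U)) (c : P.ι → Option n),
      IsChart (U.basic g) (le_trans (b := U.U) (U.basic_le g) hU) x c}
  have hs : Ideal.span s = ⊤ := IsAffineOpen.ideal_eq_top U.isAffine _ fun y hy =>
    let ⟨g, hyg, hg⟩ := hP.exists_chart U hV₀ hU hy
    ⟨g, Ideal.subset_span hg, hyg⟩
  let (g : s) : Algebra Γ(P.Y, U.U) Γ(P.Y, (U.basic g.1).U) := (rres (U.basic_le g.1)).toAlgebra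
  have (g : s) : IsLocalization.Away g.1 Γ(P.Y, (U.basic g.1).U) :=
    U.isAffine.isLocalization_basicOpen g.1
  refine projective_of_isBC s hs (fun g => Γ(P.Y, (U.basic g.1).U)) (fun g => Om (U.basic g.1))
    (fun g => Om.res (U.basic_le g.1)) (fun g => isBC_omRes hP _) fun g => ?_
  obtain ⟨n, hn, x, c, hc⟩ := g.2
  obtain ⟨b⟩ := hc.nonempty_basis hV₀
  exact ⟨Module.Free.of_basis b, Module.Finite.of_basis b⟩

end SmoothPairs


section ThickeningAlgebra

variable {P : Thickening.{u}}

theorem Thickening.preimage_eq (V : P.pair.T.Opens) : P.π ⁻¹ᵁ (P.j ⁻¹ᵁ V) = P.inv (P.pair.π ⁻¹ᵁ V) := by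
  change P.π ⁻¹ᵁ (P.j ⁻¹ᵁ V) = P.i ⁻¹ᵁ (P.pair.π ⁻¹ᵁ V)
  rw [← Scheme.Hom.comp_preimage, ← Scheme.Hom.comp_preimage, P.isPullback.w]

theorem Thickening.inv_le {U : P.pair.Y.Opens} {V : P.pair.T.Opens} (h : U ≤ P.pair.π ⁻¹ᵁ V) :
    P.inv U ≤ P.π ⁻¹ᵁ (P.j ⁻¹ᵁ V) := (inv_mono h).trans_eq (P.preimage_eq V).symm

theorem Thickening.isPushout {U : P.pair.Y.Opens} (hU : IsAffineOpen U) {V : P.pair.T.Opens}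
    (hV : IsAffineOpen V) (h : U ≤ P.pair.π ⁻¹ᵁ V) :
    IsPushout (P.pair.π.appLE V U h) (P.j.app V) (P.i.app U)
      (P.π.appLE (P.j ⁻¹ᵁ V) (P.inv U) (P.inv_le h)) := by
  have : IsAffine U := hU
  have : IsAffine V := hV
  have : IsAffine (P.j ⁻¹ᵁ V) := hV.preimage P.j
  have h1 := isPushout_appTop_of_isPullback (Scheme.Hom.isPullback_resLE P.isPullback
    (US := V) (UT := P.j ⁻¹ᵁ V) (UX := U) (UY := P.inv U) le_rfl h
    (inf_eq_left.mpr (P.inv_le h)).symm)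
  have e {X Z : Scheme.{u}} (f : X ⟶ Z) (A : Z.Opens) (B : X.Opens) (hAB : B ≤ f ⁻¹ᵁ A) :
      (f.resLE A B hAB).appTop ≫ B.topIso.hom = A.topIso.hom ≫ f.appLE A B hAB := by
    rw [show (f.resLE A B hAB).appTop = _ from Scheme.Hom.resLE_app_top f hAB]
    simp only [Category.assoc, Iso.inv_hom_id, Category.comp_id]
  refine h1.of_iso V.topIso U.topIso (Scheme.Opens.topIso _) (Scheme.Opens.topIso _)
    (e _ _ _ _) ?_ ?_ (e _ _ _ _)
  · rw [e, Scheme.Hom.app_eq_appLE]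
  · rw [e, Scheme.Hom.app_eq_appLE]

theorem Thickening.redHom_surjective {U : P.pair.Y.Opens} (hU : IsAffineOpen U) :
    Function.Surjective (P.redHom U) := P.i.app_surjective U hU

theorem Thickening.ker_redHom {U : P.pair.Y.Opens} (hU : IsAffineOpen U) {V : P.pair.T.Opens}
    (hV : IsAffineOpen V) (h : U ≤ P.pair.π ⁻¹ᵁ V) :
    RingHom.ker (P.redHom U) =
      (RingHom.ker (P.j.app V).hom).map (P.pair.π.appLE V U h).hom := by
  have hsq := P.isPushout hU hV h
  apply le_antisymm
  · let K := (RingHom.ker (P.j.app V).hom).map (P.pair.π.appLE V U h).hom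
    let q : Γ(P.pair.Y, U) →+* Γ(P.pair.Y, U) ⧸ K := Ideal.Quotient.mk K
    let l₀ := Ideal.Quotient.lift (RingHom.ker (P.j.app V).hom) (q.comp (P.pair.π.appLE V U h).hom)
        fun a ha => Ideal.Quotient.eq_zero_iff_mem.mpr (Ideal.mem_map_of_mem _ ha)
    let l : Γ(P.S, P.j ⁻¹ᵁ V) →+* Γ(P.pair.Y, U) ⧸ K := l₀.comp
        (RingHom.quotientKerEquivOfSurjective (P.j.app_surjective V hV)).symm.toRingHom
    have hl (a : Γ(P.pair.T, V)) : l ((P.j.app V).hom a) = q ((P.pair.π.appLE V U h).hom a) := by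
      have : (RingHom.quotientKerEquivOfSurjective (P.j.app_surjective V hV)).symm
          ((P.j.app V).hom a) = Ideal.Quotient.mk _ a := by
        rw [RingEquiv.symm_apply_eq]
        rfl
      exact congrArg l₀ this
    have w : P.pair.π.appLE V U h ≫ CommRingCat.ofHom q = P.j.app V ≫ CommRingCat.ofHom l := by
      ext a
      exact (hl a).symm
    intro x hx
    have h2 := congrArg (fun k => k.hom x) (hsq.inl_desc _ _ w)
    change (hsq.desc _ _ w).hom (P.redHom U x) = q x at h2
    rw [show P.redHom U x = 0 from hx, map_zero] at h2
    exact Ideal.Quotient.eq_zero_iff_mem.mp h2.symm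
  · rw [Ideal.map_le_iff_le_comap]
    intro a ha
    have h2 := congrArg (fun k => k.hom a) hsq.w
    change P.redHom U ((P.pair.π.appLE V U h).hom a) = (P.π.appLE _ _ _).hom ((P.j.app V).hom a) at h2
    rw [show (P.j.app V).hom a = 0 from ha, map_zero] at h2
    exact h2

theorem Thickening.ker_mul_ker (U : AOpen P.pair) {a b : Γ(P.pair.Y, U.U)}
    (ha : a ∈ RingHom.ker (P.redHom U.U)) (hb : b ∈ RingHom.ker (P.redHom U.U)) : a * b = 0 := by
  obtain ⟨V, hV, h⟩ := U.base
  have h1 : (P.j.ker ^ 2).ideal ⟨V, hV⟩ = ⊥ := by rw [P.squareZero]; rfl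
  rw [Scheme.IdealSheafData.ideal_pow, Pi.pow_apply, Scheme.Hom.ker_apply] at h1
  have h2 := Ideal.mul_mem_mul ha hb
  rw [P.ker_redHom U.isAffine hV h, ← Ideal.map_mul, ← pow_two] at h2
  have h3 : RingHom.ker (P.j.app V).hom ^ 2 = ⊥ := h1
  rw [h3, Ideal.map_bot] at h2
  exact h2

theorem Thickening.red_isSmoothPair (P : Thickening.{u}) : P.red.IsSmoothPair where
  smooth := by
    have := P.smoothPair.smooth
    exact MorphismProperty.of_isPullback P.isPullback this
  coordinates y := by
    obtain ⟨U, hyU, n, hn, x, c, het, hinj, htop, hspan⟩ := P.smoothPair.coordinates (P.i y)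
    have hid (a : P.pair.ι) := ideal_comap_closedImmersion P.i (P.pair.D a) U (U.2.preimage P.i)
    refine ⟨⟨P.inv U.1, U.2.preimage P.i⟩, hyU, n, hn, fun k => P.redHom U.1 (x k), c, ?_, hinj,
      fun a ha => ?_, fun a k ha => ?_⟩
    · have h1 := (isPullback_morphismRestrict P.i U.1).paste_vert P.isPullback
      set g := AffineSpace.homOfVector (U.1.ι ≫ P.pair.π) fun k => U.1.topIso.inv.hom (x k)
      set g' := AffineSpace.homOfVector ((P.inv U.1).ι ≫ P.red.π) fun k =>
        (P.inv U.1).topIso.inv.hom (P.redHom U.1 (x k))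
      have hg : g ≫ 𝔸(n; P.pair.T) ↘ P.pair.T = U.1.ι ≫ P.pair.π := AffineSpace.homOfVector_over _ _
      have hg' : g' ≫ 𝔸(n; P.S) ↘ P.S = (P.inv U.1).ι ≫ P.π := AffineSpace.homOfVector_over _ _
      rw [← hg, ← hg'] at h1
      have h2 : IsPullback (P.i ∣_ U.1) g' g (AffineSpace.map n P.j) := by
        refine IsPullback.of_bot h1 (AffineSpace.hom_ext ?_ fun k => ?_) (AffineSpace.isPullback_map P.j)
        · rw [Category.assoc, hg, Category.assoc, AffineSpace.map_over, ← Category.assoc g', hg',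
            Category.assoc, ← P.isPullback.w, ← Category.assoc, ← Category.assoc, morphismRestrict_ι]
        · rw [Scheme.Hom.comp_appTop, Scheme.Hom.comp_appTop, CommRingCat.comp_apply,
            CommRingCat.comp_apply, AffineSpace.map_appTop_coord,
            AffineSpace.homOfVector_appTop_coord, AffineSpace.homOfVector_appTop_coord]
          change (U.1.topIso.inv ≫ (P.i ∣_ U.1).appTop).hom (x k) =
            (P.i.app U.1 ≫ (P.inv U.1).topIso.inv).hom (x k)
          congr 2
          rw [Iso.inv_comp_eq, ← Category.assoc, Iso.eq_comp_inv, ← Scheme.Hom.resLE_eq_morphismRestrict,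
            show (P.i.resLE U.1 _ _).appTop = _ from Scheme.Hom.resLE_app_top P.i _,
            Scheme.Hom.app_eq_appLE]
          simp only [Category.assoc, Iso.inv_hom_id, Category.comp_id]
      exact MorphismProperty.of_isPullback h2 het
    · refine (hid a).trans ?_
      rw [htop a ha, Ideal.map_top]
    · refine (hid a).trans ?_
      rw [hspan a k ha, Ideal.map_span, Set.image_singleton]

theorem isBC_omRed (U : AOpen P.pair) : IsBC (Om.red U) := by
  obtain ⟨V, hV, h⟩ := U.base
  have hsurj := P.redHom_surjective U.isAffine
  refine logMap_isBC _ _ _ (P.smoothPair.gens U)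
    (fun a => P.red_isSmoothPair.regular U.pre
      (redHom_ideal a U (U.isAffine.preimage P.i) _ ((P.smoothPair.gens U).span_eq a)))
    (fun Q _ _ D hD hDC => ?_) fun Q _ _ D hD _ h0 b => ?_
  · have hker : (P.redHom U.U).toAddMonoidHom.ker ≤ D.ker := by
      intro x hx
      replace hx : x ∈ RingHom.ker (P.redHom U.U) := hx
      rw [P.ker_redHom U.isAffine hV h, Ideal.map] at hx
      induction hx using Submodule.span_induction with
      | zero => exact zero_mem _
      | add x y _ _ hx hy => exact add_mem hx hy
      | mem x hx =>
        obtain ⟨r, -, rfl⟩ := hx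
        exact hDC _ (Subring.subset_closure (Set.mem_ofPred.mpr ⟨V, h, r, rfl⟩))
      | smul a x hx' hx =>
        have hx0 : P.redHom U.U x = 0 := by
          rw [← RingHom.mem_ker, P.ker_redHom U.isAffine hV h]; exact hx'
        change D (a * x) = 0
        rw [hD, show D x = 0 from hx, hx0, smul_zero, zero_smul, add_zero]
    let D' := (P.redHom U.U).toAddMonoidHom.liftOfSurjective hsurj ⟨D, hker⟩
    have hD' (a : Γ(P.pair.Y, U.U)) : D' (P.redHom U.U a) = D a :=
      AddMonoidHom.liftOfRightInverse_comp_apply _ _ _ ⟨D, hker⟩ a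
    have hder : IsDer (RingHom.id _) D' := fun a b => by
      obtain ⟨a, rfl⟩ := hsurj a
      obtain ⟨b, rfl⟩ := hsurj b
      rw [← map_mul, hD', hD', hD', hD]
      rfl
    refine ⟨D', hder, der_consts (P := P.red) U.pre.isAffine (hV.preimage P.j) (P.inv_le h) hder
      fun r => ?_, hD'⟩
    obtain ⟨r, rfl⟩ := P.j.app_surjective V hV r
    have h2 := congrArg (fun k => k.hom r) (P.isPushout U.isAffine hV h).w
    change P.redHom U.U ((P.pair.π.appLE V U.U h).hom r) = (P.π.appLE _ _ _).hom ((P.j.app V).hom r) at h2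
    refine (congrArg D' h2.symm).trans ?_
    rw [hD']
    exact hDC _ (Subring.subset_closure (Set.mem_ofPred.mpr ⟨V, h, r, rfl⟩))
  · obtain ⟨b, rfl⟩ := hsurj b
    exact h0 b

end ThickeningAlgebra



section Duals

variable {A B : Type u} [CommRing A] [CommRing B]

/-- Finitely many elements `e j` of a module and linear forms `F j` such that
`x = ∑ F j x • e j` for all `x`. -/
structure FinDual (A M : Type u) [CommRing A] [AddCommGroup M] [Module A M] (σ : Type) [Fintype σ]
    where
  e : σ → M
  F : σ → M →ₗ[A] A
  sum_eq : ∀ x, ∑ j, F j x • e j = x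

variable {M N Q R : Type u} [AddCommGroup M] [Module A M] [AddCommGroup N] [Module B N]
  [AddCommGroup Q] [Module A Q] [AddCommGroup R] [Module B R]
  {σ τ : Type} [Fintype σ] [Fintype τ] {h : A →+* B}

namespace FinDual

/-- The semilinear map `m` carries the elements and linear forms of `D` to those of `D'`. -/
structure Compat (m : M →ₛₗ[h] N) (D : FinDual A M σ) (D' : FinDual B N σ) : Prop where
  e_eq : ∀ j, D'.e j = m (D.e j)
  F_eq : ∀ j x, D'.F j (m x) = h (D.F j x)

theorem exists_of_projective (M : Type u) [AddCommGroup M] [Module A M] [Module.Finite A M]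
    [Module.Projective A M] : ∃ n : ℕ, Nonempty (FinDual A M (Fin n)) := by
  obtain ⟨n, f, g, -, -, hfg⟩ := Module.Finite.exists_comp_eq_id_of_projective A M
  refine ⟨n, ⟨⟨fun j => f (Pi.single j 1), fun j => LinearMap.proj j ∘ₗ g, fun x => ?_⟩⟩⟩
  have h1 : f (g x) = x := LinearMap.congr_fun hfg x
  conv_rhs => rw [← h1, ← Finset.univ_sum_single (g x), map_sum]
  refine Finset.sum_congr rfl fun j _ => ?_
  rw [← map_smul]
  congr 1
  rw [← Pi.single_smul]
  simp

theorem exists_compat (D : FinDual A M σ) {m : M →ₛₗ[h] N} (hm : IsBC m) :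
    ∃ D' : FinDual B N σ, D.Compat m D' := by
  let g (j : σ) : M →ₛₗ[h] B :=
    { toFun := fun x => h (D.F j x)
      map_add' := by simp
      map_smul' := by simp }
  choose F hF using fun j => hm.exists_ext B (g j)
  refine ⟨⟨fun j => m (D.e j), F, fun y => ?_⟩, ⟨fun _ => rfl, hF⟩⟩
  have hy : y ∈ Submodule.span B (Set.range m) := by rw [hm.span_eq]; trivial
  induction hy using Submodule.span_induction with
  | mem y hy =>
    obtain ⟨x, rfl⟩ := hy
    conv_rhs => rw [← D.sum_eq x, map_sum]
    refine Finset.sum_congr rfl fun j _ => ?_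
    rw [hF, map_smulₛₗ]
    rfl
  | zero => simp
  | add y z _ _ hy hz => simp only [map_add, add_smul, Finset.sum_add_distrib, hy, hz]
  | smul b y _ hy => simp only [map_smul, smul_eq_mul, mul_smul, ← Finset.smul_sum, hy]

theorem Compat.span_eq {m : M →ₛₗ[h] N} {D : FinDual A M σ} {D' : FinDual B N σ}
    (hD : D.Compat m D') : Submodule.span B (Set.range m) = ⊤ := by
  rw [eq_top_iff]
  rintro y -
  rw [← D'.sum_eq y]
  refine Submodule.sum_mem _ fun j _ => Submodule.smul_mem _ _ (Submodule.subset_span ?_)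
  exact ⟨D.e j, (hD.e_eq j).symm⟩

theorem Compat.surjective {m : M →ₛₗ[h] N} {D : FinDual A M σ} {D' : FinDual B N σ}
    (hD : D.Compat m D') (hh : Function.Surjective h) : Function.Surjective m := by
  intro y
  choose a ha using fun j => hh (D'.F j y)
  refine ⟨∑ j, a j • D.e j, ?_⟩
  rw [map_sum, ← D'.sum_eq y]
  refine Finset.sum_congr rfl fun j _ => ?_
  rw [map_smulₛₗ, ha, hD.e_eq]

theorem Compat.ext_of_forall {m : M →ₛₗ[h] N} {D : FinDual A M σ} {D' : FinDual B N σ}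
    (hD : D.Compat m D') {f g : N →ₗ[B] R} (hfg : ∀ x, f (m x) = g (m x)) : f = g :=
  LinearMap.ext_on_range (v := m) hD.span_eq hfg

theorem Compat.of_comp {C K : Type u} [CommRing C] [AddCommGroup K] [Module C K] {k : B →+* C}
    {l : A →+* C} {m : M →ₛₗ[h] N} {n : N →ₛₗ[k] K} {q : M →ₛₗ[l] K} (hl : ∀ a, l a = k (h a))
    (hq : ∀ x, q x = n (m x)) {D : FinDual A M σ} {D' : FinDual B N σ} {D'' : FinDual C K σ}
    (hD : D.Compat m D') (hD' : D.Compat q D'') : D'.Compat n D'' := by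
  refine ⟨fun j => by rw [hD'.e_eq, hq, hD.e_eq], fun j y => ?_⟩
  have hy : y ∈ Submodule.span B (Set.range m) := by rw [hD.span_eq]; trivial
  induction hy using Submodule.span_induction with
  | mem y hy =>
    obtain ⟨x, rfl⟩ := hy
    rw [hD.F_eq, ← hq, hD'.F_eq, hl]
  | zero => simp
  | add y z _ _ hy hz => simp only [map_add, hy, hz]
  | smul b y _ hy => simp only [map_smulₛₗ, smul_eq_mul, map_mul, hy]; rfl

/-- The tensor product of two such systems. -/
def tensor (D : FinDual A M σ) (D' : FinDual A Q τ) : FinDual A (M ⊗[A] Q) (σ × τ) where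
  e j := D.e j.1 ⊗ₜ D'.e j.2
  F j := LinearMap.mul' A A ∘ₗ TensorProduct.map (D.F j.1) (D'.F j.2)
  sum_eq x := by
    induction x using TensorProduct.induction_on with
    | zero => simp
    | add x y hx hy => simp only [map_add, add_smul, Finset.sum_add_distrib, hx, hy]
    | tmul x y =>
      conv_rhs => rw [← D.sum_eq x, ← D'.sum_eq y]
      rw [TensorProduct.sum_tmul, Fintype.sum_prod_type]
      refine Finset.sum_congr rfl fun j _ => ?_
      rw [TensorProduct.tmul_sum]
      refine Finset.sum_congr rfl fun i _ => ?_
      rw [TensorProduct.smul_tmul_smul]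
      simp

theorem Compat.tensor {m : M →ₛₗ[h] N} {q : Q →ₛₗ[h] R} {D : FinDual A M σ} {D' : FinDual B N σ}
    {G : FinDual A Q τ} {G' : FinDual B R τ} (hD : D.Compat m D') (hG : G.Compat q G') :
    (D.tensor G).Compat (TensorProduct.map m q) (D'.tensor G') := by
  refine ⟨fun j => ?_, fun j x => ?_⟩
  · change D'.e j.1 ⊗ₜ[B] G'.e j.2 = m (D.e j.1) ⊗ₜ[B] q (G.e j.2)
    rw [hD.e_eq, hG.e_eq]
  · induction x using TensorProduct.induction_on with
    | zero => simp
    | add x y hx hy => simp only [map_add, hx, hy]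
    | tmul x y =>
      change D'.F j.1 (m x) * G'.F j.2 (q y) = h (D.F j.1 x * G.F j.2 y)
      rw [hD.F_eq, hG.F_eq, map_mul]

instance {n k : ℕ} : Fintype (Set.powersetCard (Fin n) k) := Fintype.ofFinite _

/-- The exterior power of such a system. -/
def ext {n : ℕ} (D : FinDual A M (Fin n)) (k : ℕ) :
    FinDual A (⋀[A]^k M) (Set.powersetCard (Fin n) k) where
  e := exteriorPower.ιMulti_family A k D.e
  F s := exteriorPower.pairingDual A M k (exteriorPower.ιMulti_family A k D.F s)
  sum_eq x := by
    let f : M →ₗ[A] (Fin n → A) := LinearMap.pi D.F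
    let g : (Fin n → A) →ₗ[A] M := Fintype.linearCombination A D.e
    have hgf : g ∘ₗ f = LinearMap.id := by
      ext x
      exact (Fintype.linearCombination_apply A D.e _).trans (D.sum_eq x)
    let b := Pi.basisFun A (Fin n)
    have hg (j : Fin n) : g (b j) = D.e j := by
      simp [g, b, Fintype.linearCombination_apply, Pi.single_apply]
    have h1 : exteriorPower.map k g (exteriorPower.map k f x) = x := by
      refine (LinearMap.congr_fun (exteriorPower.map_comp f g) x).symm.trans ?_
      rw [hgf, exteriorPower.map_id]
      rfl
    have h2 (s : Set.powersetCard (Fin n) k) :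
        exteriorPower.ιMultiDual A k b s (exteriorPower.map k f x) =
          exteriorPower.pairingDual A M k (exteriorPower.ιMulti_family A k D.F s) x := by
      rw [← LinearMap.comp_apply]
      refine LinearMap.congr_fun (exteriorPower.linearMap_ext (AlternatingMap.ext fun v => ?_)) x
      simp only [LinearMap.compAlternatingMap_apply, LinearMap.comp_apply,
        exteriorPower.map_apply_ιMulti, exteriorPower.ιMultiDual_apply_ιMulti,
        exteriorPower.ιMulti_family, exteriorPower.pairingDual_ιMulti_ιMulti]
      congr 1
    conv_rhs => rw [← h1, ← (b.exteriorPower k).sum_repr (exteriorPower.map k f x), map_sum]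
    refine Finset.sum_congr rfl fun s _ => ?_
    rw [map_smul, exteriorPower.basis_repr_apply, h2, exteriorPower.basis_apply,
      exteriorPower.map_apply_ιMulti_family]
    congr 2
    exact funext fun j => (hg j).symm

theorem Compat.ext {n : ℕ} {m : M →ₛₗ[h] N} {D : FinDual A M (Fin n)} {D' : FinDual B N (Fin n)}
    (hD : D.Compat m D') (k : ℕ) : (D.ext k).Compat (extMap m k) (D'.ext k) := by
  refine ⟨fun s => ?_, fun s x => ?_⟩
  · change exteriorPower.ιMulti_family B k D'.e s = extMap m k (exteriorPower.ιMulti_family A k D.e s)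
    rw [exteriorPower.ιMulti_family, exteriorPower.ιMulti_family, extMap_ιMulti]
    exact congrArg _ (funext fun t => hD.e_eq _)
  · change exteriorPower.pairingDual B N k (exteriorPower.ιMulti_family B k D'.F s) (extMap m k x) =
      h (exteriorPower.pairingDual A M k (exteriorPower.ιMulti_family A k D.F s) x)
    have hx : x ∈ Submodule.span A (Set.range (exteriorPower.ιMulti A k (M := M))) := by
      rw [exteriorPower.ιMulti_span]; trivial
    induction hx using Submodule.span_induction with
    | mem x hx =>
      obtain ⟨v, rfl⟩ := hx
      simp only [extMap_ιMulti, exteriorPower.ιMulti_family,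
        exteriorPower.pairingDual_ιMulti_ιMulti, RingHom.map_det]
      congr 1
      ext i j
      exact hD.F_eq _ _
    | zero => simp
    | add x y _ _ hx hy => simp only [map_add, hx, hy]
    | smul a x _ hx => simp only [map_smulₛₗ, smul_eq_mul, map_mul, hx]; rfl

end FinDual

theorem IsBC.of_surjective {m : M →ₛₗ[h] N} (hh : Function.Surjective h)
    (hm : Function.Surjective m)
    (hk : ∀ x, m x = 0 → x ∈ RingHom.ker h • (⊤ : Submodule A M)) : IsBC m where
  span_eq := by rw [hm.range_eq, Submodule.span_univ]
  exists_ext Q _ _ g := by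
    have h0 : ∀ x, m x = 0 → g x = 0 := fun x hx => by
      refine Submodule.smul_induction_on (hk x hx) (fun r hr y _ => ?_) fun y z hy hz => ?_
      · rw [map_smulₛₗ, RingHom.mem_ker.mp hr, zero_smul]
      · rw [map_add, hy, hz, add_zero]
    have h1 (x y) (e : m x = m y) : g x = g y := by
      rw [← sub_eq_zero, ← map_sub]
      exact h0 _ (by rw [map_sub, e, sub_self])
    have hs (y) : m (Function.surjInv hm y) = y := Function.surjInv_eq hm y
    refine ⟨{ toFun := fun y => g (Function.surjInv hm y), map_add' := fun y z => ?_,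
              map_smul' := fun b y => ?_ }, fun x => h1 _ _ (hs _)⟩
    · rw [← map_add]
      exact h1 _ _ (by rw [map_add, hs, hs, hs])
    · obtain ⟨a, rfl⟩ := hh b
      rw [RingHom.id_apply, ← map_smulₛₗ]
      exact h1 _ _ (by rw [map_smulₛₗ, hs, hs])

end Duals

section Kernels

variable {A B : Type u} [CommRing A] [CommRing B] {h : A →+* B}

/-- The elements `mk 1 r` exhaust the module `B ⊗_A K`, if `h` is surjective. -/
theorem KerModule.exists_eq_mk (hh : Function.Surjective h) (z : KerModule h) :
    ∃ r, z = KerModule.mk h 1 r := by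
  let i := h.toAlgebra
  induction z using KerModule.induction with
  | h0 => exact ⟨0, (TensorProduct.tmul_zero _ _).symm⟩
  | hm b r =>
    obtain ⟨a, rfl⟩ := hh b
    refine ⟨a • r, ?_⟩
    change (h a) ⊗ₜ[A] r = (1 : B) ⊗ₜ[A] (a • r)
    rw [← TensorProduct.smul_tmul]
    congr 1
    exact (mul_one _).symm
  | ha x y hx hy =>
    obtain ⟨r, rfl⟩ := hx
    obtain ⟨s, rfl⟩ := hy
    exact ⟨r + s, (TensorProduct.tmul_add _ _ _).symm⟩

variable {Q R : Type u} [AddCommGroup Q] [Module A Q] [AddCommGroup R] [Module B R]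

theorem exists_toKer (hh : Function.Surjective h)
    (hK : ∀ a b, h a = 0 → h b = 0 → a * b = 0) :
    ∃ t : KerModule h →+ A, (∀ r, t (KerModule.mk h 1 r) = r.1) ∧
      (∀ a z, t (h a • z) = a * t z) ∧ Function.Injective t := by
  let i := h.toAlgebra
  let s := Function.surjInv hh
  have hs (b) : h (s b) = b := Function.surjInv_eq hh b
  have key (a c : A) (r : RingHom.ker h) (e : h a = h c) : a * r.1 = c * r.1 := by
    rw [← sub_eq_zero, ← sub_mul]
    exact hK _ _ (by rw [map_sub, e, sub_self]) r.2
  let t : KerModule h →+ A := (TensorProduct.lift (LinearMap.mk₂ A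
    (fun (b : B) (r : RingHom.ker h) => s b * r.1)
    (fun b c r => by rw [← add_mul]; exact key _ _ r (by simp only [map_add, hs]))
    (fun a b r => by
      rw [smul_eq_mul, ← mul_assoc]
      exact key _ _ r (by rw [map_mul, hs, hs]; rfl))
    (fun b r r' => mul_add _ _ _)
    (fun a b r => by
      change s b * (a * r.1) = a * (s b * r.1)
      ring))).toAddMonoidHom
  have ht (b) (r : RingHom.ker h) : t (KerModule.mk h b r) = s b * r.1 := rfl
  have h1 (r) : t (KerModule.mk h 1 r) = r.1 := by
    rw [ht, key _ 1 r (by rw [hs, map_one]), one_mul]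
  refine ⟨t, h1, fun a z => ?_, (injective_iff_map_eq_zero t).mpr fun z hz => ?_⟩
  · induction z using KerModule.induction with
    | h0 => simp
    | hm b r =>
      rw [KerModule.smul_mk, ht, ht, ← mul_assoc]
      exact key _ _ r (by rw [map_mul, hs, hs])
    | ha x y hx hy => rw [smul_add, map_add, hx, hy, map_add, mul_add]
  · obtain ⟨r, rfl⟩ := KerModule.exists_eq_mk hh z
    obtain rfl : r = 0 := Subtype.ext ((h1 r).symm.trans hz)
    exact TensorProduct.tmul_zero _ _

/-- The multiplication `R ⊗ K → Q`, `p q ⊗ r ↦ r q`, where `p : Q → R` identifies `R` with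
`Q / K Q`. -/
theorem exists_kerMul (hh : Function.Surjective h) (hK : ∀ a b, h a = 0 → h b = 0 → a * b = 0)
    {p : Q →ₛₗ[h] R} {σ : Type} [Fintype σ] {D : FinDual A Q σ} {D' : FinDual B R σ}
    (hD : D.Compat p D') :
    ∃ μ : R ⊗[B] KerModule h →+ Q,
      (∀ q r, μ (p q ⊗ₜ KerModule.mk h 1 r) = r.1 • q) ∧
      (∀ a z, μ (h a • z) = a • μ z) ∧ Function.Injective μ ∧
      ∀ q, p q = 0 → ∃ z, μ z = q := by
  obtain ⟨t, t1, t2, t3⟩ := exists_toKer hh hK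
  let μ : R ⊗[B] KerModule h →+ Q := TensorProduct.liftAddHom
    { toFun := fun y =>
        { toFun := fun z => ∑ j, t (D'.F j y • z) • D.e j
          map_zero' := by simp
          map_add' := fun z w => by simp [add_smul, Finset.sum_add_distrib] }
      map_zero' := by ext z; simp
      map_add' := fun y w => by
        ext z
        simp [add_smul, Finset.sum_add_distrib] }
    (fun b y z => Finset.sum_congr rfl fun j _ => by
      rw [(D'.F j).map_smul, smul_eq_mul, mul_comm, mul_smul])
  have hμ (y z) : μ (y ⊗ₜ z) = ∑ j, t (D'.F j y • z) • D.e j := rfl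
  have h1 (q r) : μ (p q ⊗ₜ KerModule.mk h 1 r) = r.1 • q := by
    rw [hμ]
    conv_rhs => rw [← D.sum_eq q, Finset.smul_sum]
    refine Finset.sum_congr rfl fun j _ => ?_
    rw [hD.F_eq, t2, t1, smul_smul, mul_comm]
  refine ⟨μ, h1, fun a z => ?_, (injective_iff_map_eq_zero μ).mpr fun z hz => ?_, fun q hq => ?_⟩
  · induction z using TensorProduct.induction_on with
    | zero => simp
    | add x y hx hy => rw [smul_add, map_add, hx, hy, map_add, smul_add]
    | tmul y z =>
      rw [TensorProduct.smul_tmul', hμ, hμ, Finset.smul_sum]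
      refine Finset.sum_congr rfl fun j _ => ?_
      rw [(D'.F j).map_smul, smul_eq_mul, mul_smul, t2, mul_smul]
  · let c (j : σ) : R ⊗[B] KerModule h →ₗ[B] KerModule h :=
      (TensorProduct.lid B (KerModule h)).toLinearMap ∘ₗ (D'.F j).rTensor (KerModule h)
    have hc (j y z) : c j (y ⊗ₜ z) = D'.F j y • z := rfl
    have h2 (j : σ) (z) : D.F j (μ z) = t (c j z) := by
      induction z using TensorProduct.induction_on with
      | zero => simp
      | add x y hx hy => simp only [map_add, hx, hy]
      | tmul y z =>
        rw [hμ, hc, map_sum]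
        conv_rhs => rw [← D'.sum_eq y, map_sum, Finset.sum_smul, map_sum]
        refine Finset.sum_congr rfl fun i _ => ?_
        rw [(D.F j).map_smul, (D'.F j).map_smul, hD.e_eq, hD.F_eq, smul_eq_mul, smul_eq_mul,
          mul_comm, ← t2, smul_smul, mul_comm]
    have h3 (z) : z = ∑ j, D'.e j ⊗ₜ c j z := by
      induction z using TensorProduct.induction_on with
      | zero => simp
      | add x y hx hy =>
        simp only [map_add, TensorProduct.tmul_add, Finset.sum_add_distrib, ← hx, ← hy]
      | tmul y z =>
        conv_lhs => rw [← D'.sum_eq y, TensorProduct.sum_tmul]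
        refine Finset.sum_congr rfl fun j _ => ?_
        rw [hc, TensorProduct.smul_tmul]
    rw [h3 z]
    refine Finset.sum_eq_zero fun j _ => ?_
    rw [t3 (a₁ := c j z) (a₂ := 0) (by rw [← h2, hz, map_zero, map_zero]), TensorProduct.tmul_zero]
  · have h2 (j) : h (D.F j q) = 0 := by rw [← hD.F_eq, hq, map_zero]
    refine ⟨∑ j, p (D.e j) ⊗ₜ KerModule.mk h 1 ⟨D.F j q, h2 j⟩, ?_⟩
    rw [map_sum]
    conv_rhs => rw [← D.sum_eq q]
    exact Finset.sum_congr rfl fun j _ => h1 _ _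

end Kernels

section Forms

variable {P : LogPair.{u}} (hP : P.IsSmoothPair)

/-- The system of sections and linear forms over `V` given by a dual basis over `U`. -/
def GradedBundle.DualBasis.finDual {Y : Scheme.{u}} {U₀ U : Y.Opens} {E : GradedBundle Y U₀}
    (D : E.DualBasis U) {V : Y.Opens} (h : V ≤ U) : FinDual Γ(Y, V) Γ(E.M, V) D.κ where
  e k := mres E.M h (D.e k)
  F k := Functional.val (D.f k) V h
  sum_eq := D.sum_eq V h

theorem GradedBundle.DualBasis.compat_mres {Y : Scheme.{u}} {U₀ U : Y.Opens} {E : GradedBundle Y U₀}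
    (D : E.DualBasis U) {V W : Y.Opens} (hV : V ≤ U) (h : W ≤ V) :
    (D.finDual hV).Compat (mres E.M h) (D.finDual (h.trans hV)) :=
  ⟨fun _ => (mres_mres _ _ _ _).symm, fun k x => (Functional.rres_val (D.f k) hV h x).symm⟩

include hP in
theorem LogPair.IsSmoothPair.exists_omDual (U : AOpen P) :
    ∃ n : ℕ, Nonempty (FinDual Γ(P.Y, U.U) (Om U) (Fin n)) := by
  obtain ⟨h1, h2⟩ := hP.om_projective U
  exact FinDual.exists_of_projective (Om U)

variable (W : AOpen P → Type u) [∀ U, AddCommGroup (W U)] [∀ U, Module Γ(P.Y, U.U) (W U)]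
  (r : ∀ {U V : AOpen P} (h : U ≤ V), W V →ₛₗ[rres (U := U.U) (V := V.U) h] W U)

/-- Compatible coordinates for the modules `W V'`, where `V' ≤ V`. -/
structure FormCoords (V : AOpen P) where
  σ : Type
  [fintype : Fintype σ]
  D : ∀ V' ≤ V, FinDual Γ(P.Y, V'.U) (W V') σ
  compat : ∀ V' (h' : V' ≤ V) V'' (h : V'' ≤ V'), (D V' h').Compat (r h) (D V'' (h.trans h'))

attribute [instance] FormCoords.fintype

include hP in
theorem LogPair.IsSmoothPair.exists_omCoords (V : AOpen P) :
    ∃ (n : ℕ) (D : ∀ V' ≤ V, FinDual Γ(P.Y, V'.U) (Om V') (Fin n)),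
      ∀ V' (h' : V' ≤ V) V'' (h : V'' ≤ V'), (D V' h').Compat (Om.res h) (D V'' (h.trans h')) := by
  obtain ⟨n, ⟨D⟩⟩ := hP.exists_omDual V
  choose D' hD' using fun (V') (h : V' ≤ V) => D.exists_compat (isBC_omRes hP h)
  refine ⟨n, D', fun V' h' V'' h => ?_⟩
  exact FinDual.Compat.of_comp (fun a => (rres_rres (Y := P.Y) h h' a).symm)
    (fun x => (Om.res_res h h' x).symm) (hD' V' h') (hD' V'' (h.trans h'))

include hP in
theorem LogPair.IsSmoothPair.om_coords (V : AOpen P) : Nonempty (FormCoords Om Om.res V) := by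
  obtain ⟨n, D, hD⟩ := hP.exists_omCoords V
  exact ⟨⟨Fin n, D, hD⟩⟩

include hP in
theorem LogPair.IsSmoothPair.omExt_coords (k : ℕ) (V : AOpen P) :
    Nonempty (FormCoords (OmExt k) (OmExt.res k) V) := by
  obtain ⟨n, D, hD⟩ := hP.exists_omCoords V
  exact ⟨⟨_, fun V' h => (D V' h).ext k, fun V' h' V'' h => (hD V' h' V'' h).ext k⟩⟩

variable {W}

/-- Restriction of sections of `M ⊗ W`. -/
def tres (M : P.Y.Modules) {U V : AOpen P} (h : U ≤ V) :
    Γ(M, V.U) ⊗[Γ(P.Y, V.U)] W V →ₛₗ[rres (U := U.U) (V := V.U) h]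
      Γ(M, U.U) ⊗[Γ(P.Y, U.U)] W U :=
  TensorProduct.map (mres M (U := U.U) (V := V.U) h) (r h)

variable {r}

namespace FormCoords

variable {V : AOpen P} (C : FormCoords W r V) (M : P.Y.Modules)

/-- The coordinates of a section of `M ⊗ W`. -/
def coord (V' : AOpen P) (h : V' ≤ V) (j : C.σ) :
    Γ(M, V'.U) ⊗[Γ(P.Y, V'.U)] W V' →ₗ[Γ(P.Y, V'.U)] Γ(M, V'.U) :=
  (TensorProduct.rid Γ(P.Y, V'.U) Γ(M, V'.U)).toLinearMap ∘ₗ ((C.D V' h).F j).lTensor Γ(M, V'.U)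

theorem coord_tmul (V' : AOpen P) (h : V' ≤ V) (j : C.σ) (m : Γ(M, V'.U)) (w : W V') :
    C.coord M V' h j (m ⊗ₜ w) = (C.D V' h).F j w • m := rfl

theorem sum_coord (V' : AOpen P) (h : V' ≤ V) (t : Γ(M, V'.U) ⊗[Γ(P.Y, V'.U)] W V') :
    ∑ j, C.coord M V' h j t ⊗ₜ (C.D V' h).e j = t := by
  induction t using TensorProduct.induction_on with
  | zero => simp
  | add x y hx hy => simp only [map_add, TensorProduct.add_tmul, Finset.sum_add_distrib, hx, hy]
  | tmul m w =>
    conv_rhs => rw [← (C.D V' h).sum_eq w, TensorProduct.tmul_sum]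
    refine Finset.sum_congr rfl fun j _ => ?_
    rw [coord_tmul, TensorProduct.smul_tmul]

theorem coord_tres (V' : AOpen P) (h' : V' ≤ V) (V'' : AOpen P) (h : V'' ≤ V') (j : C.σ)
    (t : Γ(M, V'.U) ⊗[Γ(P.Y, V'.U)] W V') :
    C.coord M V'' (h.trans h') j (tres r M h t) =
      mres M (U := V''.U) (V := V'.U) h (C.coord M V' h' j t) := by
  induction t using TensorProduct.induction_on with
  | zero => simp
  | add x y hx hy => simp only [map_add, hx, hy]
  | tmul m w =>
    change C.coord M V'' _ j (mres M _ m ⊗ₜ r h w) = _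
    rw [coord_tmul, coord_tmul, map_smulₛₗ, (C.compat V' h' V'' h).F_eq]

variable {M}

include C in
theorem tres_eq_of_locally_eq {t t' : Γ(M, V.U) ⊗[Γ(P.Y, V.U)] W V}
    (H : ∀ x ∈ V.U, ∃ (V' : AOpen P) (h : V' ≤ V), x ∈ V'.U ∧ tres r M h t = tres r M h t') :
    t = t' := by
  rw [← C.sum_coord M V le_rfl t, ← C.sum_coord M V le_rfl t']
  refine Finset.sum_congr rfl fun j _ => ?_
  congr 1
  refine mres_eq_of_locally_eq M fun x hx => ?_
  obtain ⟨V', h, hxV, e⟩ := H x hx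
  refine ⟨V'.U, h, hxV, ?_⟩
  rw [← C.coord_tres M V le_rfl V' h, e, C.coord_tres]

include C in
theorem exists_tres_eq [SemiSeparated P.Y] {ι : Type u} (V' : ι → AOpen P) (hV : ∀ i, V' i ≤ V)
    (hc : ∀ x ∈ V.U, ∃ i, x ∈ (V' i).U) (t : ∀ i, Γ(M, (V' i).U) ⊗[Γ(P.Y, (V' i).U)] W (V' i))
    (ht : ∀ i j, tres r M (inf_le_left : V' i ⊓ V' j ≤ V' i) (t i) = tres r M inf_le_right (t j)) :
    ∃ s, ∀ i, tres r M (hV i) s = t i := by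
  choose s hs using fun j : C.σ => exists_mres_eq M (fun i => (V' i).U) (fun i => hV i) hc
    (fun i => C.coord M (V' i) (hV i) j (t i)) fun i k => by
      have h1 := congrArg (C.coord M (V' i ⊓ V' k) (inf_le_left.trans (hV i)) j) (ht i k)
      rwa [C.coord_tres M _ (hV i), C.coord_tres M _ (hV k)] at h1
  refine ⟨∑ j, s j ⊗ₜ (C.D V le_rfl).e j, fun i => ?_⟩
  rw [map_sum, ← C.sum_coord M (V' i) (hV i) (t i)]
  refine Finset.sum_congr rfl fun j _ => ?_
  change mres M _ (s j) ⊗ₜ r (hV i) _ = _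
  rw [hs, (C.compat V le_rfl (V' i) (hV i)).e_eq]

end FormCoords

end Forms



section Reduction

variable {P : Thickening.{u}} {E : GradedField P.red ⊤} {U₀ : P.pair.Y.Opens}

theorem inv_basicOpen {W : P.pair.Y.Opens} (g : Γ(P.pair.Y, W)) :
    P.inv (P.pair.Y.basicOpen g) = P.red.Y.basicOpen (P.redHom W g) :=
  Scheme.preimage_basicOpen P.i g

namespace LiftData

variable (L : LiftData E U₀)

theorem φ_surjective {W : P.pair.Y.Opens} (hW : IsAffineOpen W) (h : W ≤ U₀) :
    Function.Surjective (L.φ W h) := by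
  intro n
  let I : Ideal Γ(P.pair.Y, W) :=
    { carrier := {r | ∃ e, L.φ W h e = P.redHom W r • n}
      zero_mem' := ⟨0, by rw [map_zero, map_zero, zero_smul]⟩
      add_mem' := by
        rintro r s ⟨e, he⟩ ⟨e', he'⟩
        exact ⟨e + e', by rw [map_add, he, he', map_add, add_smul]⟩
      smul_mem' := by
        rintro c r ⟨e, he⟩
        exact ⟨c • e, by rw [map_smulₛₗ, he, smul_eq_mul, map_mul, mul_smul]⟩ }
  have hI : I = ⊤ := IsAffineOpen.ideal_eq_top hW I fun x hx => by
    obtain ⟨V, hV, hxV, hVs⟩ := L.φ_iso x (h hx)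
    obtain ⟨g, hg, hxg⟩ := hW.exists_basicOpen_le ⟨x, hxV⟩ hx
    have hle : P.pair.Y.basicOpen g ≤ W := P.pair.Y.basicOpen_le g
    obtain ⟨e', he'⟩ := (hVs _ hg (hW.basicOpen g)).1 (mres E.M (inv_mono hle) n)
    obtain ⟨k, e, he⟩ := ((L.toGradedBundle.locallyFree.qc.mono h) W _ le_rfl hW g hle rfl).2 e'
    have h1 : mres E.M (inv_mono hle) (L.φ W h e - P.redHom W (g ^ k) • n) = 0 := by
      have he1 : mres L.M hle e = rres hle g ^ k • e' := he
      rw [map_sub, L.φ_res W _ h hle, map_smulₛₗ, he1, map_smulₛₗ, map_pow, redHom_rres hle,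
        map_pow, sub_eq_zero, he', map_pow]
    obtain ⟨m, hm⟩ := (E.toGradedBundle.locallyFree.qc (P.inv W) (P.inv (P.pair.Y.basicOpen g)) le_top
      (hW.preimage P.i) (P.redHom W g) (inv_mono hle) (inv_basicOpen g)).1 _ h1
    refine ⟨g ^ (m + k), ⟨g ^ m • e, ?_⟩, ?_⟩
    · have hm1 : P.redHom W g ^ m • (L.φ W h e - P.redHom W (g ^ k) • n) = 0 := hm
      rw [smul_sub, sub_eq_zero] at hm1
      rw [map_smulₛₗ, map_pow, hm1, smul_smul, ← map_pow, ← map_mul, pow_add]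
    · rcases Nat.eq_zero_or_pos (m + k) with h0 | h0
      · rw [h0, pow_zero, Scheme.basicOpen_of_isUnit _ isUnit_one]
        exact hx
      · rwa [Scheme.basicOpen_pow _ _ h0]
  obtain ⟨e, he⟩ : (1 : Γ(P.pair.Y, W)) ∈ I := hI ▸ Submodule.mem_top
  exact ⟨e, by rw [he, map_one, one_smul]⟩

theorem mem_ker_smul_of_φ_eq_zero {W : P.pair.Y.Opens} (hW : IsAffineOpen W) (h : W ≤ U₀)
    {e : Γ(L.M, W)} (he : L.φ W h e = 0) :
    e ∈ RingHom.ker (P.redHom W) • (⊤ : Submodule Γ(P.pair.Y, W) Γ(L.M, W)) := by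
  obtain ⟨D⟩ := L.toGradedBundle.nonempty_dualBasis hW h
  rw [← D.sum_eq W le_rfl e]
  refine Submodule.sum_mem _ fun k _ => Submodule.smul_mem_smul ?_ trivial
  rw [RingHom.mem_ker]
  refine rres_eq_of_locally_eq (Y := P.red.Y) fun x hx => ?_
  obtain ⟨V, hV, hxV, hVs⟩ := L.φ_iso (P.i x) (h hx)
  obtain ⟨g, hg, hxg⟩ := hW.exists_basicOpen_le ⟨P.i x, hxV⟩ hx
  have hle : P.pair.Y.basicOpen g ≤ W := P.pair.Y.basicOpen_le g
  refine ⟨_, inv_mono hle, hxg, ?_⟩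
  have h1 := (hVs _ hg (hW.basicOpen g)).2 (mres L.M hle e) (by
    rw [← L.φ_res W _ h hle, he, map_zero])
  rw [← redHom_rres hle, Functional.rres_val (D.f k) le_rfl hle, map_zero]
  refine Submodule.smul_induction_on h1 (fun r hr y _ => ?_) fun y z hy hz => ?_
  · rw [map_smul, smul_eq_mul, map_mul, RingHom.mem_ker.mp hr, zero_mul]
  · rw [map_add, map_add, hy, hz, add_zero]

theorem isBC_φ {W : P.pair.Y.Opens} (hW : IsAffineOpen W) (h : W ≤ U₀) : IsBC (L.φ W h) :=
  .of_surjective (P.redHom_surjective hW) (L.φ_surjective hW h)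
    fun _ => L.mem_ker_smul_of_φ_eq_zero hW h

theorem φ_proj (ℓ : ℤ) {W : P.pair.Y.Opens} (hW : IsAffineOpen W) (h : W ≤ U₀) (e : Γ(L.M, W)) :
    L.φ W h ((L.proj ℓ).app W h e) = (E.proj ℓ).app (P.inv W) le_top (L.φ W h e) := by
  classical
  obtain ⟨D⟩ := L.toGradedBundle.nonempty_dualBasis hW h
  rw [← D.sum_eq W le_rfl e]
  simp only [map_sum, map_smulₛₗ, RingHom.id_apply]
  refine Finset.sum_congr rfl fun k _ => ?_
  congr 1
  rw [mres_self]
  by_cases hk : D.deg k = ℓ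
  · rw [L.proj_of_mem h (hk ▸ D.e_mem k), E.proj_of_mem le_top (hk ▸ L.φ_Gr _ W h _ (D.e_mem k))]
  · rw [L.proj_of_mem_ne hk h (D.e_mem k), E.proj_of_mem_ne hk le_top (L.φ_Gr _ W h _ (D.e_mem k)),
      map_zero]

theorem exists_mem_φ_eq {ℓ : ℤ} {W : P.pair.Y.Opens} (hW : IsAffineOpen W) (h : W ≤ U₀)
    {n : Γ(E.M, P.inv W)} (hn : n ∈ E.Gr ℓ (P.inv W)) : ∃ e ∈ L.Gr ℓ W, L.φ W h e = n := by
  obtain ⟨e, he⟩ := L.φ_surjective hW h n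
  exact ⟨_, L.proj_mem ℓ h e, by rw [L.φ_proj ℓ hW, he, E.proj_of_mem le_top hn]⟩

end LiftData

/-- The restriction to `X` of forms with values in a lift of `E`. -/
abbrev LiftData.φForm (L : LiftData E U₀) (k : ℕ) (U : AOpen P.pair) (h : U.U ≤ U₀) :
    Γ(L.M, U.U) ⊗[Γ(P.pair.Y, U.U)] OmExt k U →ₛₗ[P.redHom U.U]
      Γ(E.M, U.pre.U) ⊗[Γ(P.red.Y, U.pre.U)] OmExt k U.pre :=
  TensorProduct.map (L.φ U.U h) (OmExt.red k U)

theorem exists_compat_red (k : ℕ) (U : AOpen P.pair) :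
    ∃ (σ : Type) (_ : Fintype σ) (D : FinDual Γ(P.pair.Y, U.U) (OmExt k U) σ)
      (D' : FinDual Γ(P.red.Y, U.pre.U) (OmExt k U.pre) σ), D.Compat (OmExt.red k U) D' := by
  obtain ⟨n, ⟨D⟩⟩ := P.smoothPair.exists_omDual U
  obtain ⟨D', hD'⟩ := D.exists_compat (isBC_omRed U)
  exact ⟨_, inferInstance, D.ext k, D'.ext k, hD'.ext k⟩

theorem OmExt.red_surjective (k : ℕ) (U : AOpen P.pair) : Function.Surjective (OmExt.red k U) := by
  obtain ⟨σ, _, D, D', hD⟩ := exists_compat_red k U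
  exact hD.surjective (P.redHom_surjective U.isAffine)

theorem Om.red_surjective (U : AOpen P.pair) : Function.Surjective (Om.red U) := by
  obtain ⟨n, ⟨D⟩⟩ := P.smoothPair.exists_omDual U
  obtain ⟨D', hD'⟩ := D.exists_compat (isBC_omRed U)
  exact hD'.surjective (P.redHom_surjective U.isAffine)

namespace LiftData

variable (L : LiftData E U₀)

theorem exists_compat_φForm (k : ℕ) (U : AOpen P.pair) (h : U.U ≤ U₀) :
    ∃ (σ : Type) (_ : Fintype σ)
      (D : FinDual Γ(P.pair.Y, U.U) (Γ(L.M, U.U) ⊗[Γ(P.pair.Y, U.U)] OmExt k U) σ)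
      (D' : FinDual Γ(P.red.Y, U.pre.U)
        (Γ(E.M, U.pre.U) ⊗[Γ(P.red.Y, U.pre.U)] OmExt k U.pre) σ),
      D.Compat (L.φForm k U h) D' := by
  obtain ⟨σ, _, D, D', hD⟩ := exists_compat_red k U
  obtain ⟨D₀⟩ := L.toGradedBundle.nonempty_dualBasis U.isAffine h
  obtain ⟨D₁, hD₁⟩ := (D₀.finDual le_rfl).exists_compat (L.isBC_φ U.isAffine h)
  exact ⟨_, inferInstance, _, _, hD₁.tensor hD⟩

theorem exists_kerMul (k : ℕ) (U : AOpen P.pair) (h : U.U ≤ U₀) :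
    ∃ μ : (Γ(E.M, U.pre.U) ⊗[Γ(P.red.Y, U.pre.U)] OmExt k U.pre) ⊗[Γ(P.red.Y, U.pre.U)] Ideal_I U →+
        Γ(L.M, U.U) ⊗[Γ(P.pair.Y, U.U)] OmExt k U,
      (∀ q r, μ (L.φForm k U h q ⊗ₜ KerModule.mk _ 1 r) = r.1 • q) ∧
      (∀ a z, μ (P.redHom U.U a • z) = a • μ z) ∧ Function.Injective μ ∧
      ∀ q, L.φForm k U h q = 0 → ∃ z, μ z = q :=
  let ⟨_, _, _, _, hD⟩ := L.exists_compat_φForm k U h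
  HiggsDeformation.exists_kerMul (P.redHom_surjective U.isAffine) (fun _ _ ha hb =>
    P.ker_mul_ker U (RingHom.mem_ker.mpr ha) (RingHom.mem_ker.mpr hb)) hD

/-- The multiplication `E ⊗ Ω^k ⊗ I → E' ⊗ Ω^k`. -/
def kerMul (k : ℕ) (U : AOpen P.pair) (h : U.U ≤ U₀) :
    (Γ(E.M, U.pre.U) ⊗[Γ(P.red.Y, U.pre.U)] OmExt k U.pre) ⊗[Γ(P.red.Y, U.pre.U)] Ideal_I U →+
        Γ(L.M, U.U) ⊗[Γ(P.pair.Y, U.U)] OmExt k U := (L.exists_kerMul k U h).choose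

variable (k : ℕ) (U : AOpen P.pair) (h : U.U ≤ U₀)

theorem kerMul_tmul (q) (r) :
    L.kerMul k U h (L.φForm k U h q ⊗ₜ KerModule.mk _ 1 r) = r.1 • q :=
  (L.exists_kerMul k U h).choose_spec.1 q r

theorem kerMul_smul (a : Γ(P.pair.Y, U.U)) (z) :
    L.kerMul k U h (P.redHom U.U a • z) = a • L.kerMul k U h z :=
  (L.exists_kerMul k U h).choose_spec.2.1 a z

theorem kerMul_injective : Function.Injective (L.kerMul k U h) :=
  (L.exists_kerMul k U h).choose_spec.2.2.1

theorem exists_kerMul_eq {q} (hq : L.φForm k U h q = 0) : ∃ z, L.kerMul k U h z = q :=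
  (L.exists_kerMul k U h).choose_spec.2.2.2 q hq

theorem φForm_surjective : Function.Surjective (L.φForm k U h) := by
  intro y
  induction y using TensorProduct.induction_on with
  | zero => exact ⟨0, map_zero _⟩
  | add x y hx hy =>
    obtain ⟨x', rfl⟩ := hx
    obtain ⟨y', rfl⟩ := hy
    exact ⟨x' + y', map_add _ _ _⟩
  | tmul m w =>
    obtain ⟨m', rfl⟩ := L.φ_surjective U.isAffine h m
    obtain ⟨w', rfl⟩ := OmExt.red_surjective k U w
    exact ⟨m' ⊗ₜ w', rfl⟩

theorem kerMul_induction {p : (Γ(E.M, U.pre.U) ⊗[Γ(P.red.Y, U.pre.U)] OmExt k U.pre)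
      ⊗[Γ(P.red.Y, U.pre.U)] Ideal_I U → Prop} (z)
    (ht : ∀ q r, p (L.φForm k U h q ⊗ₜ KerModule.mk _ 1 r)) (ha : ∀ x y, p x → p y → p (x + y)) :
    p z := by
  induction z using TensorProduct.induction_on with
  | zero => simpa using ht 0 0
  | add x y hx hy => exact ha x y hx hy
  | tmul q r =>
    obtain ⟨q, rfl⟩ := L.φForm_surjective k U h q
    obtain ⟨r, rfl⟩ := KerModule.exists_eq_mk (P.redHom_surjective U.isAffine) r
    exact ht q r

end LiftData

end Reduction



section GradedHom

variable {Y : Scheme.{u}} {U₀ : Y.Opens} (E : GradedBundle Y U₀)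

/-- For a homogeneous linear form `f k` of a dual basis, the endomorphism `f k ⊗ n`, where `n` is
projected to the graded piece that makes this homogeneous of degree `ℓ`. -/
def GradedBundle.DualBasis.single {E : GradedBundle Y U₀} {U : Y.Opens} (D : E.DualBasis U)
    (hU : U ≤ U₀) (ℓ : ℤ) (k : D.κ) : Γ(E.M, U) →ₗ[Γ(Y, U)] EndGr E ℓ U where
  toFun n := ⟨(D.f k).smulRight ((E.proj (D.deg k + ℓ)).app U hU n), fun m V h e he => by
    rw [Functional.smulRight_app]
    by_cases hm : m = D.deg k
    · rw [hm]
      exact Submodule.smul_mem _ _ (E.res_mem _ _ _ _ hU _ (E.proj_mem _ _ _))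
    · rw [D.f_of_ne k m hm V h e he, zero_smul]
      exact zero_mem _⟩
  map_add' n n' := Subtype.ext (HomSec.ext' fun V hV e => by
    have h1 := fun n => Functional.smulRight_app (D.f k) ((E.proj (D.deg k + ℓ)).app U hU n) V hV e
    refine (h1 _).trans (Eq.trans ?_ (congrArg₂ (· + ·) (h1 n).symm (h1 n').symm))
    simp only [map_add, smul_add])
  map_smul' r n := Subtype.ext (HomSec.ext' fun V hV e => by
    have h1 := fun n => Functional.smulRight_app (D.f k) ((E.proj (D.deg k + ℓ)).app U hU n) V hV e
    refine (h1 _).trans (Eq.trans ?_ (congrArg (rres hV r • ·) (h1 n).symm))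
    simp only [map_smul, map_smulₛₗ]
    rw [smul_comm])

variable {E} in
theorem GradedBundle.DualBasis.toLin_single {U : Y.Opens} (D : E.DualBasis U) (hU : U ≤ U₀) (ℓ : ℤ)
    (k : D.κ) (n e : Γ(E.M, U)) : EndGr.toLin E ℓ U (D.single hU ℓ k n) e =
      Functional.val (D.f k) U le_rfl e • (E.proj (D.deg k + ℓ)).app U hU n := by
  refine (Functional.smulRight_app (D.f k) _ U le_rfl e).trans ?_
  rw [mres_self]

variable {E} in
theorem GradedBundle.DualBasis.sum_single {U : Y.Opens} (D : E.DualBasis U) (hU : U ≤ U₀) (ℓ : ℤ)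
    (g : EndGr E ℓ U) : ∑ k, D.single hU ℓ k (EndGr.toLin E ℓ U g (D.e k)) = g := by
  refine Subtype.ext (HomSec.ext' fun V hV e => ?_)
  rw [AddSubmonoidClass.coe_finsetSum, HomSec.sum_app]
  conv_rhs => rw [← D.sum_eq V hV e, map_sum]
  refine Finset.sum_congr rfl fun k _ => ?_
  refine (Functional.smulRight_app (D.f k) _ V hV e).trans ?_
  have h1 : EndGr.toLin E ℓ U g (D.e k) ∈ E.Gr (D.deg k + ℓ) U :=
    g.2 _ U le_rfl _ (D.e_mem k)
  rw [E.proj_of_mem hU h1, map_smul]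
  exact congrArg _ (g.1.naturality U V le_rfl hV _)

variable {U : Y.Opens} (hU : IsAffineOpen U) (hU₀ : U ≤ U₀) (ℓ : ℤ) {W : Type u} [AddCommGroup W]
  [Module Γ(Y, U) W]

include hU hU₀ in
theorem GradedBundle.evalMap_injective :
    Function.Injective (evalMap (W := W) (EndGr.toLin E ℓ U)) := by
  obtain ⟨D⟩ := E.nonempty_dualBasis hU hU₀
  refine Function.LeftInverse.injective
    (g := fun F => ∑ k, (D.single hU₀ ℓ k).rTensor W (F (D.e k))) fun x => ?_
  induction x using TensorProduct.induction_on with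
  | zero => simp
  | add x y hx hy =>
    simp only [map_add, LinearMap.add_apply, Finset.sum_add_distrib] at hx hy ⊢
    rw [hx, hy]
  | tmul g w =>
    conv_rhs => rw [← D.sum_single hU₀ ℓ g, TensorProduct.sum_tmul]
    rfl

include hU in
theorem GradedBundle.exists_evalMap_eq (F : Γ(E.M, U) →ₗ[Γ(Y, U)] Γ(E.M, U) ⊗[Γ(Y, U)] W)
    (hF : ∀ m, ∀ e ∈ E.Gr m U, ((E.proj (m + ℓ)).app U hU₀).rTensor W (F e) = F e) :
    ∃ x, evalMap (EndGr.toLin E ℓ U) x = F := by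
  obtain ⟨D⟩ := E.nonempty_dualBasis hU hU₀
  refine ⟨∑ k, (D.single hU₀ ℓ k).rTensor W (F (D.e k)), ?_⟩
  have key (k) (t : Γ(E.M, U) ⊗[Γ(Y, U)] W) (e) :
      evalMap (EndGr.toLin E ℓ U) ((D.single hU₀ ℓ k).rTensor W t) e =
        Functional.val (D.f k) U le_rfl e • ((E.proj (D.deg k + ℓ)).app U hU₀).rTensor W t := by
    induction t using TensorProduct.induction_on with
    | zero => simp
    | add x y hx hy => simp only [map_add, LinearMap.add_apply, hx, hy, smul_add]
    | tmul n w =>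
      change EndGr.toLin E ℓ U (D.single hU₀ ℓ k n) e ⊗ₜ w = _
      rw [D.toLin_single]
      rfl
  ext e
  rw [map_sum, LinearMap.sum_apply]
  conv_rhs => rw [← D.sum_eq U le_rfl e, map_sum]
  refine Finset.sum_congr rfl fun k _ => ?_
  rw [key, hF _ _ (D.e_mem k), map_smul, mres_self]

/-- The map associated with a tensor is graded. -/
theorem GradedBundle.rTensor_proj_evalMap (x : EndGr E ℓ U ⊗[Γ(Y, U)] W) (m : ℤ) {e : Γ(E.M, U)}
    (he : e ∈ E.Gr m U) : ((E.proj (m + ℓ)).app U hU₀).rTensor W (evalMap (EndGr.toLin E ℓ U) x e) =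
      evalMap (EndGr.toLin E ℓ U) x e := by
  induction x using TensorProduct.induction_on with
  | zero => simp
  | add x y hx hy => simp only [map_add, LinearMap.add_apply, hx, hy]
  | tmul g w =>
    change (E.proj (m + ℓ)).app U hU₀ (EndGr.toLin E ℓ U g e) ⊗ₜ w = EndGr.toLin E ℓ U g e ⊗ₜ w
    congr 1
    exact E.proj_of_mem hU₀ (g.2 m U le_rfl e he)

end GradedHom

theorem eq_of_mem_closure {A B : Type*} [AddCommGroup A] [AddCommGroup B] (f : A →+ B)
    {S : Set (A × B)} (hS : ∀ y ∈ S, f y.1 = y.2) {x : A} {z : B}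
    (h : (x, z) ∈ AddSubgroup.closure S) : f x = z := by
  refine AddSubgroup.closure_induction (p := fun y _ => f y.1 = y.2) hS (map_zero f)
    (fun y z _ _ hy hz => ?_) (fun y _ hy => ?_) h
  · rw [Prod.fst_add, Prod.snd_add, map_add, hy, hz]
  · rw [Prod.fst_neg, Prod.snd_neg, map_neg, hy]

theorem mem_closure_add {A B : Type*} [AddCommGroup A] [AddCommGroup B] (f : A →+ B)
    {S : AddSubgroup (A × B)} {x y : A} (hx : (x, f x) ∈ S) (hy : (y, f y) ∈ S) :
    (x + y, f (x + y)) ∈ S := by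
  rw [map_add]
  exact add_mem hx hy

section Iota

variable {P : Thickening.{u}} {E : GradedField P.red ⊤} {U₁ U₂ U₃ : P.pair.Y.Opens}

theorem DRTerm.induction' {k : ℕ} {U : AOpen P.pair} {p : DRTerm E k U → Prop}
    (ht : ∀ g r ω, p (DRTerm.tmul g (KerModule.mk _ 1 r) (OmExt.red k U ω)))
    (ha : ∀ x y, p x → p y → p (x + y)) (x : DRTerm E k U) : p x := by
  induction x using DRTerm.induction with
  | h0 =>
    have := ht 0 0 0
    rwa [map_zero, show DRTerm.tmul (0 : EndGr E.toGradedBundle (-(k : ℤ)) U.pre.U) _ 0 = 0 from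
      TensorProduct.tmul_zero _ _] at this
  | ht g r ω =>
    obtain ⟨r, rfl⟩ := KerModule.exists_eq_mk (P.redHom_surjective U.isAffine) r
    obtain ⟨ω, rfl⟩ := OmExt.red_surjective k U ω
    exact ht g r ω
  | ha x y hx hy => exact ha x y hx hy

/-- The isomorphism of the terms of the complex with `Gr^{-k} End(E) ⊗ (Ω^k ⊗ I)`. -/
def DRTerm.swap (k : ℕ) (U : AOpen P.pair) : DRTerm E k U ≃ₗ[Γ(P.red.Y, U.pre.U)]
    EndGr E.toGradedBundle (-(k : ℤ)) U.pre.U ⊗[Γ(P.red.Y, U.pre.U)]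
      (OmExt k U.pre ⊗[Γ(P.red.Y, U.pre.U)] Ideal_I U) :=
  TensorProduct.assoc _ _ _ _ ≪≫ₗ (TensorProduct.comm _ _ _).lTensor _

/-- The map `E → E ⊗ Ω^k ⊗ I` defined by a section of the complex. -/
def DRTerm.eval (k : ℕ) (U : AOpen P.pair) (x : DRTerm E k U) : Γ(E.M, U.pre.U) →ₗ[Γ(P.red.Y, U.pre.U)]
    (Γ(E.M, U.pre.U) ⊗[Γ(P.red.Y, U.pre.U)] OmExt k U.pre) ⊗[Γ(P.red.Y, U.pre.U)] Ideal_I U :=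
  (TensorProduct.assoc _ _ _ _).symm.toLinearMap ∘ₗ
    evalMap (W := OmExt k U.pre ⊗[Γ(P.red.Y, U.pre.U)] Ideal_I U)
      (EndGr.toLin E.toGradedBundle (-(k : ℤ)) U.pre.U) (DRTerm.swap k U x)

theorem DRTerm.eval_add (k : ℕ) (U : AOpen P.pair) (x y : DRTerm E k U) :
    (x + y).eval k U = x.eval k U + y.eval k U := by
  simp only [DRTerm.eval, map_add, LinearMap.comp_add]

theorem DRTerm.eval_tmul (k : ℕ) (U : AOpen P.pair) (g : EndGr E.toGradedBundle (-(k : ℤ)) U.pre.U)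
    (r : Ideal_I U) (ω : OmExt k U.pre) (e : Γ(E.M, U.pre.U)) : (DRTerm.tmul g r ω).eval k U e =
      (EndGr.toLin E.toGradedBundle (-(k : ℤ)) U.pre.U g e ⊗ₜ ω) ⊗ₜ r := rfl

theorem DRTerm.eval_injective (k : ℕ) (U : AOpen P.pair) :
    Function.Injective (DRTerm.eval (E := E) k U) := by
  intro x y h
  refine (DRTerm.swap k U).injective (E.evalMap_injective (W := OmExt k U.pre ⊗[Γ(P.red.Y, U.pre.U)]
    Ideal_I U) U.pre.isAffine le_top _ ?_)
  ext e
  exact (TensorProduct.assoc _ _ _ _).symm.injective (LinearMap.congr_fun h e)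

/-- The homomorphism `E' → E'' ⊗ Ω^k(log D')` defined by a section of the complex. -/
def iotaFun (L : LiftData E U₁) (L' : LiftData E U₂) (k : ℕ) (U : AOpen P.pair) (h₁ : U.U ≤ U₁)
    (h₂ : U.U ≤ U₂) (x : DRTerm E k U) : FormHom L L' k U where
  toFun e := L'.kerMul k U h₂ (x.eval k U (L.φ U.U h₁ e))
  map_add' e e' :=
    (congrArg _ ((congrArg _ (map_add (L.φ U.U h₁) e e')).trans (map_add (x.eval k U) _ _))).trans
      (map_add (L'.kerMul k U h₂) _ _)
  map_smul' a e :=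
    (congrArg _ ((congrArg _ (map_smulₛₗ (L.φ U.U h₁) a e)).trans
      (map_smul (x.eval k U) _ _))).trans (L'.kerMul_smul k U h₂ a _)

/-- The canonical injection `Gr^{-k} End(E) ⊗ I ⊗ Ω^k(log D) → Hom(E', E'' ⊗ Ω^k(log D'))`. -/
def iota (L : LiftData E U₁) (L' : LiftData E U₂) (k : ℕ) (U : AOpen P.pair) (h₁ : U.U ≤ U₁)
    (h₂ : U.U ≤ U₂) : DRTerm E k U →+ FormHom L L' k U :=
  AddMonoidHom.mk' (iotaFun L L' k U h₁ h₂) fun x y => LinearMap.ext fun _ =>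
    (congrArg (L'.kerMul k U h₂) (LinearMap.congr_fun (DRTerm.eval_add k U x y) _)).trans
      (map_add (L'.kerMul k U h₂) _ _)

variable (L : LiftData E U₁) (L' : LiftData E U₂) (k : ℕ) (U : AOpen P.pair) (h₁ : U.U ≤ U₁)
    (h₂ : U.U ≤ U₂)

theorem iota_apply (x : DRTerm E k U) (e : Γ(L.M, U.U)) :
    iota L L' k U h₁ h₂ x e = L'.kerMul k U h₂ (x.eval k U (L.φ U.U h₁ e)) := rfl

theorem iota_tmul (g : EndGr E.toGradedBundle (-(k : ℤ)) U.pre.U) (r : RingHom.ker (P.redHom U.U))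
    (ω : OmExt k U) (e : Γ(L.M, U.U)) (n : Γ(L'.M, U.U))
    (hn : L'.φ U.U h₂ n = EndGr.toLin E.toGradedBundle (-(k : ℤ)) U.pre.U g (L.φ U.U h₁ e)) :
    iota L L' k U h₁ h₂ (DRTerm.tmul g (KerModule.mk _ 1 r) (OmExt.red k U ω)) e =
      r.1 • (n ⊗ₜ ω) := by
  rw [iota_apply, DRTerm.eval_tmul, ← hn]
  exact L'.kerMul_tmul k U h₂ (n ⊗ₜ ω) r

theorem iota_injective : Function.Injective (iota L L' k U h₁ h₂) := by
  intro x y h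
  refine DRTerm.eval_injective k U (LinearMap.ext fun e => ?_)
  obtain ⟨e, rfl⟩ := L.φ_surjective U.isAffine h₁ e
  exact L'.kerMul_injective k U h₂ (LinearMap.congr_fun h e)

/-- Homomorphisms between restrictions of lifts to `X` can be lifted. -/
theorem exists_homSec_lift (ℓ : ℤ) {U : P.pair.Y.Opens} (hU : IsAffineOpen U) (h₁ : U ≤ U₁)
    (h₂ : U ≤ U₂) (g : EndGr E.toGradedBundle ℓ (P.inv U)) :
    ∃ g' ∈ HomGr L.toGradedBundle L'.toGradedBundle ℓ U,
      ∀ (V : P.pair.Y.Opens) (h : V ≤ U) (e : Γ(L.M, V)),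
        L'.φ V (h.trans h₂) (g'.app V h e) =
          g.1.app (P.inv V) (inv_mono h) (L.φ V (h.trans h₁) e) := by
  obtain ⟨D⟩ := L.toGradedBundle.nonempty_dualBasis hU h₁
  choose n hn hφ using fun k => L'.exists_mem_φ_eq hU h₂
    (g.2 _ (P.inv U) le_rfl _ (L.φ_Gr _ _ h₁ _ (D.e_mem k)))
  refine ⟨∑ k, (D.f k).smulRight (n k), Submodule.sum_mem _ fun k _ m V h e he => ?_,
    fun V h e => ?_⟩
  · rw [Functional.smulRight_app]
    by_cases hm : m = D.deg k
    · rw [hm]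
      exact Submodule.smul_mem _ _ (L'.res_mem _ _ _ _ h₂ _ (hn k))
    · rw [D.f_of_ne k m hm V h e he, zero_smul]
      exact zero_mem _
  · conv_rhs => rw [← D.sum_eq V h e]
    rw [HomSec.sum_app]
    simp only [map_sum, map_smulₛₗ, RingHom.id_apply, Functional.smulRight_app]
    refine Finset.sum_congr rfl fun k _ => ?_
    congr 1
    rw [← L'.φ_res U V h₂ h, hφ, ← L.φ_res U V h₁ h]
    exact g.1.naturality _ _ _ _ _

theorem iota_eq_of_mem {x : DRTerm E k U} {F : FormHom L L' k U}
    (h : (x, F) ∈ iotaGraph L L' k U h₁ h₂) : iota L L' k U h₁ h₂ x = F := by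
  refine eq_of_mem_closure (iota L L' k U h₁ h₂) (fun y hy => ?_) h
  obtain ⟨g, g', r, ω, hg, rfl⟩ := hy
  exact LinearMap.ext fun e => iota_tmul L L' k U h₁ h₂ g r ω e _ (hg U.U le_rfl e)

theorem iota_mem (x : DRTerm E k U) : (x, iota L L' k U h₁ h₂ x) ∈ iotaGraph L L' k U h₁ h₂ := by
  induction x using DRTerm.induction' with
  | ht g r ω =>
    obtain ⟨g', -, hg⟩ := exists_homSec_lift L L' _ U.isAffine h₁ h₂ g
    refine AddSubgroup.subset_closure (Set.mem_ofPred.mpr ⟨g, g', r, ω, hg, ?_⟩)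
    refine Prod.ext rfl (LinearMap.ext fun e => ?_)
    exact iota_tmul L L' k U h₁ h₂ g r ω e _ (hg U.U le_rfl e)
  | ha x y hx hy => exact mem_closure_add (iota L L' k U h₁ h₂) hx hy

theorem mem_iotaGraph_iff {x : DRTerm E k U} {F : FormHom L L' k U} :
    (x, F) ∈ iotaGraph L L' k U h₁ h₂ ↔ iota L L' k U h₁ h₂ x = F :=
  ⟨iota_eq_of_mem L L' k U h₁ h₂, fun h => h ▸ iota_mem L L' k U h₁ h₂ x⟩

end Iota



section Restriction

variable {P : Thickening.{u}} {E : GradedField P.red ⊤} {U₁ U₂ U₃ : P.pair.Y.Opens}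

theorem Om.red_res {U V : AOpen P.pair} (h : U ≤ V) (w : Om V) :
    Om.red U (Om.res h w) = Om.res (AOpen.pre_mono h) (Om.red V w) := by
  have hC : ∀ c ∈ consts P.pair V.U,
      ((P.redHom U.U).comp (rres (U := U.U) (V := V.U) h)) c ∈ consts P.red U.pre.U :=
    fun c hc => redHom_consts U.U _ (rres_consts P.pair h c hc)
  have hJ (a) (f : Γ(P.pair.Y, V.U)) (hf : (P.pair.D a).ideal ⟨V.U, V.isAffine⟩ = Ideal.span {f}) :
      (P.red.D a).ideal ⟨U.pre.U, U.pre.isAffine⟩ =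
        Ideal.span {((P.redHom U.U).comp (rres (U := U.U) (V := V.U) h)) f} :=
    redHom_ideal a U _ _ (rres_ideal a h f hf)
  exact (logMap_comp _ _ _ _ _ _ _ hC hJ (fun _ => rfl) w).trans
    (logMap_comp _ _ _ _ _ _ _ hC hJ (fun a => redHom_rres (U := U.U) (V := V.U) h a) w).symm

theorem OmExt.red_res (k : ℕ) {U V : AOpen P.pair} (h : U ≤ V) (w : OmExt k V) :
    OmExt.red k U (OmExt.res k h w) = OmExt.res k (AOpen.pre_mono h) (OmExt.red k V w) := by
  let q : Om V →ₛₗ[(P.redHom U.U).comp (rres (U := U.U) (V := V.U) h)] Om U.pre :=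
    { toFun := fun w => Om.red U (Om.res h w)
      map_add' := fun x y => by rw [map_add, map_add]
      map_smul' := fun r x => by rw [map_smulₛₗ, map_smulₛₗ]; rfl }
  exact (extMap_comp (Om.res h) (Om.red U) q (fun _ => rfl) (fun _ => rfl) k w).trans
    (extMap_comp (Om.red V) (Om.res (AOpen.pre_mono h)) q
      (fun a => redHom_rres (U := U.U) (V := V.U) h a) (Om.red_res h) k w).symm

theorem Ideal_I.res_mk {U V : AOpen P.pair} (h : U ≤ V) (r : RingHom.ker (P.redHom V.U))
    (hr : rres (U := U.U) (V := V.U) h r.1 ∈ RingHom.ker (P.redHom U.U)) :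
    Ideal_I.res h (KerModule.mk _ 1 r) = KerModule.mk (P.redHom U.U) 1 ⟨_, hr⟩ := by
  refine (KerModule.mapAux_mk (f := P.redHom V.U) (f' := P.redHom U.U) _ _
    (fun r => (redHom_rres (U := U.U) (V := V.U) h r).symm) 1 r hr).trans ?_
  rw [map_one]

theorem rres_mem_ker {U V : AOpen P.pair} (h : U ≤ V) (r : RingHom.ker (P.redHom V.U)) :
    rres (U := U.U) (V := V.U) h r.1 ∈ RingHom.ker (P.redHom U.U) := by
  rw [RingHom.mem_ker, redHom_rres (U := U.U) (V := V.U) h, RingHom.mem_ker.mp r.2, map_zero]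

theorem rTensor_assoc {A M W K : Type*} [CommRing A] [AddCommGroup M] [Module A M] [AddCommGroup W]
    [Module A W] [AddCommGroup K] [Module A K] (p : M →ₗ[A] M) (z : (M ⊗[A] W) ⊗[A] K) :
    p.rTensor (W ⊗[A] K) (TensorProduct.assoc A M W K z) =
      TensorProduct.assoc A M W K ((p.rTensor W).rTensor K z) := by
  rw [LinearMap.rTensor_tensor]
  simp

theorem GradedBundle.exists_evalMap_assoc {Y : Scheme.{u}} {U₀ U : Y.Opens} (E : GradedBundle Y U₀)
    (hU : IsAffineOpen U) (hU₀ : U ≤ U₀) (ℓ : ℤ) {W K : Type u} [AddCommGroup W] [Module Γ(Y, U) W]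
    [AddCommGroup K] [Module Γ(Y, U) K]
    (G : Γ(E.M, U) →ₗ[Γ(Y, U)] (Γ(E.M, U) ⊗[Γ(Y, U)] W) ⊗[Γ(Y, U)] K)
    (hG : ∀ m, ∀ n ∈ E.Gr m U, (((E.proj (m + ℓ)).app U hU₀).rTensor W).rTensor K (G n) = G n) :
    ∃ x, ∀ n, evalMap (W := W ⊗[Γ(Y, U)] K) (EndGr.toLin E ℓ U) x n =
      TensorProduct.assoc _ _ _ _ (G n) := by
  obtain ⟨x, hx⟩ := E.exists_evalMap_eq (W := W ⊗[Γ(Y, U)] K) hU hU₀ ℓ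
    ((TensorProduct.assoc Γ(Y, U) Γ(E.M, U) W K).toLinearMap ∘ₗ G)
    fun m n hn => (rTensor_assoc _ (G n)).trans (congrArg _ (hG m n hn))
  exact ⟨x, fun n => LinearMap.congr_fun hx n⟩

section Eval

variable (k : ℕ) (U : AOpen P.pair)

theorem DRTerm.assoc_eval (x : DRTerm E k U) (n : Γ(E.M, U.pre.U)) :
    TensorProduct.assoc _ _ _ _ (x.eval k U n) =
      evalMap (W := OmExt k U.pre ⊗[Γ(P.red.Y, U.pre.U)] Ideal_I U)
        (EndGr.toLin E.toGradedBundle (-(k : ℤ)) U.pre.U) (DRTerm.swap k U x) n :=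
  (TensorProduct.assoc _ _ _ _).apply_symm_apply _

theorem DRTerm.rTensor_proj_eval (x : DRTerm E k U) (m : ℤ) {n : Γ(E.M, U.pre.U)}
    (hn : n ∈ E.Gr m U.pre.U) :
    (((E.proj (m + -(k : ℤ))).app U.pre.U le_top).rTensor (OmExt k U.pre)).rTensor (Ideal_I U)
      (x.eval k U n) = x.eval k U n := by
  refine (TensorProduct.assoc _ _ _ _).injective ?_
  refine (rTensor_assoc _ _).symm.trans ?_
  rw [DRTerm.assoc_eval]
  exact E.rTensor_proj_evalMap (W := OmExt k U.pre ⊗[Γ(P.red.Y, U.pre.U)] Ideal_I U)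
    (hU₀ := le_top) (-(k : ℤ)) (DRTerm.swap k U x) m hn

theorem DRTerm.exists_eval_eq (G : Γ(E.M, U.pre.U) →ₗ[Γ(P.red.Y, U.pre.U)]
      (Γ(E.M, U.pre.U) ⊗[Γ(P.red.Y, U.pre.U)] OmExt k U.pre) ⊗[Γ(P.red.Y, U.pre.U)] Ideal_I U)
    (hG : ∀ m, ∀ n ∈ E.Gr m U.pre.U, (((E.proj (m + -(k : ℤ))).app U.pre.U le_top).rTensor
      (OmExt k U.pre)).rTensor (Ideal_I U) (G n) = G n) : ∃ x : DRTerm E k U, x.eval k U = G := by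
  obtain ⟨x, hx⟩ := E.exists_evalMap_assoc U.pre.isAffine le_top (-(k : ℤ)) G hG
  refine ⟨(DRTerm.swap k U).symm x, LinearMap.ext fun n => ?_⟩
  refine (TensorProduct.assoc _ _ _ _).injective ?_
  rw [DRTerm.assoc_eval, LinearEquiv.apply_symm_apply, hx]

end Eval

variable (L : LiftData E U₁) (L' : LiftData E U₂) (L'' : LiftData E U₃) (k : ℕ) {U V : AOpen P.pair}

/-- Restriction of forms with values in the bundle underlying a lift. -/
abbrev fres (k : ℕ) (h : U ≤ V) : Γ(L.M, V.U) ⊗[Γ(P.pair.Y, V.U)] OmExt k V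
      →ₛₗ[rres (U := U.U) (V := V.U) h] Γ(L.M, U.U) ⊗[Γ(P.pair.Y, U.U)] OmExt k U :=
  tres (OmExt.res k) L.M h

variable {L L'} in
theorem FormHom.ext_res {R : Type u} [AddCommGroup R] [Module Γ(P.pair.Y, U.U) R] (hV : V.U ≤ U₁)
    (h : U ≤ V) {F G : Γ(L.M, U.U) →ₗ[Γ(P.pair.Y, U.U)] R}
    (hFG : ∀ e, F (mres L.M (U := U.U) (V := V.U) h e) = G (mres L.M (U := U.U) (V := V.U) h e)) :
    F = G := by
  obtain ⟨D⟩ := L.toGradedBundle.nonempty_dualBasis V.isAffine hV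
  exact (D.compat_mres le_rfl h).ext_of_forall hFG

theorem iota_res (h₁ : V.U ≤ U₁) (h₂ : V.U ≤ U₂) (h : U ≤ V) (x : DRTerm E k V) (e : Γ(L.M, V.U)) :
    iota L L' k U (le_trans (b := V.U) h h₁) (le_trans (b := V.U) h h₂) (DRTerm.res E k h x)
        (mres L.M (U := U.U) (V := V.U) h e) =
      fres L' k h (iota L L' k V h₁ h₂ x e) := by
  induction x using DRTerm.induction' with
  | ha x y hx hy =>
    rw [map_add, map_add, map_add, LinearMap.add_apply, LinearMap.add_apply, map_add, hx, hy]
  | ht g r ω =>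
    obtain ⟨n, hn⟩ := L'.φ_surjective V.isAffine h₂
      (EndGr.toLin E.toGradedBundle (-(k : ℤ)) V.pre.U g (L.φ V.U h₁ e))
    rw [iota_tmul L L' k V h₁ h₂ g r ω e n hn]
    have h2 : L'.φ U.U (le_trans (b := V.U) h h₂) (mres L'.M (U := U.U) (V := V.U) h n) =
        EndGr.toLin E.toGradedBundle (-(k : ℤ)) U.pre.U
          (EndGr.res E.toGradedBundle _ (AOpen.pre_mono h) g)
          (L.φ U.U (le_trans (b := V.U) h h₁) (mres L.M (U := U.U) (V := V.U) h e)) := by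
      refine (L'.φ_res V.U U.U h₂ h n).symm.trans ((congrArg _ hn).trans ?_)
      refine (g.1.naturality _ _ _ _ _).trans ?_
      exact congrArg _ (L.φ_res V.U U.U h₁ h e)
    rw [DRTerm.res_tmul, Ideal_I.res_mk h r (rres_mem_ker h r), ← OmExt.red_res k h]
    exact (iota_tmul L L' k U _ _ _ _ _ _ _ h2).trans (map_smulₛₗ (fres L' k h) r.1 (n ⊗ₜ ω)).symm

theorem LiftData.kerMul_rTensor (h₁ : U.U ≤ U₁) (h₂ : U.U ≤ U₂)
    (f : Γ(L.M, U.U) →ₗ[Γ(P.pair.Y, U.U)] Γ(L'.M, U.U))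
    (g : Γ(E.M, U.pre.U) →ₗ[Γ(P.red.Y, U.pre.U)] Γ(E.M, U.pre.U))
    (hf : ∀ e, L'.φ U.U h₂ (f e) = g (L.φ U.U h₁ e)) (z) :
    f.rTensor (OmExt k U) (L.kerMul k U h₁ z) =
      L'.kerMul k U h₂ ((g.rTensor (OmExt k U.pre)).rTensor (Ideal_I U) z) := by
  induction z using L.kerMul_induction k U h₁ with
  | ha x y hx hy => simp only [map_add, hx, hy]
  | ht q r =>
    have h1 : g.rTensor (OmExt k U.pre) (L.φForm k U h₁ q) =
        L'.φForm k U h₂ (f.rTensor (OmExt k U) q) := by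
      induction q using TensorProduct.induction_on with
      | zero => simp only [map_zero]
      | add x y hx hy => simp only [map_add, hx, hy]
      | tmul m w => exact congrArg (· ⊗ₜ _) (hf m).symm
    rw [L.kerMul_tmul, map_smul, LinearMap.rTensor_tmul, h1, L'.kerMul_tmul]

theorem rTensor_iota (h₁ : U.U ≤ U₁) (h₂ : U.U ≤ U₂) (h₃ : U.U ≤ U₃)
    {f : Γ(L'.M, U.U) →ₗ[Γ(P.pair.Y, U.U)] Γ(L''.M, U.U)}
    (hf : ∀ e, L''.φ U.U h₃ (f e) = L'.φ U.U h₂ e) (x : DRTerm E k U) :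
    f.rTensor (OmExt k U) ∘ₗ iota L L' k U h₁ h₂ x = iota L L'' k U h₁ h₃ x := by
  ext e
  refine (LiftData.kerMul_rTensor L' L'' k h₂ h₃ f LinearMap.id hf _).trans ?_
  rw [LinearMap.rTensor_id, LinearMap.rTensor_id]
  rfl

theorem iota_comp (h₁ : U.U ≤ U₁) (h₂ : U.U ≤ U₂) (h₃ : U.U ≤ U₃)
    {f : Γ(L.M, U.U) →ₗ[Γ(P.pair.Y, U.U)] Γ(L'.M, U.U)}
    (hf : ∀ e, L'.φ U.U h₂ (f e) = L.φ U.U h₁ e) (x : DRTerm E k U) :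
    iota L' L'' k U h₂ h₃ x ∘ₗ f = iota L L'' k U h₁ h₃ x := by
  ext e
  change L''.kerMul k U h₃ (x.eval k U (L'.φ U.U h₂ (f e))) = _
  rw [hf]
  rfl

theorem φForm_iota (h₁ : U.U ≤ U₁) (h₂ : U.U ≤ U₂) (x : DRTerm E k U) (e : Γ(L.M, U.U)) :
    L'.φForm k U h₂ (iota L L' k U h₁ h₂ x e) = 0 := by
  change L'.φForm k U h₂ (L'.kerMul k U h₂ _) = 0
  generalize x.eval k U (L.φ U.U h₁ e) = z
  induction z using L'.kerMul_induction k U h₂ with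
  | ha x y hx hy => rw [map_add, map_add, hx, hy, add_zero]
  | ht q r => rw [L'.kerMul_tmul, map_smulₛₗ, RingHom.mem_ker.mp r.2, zero_smul]

/-- A map `E' → E'' ⊗ Ω^k(log D')` that is homogeneous of degree `-k`. -/
def IsGradedForm (U : AOpen P.pair) (h₂ : U.U ≤ U₂) (F : FormHom L L' k U) : Prop :=
  ∀ m, ∀ e ∈ L.Gr m U.U,
    ((L'.proj (m + -(k : ℤ))).app U.U h₂).rTensor (OmExt k U) (F e) = F e

theorem isGradedForm_iota (h₁ : U.U ≤ U₁) (h₂ : U.U ≤ U₂) (x : DRTerm E k U) :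
    IsGradedForm L L' k U h₂ (iota L L' k U h₁ h₂ x) := by
  intro m e he
  refine (LiftData.kerMul_rTensor L' L' k h₂ h₂ _ ((E.proj (m + -(k : ℤ))).app U.pre.U le_top)
    (L'.φ_proj _ U.isAffine h₂) _).trans (congrArg (L'.kerMul k U h₂) ?_)
  exact DRTerm.rTensor_proj_eval k U x m (L.φ_Gr m U.U h₁ e he)

theorem exists_iota_eq (h₁ : U.U ≤ U₁) (h₂ : U.U ≤ U₂) (F : FormHom L L' k U)
    (hF : IsGradedForm L L' k U h₂ F) (h0 : ∀ e, L'.φForm k U h₂ (F e) = 0) :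
    ∃ x, iota L L' k U h₁ h₂ x = F := by
  obtain ⟨D₀⟩ := L.toGradedBundle.nonempty_dualBasis U.isAffine h₁
  obtain ⟨D₁, hD⟩ := (D₀.finDual le_rfl).exists_compat (L.isBC_φ U.isAffine h₁)
  choose y hy using fun k' => L'.exists_kerMul_eq k U h₂ (h0 ((D₀.finDual le_rfl).e k'))
  let G := ∑ j, (D₁.F j).smulRight (y j)
  have hG (e) : L'.kerMul k U h₂ (G (L.φ U.U h₁ e)) = F e := by
    conv_rhs => rw [← (D₀.finDual le_rfl).sum_eq e, map_sum]
    rw [LinearMap.sum_apply, map_sum]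
    refine Finset.sum_congr rfl fun j _ => ?_
    rw [LinearMap.smulRight_apply, hD.F_eq, L'.kerMul_smul, hy, map_smul]
  obtain ⟨x, hx⟩ := DRTerm.exists_eval_eq k U G fun m n hn => by
    obtain ⟨e, he, rfl⟩ := L.exists_mem_φ_eq U.isAffine h₁ hn
    refine L'.kerMul_injective k U h₂ ?_
    refine (LiftData.kerMul_rTensor L' L' k h₂ h₂ _ ((E.proj (m + -(k : ℤ))).app U.pre.U le_top)
      (L'.φ_proj _ U.isAffine h₂) _).symm.trans ?_
    rw [hG]
    exact hF m e he
  refine ⟨x, LinearMap.ext fun e => ?_⟩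
  rw [← hG, iota_apply, hx]

end Restriction



section TwistedForms

variable {A : Type u} [CommRing A] {M N R Ω : Type u} [AddCommGroup M] [Module A M] [AddCommGroup N]
  [Module A N] [AddCommGroup R] [Module A R] [AddCommGroup Ω] [Module A Ω]

/-- The exterior multiplication `(n ⊗ η, ω) ↦ n ⊗ (η ∧ ω)`. -/
def wedgeForm (A N Ω : Type u) [CommRing A] [AddCommGroup N] [Module A N] [AddCommGroup Ω]
    [Module A Ω] (k : ℕ) : N ⊗[A] Ω →ₗ[A] ⋀[A]^k Ω →ₗ[A] N ⊗[A] ⋀[A]^(k + 1) Ω :=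
  TensorProduct.lift (LinearMap.mk₂ A (fun n η => TensorProduct.mk A _ _ n ∘ₗ wedge A Ω k η)
    (fun _ _ _ => by ext; simp) (fun _ _ _ => by ext; simp)
    (fun _ _ _ => by ext; simp [TensorProduct.tmul_add]) (fun _ _ _ => by ext; simp))

theorem wedgeForm_tmul (k : ℕ) (n : N) (η : Ω) (ω : ⋀[A]^k Ω) :
    wedgeForm A N Ω k (n ⊗ₜ η) ω = n ⊗ₜ wedge A Ω k η ω := rfl

theorem wedge_anticomm (k : ℕ) (η ζ : Ω) (ω : ⋀[A]^k Ω) :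
    wedge A Ω (k + 1) η (wedge A Ω k ζ ω) = - wedge A Ω (k + 1) ζ (wedge A Ω k η ω) := by
  refine Subtype.ext ?_
  change ExteriorAlgebra.ι A η * (ExteriorAlgebra.ι A ζ * ω.1) =
    -(ExteriorAlgebra.ι A ζ * (ExteriorAlgebra.ι A η * ω.1))
  rw [← mul_assoc, ← mul_assoc, eq_neg_iff_add_eq_zero, ← add_mul,
    ExteriorAlgebra.ι_add_mul_swap, zero_mul]

theorem wedge_zeroEquiv_symm (η : Ω) : wedge A Ω 0 η ((exteriorPower.zeroEquiv A Ω).symm 1) =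
    (exteriorPower.oneEquiv A Ω).symm η := by
  have h : (exteriorPower.zeroEquiv A Ω).symm 1 = exteriorPower.ιMulti A 0 Fin.elim0 := by
    rw [LinearEquiv.symm_apply_eq, exteriorPower.zeroEquiv_ιMulti]
  rw [h, wedge_ιMulti, LinearEquiv.eq_symm_apply, exteriorPower.oneEquiv_ιMulti]
  rfl

theorem wedge_oneForm_anticomm (η ζ : Ω) :
    wedge A Ω 1 η ((exteriorPower.oneEquiv A Ω).symm ζ) =
      - wedge A Ω 1 ζ ((exteriorPower.oneEquiv A Ω).symm η) := by
  rw [← wedge_zeroEquiv_symm, ← wedge_zeroEquiv_symm, wedge_anticomm]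

/-- The extension `n ⊗ ω ↦ t n ∧ ω` of `t : N → N ⊗ Ω` to forms. -/
def extForm (t : N →ₗ[A] N ⊗[A] Ω) (k : ℕ) : N ⊗[A] ⋀[A]^k Ω →ₗ[A] N ⊗[A] ⋀[A]^(k + 1) Ω :=
  TensorProduct.lift (wedgeForm A N Ω k ∘ₗ t)

theorem extForm_tmul (t : N →ₗ[A] N ⊗[A] Ω) (k : ℕ) (n : N) (ω : ⋀[A]^k Ω) :
    extForm t k (n ⊗ₜ ω) = wedgeForm A N Ω k (t n) ω := rfl

/-- The map `p ⊗ η ↦ η ∧ F p` defined by a map `F : M → N ⊗ Ω^k`. -/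
def mulForm (k : ℕ) (F : M →ₗ[A] N ⊗[A] ⋀[A]^k Ω) : M ⊗[A] Ω →ₗ[A] N ⊗[A] ⋀[A]^(k + 1) Ω :=
  TensorProduct.lift ((LinearMap.lTensorHom N ∘ₗ wedge A Ω k).flip ∘ₗ F)

theorem mulForm_tmul (k : ℕ) (F : M →ₗ[A] N ⊗[A] ⋀[A]^k Ω) (p : M) (η : Ω) :
    mulForm k F (p ⊗ₜ η) = (wedge A Ω k η).lTensor N (F p) := rfl

/-- The commutator of `F : M → N ⊗ Ω^k` with the maps `t` and `t'`. -/
def bracketForm (t : M →ₗ[A] M ⊗[A] Ω) (t' : N →ₗ[A] N ⊗[A] Ω) (k : ℕ) (F : M →ₗ[A] N ⊗[A] ⋀[A]^k Ω) :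
    M →ₗ[A] N ⊗[A] ⋀[A]^(k + 1) Ω :=
  extForm t' k ∘ₗ F - mulForm k F ∘ₗ t

variable {t : M →ₗ[A] M ⊗[A] Ω} {t' : N →ₗ[A] N ⊗[A] Ω}

theorem mulForm_add (k : ℕ) (F G : M →ₗ[A] N ⊗[A] ⋀[A]^k Ω) :
    mulForm k (F + G) = mulForm k F + mulForm k G := by
  ext p η
  simp [mulForm_tmul]

theorem bracketForm_add (k : ℕ) (F G : M →ₗ[A] N ⊗[A] ⋀[A]^k Ω) :
    bracketForm t t' k (F + G) = bracketForm t t' k F + bracketForm t t' k G := by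
  rw [bracketForm, bracketForm, bracketForm, mulForm_add, LinearMap.comp_add, LinearMap.add_comp]
  abel

theorem bracketForm_smul_tmul (k : ℕ) (r : A) (f : M →ₗ[A] N) (ω : ⋀[A]^k Ω) (e : M) :
    bracketForm t t' k (r • ((TensorProduct.mk A N _).flip ω ∘ₗ f)) e =
      r • wedgeForm A N Ω k (t' (f e) - f.rTensor Ω (t e)) ω := by
  have h (x : M ⊗[A] Ω) : mulForm k (r • ((TensorProduct.mk A N _).flip ω ∘ₗ f)) x =
      r • wedgeForm A N Ω k (f.rTensor Ω x) ω := by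
    induction x using TensorProduct.induction_on with
    | zero => simp
    | add x y hx hy => simp only [map_add, LinearMap.add_apply, hx, hy, smul_add]
    | tmul p η => simp [mulForm_tmul, wedgeForm_tmul]
  rw [map_sub, LinearMap.sub_apply, smul_sub, ← h]
  simp [bracketForm, extForm_tmul]

/-- The map `t : N → N ⊗ Ω` with values in `N ⊗ ⋀^1 Ω`. -/
def toOneForm (t : M →ₗ[A] N ⊗[A] Ω) : M →ₗ[A] N ⊗[A] ⋀[A]^1 Ω :=
  (exteriorPower.oneEquiv A Ω).symm.toLinearMap.lTensor N ∘ₗ t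

/-- The map `t ∧ t : N → N ⊗ Ω²`. -/
def sqForm (t : N →ₗ[A] N ⊗[A] Ω) : N →ₗ[A] N ⊗[A] ⋀[A]^2 Ω := extForm t 1 ∘ₗ toOneForm t

theorem lTensor_wedge_one (η : Ω) (x : N ⊗[A] Ω) :
    (wedge A Ω 1 η).lTensor N ((exteriorPower.oneEquiv A Ω).symm.toLinearMap.lTensor N x) =
      - wedgeForm A N Ω 1 x ((exteriorPower.oneEquiv A Ω).symm η) := by
  induction x using TensorProduct.induction_on with
  | zero => simp
  | add x y hx hy => simp only [map_add, LinearMap.add_apply, hx, hy, neg_add]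
  | tmul n ζ =>
    rw [wedgeForm_tmul, ← TensorProduct.tmul_neg, ← wedge_oneForm_anticomm]
    rfl

theorem lTensor_wedge_extForm (k : ℕ) (η : Ω) (x : N ⊗[A] ⋀[A]^k Ω) :
    (wedge A Ω (k + 1) η).lTensor N (extForm t' k x) =
      - extForm t' (k + 1) ((wedge A Ω k η).lTensor N x) := by
  induction x using TensorProduct.induction_on with
  | zero => simp
  | add x y hx hy => simp only [map_add, hx, hy, neg_add]
  | tmul n ω =>
    rw [extForm_tmul, LinearMap.lTensor_tmul, extForm_tmul]
    generalize t' n = y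
    induction y using TensorProduct.induction_on with
    | zero => simp
    | add x y hx hy => simp only [map_add, LinearMap.add_apply, hx, hy, neg_add]
    | tmul n ζ =>
      rw [wedgeForm_tmul, wedgeForm_tmul, LinearMap.lTensor_tmul, wedge_anticomm,
        TensorProduct.tmul_neg]

theorem mulForm_toOneForm (f : M →ₗ[A] N) (x : M ⊗[A] Ω) :
    mulForm 1 (toOneForm t' ∘ₗ f) x = - extForm t' 1 (TensorProduct.map f
      (exteriorPower.oneEquiv A Ω).symm.toLinearMap x) := by
  induction x using TensorProduct.induction_on with
  | zero => simp
  | add x y hx hy => simp only [map_add, hx, hy, neg_add]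
  | tmul p η =>
    rw [mulForm_tmul]
    exact lTensor_wedge_one η (t' (f p))

theorem mulForm_rTensor (k : ℕ) (f : N →ₗ[A] R) (F : M →ₗ[A] N ⊗[A] ⋀[A]^k Ω) (x : M ⊗[A] Ω) :
    mulForm k (f.rTensor _ ∘ₗ F) x = f.rTensor _ (mulForm k F x) := by
  induction x using TensorProduct.induction_on with
  | zero => simp
  | add x y hx hy => simp only [map_add, hx, hy]
  | tmul p η =>
    rw [mulForm_tmul, mulForm_tmul]
    change ((wedge A Ω k η).lTensor R ∘ₗ f.rTensor _) (F p) =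
      (f.rTensor _ ∘ₗ (wedge A Ω k η).lTensor N) (F p)
    rw [LinearMap.lTensor_comp_rTensor, LinearMap.rTensor_comp_lTensor]

theorem mulForm_extForm (k : ℕ) (F : M →ₗ[A] N ⊗[A] ⋀[A]^k Ω) (x : M ⊗[A] Ω) :
    mulForm (k + 1) (extForm t' k ∘ₗ F) x = - extForm t' (k + 1) (mulForm k F x) := by
  induction x using TensorProduct.induction_on with
  | zero => simp
  | add x y hx hy => simp only [map_add, hx, hy, neg_add]
  | tmul p η => exact lTensor_wedge_extForm k η (F p)

theorem bracketForm_sqForm : bracketForm t t 2 (sqForm t) = 0 := by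
  ext e
  have h1 := mulForm_toOneForm (t' := t) LinearMap.id (t e)
  rw [LinearMap.comp_id] at h1
  change extForm t 2 (extForm t 1 (toOneForm t e)) -
    mulForm 2 (extForm t 1 ∘ₗ toOneForm t) (t e) = 0
  rw [mulForm_extForm, h1, map_neg, neg_neg]
  exact sub_self _

theorem bracketForm_toOneForm (f : M →ₗ[A] N) :
    bracketForm t t' 1 (toOneForm (t' ∘ₗ f - f.rTensor Ω ∘ₗ t)) =
      sqForm t' ∘ₗ f - f.rTensor _ ∘ₗ sqForm t := by
  have h0 : toOneForm (t' ∘ₗ f - f.rTensor Ω ∘ₗ t) + f.rTensor _ ∘ₗ toOneForm t =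
      toOneForm t' ∘ₗ f := by
    rw [toOneForm, LinearMap.comp_sub, toOneForm, toOneForm, ← LinearMap.comp_assoc (R₁ := A),
      ← LinearMap.comp_assoc (R₁ := A), ← LinearMap.comp_assoc (R₁ := A),
      LinearMap.lTensor_comp_rTensor, LinearMap.rTensor_comp_lTensor, sub_add_cancel]
  have h1 : bracketForm t t' 1 (toOneForm t' ∘ₗ f) =
      sqForm t' ∘ₗ f + extForm t' 1 ∘ₗ f.rTensor _ ∘ₗ toOneForm t := by
    ext e
    change extForm t' 1 (toOneForm t' (f e)) - mulForm 1 (toOneForm t' ∘ₗ f) (t e) = _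
    rw [mulForm_toOneForm, sub_neg_eq_add, ← LinearMap.rTensor_comp_lTensor]
    rfl
  have h2 : bracketForm t t' 1 (f.rTensor _ ∘ₗ toOneForm t) =
      extForm t' 1 ∘ₗ f.rTensor _ ∘ₗ toOneForm t + f.rTensor _ ∘ₗ sqForm t := by
    ext e
    change extForm t' 1 (f.rTensor _ (toOneForm t e)) -
      mulForm 1 (f.rTensor _ ∘ₗ toOneForm t) (t e) = _
    have h3 := mulForm_toOneForm (t' := t) LinearMap.id (t e)
    rw [LinearMap.comp_id] at h3
    rw [mulForm_rTensor, h3, map_neg, sub_neg_eq_add]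
    rfl
  rw [← h0, bracketForm_add, h2] at h1
  rw [eq_sub_iff_add_eq]
  refine add_left_cancel (a := extForm t' 1 ∘ₗ f.rTensor _ ∘ₗ toOneForm t) ?_
  rw [add_left_comm, h1]
  exact add_comm _ _

theorem wedgeForm_zeroForm (x : N ⊗[A] Ω) :
    wedgeForm A N Ω 0 x ((exteriorPower.zeroEquiv A Ω).symm 1) =
      (exteriorPower.oneEquiv A Ω).symm.toLinearMap.lTensor N x := by
  induction x using TensorProduct.induction_on with
  | zero => simp
  | add x y hx hy => simp only [map_add, LinearMap.add_apply, hx, hy]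
  | tmul n η =>
    rw [wedgeForm_tmul, wedge_zeroEquiv_symm]
    rfl

theorem bracketForm_zero (f : M →ₗ[A] N) : bracketForm t t' 0
      ((TensorProduct.mk A N _).flip ((exteriorPower.zeroEquiv A Ω).symm 1) ∘ₗ f) =
    toOneForm (t' ∘ₗ f - f.rTensor Ω ∘ₗ t) := by
  ext e
  have h := bracketForm_smul_tmul (t := t) (t' := t') 0 1 f ((exteriorPower.zeroEquiv A Ω).symm 1) e
  rw [one_smul, one_smul, wedgeForm_zeroForm] at h
  exact h

/-- The operators on forms with values in `End(N)` given by composition and by evaluation. -/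
theorem evalMap_map₂_wedge {G G' : Type u} [AddCommGroup G] [Module A G] [AddCommGroup G']
    [Module A G'] (ev : G →ₗ[A] N →ₗ[A] N) (ev' : G' →ₗ[A] N →ₗ[A] N) (m : G →ₗ[A] G →ₗ[A] G')
    (hm : ∀ g h n, ev' (m g h) n = ev g (ev h n)) (x y : G ⊗[A] Ω) (n : N) :
    evalMap ev' (TensorProduct.map₂ m ((wedge A Ω 1).compl₂
      (exteriorPower.oneEquiv A Ω).symm.toLinearMap) x y) n =
      extForm (evalMap ev x) 1 (toOneForm (evalMap ev y) n) := by
  induction y using TensorProduct.induction_on with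
  | zero => simp [toOneForm]
  | add y z hy hz =>
    simp only [map_add, LinearMap.add_apply, hy, hz, toOneForm, LinearMap.comp_add]
  | tmul h ζ =>
    induction x using TensorProduct.induction_on with
    | zero => simp [toOneForm, extForm_tmul, evalMap]
    | add x y hx hy =>
      have (s : N ⊗[A] ⋀[A]^1 Ω) : extForm (evalMap ev (x + y)) 1 s =
          extForm (evalMap ev x) 1 s + extForm (evalMap ev y) 1 s := by
        rw [extForm, map_add, LinearMap.comp_add]
        induction s using TensorProduct.induction_on with
        | zero => simp
        | add a b ha hb => simp only [map_add, ha, hb]; abel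
        | tmul a b => rfl
      rw [this, ← hx, ← hy]
      simp only [map_add, LinearMap.add_apply]
    | tmul g η =>
      change ev' (m g h) n ⊗ₜ[A] _ = ev g (ev h n) ⊗ₜ[A] _
      rw [hm]
      rfl

end TwistedForms



section LiftForms

variable {P : Thickening.{u}} {E : GradedField P.red ⊤} {U₁ U₂ U₃ : P.pair.Y.Opens}
  (L : LiftData E U₁) (L' : LiftData E U₂) (L'' : LiftData E U₃) {U V : AOpen P.pair}

theorem lin_res {P : LogPair.{u}} {U₀ : P.Y.Opens} (E : GradedField P U₀) {U V : AOpen P}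
    (hV : V.U ≤ U₀) (h : U ≤ V) (e : Γ(E.M, V.U)) :
    E.lin U (le_trans (b := V.U) h hV) (mres E.M (U := U.U) (V := V.U) h e) =
      tres Om.res E.M h (E.lin V hV e) := by
  rw [GradedField.lin, ← E.θ_res V U hV h, GradedField.lin]
  generalize E.θ V hV = t
  induction t using TensorProduct.induction_on with
  | zero => simp
  | add x y hx hy => simp only [map_add, LinearMap.add_apply, hx, hy]
  | tmul g η => exact congrArg (· ⊗ₜ _) (g.1.naturality V.U U.U le_rfl h e).symm

theorem tres_rTensor {P : LogPair.{u}} {M N : P.Y.Modules} {W : AOpen P → Type u}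
    [∀ U, AddCommGroup (W U)] [∀ U, Module Γ(P.Y, U.U) (W U)]
    (r : ∀ {U V : AOpen P} (h : U ≤ V), W V →ₛₗ[rres (U := U.U) (V := V.U) h] W U)
    {U V : AOpen P} (h : U ≤ V) {U₀ : P.Y.Opens} (hV : V.U ≤ U₀) (f : HomSec M N U₀)
    (x : Γ(M, V.U) ⊗[Γ(P.Y, V.U)] W V) :
    (f.app U.U (le_trans (b := V.U) h hV)).rTensor (W U) (tres r M h x) =
      tres r N h ((f.app V.U hV).rTensor (W V) x) := by
  induction x using TensorProduct.induction_on with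
  | zero => simp
  | add x y hx hy => simp only [map_add, hx, hy]
  | tmul m w => exact congrArg (· ⊗ₜ _) (f.naturality V.U U.U hV h m).symm

theorem tres_wedgeForm {P : LogPair.{u}} {M : P.Y.Modules} {U V : AOpen P} (h : U ≤ V) (k : ℕ)
    (x : Γ(M, V.U) ⊗[Γ(P.Y, V.U)] Om V) (ω : OmExt k V) :
    tres (OmExt.res (k + 1)) M h (wedgeForm _ _ _ k x ω) =
      wedgeForm _ _ _ k (tres Om.res M h x) (OmExt.res k h ω) := by
  induction x using TensorProduct.induction_on with
  | zero => simp
  | add x y hx hy => simp only [map_add, LinearMap.add_apply, hx, hy]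
  | tmul m η => exact congrArg (_ ⊗ₜ ·) (extMap_wedge (Om.res h) k η ω)

theorem extMap_zeroEquiv {A B M N : Type u} [CommRing A] [CommRing B] [AddCommGroup M] [Module A M]
    [AddCommGroup N] [Module B N] {h : A →+* B} (m : M →ₛₗ[h] N) :
    extMap m 0 ((exteriorPower.zeroEquiv A M).symm 1) = (exteriorPower.zeroEquiv B N).symm 1 := by
  have e (A M : Type u) [CommRing A] [AddCommGroup M] [Module A M] :
      (exteriorPower.zeroEquiv A M).symm 1 = exteriorPower.ιMulti A 0 Fin.elim0 := by
    rw [LinearEquiv.symm_apply_eq, exteriorPower.zeroEquiv_ιMulti]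
  rw [e, e, extMap_ιMulti]
  exact congrArg _ (funext fun t => t.elim0)

theorem extMap_oneEquiv {A B M N : Type u} [CommRing A] [CommRing B] [AddCommGroup M] [Module A M]
    [AddCommGroup N] [Module B N] {h : A →+* B} (m : M →ₛₗ[h] N) (x : M) :
    extMap m 1 ((exteriorPower.oneEquiv A M).symm x) = (exteriorPower.oneEquiv B N).symm (m x) := by
  rw [← wedge_zeroEquiv_symm, ← wedge_zeroEquiv_symm, extMap_wedge, extMap_zeroEquiv]

theorem tres_oneForm {P : LogPair.{u}} {M : P.Y.Modules} {U V : AOpen P} (h : U ≤ V)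
    (x : Γ(M, V.U) ⊗[Γ(P.Y, V.U)] Om V) :
    tres (OmExt.res 1) M h ((oneForm V).lTensor _ x) = (oneForm U).lTensor _ (tres Om.res M h x) := by
  induction x using TensorProduct.induction_on with
  | zero => simp
  | add x y hx hy => simp only [map_add, hx, hy]
  | tmul m η => exact congrArg (_ ⊗ₜ ·) (extMap_oneEquiv (Om.res h) η)

theorem tres_extForm {P : LogPair.{u}} {U₀ : P.Y.Opens} (E : GradedField P U₀) {U V : AOpen P}
    (hV : V.U ≤ U₀) (h : U ≤ V) (k : ℕ) (x : Γ(E.M, V.U) ⊗[Γ(P.Y, V.U)] OmExt k V) :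
    tres (OmExt.res (k + 1)) E.M h (extForm (E.lin V hV) k x) =
      extForm (E.lin U (le_trans (b := V.U) h hV)) k (tres (OmExt.res k) E.M h x) := by
  induction x using TensorProduct.induction_on with
  | zero => simp
  | add x y hx hy => simp only [map_add, hx, hy]
  | tmul m ω =>
    refine (tres_wedgeForm h k _ ω).trans ?_
    rw [← lin_res E hV h m]
    rfl

/-- The operator on forms with values in `Hom(E', E'')` defined by the fields `θ'` and `θ''`. -/
abbrev dForm (k : ℕ) (U : AOpen P.pair) (h₁ : U.U ≤ U₁) (h₂ : U.U ≤ U₂) (F : FormHom L L' k U) :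
    FormHom L L' (k + 1) U :=
  bracketForm (L.lin U h₁) (L'.lin U h₂) k F

theorem dForm_toForm₀ (h₁ : U.U ≤ U₁) (h₂ : U.U ≤ U₂) (f : HomSec L.M L'.M U.U) :
    dForm L L' 0 U h₁ h₂ (toForm₀ f) = higgsDefect L L' U h₁ h₂ f :=
  bracketForm_zero _

theorem GradedField.evalMap_sq {P : LogPair.{u}} {U₀ : P.Y.Opens} (E : GradedField P U₀) (U : AOpen P)
    (h : U.U ≤ U₀) : evalMap (EndGr.toLin E.toGradedBundle (-2) U.U) (E.sq U h) =
      sqForm (E.lin U h) := by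
  ext n
  have hm (g f : EndGr E.toGradedBundle (-1) U.U) (n : Γ(E.M, U.U)) :
      EndGr.toLin E.toGradedBundle (-2) U.U (EndGr.mul E.toGradedBundle (by norm_num) U.U g f) n =
        EndGr.toLin E.toGradedBundle (-1) U.U g (EndGr.toLin E.toGradedBundle (-1) U.U f n) := rfl
  exact evalMap_map₂_wedge _ _ _ hm (E.θ U h) (E.θ U h) n

theorem higgsSquare_eq (h₁ : U.U ≤ U₁) : higgsSquare L U h₁ = sqForm (L.lin U h₁) :=
  L.toGradedField.evalMap_sq U h₁

theorem dForm_higgsDefect (h₁ : U.U ≤ U₁) (h₂ : U.U ≤ U₂) (f : HomSec L.M L'.M U.U) :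
    dForm L L' 1 U h₁ h₂ (higgsDefect L L' U h₁ h₂ f) =
      higgsSquare L' U h₂ ∘ₗ f.app U.U le_rfl -
        (f.app U.U le_rfl).rTensor _ ∘ₗ higgsSquare L U h₁ := by
  rw [higgsSquare_eq, higgsSquare_eq]
  exact bracketForm_toOneForm _

theorem dForm_higgsSquare (h₁ : U.U ≤ U₁) :
    dForm L L 2 U h₁ h₁ (higgsSquare L U h₁) = 0 := by
  rw [higgsSquare_eq]
  exact bracketForm_sqForm

theorem higgsDefect_comp (h₁ : U.U ≤ U₁) (h₂ : U.U ≤ U₂) (h₃ : U.U ≤ U₃)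
    (g : HomSec L'.M L''.M U.U) (f : HomSec L.M L'.M U.U) :
    higgsDefect L L'' U h₁ h₃ (g.comp f) = higgsDefect L' L'' U h₂ h₃ g ∘ₗ f.app U.U le_rfl +
      (g.app U.U le_rfl).rTensor _ ∘ₗ higgsDefect L L' U h₁ h₂ f := by
  ext e
  change (oneForm U).lTensor _ (L''.lin U h₃ (g.app U.U le_rfl (f.app U.U le_rfl e)) -
      ((g.app U.U le_rfl ∘ₗ f.app U.U le_rfl).rTensor (Om U)) (L.lin U h₁ e)) =
    (oneForm U).lTensor _ (L''.lin U h₃ (g.app U.U le_rfl (f.app U.U le_rfl e)) -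
      (g.app U.U le_rfl).rTensor (Om U) (L'.lin U h₂ (f.app U.U le_rfl e))) +
    (g.app U.U le_rfl).rTensor (OmExt 1 U) ((oneForm U).lTensor _
      (L'.lin U h₂ (f.app U.U le_rfl e) - (f.app U.U le_rfl).rTensor (Om U) (L.lin U h₁ e)))
  have h (x : Γ(L'.M, U.U) ⊗[Γ(P.pair.Y, U.U)] Om U) :
      (g.app U.U le_rfl).rTensor (OmExt 1 U) ((oneForm U).lTensor _ x) =
        (oneForm U).lTensor _ ((g.app U.U le_rfl).rTensor (Om U) x) := by
    rw [← LinearMap.comp_apply, ← LinearMap.comp_apply, LinearMap.rTensor_comp_lTensor,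
      LinearMap.lTensor_comp_rTensor]
  rw [h, ← map_add, LinearMap.rTensor_comp, LinearMap.comp_apply]
  congr 1
  rw [map_sub, sub_add_sub_cancel]

theorem higgsDefect_add (h₁ : U.U ≤ U₁) (h₂ : U.U ≤ U₂) (f g : HomSec L.M L'.M U.U) :
    higgsDefect L L' U h₁ h₂ (f + g) = higgsDefect L L' U h₁ h₂ f + higgsDefect L L' U h₁ h₂ g := by
  ext e
  simp only [higgsDefect, HomSec.add_app, LinearMap.comp_apply, LinearMap.sub_apply,
    LinearMap.add_apply, map_add, LinearMap.rTensor_add, map_sub]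
  abel

theorem higgsDefect_sub (h₁ : U.U ≤ U₁) (h₂ : U.U ≤ U₂) (f g : HomSec L.M L'.M U.U) :
    higgsDefect L L' U h₁ h₂ (f - g) = higgsDefect L L' U h₁ h₂ f - higgsDefect L L' U h₁ h₂ g := by
  rw [eq_sub_iff_add_eq, ← higgsDefect_add, sub_add_cancel]

theorem higgsDefect_id (h₁ : U.U ≤ U₁) : higgsDefect L L U h₁ h₁ (HomSec.id L.M U.U) = 0 := by
  ext e
  change (oneForm U).lTensor _ (L.lin U h₁ e - (LinearMap.id.rTensor (Om U)) (L.lin U h₁ e)) = 0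
  rw [LinearMap.rTensor_id, LinearMap.id_apply, sub_self, map_zero]

theorem fres_toForm₀ (h : U ≤ V) (f : HomSec L.M L'.M V.U) (e : Γ(L.M, V.U)) :
    toForm₀ (L := L) (L' := L') (HomSec.res h f) (mres L.M (U := U.U) (V := V.U) h e) =
      fres L' 0 h (toForm₀ (L := L) (L' := L') f e) :=
  congrArg₂ (· ⊗ₜ ·) (f.naturality V.U U.U le_rfl h e).symm (extMap_zeroEquiv (Om.res h)).symm

theorem fres_higgsDefect (h₁ : V.U ≤ U₁) (h₂ : V.U ≤ U₂) (h : U ≤ V) (f : HomSec L.M L'.M V.U)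
    (e : Γ(L.M, V.U)) :
    higgsDefect L L' U (le_trans (b := V.U) h h₁) (le_trans (b := V.U) h h₂) (HomSec.res h f)
        (mres L.M (U := U.U) (V := V.U) h e) =
      fres L' 1 h (higgsDefect L L' V h₁ h₂ f e) := by
  change (oneForm U).lTensor _ (L'.lin U _ (f.app U.U h (mres L.M (U := U.U) (V := V.U) h e)) -
    (f.app U.U h).rTensor (Om U) (L.lin U _ (mres L.M (U := U.U) (V := V.U) h e))) =
      tres (OmExt.res 1) L'.M h ((oneForm V).lTensor _ (L'.lin V h₂ (f.app V.U le_rfl e) -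
        (f.app V.U le_rfl).rTensor (Om V) (L.lin V h₁ e)))
  rw [tres_oneForm, ← f.naturality V.U U.U le_rfl h e, lin_res L'.toGradedField h₂ h,
    lin_res L.toGradedField h₁ h, map_sub (tres Om.res L'.M h),
    ← tres_rTensor Om.res h le_rfl f]

theorem fres_higgsSquare (h₁ : V.U ≤ U₁) (h : U ≤ V) (e : Γ(L.M, V.U)) :
    higgsSquare L U (le_trans (b := V.U) h h₁) (mres L.M (U := U.U) (V := V.U) h e) =
      fres L 2 h (higgsSquare L V h₁ e) := by
  rw [higgsSquare_eq, higgsSquare_eq]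
  refine Eq.trans ?_ (tres_extForm L.toGradedField h₁ h 1 _).symm
  refine congrArg (extForm _ 1) ?_
  refine Eq.trans ?_ (tres_oneForm h _).symm
  exact congrArg ((oneForm U).lTensor _) (lin_res L.toGradedField h₁ h e)

end LiftForms



section

variable {A : Type u} [CommRing A] {M N W W' : Type u} [AddCommGroup M] [Module A M]
  [AddCommGroup N] [Module A N] [AddCommGroup W] [Module A W] [AddCommGroup W'] [Module A W']

theorem rTensor_comm (f : M →ₗ[A] N) (g : W →ₗ[A] W') (x : M ⊗[A] W) :
    f.rTensor W' (g.lTensor M x) = g.lTensor N (f.rTensor W x) := by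
  rw [← LinearMap.comp_apply, ← LinearMap.comp_apply, LinearMap.rTensor_comp_lTensor,
    LinearMap.lTensor_comp_rTensor]

theorem rTensor_rTensor_of_forall (p : M →ₗ[A] M) (f : M →ₗ[A] N) (q : N →ₗ[A] N)
    (h : ∀ x, q (f (p x)) = f (p x)) {x : M ⊗[A] W} (hx : p.rTensor W x = x) :
    q.rTensor W (f.rTensor W x) = f.rTensor W x := by
  rw [← hx]
  generalize x = y
  induction y using TensorProduct.induction_on with
  | zero => simp
  | add x y hx hy => simp only [map_add, hx, hy]
  | tmul m w => simp [h]

theorem wedgeForm_evalMap_add {G : Type u} [AddCommGroup G] [Module A G] (ev : G →ₗ[A] N →ₗ[A] N)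
    (k : ℕ) (g : N →ₗ[A] N) (n : N) (ω : ⋀[A]^k W) (x y : G ⊗[A] W) :
    wedgeForm A N W k (evalMap ev (x + y) (g n) - g.rTensor W (evalMap ev (x + y) n)) ω =
      wedgeForm A N W k (evalMap ev x (g n) - g.rTensor W (evalMap ev x n)) ω +
      wedgeForm A N W k (evalMap ev y (g n) - g.rTensor W (evalMap ev y n)) ω := by
  rw [← LinearMap.add_apply, ← map_add]
  congr 2
  simp only [map_add, LinearMap.add_apply]
  abel

theorem tensor_eq_of_tmul {G X : Type u} [AddCommGroup G] [Module A G] [AddCommGroup X]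
    (F F' : G ⊗[A] W → X) (hF : ∀ x y, F (x + y) = F x + F y)
    (hF' : ∀ x y, F' (x + y) = F' x + F' y) (h : ∀ g w, F (g ⊗ₜ w) = F' (g ⊗ₜ w)) (x : G ⊗[A] W) :
    F x = F' x := by
  induction x using TensorProduct.induction_on with
  | zero => rw [← TensorProduct.zero_tmul G (0 : W)]; exact h 0 0
  | add x y hx hy => rw [hF, hF', hx, hy]
  | tmul g w => exact h g w

theorem wedgeForm_evalMap_add_tmul {G I : Type u} [AddCommGroup G] [Module A G] [AddCommGroup I]
    [Module A I] (ev : G →ₗ[A] N →ₗ[A] N) (k : ℕ) (g : N →ₗ[A] N) (n : N) (ω : ⋀[A]^k W) (r : I)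
    (x y : G ⊗[A] W) :
    wedgeForm A N W k (evalMap ev (x + y) (g n) - g.rTensor W (evalMap ev (x + y) n)) ω ⊗ₜ[A] r =
      wedgeForm A N W k (evalMap ev x (g n) - g.rTensor W (evalMap ev x n)) ω ⊗ₜ[A] r +
      wedgeForm A N W k (evalMap ev y (g n) - g.rTensor W (evalMap ev y n)) ω ⊗ₜ[A] r := by
  rw [wedgeForm_evalMap_add, TensorProduct.add_tmul]

end

section LiftDifferential

variable {P : Thickening.{u}} {E : GradedField P.red ⊤} {U₁ U₂ U₃ : P.pair.Y.Opens}
  (L : LiftData E U₁) (L' : LiftData E U₂) (L'' : LiftData E U₃) {U V : AOpen P.pair}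

theorem LiftData.φForm_wedgeForm (k : ℕ) (h₁ : U.U ≤ U₁) (x : Γ(L.M, U.U) ⊗[Γ(P.pair.Y, U.U)] Om U)
    (ω : OmExt k U) : L.φForm (k + 1) U h₁ (wedgeForm _ _ _ k x ω) =
      wedgeForm _ _ _ k (TensorProduct.map (L.φ U.U h₁) (Om.red U) x) (OmExt.red k U ω) := by
  induction x using TensorProduct.induction_on with
  | zero => simp
  | add x y hx hy => simp only [map_add, LinearMap.add_apply, hx, hy]
  | tmul m η => exact congrArg (_ ⊗ₜ ·) (extMap_wedge (Om.red U) k η ω)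

theorem LiftData.φForm_oneForm (h₁ : U.U ≤ U₁) (x : Γ(L.M, U.U) ⊗[Γ(P.pair.Y, U.U)] Om U) :
    L.φForm 1 U h₁ ((oneForm U).lTensor _ x) =
      (oneForm U.pre).lTensor _ (TensorProduct.map (L.φ U.U h₁) (Om.red U) x) := by
  induction x using TensorProduct.induction_on with
  | zero => simp
  | add x y hx hy => simp only [map_add, hx, hy]
  | tmul m η => exact congrArg (_ ⊗ₜ ·) (extMap_oneEquiv (Om.red U) η)

theorem LiftData.φForm_extForm (k : ℕ) (h₁ : U.U ≤ U₁)
    (x : Γ(L.M, U.U) ⊗[Γ(P.pair.Y, U.U)] OmExt k U) :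
    L.φForm (k + 1) U h₁ (extForm (L.lin U h₁) k x) =
      extForm (E.lin U.pre le_top) k (L.φForm k U h₁ x) := by
  induction x using TensorProduct.induction_on with
  | zero => simp only [map_zero]
  | add x y hx hy => simp only [map_add, hx, hy]
  | tmul m ω =>
    refine (L.φForm_wedgeForm k h₁ _ ω).trans ?_
    rw [L.φ_θ U h₁ m]
    rfl

theorem map_φ_rTensor (h₁ : U.U ≤ U₁) (h₂ : U.U ≤ U₂)
    (f : Γ(L.M, U.U) →ₗ[Γ(P.pair.Y, U.U)] Γ(L'.M, U.U))
    (g : Γ(E.M, U.pre.U) →ₗ[Γ(P.red.Y, U.pre.U)] Γ(E.M, U.pre.U))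
    (hf : ∀ e, L'.φ U.U h₂ (f e) = g (L.φ U.U h₁ e)) (x : Γ(L.M, U.U) ⊗[Γ(P.pair.Y, U.U)] Om U) :
    TensorProduct.map (L'.φ U.U h₂) (Om.red U) (f.rTensor (Om U) x) =
      g.rTensor (Om U.pre) (TensorProduct.map (L.φ U.U h₁) (Om.red U) x) := by
  induction x using TensorProduct.induction_on with
  | zero => simp
  | add x y hx hy => simp only [map_add, hx, hy]
  | tmul m w => exact congrArg (· ⊗ₜ _) (hf m)

theorem EndGr.toLin_bracket {Y : Scheme.{u}} {U₀ : Y.Opens} (E : GradedBundle Y U₀) {ℓ m n : ℤ}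
    (hn : n = ℓ + m) (U : Y.Opens) (g : EndGr E ℓ U) (f : EndGr E m U) (e : Γ(E.M, U)) :
    EndGr.toLin E n U (EndGr.bracket E hn U g f) e =
      EndGr.toLin E ℓ U g (EndGr.toLin E m U f e) - EndGr.toLin E m U f (EndGr.toLin E ℓ U g e) :=
  LinearMap.congr_fun (HomSec.sub_app (g.1.comp f.1) (f.1.comp g.1) le_rfl) e

theorem wedgeBracket_eval_add (k : ℕ) (U : AOpen P.pair)
    (x y : EndGr E.toGradedBundle (-1) U.pre.U ⊗[Γ(P.red.Y, U.pre.U)] Om U.pre)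
    (z : DRTerm E k U) (n : Γ(E.M, U.pre.U)) :
    (wedgeBracket E k U (x + y) z).eval (k + 1) U n =
      (wedgeBracket E k U x z).eval (k + 1) U n + (wedgeBracket E k U y z).eval (k + 1) U n := by
  have h1 : wedgeBracket E k U (x + y) = wedgeBracket E k U x + wedgeBracket E k U y :=
    map_add (wedgeBracket E k U) x y
  have h2 : wedgeBracket E k U (x + y) z = wedgeBracket E k U x z + wedgeBracket E k U y z :=
    congrArg (fun f : DRTerm E k U →ₗ[Γ(P.red.Y, U.pre.U)] DRTerm E (k + 1) U => f z) h1
  exact (congrArg (fun z => DRTerm.eval (k + 1) U z n) h2).trans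
    (LinearMap.congr_fun (DRTerm.eval_add _ _ _ _) n)

theorem wedgeBracket_eval (k : ℕ) (U : AOpen P.pair)
    (t : EndGr E.toGradedBundle (-1) U.pre.U ⊗[Γ(P.red.Y, U.pre.U)] Om U.pre)
    (g : EndGr E.toGradedBundle (-(k : ℤ)) U.pre.U) (r : Ideal_I U) (ω : OmExt k U.pre)
    (n : Γ(E.M, U.pre.U)) :
    (wedgeBracket E k U t (DRTerm.tmul g r ω)).eval (k + 1) U n =
      wedgeForm _ _ _ k (evalMap (EndGr.toLin E.toGradedBundle (-1) U.pre.U) t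
          (EndGr.toLin E.toGradedBundle _ U.pre.U g n) -
        (EndGr.toLin E.toGradedBundle _ U.pre.U g).rTensor (Om U.pre)
          (evalMap (EndGr.toLin E.toGradedBundle (-1) U.pre.U) t n)) ω ⊗ₜ r := by
  refine tensor_eq_of_tmul
    (fun t => (wedgeBracket E k U t (DRTerm.tmul g r ω)).eval (k + 1) U n)
    (fun t => wedgeForm _ _ _ k (evalMap (EndGr.toLin E.toGradedBundle (-1) U.pre.U) t
          (EndGr.toLin E.toGradedBundle _ U.pre.U g n) -
        (EndGr.toLin E.toGradedBundle _ U.pre.U g).rTensor (Om U.pre)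
          (evalMap (EndGr.toLin E.toGradedBundle (-1) U.pre.U) t n)) ω ⊗ₜ r)
    (fun x y => wedgeBracket_eval_add k U x y _ n)
    (fun x y => wedgeForm_evalMap_add_tmul _ _ _ _ _ _ _ _) (fun A η => ?_) t
  have h1 : wedgeForm _ _ _ k (evalMap (EndGr.toLin E.toGradedBundle (-1) U.pre.U) (A ⊗ₜ η)
      (EndGr.toLin E.toGradedBundle _ U.pre.U g n) -
        (EndGr.toLin E.toGradedBundle _ U.pre.U g).rTensor (Om U.pre)
          (evalMap (EndGr.toLin E.toGradedBundle (-1) U.pre.U) (A ⊗ₜ η) n)) ω =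
      (EndGr.toLin E.toGradedBundle (-1) U.pre.U A (EndGr.toLin E.toGradedBundle _ U.pre.U g n) -
        EndGr.toLin E.toGradedBundle _ U.pre.U g (EndGr.toLin E.toGradedBundle (-1) U.pre.U A n)) ⊗ₜ
        wedge Γ(P.red.Y, U.pre.U) (Om U.pre) k η ω :=
    congrArg (fun z => wedgeForm _ _ _ k z ω) (TensorProduct.sub_tmul _ _ _).symm
  exact ((congrArg (fun z => DRTerm.eval (k + 1) U z n) (wedgeBracket_tmul E k U A η g r ω)).trans
    (DRTerm.eval_tmul (k + 1) U _ r _ n)).trans (congrArg (· ⊗ₜ r) (h1.trans (congrArg (· ⊗ₜ _)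
      (EndGr.toLin_bracket E.toGradedBundle (neg_degree k) U.pre.U A g n).symm)).symm)

theorem iota_thetaEnd (k : ℕ) (h₁ : U.U ≤ U₁) (h₂ : U.U ≤ U₂) (x : DRTerm E k U) :
    iota L L' (k + 1) U h₁ h₂ (thetaEnd E k U x) =
      dForm L L' k U h₁ h₂ (iota L L' k U h₁ h₂ x) := by
  induction x using DRTerm.induction' with
  | ha x y hx hy =>
    have h1 : iota L L' (k + 1) U h₁ h₂ (thetaEnd E k U (x + y)) =
        iota L L' (k + 1) U h₁ h₂ (thetaEnd E k U x) +
          iota L L' (k + 1) U h₁ h₂ (thetaEnd E k U y) := by rw [map_add, map_add]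
    rw [h1, hx, hy, map_add (iota L L' k U h₁ h₂)]
    exact (bracketForm_add _ _ _).symm
  | ht g r ω =>
    obtain ⟨g', -, hg⟩ := exists_homSec_lift L L' _ U.isAffine h₁ h₂ g
    have h0 : iota L L' k U h₁ h₂ (DRTerm.tmul g (KerModule.mk _ 1 r) (OmExt.red k U ω)) =
        r.1 • ((TensorProduct.mk _ _ _).flip ω ∘ₗ g'.app U.U le_rfl) :=
      LinearMap.ext fun e => iota_tmul L L' k U h₁ h₂ g r ω e _ (hg U.U le_rfl e)
    ext e
    rw [h0, dForm, bracketForm_smul_tmul, iota_apply]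
    have h1 := map_φ_rTensor L L' h₁ h₂ _ (EndGr.toLin E.toGradedBundle _ U.pre.U g) (hg U.U le_rfl)
      (L.lin U h₁ e)
    have h2 := (map_sub (TensorProduct.map (L'.φ U.U h₂) (Om.red U)) _ _).trans
      (congrArg₂ (· - ·) ((L'.φ_θ U h₂ (g'.app U.U le_rfl e)).trans
        (congrArg (E.lin U.pre le_top) (hg U.U le_rfl e)))
        (h1.trans (congrArg ((EndGr.toLin E.toGradedBundle _ U.pre.U g).rTensor (Om U.pre))
          (L.φ_θ U h₁ e))))
    have h3 := ((L'.φForm_wedgeForm k h₂ _ ω).trans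
      (congrArg (fun z => wedgeForm _ _ _ k z (OmExt.red k U ω)) h2)).symm
    have h4 := (wedgeBracket_eval k U (E.θ U.pre le_top) g (KerModule.mk _ 1 r) (OmExt.red k U ω)
      (L.φ U.U h₁ e)).trans (congrArg (· ⊗ₜ KerModule.mk _ 1 r) h3)
    exact (congrArg (L'.kerMul (k + 1) U h₂) h4).trans (L'.kerMul_tmul (k + 1) U h₂ _ r)

section Reduction

variable {L L'}

/-- The homomorphism `f` reduces to the identity of `E`. -/
def ReducesToId (L : LiftData E U₁) (L' : LiftData E U₂) {U : P.pair.Y.Opens} (h₁ : U ≤ U₁)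
    (h₂ : U ≤ U₂) (f : HomSec L.M L'.M U) : Prop :=
  ∀ (V : P.pair.Y.Opens) (h : V ≤ U) (e : Γ(L.M, V)),
    L'.φ V (h.trans h₂) (f.app V h e) = L.φ V (h.trans h₁) e

theorem φForm_toForm₀_sub (h₁ : U.U ≤ U₁) (h₂ : U.U ≤ U₂) {f g : HomSec L.M L'.M U.U}
    (hf : ReducesToId L L' h₁ h₂ f) (hg : ReducesToId L L' h₁ h₂ g) (e : Γ(L.M, U.U)) :
    L'.φForm 0 U h₂ (toForm₀ (L := L) (L' := L') (f - g) e) = 0 := by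
  change L'.φ U.U h₂ ((f - g).app U.U le_rfl e) ⊗ₜ _ = 0
  rw [HomSec.sub_app, LinearMap.sub_apply, map_sub, hf U.U le_rfl e, hg U.U le_rfl e, sub_self,
    TensorProduct.zero_tmul]

theorem φForm_higgsDefect (h₁ : U.U ≤ U₁) (h₂ : U.U ≤ U₂) {f : HomSec L.M L'.M U.U}
    (hf : ReducesToId L L' h₁ h₂ f) (e : Γ(L.M, U.U)) :
    L'.φForm 1 U h₂ (higgsDefect L L' U h₁ h₂ f e) = 0 := by
  refine (L'.φForm_oneForm h₂ _).trans ?_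
  rw [LinearMap.sub_apply, map_sub, LinearMap.comp_apply, LinearMap.comp_apply, L'.φ_θ U h₂,
    map_φ_rTensor L L' h₁ h₂ _ LinearMap.id (hf U.U le_rfl), L.φ_θ U h₁ e, hf U.U le_rfl e,
    LinearMap.rTensor_id, LinearMap.id_apply, sub_self, map_zero]

theorem φForm_higgsSquare (hE : E.Integrable) (h₁ : U.U ≤ U₁) (e : Γ(L.M, U.U)) :
    L.φForm 2 U h₁ (higgsSquare L U h₁ e) = 0 := by
  rw [higgsSquare_eq]
  refine (L.φForm_extForm 1 h₁ _).trans ?_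
  have h0 : sqForm (E.lin U.pre le_top) = 0 := by
    rw [← E.evalMap_sq, hE U.pre le_top, map_zero]
  refine Eq.trans ?_ (LinearMap.congr_fun h0 (L.φ U.U h₁ e))
  refine congrArg (extForm _ 1) ?_
  refine (L.φForm_oneForm h₁ _).trans ?_
  rw [L.φ_θ U h₁ e]
  rfl

variable (L) in
theorem isGradedForm_lin (h₁ : U.U ≤ U₁) (m : ℤ) {e : Γ(L.M, U.U)} (he : e ∈ L.Gr m U.U) :
    ((L.proj (m + -1)).app U.U h₁).rTensor (Om U) (L.lin U h₁ e) = L.lin U h₁ e :=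
  L.rTensor_proj_evalMap h₁ (-1) _ m he

theorem isGradedForm_toForm₀ (h₂ : U.U ≤ U₂) {f : HomSec L.M L'.M U.U}
    (hf : f ∈ HomGr L.toGradedBundle L'.toGradedBundle 0 U.U) :
    IsGradedForm L L' 0 U h₂ (toForm₀ f) := by
  intro m e he
  refine congrArg (· ⊗ₜ _) (L'.proj_of_mem h₂ ?_)
  exact hf m U.U le_rfl e he

theorem isGradedForm_higgsDefect (h₁ : U.U ≤ U₁) (h₂ : U.U ≤ U₂) {f : HomSec L.M L'.M U.U}
    (hf : f ∈ HomGr L.toGradedBundle L'.toGradedBundle 0 U.U) :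
    IsGradedForm L L' 1 U h₂ (higgsDefect L L' U h₁ h₂ f) := by
  intro m e he
  refine (rTensor_comm _ _ _).trans (congrArg ((oneForm U).lTensor _) ?_)
  rw [LinearMap.sub_apply, map_sub]
  congr 1
  · refine isGradedForm_lin L' h₂ m ?_
    have := hf m U.U le_rfl e he
    rwa [add_zero] at this
  · refine rTensor_rTensor_of_forall _ _ _ (fun n => L'.proj_of_mem h₂ ?_)
      (isGradedForm_lin L h₁ m he)
    have := hf _ U.U le_rfl _ (L.proj_mem (m + -1) h₁ n)
    rwa [add_zero] at this

theorem isGradedForm_higgsSquare (h₁ : U.U ≤ U₁) :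
    IsGradedForm L L 2 U h₁ (higgsSquare L U h₁) :=
  fun m _ he => L.rTensor_proj_evalMap h₁ (-2) _ m he

end Reduction

end LiftDifferential



section Restrict

variable {P : Thickening.{u}} {E : GradedField P.red ⊤} {U₁ U₂ U₃ : P.pair.Y.Opens}

/-- Restriction of a graded bundle to a smaller open set. -/
def GradedBundle.restrict {Y : Scheme.{u}} {U₀ : Y.Opens} (E : GradedBundle Y U₀) {V : Y.Opens}
    (hV : V ≤ U₀) : GradedBundle Y V where
  M := E.M
  Gr := E.Gr
  res_mem ℓ W W' h hW := E.res_mem ℓ W W' h (hW.trans hV)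
  of_locally_mem ℓ W hW := E.of_locally_mem ℓ W (hW.trans hV)
  locally_basis x hx := by
    obtain ⟨W, hxW, -, n, b, deg, hb⟩ := E.locally_basis x (hV hx)
    refine ⟨W ⊓ V, ⟨hxW, hx⟩, inf_le_right, n, fun k => mres E.M inf_le_left (b k), deg,
      fun W' h => ?_⟩
    simp only [mres_mres]
    exact hb W' (h.trans inf_le_left)

/-- Restriction of local liftings to a smaller open set. -/
def LiftData.restrict (L : LiftData E U₁) (hU : U₂ ≤ U₁) : LiftData E U₂ where
  toGradedBundle := L.toGradedBundle.restrict hU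
  θ V hV := L.θ V (hV.trans hU)
  θ_res V W hV h := L.θ_res V W (hV.trans hU) h
  φ V hV := L.φ V (hV.trans hU)
  φ_res V W hV h e := L.φ_res V W (hV.trans hU) h e
  φ_Gr ℓ V hV := L.φ_Gr ℓ V (hV.trans hU)
  φ_iso x hx := by
    obtain ⟨V, hV, hxV, h⟩ := L.φ_iso x (hU hx)
    exact ⟨V ⊓ U₂, inf_le_right, ⟨hxV, hx⟩, fun W hW hW' => h W (hW.trans inf_le_left) hW'⟩
  φ_θ V hV e := L.φ_θ V (hV.trans hU) e

/-- Restriction of isomorphisms of graded bundles. -/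
def GrIso.res {L : LiftData E U₁} {L' : LiftData E U₂} {U V : P.pair.Y.Opens} {h₁ : U ≤ U₁}
    {h₂ : U ≤ U₂} (f : GrIso L L' U h₁ h₂) (h : V ≤ U) :
    GrIso L L' V (h.trans h₁) (h.trans h₂) where
  hom := HomSec.res h f.hom
  inv := HomSec.res h f.inv
  hom_inv := congrArg (HomSec.res h) f.hom_inv
  inv_hom := congrArg (HomSec.res h) f.inv_hom
  hom_mem m W hW := f.hom_mem m W (hW.trans h)
  inv_mem m W hW := f.inv_mem m W (hW.trans h)
  φ_hom W hW := f.φ_hom W (hW.trans h)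

end Restrict

section Represented

variable {P : Thickening.{u}} {E : GradedField P.red ⊤} {U₁ U₂ U₃ : P.pair.Y.Opens}
  {L : LiftData E U₁} {L' : LiftData E U₂} {L'' : LiftData E U₃} {U V : AOpen P.pair}

theorem iota_res_eq {k : ℕ} (h₁ : V.U ≤ U₁) (h₂ : V.U ≤ U₂) (h : U ≤ V) {x : DRTerm E k V}
    {F : FormHom L L' k V} {F' : FormHom L L' k U} (hx : iota L L' k V h₁ h₂ x = F)
    (hF : ∀ e, F' (mres L.M (U := U.U) (V := V.U) h e) = fres L' k h (F e)) :
    iota L L' k U (le_trans (b := V.U) h h₁) (le_trans (b := V.U) h h₂) (DRTerm.res E k h x) =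
      F' :=
  FormHom.ext_res (L := L) h₁ h fun e => by
    rw [hF, iota_res L L' k h₁ h₂ h x e, hx]

theorem iota_res_toForm₀ (h₁ : V.U ≤ U₁) (h₂ : V.U ≤ U₂) (h : U ≤ V) {x : DRTerm E 0 V}
    {f : HomSec L.M L'.M V.U} (hx : iota L L' 0 V h₁ h₂ x = toForm₀ f) :
    iota L L' 0 U (le_trans (b := V.U) h h₁) (le_trans (b := V.U) h h₂) (DRTerm.res E 0 h x) =
      toForm₀ (HomSec.res h f) :=
  iota_res_eq h₁ h₂ h hx (fres_toForm₀ L L' h f)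

theorem iota_res_higgsDefect (h₁ : V.U ≤ U₁) (h₂ : V.U ≤ U₂) (h : U ≤ V) {x : DRTerm E 1 V}
    {f : HomSec L.M L'.M V.U} (hx : iota L L' 1 V h₁ h₂ x = higgsDefect L L' V h₁ h₂ f) :
    iota L L' 1 U (le_trans (b := V.U) h h₁) (le_trans (b := V.U) h h₂) (DRTerm.res E 1 h x) =
      higgsDefect L L' U (le_trans (b := V.U) h h₁) (le_trans (b := V.U) h h₂) (HomSec.res h f) :=
  iota_res_eq h₁ h₂ h hx (fres_higgsDefect L L' h₁ h₂ h f)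

theorem iota_res_higgsSquare (h₁ : V.U ≤ U₁) (h : U ≤ V) {x : DRTerm E 2 V}
    (hx : iota L L 2 V h₁ h₁ x = higgsSquare L V h₁) :
    iota L L 2 U (le_trans (b := V.U) h h₁) (le_trans (b := V.U) h h₁) (DRTerm.res E 2 h x) =
      higgsSquare L U (le_trans (b := V.U) h h₁) :=
  iota_res_eq h₁ h₁ h hx (fres_higgsSquare L h₁ h)

theorem toForm₀_add (f g : HomSec L.M L'.M U.U) :
    toForm₀ (L := L) (L' := L') (f + g) = toForm₀ f + toForm₀ g :=
  LinearMap.ext fun _ => TensorProduct.add_tmul _ _ _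

theorem toForm₀_zero : toForm₀ (L := L) (L' := L') (U := U) 0 = 0 :=
  LinearMap.ext fun _ => TensorProduct.zero_tmul _ _

theorem toForm₀_neg (f : HomSec L.M L'.M U.U) :
    toForm₀ (L := L) (L' := L') (-f) = -toForm₀ f := by
  rw [eq_neg_iff_add_eq_zero, ← toForm₀_add, neg_add_cancel, toForm₀_zero]

theorem toForm₀_sub (f g : HomSec L.M L'.M U.U) :
    toForm₀ (L := L) (L' := L') (f - g) = toForm₀ f - toForm₀ g := by
  rw [sub_eq_add_neg, toForm₀_add, toForm₀_neg, sub_eq_add_neg]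

variable (h₁ : U.U ≤ U₁) (h₂ : U.U ≤ U₂) (h₃ : U.U ≤ U₃)

theorem iota_comp_toForm₀ {f : HomSec L.M L'.M U.U} (hf : ReducesToId L L' h₁ h₂ f)
    {x : DRTerm E 0 U} {g : HomSec L'.M L''.M U.U} (hx : iota L' L'' 0 U h₂ h₃ x = toForm₀ g) :
    iota L L'' 0 U h₁ h₃ x = toForm₀ (g.comp f) :=
  (iota_comp L L' L'' 0 h₁ h₂ h₃ (hf U.U le_rfl) x).symm.trans
    (congrArg (· ∘ₗ f.app U.U le_rfl) hx)

theorem iota_toForm₀_comp {f : HomSec L'.M L''.M U.U} (hf : ReducesToId L' L'' h₂ h₃ f)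
    {x : DRTerm E 0 U} {g : HomSec L.M L'.M U.U} (hx : iota L L' 0 U h₁ h₂ x = toForm₀ g) :
    iota L L'' 0 U h₁ h₃ x = toForm₀ (f.comp g) :=
  (rTensor_iota L L' L'' 0 h₁ h₂ h₃ (hf U.U le_rfl) x).symm.trans
    (congrArg ((f.app U.U le_rfl).rTensor _ ∘ₗ ·) hx)

theorem iota_thetaEnd_toForm₀ {x : DRTerm E 0 U} {g : HomSec L.M L'.M U.U}
    (hx : iota L L' 0 U h₁ h₂ x = toForm₀ g) :
    iota L L' 1 U h₁ h₂ (thetaEnd E 0 U x) = higgsDefect L L' U h₁ h₂ g :=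
  (iota_thetaEnd L L' 0 h₁ h₂ x).trans ((congrArg (dForm L L' 0 U h₁ h₂) hx).trans
    (dForm_toForm₀ L L' h₁ h₂ g))

theorem iota_thetaEnd_higgsDefect {x : DRTerm E 1 U} {g : HomSec L.M L'.M U.U}
    (hx : iota L L' 1 U h₁ h₂ x = higgsDefect L L' U h₁ h₂ g) :
    iota L L' 2 U h₁ h₂ (thetaEnd E 1 U x) = higgsSquare L' U h₂ ∘ₗ g.app U.U le_rfl -
      (g.app U.U le_rfl).rTensor _ ∘ₗ higgsSquare L U h₁ :=
  (iota_thetaEnd L L' 1 h₁ h₂ x).trans ((congrArg (dForm L L' 1 U h₁ h₂) hx).trans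
    (dForm_higgsDefect L L' h₁ h₂ g))

theorem thetaEnd_higgsSquare_eq_zero {x : DRTerm E 2 U}
    (hx : iota L L 2 U h₁ h₁ x = higgsSquare L U h₁) : thetaEnd E 2 U x = 0 := by
  refine iota_injective L L 3 U h₁ h₁ ?_
  rw [map_zero]
  exact (iota_thetaEnd L L 2 h₁ h₁ x).trans ((congrArg (dForm L L 2 U h₁ h₁) hx).trans
    (dForm_higgsSquare L h₁))

end Represented

section TotalComplex

variable {P : Thickening.{u}} [SemiSeparated P.pair.Y] {E : GradedField P.red ⊤} {𝔘 : Cover P}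

/-- The restriction of the component of `z` with index `s ∘ m`. -/
abbrev faceRes {n : ℕ} (z : Cochain E 𝔘 n) {p r : ℕ} (q : ℕ) (h : p + q = n)
    (s : Fin (r + 1) → P.pair.Y) (m : Fin (p + 1) → Fin (r + 1)) : DRTerm E q (𝔘.inter s) :=
  DRTerm.res E q (𝔘.inter_le_inter s m) (z ⟨(p, q), h⟩ fun t => s (m t))

theorem totalD_zero_one_zero (z : Cochain E 𝔘 0) (s : Fin 2 → P.pair.Y) :
    totalD E 𝔘 0 z ⟨(1, 0), rfl⟩ s = faceRes z (p := 0) 0 rfl s (Fin.succAbove 0) -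
      faceRes z (p := 0) 0 rfl s (Fin.succAbove 1) := by
  refine (add_zero _).trans ((Fin.sum_univ_two _).trans ?_)
  simp only [Fin.val_zero, pow_zero, one_smul, Fin.val_one, pow_one, neg_smul]
  exact (sub_eq_add_neg _ _).symm

theorem totalD_zero_zero_one (z : Cochain E 𝔘 0) (s : Fin 1 → P.pair.Y) :
    totalD E 𝔘 0 z ⟨(0, 1), rfl⟩ s = thetaEnd E 0 (𝔘.inter s) (z ⟨(0, 0), rfl⟩ s) := by
  refine (zero_add _).trans ?_
  simp only [higgsPart, pow_zero, one_smul]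

theorem totalD_one_two_zero (z : Cochain E 𝔘 1) (s : Fin 3 → P.pair.Y) :
    totalD E 𝔘 1 z ⟨(2, 0), rfl⟩ s = faceRes z (p := 1) 0 rfl s (Fin.succAbove 0) -
      faceRes z (p := 1) 0 rfl s (Fin.succAbove 1) +
      faceRes z (p := 1) 0 rfl s (Fin.succAbove 2) := by
  refine (add_zero _).trans ((Fin.sum_univ_three _).trans ?_)
  simp only [Fin.val_zero, pow_zero, one_smul, Fin.val_one, pow_one, neg_smul, Fin.val_two,
    even_two, Even.neg_pow, one_pow]
  exact congrArg (· + _) (sub_eq_add_neg _ _).symm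

theorem totalD_one_one_one (z : Cochain E 𝔘 1) (s : Fin 2 → P.pair.Y) :
    totalD E 𝔘 1 z ⟨(1, 1), rfl⟩ s = faceRes z (p := 0) 1 rfl s (Fin.succAbove 0) -
      faceRes z (p := 0) 1 rfl s (Fin.succAbove 1) -
      thetaEnd E 0 (𝔘.inter s) (z ⟨(1, 0), rfl⟩ s) := by
  refine (congrArg (· + higgsPart z ⟨(1, 1), rfl⟩ s) (Fin.sum_univ_two _)).trans ?_
  simp only [higgsPart, Fin.val_zero, pow_zero, one_smul, Fin.val_one, pow_one, neg_smul]
  rw [sub_eq_add_neg, sub_eq_add_neg]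

theorem totalD_one_zero_two (z : Cochain E 𝔘 1) (s : Fin 1 → P.pair.Y) :
    totalD E 𝔘 1 z ⟨(0, 2), rfl⟩ s = thetaEnd E 1 (𝔘.inter s) (z ⟨(0, 1), rfl⟩ s) := by
  refine (zero_add _).trans ?_
  simp only [higgsPart, pow_zero, one_smul]

theorem totalD_two_three_zero (z : Cochain E 𝔘 2) (s : Fin 4 → P.pair.Y) :
    totalD E 𝔘 2 z ⟨(3, 0), rfl⟩ s = faceRes z (p := 2) 0 rfl s (Fin.succAbove 0) -
      faceRes z (p := 2) 0 rfl s (Fin.succAbove 1) +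
      faceRes z (p := 2) 0 rfl s (Fin.succAbove 2) -
      faceRes z (p := 2) 0 rfl s (Fin.succAbove 3) := by
  refine (add_zero _).trans ((Fin.sum_univ_four _).trans ?_)
  have h3 : ((3 : Fin 4) : ℕ) = 3 := rfl
  simp only [h3, Fin.val_zero, pow_zero, one_smul, Fin.val_one, neg_smul, Fin.val_two, pow_succ,
    mul_neg, neg_neg, mul_one]
  rw [sub_eq_add_neg, sub_eq_add_neg]

theorem totalD_two_two_one (z : Cochain E 𝔘 2) (s : Fin 3 → P.pair.Y) :
    totalD E 𝔘 2 z ⟨(2, 1), rfl⟩ s = faceRes z (p := 1) 1 rfl s (Fin.succAbove 0) -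
      faceRes z (p := 1) 1 rfl s (Fin.succAbove 1) +
      faceRes z (p := 1) 1 rfl s (Fin.succAbove 2) +
      thetaEnd E 0 (𝔘.inter s) (z ⟨(2, 0), rfl⟩ s) := by
  refine (congrArg (· + higgsPart z ⟨(2, 1), rfl⟩ s) (Fin.sum_univ_three _)).trans ?_
  simp only [higgsPart, Fin.val_zero, pow_zero, one_smul, Fin.val_one, pow_one, neg_smul,
    Fin.val_two, even_two, Even.neg_pow, one_pow]
  rw [sub_eq_add_neg]

theorem totalD_two_one_two (z : Cochain E 𝔘 2) (s : Fin 2 → P.pair.Y) :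
    totalD E 𝔘 2 z ⟨(1, 2), rfl⟩ s = faceRes z (p := 0) 2 rfl s (Fin.succAbove 0) -
      faceRes z (p := 0) 2 rfl s (Fin.succAbove 1) -
      thetaEnd E 1 (𝔘.inter s) (z ⟨(1, 1), rfl⟩ s) := by
  refine (congrArg (· + higgsPart z ⟨(1, 2), rfl⟩ s) (Fin.sum_univ_two _)).trans ?_
  simp only [higgsPart, Fin.val_zero, pow_zero, one_smul, Fin.val_one, pow_one, neg_smul]
  rw [sub_eq_add_neg, sub_eq_add_neg]

theorem totalD_two_zero_three (z : Cochain E 𝔘 2) (s : Fin 1 → P.pair.Y) :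
    totalD E 𝔘 2 z ⟨(0, 3), rfl⟩ s = thetaEnd E 2 (𝔘.inter s) (z ⟨(0, 2), rfl⟩ s) := by
  refine (zero_add _).trans ?_
  simp only [higgsPart, pow_zero, one_smul]

theorem Cochain.ext_zero {z w : Cochain E 𝔘 0} (h : ∀ s, z ⟨(0, 0), rfl⟩ s = w ⟨(0, 0), rfl⟩ s) :
    z = w := by
  funext ⟨⟨p, q⟩, e⟩ s
  obtain ⟨rfl, rfl⟩ : p = 0 ∧ q = 0 := by simp only at e; omega
  exact h s

theorem Cochain.ext_one {z w : Cochain E 𝔘 1} (h₁ : ∀ s, z ⟨(1, 0), rfl⟩ s = w ⟨(1, 0), rfl⟩ s)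
    (h₂ : ∀ s, z ⟨(0, 1), rfl⟩ s = w ⟨(0, 1), rfl⟩ s) : z = w := by
  funext ⟨⟨p, q⟩, e⟩ s
  obtain ⟨rfl, rfl⟩ | ⟨rfl, rfl⟩ : (p = 1 ∧ q = 0) ∨ (p = 0 ∧ q = 1) := by simp only at e; omega
  exacts [h₁ s, h₂ s]

theorem Cochain.ext_two {z w : Cochain E 𝔘 2} (h₁ : ∀ s, z ⟨(2, 0), rfl⟩ s = w ⟨(2, 0), rfl⟩ s)
    (h₂ : ∀ s, z ⟨(1, 1), rfl⟩ s = w ⟨(1, 1), rfl⟩ s)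
    (h₃ : ∀ s, z ⟨(0, 2), rfl⟩ s = w ⟨(0, 2), rfl⟩ s) : z = w := by
  funext ⟨⟨p, q⟩, e⟩ s
  obtain ⟨rfl, rfl⟩ | ⟨rfl, rfl⟩ | ⟨rfl, rfl⟩ :
      (p = 2 ∧ q = 0) ∨ (p = 1 ∧ q = 1) ∨ (p = 0 ∧ q = 2) := by simp only at e; omega
  exacts [h₁ s, h₂ s, h₃ s]

theorem Cochain.ext_three {z w : Cochain E 𝔘 3}
    (h₁ : ∀ s, z ⟨(3, 0), rfl⟩ s = w ⟨(3, 0), rfl⟩ s)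
    (h₂ : ∀ s, z ⟨(2, 1), rfl⟩ s = w ⟨(2, 1), rfl⟩ s)
    (h₃ : ∀ s, z ⟨(1, 2), rfl⟩ s = w ⟨(1, 2), rfl⟩ s)
    (h₄ : ∀ s, z ⟨(0, 3), rfl⟩ s = w ⟨(0, 3), rfl⟩ s) : z = w := by
  funext ⟨⟨p, q⟩, e⟩ s
  obtain ⟨rfl, rfl⟩ | ⟨rfl, rfl⟩ | ⟨rfl, rfl⟩ | ⟨rfl, rfl⟩ : (p = 3 ∧ q = 0) ∨
      (p = 2 ∧ q = 1) ∨ (p = 1 ∧ q = 2) ∨ (p = 0 ∧ q = 3) := by simp only at e; omega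
  exacts [h₁ s, h₂ s, h₃ s, h₄ s]

/-- The cochain of degree `1` with given components. -/
def Cochain.one (a : ∀ s : Fin 2 → P.pair.Y, DRTerm E 0 (𝔘.inter s))
    (b : ∀ s : Fin 1 → P.pair.Y, DRTerm E 1 (𝔘.inter s)) : Cochain E 𝔘 1
  | ⟨(1, 0), _⟩, s => a s
  | ⟨(0, 1), _⟩, s => b s
  | ⟨(0, 0), h⟩, _ => absurd h (by decide)
  | ⟨(0, _ + 2), h⟩, _ => absurd h (by simp only; omega)
  | ⟨(1, _ + 1), h⟩, _ => absurd h (by simp only; omega)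
  | ⟨(_ + 2, _), h⟩, _ => absurd h (by simp only; omega)

/-- The cochain of degree `2` with given components. -/
def Cochain.two (a : ∀ s : Fin 3 → P.pair.Y, DRTerm E 0 (𝔘.inter s))
    (b : ∀ s : Fin 2 → P.pair.Y, DRTerm E 1 (𝔘.inter s))
    (c : ∀ s : Fin 1 → P.pair.Y, DRTerm E 2 (𝔘.inter s)) : Cochain E 𝔘 2
  | ⟨(2, 0), _⟩, s => a s
  | ⟨(1, 1), _⟩, s => b s
  | ⟨(0, 2), _⟩, s => c s
  | ⟨(0, 0), h⟩, _ => absurd h (by decide)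
  | ⟨(0, 1), h⟩, _ => absurd h (by decide)
  | ⟨(0, _ + 3), h⟩, _ => absurd h (by simp only; omega)
  | ⟨(1, 0), h⟩, _ => absurd h (by decide)
  | ⟨(1, _ + 2), h⟩, _ => absurd h (by simp only; omega)
  | ⟨(2, _ + 1), h⟩, _ => absurd h (by simp only; omega)
  | ⟨(_ + 3, _), h⟩, _ => absurd h (by simp only; omega)

end TotalComplex



theorem ReducesToId.comp {P : Thickening.{u}} {E : GradedField P.red ⊤}
    {U₁ U₂ U₃ : P.pair.Y.Opens} {L : LiftData E U₁} {L' : LiftData E U₂}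
    {L'' : LiftData E U₃} {U : P.pair.Y.Opens} {h₁ : U ≤ U₁} {h₂ : U ≤ U₂} {h₃ : U ≤ U₃}
    {f : HomSec L.M L'.M U} {g : HomSec L'.M L''.M U} (hg : ReducesToId L' L'' h₂ h₃ g)
    (hf : ReducesToId L L' h₁ h₂ f) : ReducesToId L L'' h₁ h₃ (g.comp f) :=
  fun V h e => (hg V h _).trans (hf V h e)

section CocycleIdentities

variable {P : Thickening.{u}} {E : GradedField P.red ⊤} {V₀ V₁ V₂ V₃ V₀' V₁' V₂' : P.pair.Y.Opens}
  {L₀ : LiftData E V₀} {L₁ : LiftData E V₁} {L₂ : LiftData E V₂} {L₃ : LiftData E V₃}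
  {L₀' : LiftData E V₀'} {L₁' : LiftData E V₁'} {L₂' : LiftData E V₂'} {U : AOpen P.pair}
  (h₀ : U.U ≤ V₀) (h₁ : U.U ≤ V₁) (h₂ : U.U ≤ V₂) (h₃ : U.U ≤ V₃)
  (h₀' : U.U ≤ V₀') (h₁' : U.U ≤ V₁') (h₂' : U.U ≤ V₂')

theorem add_sub_eq_zero_of_iota {f₀₁ : HomSec L₀.M L₁.M U.U} {f₀₂ : HomSec L₀.M L₂.M U.U}
    {f₀₃ : HomSec L₀.M L₃.M U.U} {f₁₂ : HomSec L₁.M L₂.M U.U} {f₁₃ : HomSec L₁.M L₃.M U.U}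
    {f₂₃ : HomSec L₂.M L₃.M U.U} (h01 : ReducesToId L₀ L₁ h₀ h₁ f₀₁)
    (h23 : ReducesToId L₂ L₃ h₂ h₃ f₂₃) {x₀ x₁ x₂ x₃ : DRTerm E 0 U}
    (e₀ : iota L₁ L₃ 0 U h₁ h₃ x₀ = toForm₀ (-(f₂₃.comp f₁₂ - f₁₃)))
    (e₁ : iota L₀ L₃ 0 U h₀ h₃ x₁ = toForm₀ (-(f₂₃.comp f₀₂ - f₀₃)))
    (e₂ : iota L₀ L₃ 0 U h₀ h₃ x₂ = toForm₀ (-(f₁₃.comp f₀₁ - f₀₃)))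
    (e₃ : iota L₀ L₂ 0 U h₀ h₂ x₃ = toForm₀ (-(f₁₂.comp f₀₁ - f₀₂))) :
    x₀ - x₁ + x₂ - x₃ = 0 := by
  refine iota_injective L₀ L₃ 0 U h₀ h₃ ?_
  rw [map_sub, map_add, map_sub, e₁, e₂, iota_comp_toForm₀ h₀ h₁ h₃ h01 e₀,
    iota_toForm₀_comp h₀ h₂ h₃ h23 e₃, ← toForm₀_sub, ← toForm₀_add, ← toForm₀_sub]
  refine Eq.trans (congrArg toForm₀ ?_) (toForm₀_zero.trans (map_zero _).symm)
  refine HomSec.ext' fun V h e => ?_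
  simp only [HomSec.comp, HomSec.sub_app, HomSec.neg_app, HomSec.add_app, LinearMap.sub_apply,
    LinearMap.neg_apply, LinearMap.add_apply, LinearMap.comp_apply, map_sub, map_neg,
    HomSec.zero_app, LinearMap.zero_apply]
  abel

theorem add_thetaEnd_eq_zero_of_iota {f₀₁ : HomSec L₀.M L₁.M U.U} {f₀₂ : HomSec L₀.M L₂.M U.U}
    {f₁₂ : HomSec L₁.M L₂.M U.U} (h01 : ReducesToId L₀ L₁ h₀ h₁ f₀₁)
    (h12 : ReducesToId L₁ L₂ h₁ h₂ f₁₂) {x₀ x₁ x₂ : DRTerm E 1 U} {y : DRTerm E 0 U}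
    (e₀ : iota L₁ L₂ 1 U h₁ h₂ x₀ = higgsDefect L₁ L₂ U h₁ h₂ f₁₂)
    (e₁ : iota L₀ L₂ 1 U h₀ h₂ x₁ = higgsDefect L₀ L₂ U h₀ h₂ f₀₂)
    (e₂ : iota L₀ L₁ 1 U h₀ h₁ x₂ = higgsDefect L₀ L₁ U h₀ h₁ f₀₁)
    (ey : iota L₀ L₂ 0 U h₀ h₂ y = toForm₀ (-(f₁₂.comp f₀₁ - f₀₂))) :
    x₀ - x₁ + x₂ + thetaEnd E 0 U y = 0 := by
  have h4 := iota_comp L₀ L₁ L₂ 1 h₀ h₁ h₂ (h01 U.U le_rfl) x₀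
  have h5 := rTensor_iota L₀ L₁ L₂ 1 h₀ h₁ h₂ (h12 U.U le_rfl) x₂
  rw [e₀] at h4
  rw [e₂] at h5
  refine iota_injective L₀ L₂ 1 U h₀ h₂ ?_
  rw [map_add, map_add, map_sub, e₁, iota_thetaEnd_toForm₀ h₀ h₂ ey, ← h4, ← h5, neg_sub,
    higgsDefect_sub, higgsDefect_comp L₀ L₁ L₂ h₀ h₁ h₂, map_zero]
  abel

theorem sub_thetaEnd_eq_zero_of_iota {f₀₁ : HomSec L₀.M L₁.M U.U}
    (h01 : ReducesToId L₀ L₁ h₀ h₁ f₀₁) {x₀ x₁ : DRTerm E 2 U} {y : DRTerm E 1 U}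
    (e₀ : iota L₁ L₁ 2 U h₁ h₁ x₀ = higgsSquare L₁ U h₁)
    (e₁ : iota L₀ L₀ 2 U h₀ h₀ x₁ = higgsSquare L₀ U h₀)
    (ey : iota L₀ L₁ 1 U h₀ h₁ y = higgsDefect L₀ L₁ U h₀ h₁ f₀₁) :
    x₀ - x₁ - thetaEnd E 1 U y = 0 := by
  have h4 := iota_comp L₀ L₁ L₁ 2 h₀ h₁ h₁ (h01 U.U le_rfl) x₀
  have h5 := rTensor_iota L₀ L₀ L₁ 2 h₀ h₀ h₁ (h01 U.U le_rfl) x₁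
  rw [e₀] at h4
  rw [e₁] at h5
  refine iota_injective L₀ L₁ 2 U h₀ h₁ ?_
  rw [map_sub, map_sub, iota_thetaEnd_higgsDefect h₀ h₁ ey, ← h4, ← h5, sub_self, map_zero]

theorem eq_add_of_iota_comp {f₀₁ : HomSec L₀.M L₁.M U.U} {f₀₂ : HomSec L₀.M L₂.M U.U}
    {f₁₂ : HomSec L₁.M L₂.M U.U} {f₀₁' : HomSec L₀'.M L₁'.M U.U} {f₀₂' : HomSec L₀'.M L₂'.M U.U}
    {f₁₂' : HomSec L₁'.M L₂'.M U.U} {g₀ : HomSec L₀.M L₀'.M U.U} {g₁ : HomSec L₁.M L₁'.M U.U}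
    {g₂ : HomSec L₂.M L₂'.M U.U} (hg₀ : ReducesToId L₀ L₀' h₀ h₀' g₀)
    (hg₂ : ReducesToId L₂ L₂' h₂ h₂' g₂) (h01 : ReducesToId L₀ L₁ h₀ h₁ f₀₁)
    (h12' : ReducesToId L₁' L₂' h₁' h₂' f₁₂') {x x' y₀ y₁ y₂ : DRTerm E 0 U}
    (e : iota L₀ L₂ 0 U h₀ h₂ x = toForm₀ (-(f₁₂.comp f₀₁ - f₀₂)))
    (e' : iota L₀' L₂' 0 U h₀' h₂' x' = toForm₀ (-(f₁₂'.comp f₀₁' - f₀₂')))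
    (e₀ : iota L₁ L₂' 0 U h₁ h₂' y₀ = toForm₀ (g₂.comp f₁₂ - f₁₂'.comp g₁))
    (e₁ : iota L₀ L₂' 0 U h₀ h₂' y₁ = toForm₀ (g₂.comp f₀₂ - f₀₂'.comp g₀))
    (e₂ : iota L₀ L₁' 0 U h₀ h₁' y₂ = toForm₀ (g₁.comp f₀₁ - f₀₁'.comp g₀)) :
    x' = x + (y₀ - y₁ + y₂) := by
  refine iota_injective L₀ L₂' 0 U h₀ h₂' ?_
  rw [map_add, map_add, map_sub, e₁, iota_comp_toForm₀ h₀ h₀' h₂' hg₀ e',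
    iota_toForm₀_comp h₀ h₂ h₂' hg₂ e, iota_comp_toForm₀ h₀ h₁ h₂' h01 e₀,
    iota_toForm₀_comp h₀ h₁' h₂' h12' e₂, ← toForm₀_sub, ← toForm₀_add, ← toForm₀_add]
  refine congrArg toForm₀ (HomSec.ext' fun V h e => ?_)
  simp only [HomSec.comp, HomSec.sub_app, HomSec.neg_app, HomSec.add_app, LinearMap.sub_apply,
    LinearMap.neg_apply, LinearMap.add_apply, LinearMap.comp_apply, map_sub, map_neg]
  abel

theorem eq_add_of_iota_higgsDefect {f₀₁ : HomSec L₀.M L₁.M U.U} {f₀₁' : HomSec L₀'.M L₁'.M U.U}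
    {g₀ : HomSec L₀.M L₀'.M U.U} {g₁ : HomSec L₁.M L₁'.M U.U}
    (hg₀ : ReducesToId L₀ L₀' h₀ h₀' g₀) (hg₁ : ReducesToId L₁ L₁' h₁ h₁' g₁)
    (h01 : ReducesToId L₀ L₁ h₀ h₁ f₀₁) (h01' : ReducesToId L₀' L₁' h₀' h₁' f₀₁')
    {x x' y₀ y₁ : DRTerm E 1 U} {y : DRTerm E 0 U}
    (e : iota L₀ L₁ 1 U h₀ h₁ x = higgsDefect L₀ L₁ U h₀ h₁ f₀₁)
    (e' : iota L₀' L₁' 1 U h₀' h₁' x' = higgsDefect L₀' L₁' U h₀' h₁' f₀₁')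
    (e₀ : iota L₁ L₁' 1 U h₁ h₁' y₀ = higgsDefect L₁ L₁' U h₁ h₁' g₁)
    (e₁ : iota L₀ L₀' 1 U h₀ h₀' y₁ = higgsDefect L₀ L₀' U h₀ h₀' g₀)
    (ey : iota L₀ L₁' 0 U h₀ h₁' y = toForm₀ (g₁.comp f₀₁ - f₀₁'.comp g₀)) :
    x' = x + (y₀ - y₁ - thetaEnd E 0 U y) := by
  have k := rTensor_iota L₀ L₁ L₁' 1 h₀ h₁ h₁' (hg₁ U.U le_rfl) x
  have k' := iota_comp L₀ L₀' L₁' 1 h₀ h₀' h₁' (hg₀ U.U le_rfl) x'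
  have k₀ := iota_comp L₀ L₁ L₁' 1 h₀ h₁ h₁' (h01 U.U le_rfl) y₀
  have k₁ := rTensor_iota L₀ L₀' L₁' 1 h₀ h₀' h₁' (h01' U.U le_rfl) y₁
  rw [e] at k
  rw [e'] at k'
  rw [e₀] at k₀
  rw [e₁] at k₁
  refine iota_injective L₀ L₁' 1 U h₀ h₁' ?_
  rw [map_add, map_sub, map_sub, iota_thetaEnd_toForm₀ h₀ h₁' ey, ← k, ← k', ← k₀, ← k₁,
    higgsDefect_sub, higgsDefect_comp L₀ L₁ L₁' h₀ h₁ h₁', higgsDefect_comp L₀ L₀' L₁' h₀ h₀' h₁']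
  abel

theorem eq_add_of_iota_higgsSquare {g₀ : HomSec L₀.M L₀'.M U.U}
    (hg₀ : ReducesToId L₀ L₀' h₀ h₀' g₀) {x x' : DRTerm E 2 U} {y : DRTerm E 1 U}
    (e : iota L₀ L₀ 2 U h₀ h₀ x = higgsSquare L₀ U h₀)
    (e' : iota L₀' L₀' 2 U h₀' h₀' x' = higgsSquare L₀' U h₀')
    (ey : iota L₀ L₀' 1 U h₀ h₀' y = higgsDefect L₀ L₀' U h₀ h₀' g₀) :
    x' = x + thetaEnd E 1 U y := by
  have k := rTensor_iota L₀ L₀ L₀' 2 h₀ h₀ h₀' (hg₀ U.U le_rfl) x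
  have k' := iota_comp L₀ L₀' L₀' 2 h₀ h₀' h₀' (hg₀ U.U le_rfl) x'
  rw [e] at k
  rw [e'] at k'
  refine iota_injective L₀ L₀' 2 U h₀ h₀' ?_
  rw [map_add, iota_thetaEnd_higgsDefect h₀ h₀' ey, ← k, ← k', add_sub_cancel]

end CocycleIdentities

section GluingData

variable {P : Thickening.{u}} [SemiSeparated P.pair.Y] {E : GradedField P.red ⊤} {𝔘 𝔙 : Cover P}

/-- A system of local data for the lifting problem with respect to a given covering. -/
structure GluingData (E : GradedField P.red ⊤) (𝔘 : Cover P) where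
  lift : ∀ x, LiftData E (𝔘.U x).U
  f : ∀ x y, GrIso (lift x) (lift y) ((𝔘.U x).U ⊓ (𝔘.U y).U) inf_le_left inf_le_right

namespace GluingData

variable (𝔇 𝔇' : GluingData E 𝔘)

/-- The transition isomorphism between the lifts with indices `s a` and `s b`. -/
def hom {p : ℕ} (s : Fin (p + 1) → P.pair.Y) (a b : Fin (p + 1)) :
    HomSec (𝔇.lift (s a)).M (𝔇.lift (s b)).M (𝔘.inter s).U :=
  HomSec.res (le_inf (𝔘.inter_le s a) (𝔘.inter_le s b)) (𝔇.f (s a) (s b)).hom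

theorem hom_reduces {p : ℕ} (s : Fin (p + 1) → P.pair.Y) (a b : Fin (p + 1)) :
    ReducesToId (𝔇.lift (s a)) (𝔇.lift (s b)) (𝔘.inter_le s a) (𝔘.inter_le s b) (𝔇.hom s a b) :=
  fun V h => (𝔇.f (s a) (s b)).φ_hom V (h.trans
    (le_inf (c := (𝔘.inter s).U) (𝔘.inter_le s a) (𝔘.inter_le s b)))

theorem hom_mem {p : ℕ} (s : Fin (p + 1) → P.pair.Y) (a b : Fin (p + 1)) :
    𝔇.hom s a b ∈ HomGr (𝔇.lift (s a)).toGradedBundle (𝔇.lift (s b)).toGradedBundle 0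
      (𝔘.inter s).U :=
  fun m V h => (𝔇.f (s a) (s b)).hom_mem m V (h.trans
    (le_inf (c := (𝔘.inter s).U) (𝔘.inter_le s a) (𝔘.inter_le s b)))

/-- The cochain `z` is the obstruction cochain. -/
structure Represents (z : Cochain E 𝔘 2) : Prop where
  comp₂₀ : ∀ s : Fin 3 → P.pair.Y,
    iota (𝔇.lift (s 0)) (𝔇.lift (s 2)) 0 (𝔘.inter s) (𝔘.inter_le s 0) (𝔘.inter_le s 2)
      (z ⟨(2, 0), rfl⟩ s) = toForm₀ (-((𝔇.hom s 1 2).comp (𝔇.hom s 0 1) - 𝔇.hom s 0 2))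
  comp₁₁ : ∀ s : Fin 2 → P.pair.Y,
    iota (𝔇.lift (s 0)) (𝔇.lift (s 1)) 1 (𝔘.inter s) (𝔘.inter_le s 0) (𝔘.inter_le s 1)
      (z ⟨(1, 1), rfl⟩ s) = higgsDefect (𝔇.lift (s 0)) (𝔇.lift (s 1)) (𝔘.inter s)
        (𝔘.inter_le s 0) (𝔘.inter_le s 1) (𝔇.hom s 0 1)
  comp₀₂ : ∀ s : Fin 1 → P.pair.Y,
    iota (𝔇.lift (s 0)) (𝔇.lift (s 0)) 2 (𝔘.inter s) (𝔘.inter_le s 0) (𝔘.inter_le s 0)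
      (z ⟨(0, 2), rfl⟩ s) = higgsSquare (𝔇.lift (s 0)) (𝔘.inter s) (𝔘.inter_le s 0)

theorem exists_represents (hE : E.Integrable) : ∃ z, 𝔇.Represents z := by
  have h20 (s : Fin 3 → P.pair.Y) : ∃ x, iota (𝔇.lift (s 0)) (𝔇.lift (s 2)) 0 (𝔘.inter s)
      (𝔘.inter_le s 0) (𝔘.inter_le s 2) x =
        toForm₀ (-((𝔇.hom s 1 2).comp (𝔇.hom s 0 1) - 𝔇.hom s 0 2)) := by
    have hm : (𝔇.hom s 1 2).comp (𝔇.hom s 0 1) ∈ HomGr (𝔇.lift (s 0)).toGradedBundle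
        (𝔇.lift (s 2)).toGradedBundle 0 (𝔘.inter s).U := fun m V h e he => by
      have := 𝔇.hom_mem s 1 2 _ V h _ (𝔇.hom_mem s 0 1 m V h e he)
      rwa [add_zero] at this
    refine exists_iota_eq _ _ 0 _ _ _ (isGradedForm_toForm₀ _
      (neg_mem (sub_mem hm (𝔇.hom_mem s 0 2)))) fun e => ?_
    rw [neg_sub]
    exact φForm_toForm₀_sub (𝔘.inter_le s 0) (𝔘.inter_le s 2) (𝔇.hom_reduces s 0 2)
      (ReducesToId.comp (𝔇.hom_reduces s 1 2) (𝔇.hom_reduces s 0 1)) e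
  have h11 (s : Fin 2 → P.pair.Y) := exists_iota_eq (𝔇.lift (s 0)) (𝔇.lift (s 1)) 1
    (𝔘.inter_le s 0) (𝔘.inter_le s 1) _ (isGradedForm_higgsDefect (𝔘.inter_le s 0)
      (𝔘.inter_le s 1) (𝔇.hom_mem s 0 1)) fun e => φForm_higgsDefect (𝔘.inter_le s 0)
      (𝔘.inter_le s 1) (𝔇.hom_reduces s 0 1) e
  have h02 (s : Fin 1 → P.pair.Y) := exists_iota_eq (𝔇.lift (s 0)) (𝔇.lift (s 0)) 2
    (𝔘.inter_le s 0) (𝔘.inter_le s 0) _ (isGradedForm_higgsSquare (𝔘.inter_le s 0))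
      fun e => φForm_higgsSquare hE (𝔘.inter_le s 0) e
  choose a ha using h20
  choose b hb using h11
  choose c hc using h02
  exact ⟨Cochain.two a b c, ha, hb, hc⟩

variable {𝔇 𝔇'}

section Faces

variable {z : Cochain E 𝔘 2} (hz : 𝔇.Represents z) {r : ℕ} (s : Fin (r + 1) → P.pair.Y)

include hz

theorem Represents.face₂₀ (m : Fin 3 → Fin (r + 1)) {i j k : Fin (r + 1)} (hi : m 0 = i)
    (hj : m 1 = j) (hk : m 2 = k) :
    iota (𝔇.lift (s i)) (𝔇.lift (s k)) 0 (𝔘.inter s) (𝔘.inter_le s i) (𝔘.inter_le s k)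
      (faceRes z (p := 2) 0 rfl s m) =
      toForm₀ (-((𝔇.hom s j k).comp (𝔇.hom s i j) - 𝔇.hom s i k)) := by
  subst hi hj hk
  exact iota_res_toForm₀ _ _ (𝔘.inter_le_inter s m) (hz.comp₂₀ fun t => s (m t))

theorem Represents.face₁₁ (m : Fin 2 → Fin (r + 1)) {i j : Fin (r + 1)} (hi : m 0 = i)
    (hj : m 1 = j) :
    iota (𝔇.lift (s i)) (𝔇.lift (s j)) 1 (𝔘.inter s) (𝔘.inter_le s i) (𝔘.inter_le s j)
      (faceRes z (p := 1) 1 rfl s m) =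
      higgsDefect (𝔇.lift (s i)) (𝔇.lift (s j)) (𝔘.inter s) (𝔘.inter_le s i) (𝔘.inter_le s j)
        (𝔇.hom s i j) := by
  subst hi hj
  exact iota_res_higgsDefect _ _ (𝔘.inter_le_inter s m) (hz.comp₁₁ fun t => s (m t))

theorem Represents.face₀₂ (m : Fin 1 → Fin (r + 1)) {i : Fin (r + 1)} (hi : m 0 = i) :
    iota (𝔇.lift (s i)) (𝔇.lift (s i)) 2 (𝔘.inter s) (𝔘.inter_le s i) (𝔘.inter_le s i)
      (faceRes z (p := 0) 2 rfl s m) =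
      higgsSquare (𝔇.lift (s i)) (𝔘.inter s) (𝔘.inter_le s i) := by
  subst hi
  exact iota_res_higgsSquare _ (𝔘.inter_le_inter s m) (hz.comp₀₂ fun t => s (m t))

end Faces

theorem Represents.mem_cocycles {z : Cochain E 𝔘 2} (hz : 𝔇.Represents z) : z ∈ cocycles E 𝔘 2 := by
  refine Cochain.ext_three (w := 0) (fun s => ?_) (fun s => ?_) (fun s => ?_) (fun s => ?_)
  · exact (totalD_two_three_zero z s).trans (add_sub_eq_zero_of_iota (L₀ := 𝔇.lift (s 0))
      (L₁ := 𝔇.lift (s 1)) (L₂ := 𝔇.lift (s 2)) (L₃ := 𝔇.lift (s 3)) (𝔘.inter_le s 0)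
      (𝔘.inter_le s 1) (𝔘.inter_le s 2) (𝔘.inter_le s 3) (𝔇.hom_reduces s 0 1)
      (𝔇.hom_reduces s 2 3) (hz.face₂₀ s _ rfl rfl rfl) (hz.face₂₀ s _ rfl rfl rfl)
      (hz.face₂₀ s _ rfl rfl rfl) (hz.face₂₀ s _ rfl rfl rfl))
  · exact (totalD_two_two_one z s).trans (add_thetaEnd_eq_zero_of_iota (L₀ := 𝔇.lift (s 0))
      (L₁ := 𝔇.lift (s 1)) (L₂ := 𝔇.lift (s 2)) (𝔘.inter_le s 0) (𝔘.inter_le s 1)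
      (𝔘.inter_le s 2) (𝔇.hom_reduces s 0 1) (𝔇.hom_reduces s 1 2) (hz.face₁₁ s _ rfl rfl)
      (hz.face₁₁ s _ rfl rfl) (hz.face₁₁ s _ rfl rfl) (hz.comp₂₀ s))
  · exact (totalD_two_one_two z s).trans (sub_thetaEnd_eq_zero_of_iota (L₀ := 𝔇.lift (s 0))
      (L₁ := 𝔇.lift (s 1)) (𝔘.inter_le s 0) (𝔘.inter_le s 1) (𝔇.hom_reduces s 0 1)
      (hz.face₀₂ s _ rfl) (hz.face₀₂ s _ rfl) (hz.comp₁₁ s))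
  · rw [totalD_two_zero_three]
    exact thetaEnd_higgsSquare_eq_zero (𝔘.inter_le s 0) (hz.comp₀₂ s)

/-- Isomorphisms between two systems of local data relate their obstruction cochains by a
coboundary. -/
theorem Represents.eq_add_totalD {z z' : Cochain E 𝔘 2} (hz : 𝔇.Represents z)
    (hz' : 𝔇'.Represents z')
    (g : ∀ x, GrIso (𝔇.lift x) (𝔇'.lift x) (𝔘.U x).U le_rfl le_rfl) {w : Cochain E 𝔘 1}
    (h10 : ∀ s : Fin 2 → P.pair.Y, iota (𝔇.lift (s 0)) (𝔇'.lift (s 1)) 0 (𝔘.inter s)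
      (𝔘.inter_le s 0) (𝔘.inter_le s 1) (w ⟨(1, 0), rfl⟩ s) =
      toForm₀ ((HomSec.res (𝔘.inter_le s 1) (g (s 1)).hom).comp (𝔇.hom s 0 1) -
        (𝔇'.hom s 0 1).comp (HomSec.res (𝔘.inter_le s 0) (g (s 0)).hom)))
    (h01 : ∀ s : Fin 1 → P.pair.Y, iota (𝔇.lift (s 0)) (𝔇'.lift (s 0)) 1 (𝔘.inter s)
      (𝔘.inter_le s 0) (𝔘.inter_le s 0) (w ⟨(0, 1), rfl⟩ s) =
      higgsDefect (𝔇.lift (s 0)) (𝔇'.lift (s 0)) (𝔘.inter s) (𝔘.inter_le s 0) (𝔘.inter_le s 0)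
        (HomSec.res (𝔘.inter_le s 0) (g (s 0)).hom)) :
    z' = z + totalD E 𝔘 1 w := by
  have hg {r : ℕ} (s : Fin (r + 1) → P.pair.Y) (i : Fin (r + 1)) :
      ReducesToId (𝔇.lift (s i)) (𝔇'.lift (s i)) (𝔘.inter_le s i) (𝔘.inter_le s i)
        (HomSec.res (𝔘.inter_le s i) (g (s i)).hom) :=
    fun V h => (g (s i)).φ_hom V (h.trans (𝔘.inter_le s i))
  have f10 {r : ℕ} (s : Fin (r + 1) → P.pair.Y) (m : Fin 2 → Fin (r + 1)) {i j : Fin (r + 1)}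
      (hi : m 0 = i) (hj : m 1 = j) : iota (𝔇.lift (s i)) (𝔇'.lift (s j)) 0 (𝔘.inter s)
      (𝔘.inter_le s i) (𝔘.inter_le s j) (faceRes w (p := 1) 0 rfl s m) =
      toForm₀ ((HomSec.res (𝔘.inter_le s j) (g (s j)).hom).comp (𝔇.hom s i j) -
        (𝔇'.hom s i j).comp (HomSec.res (𝔘.inter_le s i) (g (s i)).hom)) := by
    subst hi hj
    exact iota_res_toForm₀ _ _ (𝔘.inter_le_inter s m) (h10 fun t => s (m t))
  have f01 {r : ℕ} (s : Fin (r + 1) → P.pair.Y) (m : Fin 1 → Fin (r + 1)) {i : Fin (r + 1)}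
      (hi : m 0 = i) : iota (𝔇.lift (s i)) (𝔇'.lift (s i)) 1 (𝔘.inter s)
      (𝔘.inter_le s i) (𝔘.inter_le s i) (faceRes w (p := 0) 1 rfl s m) =
      higgsDefect (𝔇.lift (s i)) (𝔇'.lift (s i)) (𝔘.inter s) (𝔘.inter_le s i) (𝔘.inter_le s i)
        (HomSec.res (𝔘.inter_le s i) (g (s i)).hom) := by
    subst hi
    exact iota_res_higgsDefect _ _ (𝔘.inter_le_inter s m) (h01 fun t => s (m t))
  refine Cochain.ext_two (fun s => ?_) (fun s => ?_) (fun s => ?_)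
  · exact (eq_add_of_iota_comp (L₀ := 𝔇.lift (s 0)) (L₁ := 𝔇.lift (s 1)) (L₂ := 𝔇.lift (s 2))
      (L₀' := 𝔇'.lift (s 0)) (L₁' := 𝔇'.lift (s 1)) (L₂' := 𝔇'.lift (s 2)) (𝔘.inter_le s 0)
      (𝔘.inter_le s 1) (𝔘.inter_le s 2) (𝔘.inter_le s 0) (𝔘.inter_le s 1) (𝔘.inter_le s 2)
      (hg s 0) (hg s 2) (𝔇.hom_reduces s 0 1) (𝔇'.hom_reduces s 1 2) (hz.comp₂₀ s) (hz'.comp₂₀ s)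
      (f10 s _ rfl rfl) (f10 s _ rfl rfl) (f10 s _ rfl rfl)).trans
        (congrArg (_ + ·) (totalD_one_two_zero w s).symm)
  · exact (eq_add_of_iota_higgsDefect (L₀ := 𝔇.lift (s 0)) (L₁ := 𝔇.lift (s 1))
      (L₀' := 𝔇'.lift (s 0)) (L₁' := 𝔇'.lift (s 1)) (𝔘.inter_le s 0) (𝔘.inter_le s 1)
      (𝔘.inter_le s 0) (𝔘.inter_le s 1) (hg s 0) (hg s 1) (𝔇.hom_reduces s 0 1)
      (𝔇'.hom_reduces s 0 1) (hz.comp₁₁ s) (hz'.comp₁₁ s) (f01 s _ rfl) (f01 s _ rfl)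
      (h10 s)).trans (congrArg (_ + ·) (totalD_one_one_one w s).symm)
  · exact (eq_add_of_iota_higgsSquare (L₀ := 𝔇.lift (s 0)) (L₀' := 𝔇'.lift (s 0))
      (𝔘.inter_le s 0) (𝔘.inter_le s 0) (hg s 0) (hz.comp₀₂ s) (hz'.comp₀₂ s) (h01 s)).trans
        (congrArg (_ + ·) (totalD_one_zero_two w s).symm)

end GluingData

end GluingData



section GradedLinear

variable {Y : Scheme.{u}} {U₁ U₂ : Y.Opens} (E : GradedBundle Y U₁) (E' : GradedBundle Y U₂)

theorem GradedBundle.hom_ext {N : Y.Modules} {U : Y.Opens} (hU : IsAffineOpen U) (h₁ : U ≤ U₁)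
    {f g : HomSec E.M N U} (h : f.app U le_rfl = g.app U le_rfl) : f = g := by
  obtain ⟨D⟩ := E.nonempty_dualBasis hU h₁
  refine HomSec.ext' fun V hV e => ?_
  rw [← D.sum_eq V hV e, map_sum, map_sum]
  refine Finset.sum_congr rfl fun k _ => ?_
  rw [map_smul, map_smul, ← f.naturality U V le_rfl hV, ← g.naturality U V le_rfl hV, h]

theorem GradedBundle.exists_homSec_eq {U : Y.Opens} (hU : IsAffineOpen U) (h₁ : U ≤ U₁)
    (h₂ : U ≤ U₂) (ℓ : ℤ) (F : Γ(E.M, U) →ₗ[Γ(Y, U)] Γ(E'.M, U))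
    (hF : ∀ m, ∀ e ∈ E.Gr m U, F e ∈ E'.Gr (m + ℓ) U) :
    ∃ g ∈ HomGr E E' ℓ U, g.app U le_rfl = F := by
  obtain ⟨D⟩ := E.nonempty_dualBasis hU h₁
  refine ⟨∑ k, (D.f k).smulRight (F (D.e k)), Submodule.sum_mem _ fun k _ m V h e he => ?_,
    LinearMap.ext fun e => ?_⟩
  · rw [Functional.smulRight_app]
    by_cases hm : m = D.deg k
    · rw [hm]
      exact Submodule.smul_mem _ _ (E'.res_mem _ _ _ _ h₂ _ (hF _ _ (D.e_mem k)))
    · rw [D.f_of_ne k m hm V h e he, zero_smul]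
      exact zero_mem _
  · conv_rhs => rw [← D.sum_eq U le_rfl e, map_sum]
    rw [HomSec.sum_app]
    refine Finset.sum_congr rfl fun k _ => ?_
    rw [Functional.smulRight_app, mres_self, map_smul, mres_self]

end GradedLinear

section Isomorphisms

variable {P : Thickening.{u}} {E : GradedField P.red ⊤} {U₁ U₂ U₃ : P.pair.Y.Opens}
  (L : LiftData E U₁) (L' : LiftData E U₂) (L'' : LiftData E U₃)

/-- The composite of two homomorphisms that vanish on `X` vanishes. -/
theorem comp_eq_zero_of_φ_eq_zero (U : AOpen P.pair) (h₁ : U.U ≤ U₁)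
    (h₂ : U.U ≤ U₂) (h₃ : U.U ≤ U₃) {f : HomSec L.M L'.M U.U} {g : HomSec L'.M L''.M U.U}
    (hf : ∀ e, L'.φ U.U h₂ (f.app U.U le_rfl e) = 0) (hg : ∀ e, L''.φ U.U h₃ (g.app U.U le_rfl e) = 0) :
    g.comp f = 0 := by
  refine L.toGradedBundle.hom_ext U.isAffine h₁ (LinearMap.ext fun e => ?_)
  change g.app U.U le_rfl (f.app U.U le_rfl e) = 0
  refine Submodule.smul_induction_on (L'.mem_ker_smul_of_φ_eq_zero U.isAffine h₂ (hf e))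
    (fun r hr y _ => ?_) fun y z hy hz => by rw [map_add, hy, hz, add_zero]
  rw [map_smul]
  refine Submodule.smul_induction_on (L''.mem_ker_smul_of_φ_eq_zero U.isAffine h₃ (hg y))
    (fun s hs z _ => ?_) fun y z hy hz => by rw [smul_add, hy, hz, add_zero]
  rw [smul_smul, Thickening.ker_mul_ker U hr hs, zero_smul]

variable {L L'}

theorem ReducesToId.φ_sub_id {U : P.pair.Y.Opens} {h₁ : U ≤ U₁} {f : HomSec L.M L.M U}
    (hf : ReducesToId L L h₁ h₁ f) (e : Γ(L.M, U)) :
    L.φ U h₁ ((f - HomSec.id L.M U).app U le_rfl e) = 0 := by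
  rw [HomSec.sub_app, LinearMap.sub_apply, map_sub, hf U le_rfl e, sub_eq_zero]
  rfl

theorem id_mem_homGr (U : P.pair.Y.Opens) :
    HomSec.id L.M U ∈ HomGr L.toGradedBundle L.toGradedBundle 0 U :=
  fun m V h e he => by rwa [add_zero]

theorem comp_mem_homGr {U : P.pair.Y.Opens} {f : HomSec L.M L'.M U} {g : HomSec L'.M L''.M U}
    (hg : g ∈ HomGr L'.toGradedBundle L''.toGradedBundle 0 U)
    (hf : f ∈ HomGr L.toGradedBundle L'.toGradedBundle 0 U) :
    g.comp f ∈ HomGr L.toGradedBundle L''.toGradedBundle 0 U := fun m V h e he => by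
  have := hg _ V h _ (hf m V h e he)
  rwa [add_zero] at this

/-- An endomorphism that reduces to the identity is invertible. -/
theorem exists_inv_of_reducesToId (U : AOpen P.pair) (h₁ : U.U ≤ U₁)
    {f : HomSec L.M L.M U.U} (hf : ReducesToId L L h₁ h₁ f)
    (hm : f ∈ HomGr L.toGradedBundle L.toGradedBundle 0 U.U) :
    ∃ g ∈ HomGr L.toGradedBundle L.toGradedBundle 0 U.U,
      f.comp g = HomSec.id L.M U.U ∧ g.comp f = HomSec.id L.M U.U := by
  have h0 := comp_eq_zero_of_φ_eq_zero L L L U h₁ h₁ h₁ hf.φ_sub_id hf.φ_sub_id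
  refine ⟨HomSec.id L.M U.U + HomSec.id L.M U.U - f,
    sub_mem (add_mem (id_mem_homGr U.U) (id_mem_homGr U.U)) hm, ?_, ?_⟩ <;>
  · refine HomSec.ext' fun V h e => ?_
    have h2 := congrArg (fun u : HomSec L.M L.M U.U => u.app V h e) h0
    simp only [HomSec.comp, HomSec.sub_app, HomSec.add_app, HomSec.id, LinearMap.comp_apply,
      LinearMap.sub_apply, LinearMap.add_apply, LinearMap.id_apply, map_sub, map_add,
      HomSec.zero_app, LinearMap.zero_apply] at h2 ⊢
    rw [← sub_eq_zero, ← neg_eq_zero, ← h2]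
    abel

/-- A homomorphism of graded bundles over an affine open set is an isomorphism if it reduces to the
identity. -/
theorem exists_grIso (U : AOpen P.pair) (h₁ : U.U ≤ U₁) (h₂ : U.U ≤ U₂)
    {f : HomSec L.M L'.M U.U} (hf : ReducesToId L L' h₁ h₂ f)
    (hm : f ∈ HomGr L.toGradedBundle L'.toGradedBundle 0 U.U) :
    ∃ g : GrIso L L' U.U h₁ h₂, g.hom = f := by
  obtain ⟨f', hm', hf'⟩ := exists_homSec_lift L' L 0 U.isAffine h₂ h₁
    ⟨HomSec.id E.M (P.inv U.U), fun m V h e he => by rwa [add_zero]⟩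
  have hr' : ReducesToId L' L h₂ h₁ f' := hf'
  obtain ⟨g, hg, -, hgf⟩ := exists_inv_of_reducesToId U h₁ (hr'.comp hf)
    (comp_mem_homGr L hm' hm)
  obtain ⟨g', -, hfg', -⟩ := exists_inv_of_reducesToId U h₂ (hf.comp hr')
    (comp_mem_homGr L' hm hm')
  have e1 (V h) (e : Γ(L.M, V)) : g.app V h (f'.app V h (f.app V h e)) = e :=
    congrArg (fun u : HomSec L.M L.M U.U => u.app V h e) hgf
  have e2 (V h) (e : Γ(L'.M, V)) : f.app V h (f'.app V h (g'.app V h e)) = e :=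
    congrArg (fun u : HomSec L'.M L'.M U.U => u.app V h e) hfg'
  have e3 : f.comp (g.comp f') = HomSec.id L'.M U.U := HomSec.ext' fun V h e => by
    change f.app V h (g.app V h (f'.app V h e)) = e
    have h3 := e1 V h (f'.app V h (g'.app V h e))
    rw [e2] at h3
    rw [h3, e2]
  exact ⟨{ hom := f
           inv := g.comp f'
           hom_inv := e3
           inv_hom := hgf
           hom_mem := hm
           inv_mem := comp_mem_homGr L hg hm'
           φ_hom := hf }, rfl⟩

variable (L L') in
/-- Lifts of `E` are isomorphic as graded bundles over affine open sets. -/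
theorem nonempty_grIso (U : AOpen P.pair) (h₁ : U.U ≤ U₁) (h₂ : U.U ≤ U₂) :
    Nonempty (GrIso L L' U.U h₁ h₂) := by
  obtain ⟨f, hm, hf⟩ := exists_homSec_lift L L' 0 U.isAffine h₁ h₂
    ⟨HomSec.id E.M (P.inv U.U), fun m V h e he => by rwa [add_zero]⟩
  obtain ⟨g, -⟩ := exists_grIso U h₁ h₂ hf hm
  exact ⟨g⟩

end Isomorphisms

section Perturbation

variable {P : Thickening.{u}} {E : GradedField P.red ⊤} {U₁ U₂ : P.pair.Y.Opens}
  {L : LiftData E U₁} {L' : LiftData E U₂} {U V : AOpen P.pair}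

/-- Forms of degree `0` are homomorphisms. -/
theorem exists_toForm₀_eq_iota (h₁ : U.U ≤ U₁) (h₂ : U.U ≤ U₂) (x : DRTerm E 0 U) :
    ∃ f ∈ HomGr L.toGradedBundle L'.toGradedBundle 0 U.U,
      (∀ (V : P.pair.Y.Opens) (h : V ≤ U.U) (e : Γ(L.M, V)),
        L'.φ V (h.trans h₂) (f.app V h e) = 0) ∧ iota L L' 0 U h₁ h₂ x = toForm₀ f := by
  let ρ : Γ(L'.M, U.U) ⊗[Γ(P.pair.Y, U.U)] OmExt 0 U ≃ₗ[Γ(P.pair.Y, U.U)] Γ(L'.M, U.U) :=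
    (exteriorPower.zeroEquiv Γ(P.pair.Y, U.U) (Om U)).lTensor _ ≪≫ₗ TensorProduct.rid _ _
  have hρ (m : Γ(L'.M, U.U)) : ρ.symm m = m ⊗ₜ zeroForm U := rfl
  have hp (p : Γ(L'.M, U.U) →ₗ[Γ(P.pair.Y, U.U)] Γ(L'.M, U.U)) (t) :
      ρ (p.rTensor (OmExt 0 U) t) = p (ρ t) := by
    obtain ⟨m, rfl⟩ := ρ.symm.surjective t
    rw [hρ, LinearMap.rTensor_tmul, ← hρ, ← hρ, LinearEquiv.apply_symm_apply,
      LinearEquiv.apply_symm_apply]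
  obtain ⟨f, hf, hfa⟩ := L.toGradedBundle.exists_homSec_eq L'.toGradedBundle U.isAffine h₁ h₂ 0
    (ρ.toLinearMap ∘ₗ iota L L' 0 U h₁ h₂ x) fun m e he => by
      have h3 := congrArg ρ (isGradedForm_iota L L' 0 h₁ h₂ x m e he)
      rw [hp] at h3
      have h4 := L'.proj_mem (m + -((0 : ℕ) : ℤ)) h₂ (ρ (iota L L' 0 U h₁ h₂ x e))
      rw [h3] at h4
      simpa using h4
  have hfx : iota L L' 0 U h₁ h₂ x = toForm₀ f := LinearMap.ext fun e => by
    change _ = f.app U.U le_rfl e ⊗ₜ zeroForm U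
    rw [hfa, ← hρ]
    exact (ρ.symm_apply_apply _).symm
  have h0 (e : Γ(L.M, U.U)) : L'.φ U.U h₂ (f.app U.U le_rfl e) = 0 := by
    have h3 := φForm_iota L L' 0 h₁ h₂ x e
    rw [hfx] at h3
    have h4 : L'.φ U.U h₂ (f.app U.U le_rfl e) ⊗ₜ[Γ(P.red.Y, U.pre.U)] zeroForm U.pre = 0 :=
      (congrArg (_ ⊗ₜ ·) (extMap_zeroEquiv (Om.red U)).symm).trans h3
    have h5 := congrArg ((exteriorPower.zeroEquiv Γ(P.red.Y, U.pre.U) (Om U.pre)).lTensor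
      Γ(E.M, U.pre.U) ≪≫ₗ TensorProduct.rid _ _) h4
    rw [map_zero] at h5
    refine Eq.trans ?_ h5
    rw [LinearEquiv.trans_apply, LinearEquiv.lTensor_tmul, zeroForm, LinearEquiv.apply_symm_apply,
      TensorProduct.rid_tmul, one_smul]
  refine ⟨f, hf, fun V h e => ?_, hfx⟩
  obtain ⟨D⟩ := L.toGradedBundle.nonempty_dualBasis U.isAffine h₁
  rw [← D.sum_eq V h e, map_sum, map_sum]
  refine Finset.sum_eq_zero fun k _ => ?_
  rw [map_smul, map_smulₛₗ, ← f.naturality U.U V le_rfl h, ← L'.φ_res U.U V h₂ h, h0, map_zero,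
    smul_zero]

end Perturbation



section PerturbField

variable {P : Thickening.{u}} {E : GradedField P.red ⊤} {U₁ U₂ : P.pair.Y.Opens}

theorem evalMap_res {P : LogPair.{u}} {U₀ : P.Y.Opens} (E : GradedBundle P.Y U₀) {U V : AOpen P}
    (h : U ≤ V) (t : EndGr E (-1) V.U ⊗[Γ(P.Y, V.U)] Om V) (e : Γ(E.M, V.U)) :
    evalMap (EndGr.toLin E (-1) U.U) (TensorProduct.map (EndGr.res E (-1) (U := U.U) (V := V.U) h)
        (Om.res h) t) (mres E.M (U := U.U) (V := V.U) h e) =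
      tres Om.res E.M h (evalMap (EndGr.toLin E (-1) V.U) t e) := by
  induction t using TensorProduct.induction_on with
  | zero => simp
  | add x y hx hy => simp only [map_add, LinearMap.add_apply, hx, hy]
  | tmul g η => exact congrArg (· ⊗ₜ _) (g.1.naturality V.U U.U le_rfl h e).symm

theorem map_res_map_res {P : LogPair.{u}} {U₀ : P.Y.Opens} (E : GradedBundle P.Y U₀)
    {U V W : AOpen P} (h : U ≤ V) (h' : V ≤ W) (t : EndGr E (-1) W.U ⊗[Γ(P.Y, W.U)] Om W) :
    TensorProduct.map (EndGr.res E (-1) (U := U.U) (V := V.U) h) (Om.res h)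
      (TensorProduct.map (EndGr.res E (-1) (U := V.U) (V := W.U) h') (Om.res h') t) =
      TensorProduct.map (EndGr.res E (-1) (U := U.U) (V := W.U) (h.trans h'))
        (Om.res (h.trans h')) t := by
  induction t using TensorProduct.induction_on with
  | zero => simp
  | add x y hx hy => simp only [map_add, hx, hy]
  | tmul g η => exact congrArg (_ ⊗ₜ ·) (Om.res_res h h' η)

theorem Om.res_self {P : LogPair.{u}} (hP : P.IsSmoothPair) {U : AOpen P} (w : Om U) :
    Om.res le_rfl w = w := by
  have hs : Function.Surjective (Om.res (le_refl U)) := fun w => by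
    have hw : w ∈ Submodule.span Γ(P.Y, U.U) (Set.range (Om.res (le_refl U))) := by
      rw [(isBC_omRes hP le_rfl).span_eq]; trivial
    induction hw using Submodule.span_induction with
    | mem x hx => exact hx
    | zero => exact ⟨0, map_zero _⟩
    | add x y _ _ hx hy =>
      obtain ⟨x, rfl⟩ := hx
      obtain ⟨y, rfl⟩ := hy
      exact ⟨x + y, map_add _ _ _⟩
    | smul r x _ hx =>
      obtain ⟨x, rfl⟩ := hx
      exact ⟨r • x, ((Om.res (le_refl U)).map_smulₛₗ r x).trans
        (congrArg (· • _) (rres_self (U := U.U) r))⟩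
  obtain ⟨v, rfl⟩ := hs w
  exact Om.res_res _ _ v

theorem map_res_self {P : Thickening.{u}} {U₀ : P.pair.Y.Opens} (E : GradedBundle P.pair.Y U₀)
    {U : AOpen P.pair} (t : EndGr E (-1) U.U ⊗[Γ(P.pair.Y, U.U)] Om U) :
    TensorProduct.map (EndGr.res E (-1) (le_refl U.U)) (Om.res (le_refl U)) t = t := by
  induction t using TensorProduct.induction_on with
  | zero => simp
  | add x y hx hy => simp only [map_add, hx, hy]
  | tmul g η => exact congrArg (_ ⊗ₜ ·) (Om.res_self P.smoothPair η)

theorem LiftData.map_φ_tres (L : LiftData E U₁) {U V : AOpen P.pair} (hV : V.U ≤ U₁) (h : U ≤ V)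
    (x : Γ(L.M, V.U) ⊗[Γ(P.pair.Y, V.U)] Om V) :
    TensorProduct.map (L.φ U.U (le_trans (b := V.U) h hV)) (Om.red U) (tres Om.res L.M h x) =
      tres Om.res E.M (AOpen.pre_mono h) (TensorProduct.map (L.φ V.U hV) (Om.red V) x) := by
  induction x using TensorProduct.induction_on with
  | zero => simp
  | add x y hx hy => simp only [map_add, hx, hy]
  | tmul m η => exact congrArg₂ (· ⊗ₜ ·) (L.φ_res V.U U.U hV h m).symm (Om.red_res h η)

variable (L : LiftData E U₁) {U : AOpen P.pair}

theorem exists_evalMap_eq_iota (hU : U.U ≤ U₁) (b : DRTerm E 1 U) :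
    ∃ t : EndGr L.toGradedBundle (-1) U.U ⊗[Γ(P.pair.Y, U.U)] Om U,
      (oneForm U).lTensor _ ∘ₗ evalMap (EndGr.toLin L.toGradedBundle (-1) U.U) t =
        iota L L 1 U hU hU b := by
  let ρ : Γ(L.M, U.U) ⊗[Γ(P.pair.Y, U.U)] Om U ≃ₗ[Γ(P.pair.Y, U.U)]
      Γ(L.M, U.U) ⊗[Γ(P.pair.Y, U.U)] OmExt 1 U :=
    (exteriorPower.oneEquiv Γ(P.pair.Y, U.U) (Om U)).symm.lTensor _
  have hρ (x) : ρ x = (oneForm U).lTensor _ x := rfl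
  obtain ⟨t, ht⟩ := L.toGradedBundle.exists_evalMap_eq U.isAffine hU (-1)
    (ρ.symm.toLinearMap ∘ₗ iota L L 1 U hU hU b) fun m e he => by
      refine ρ.injective ?_
      change ρ (_) = ρ (ρ.symm _)
      rw [hρ, ← rTensor_comm, ← hρ, LinearMap.comp_apply]
      change LinearMap.rTensor _ _ (ρ (ρ.symm _)) = _
      rw [LinearEquiv.apply_symm_apply]
      exact isGradedForm_iota L L 1 hU hU b m e he
  refine ⟨t, ?_⟩
  rw [ht]
  exact LinearMap.ext fun e => ρ.apply_symm_apply _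

/-- Addition of an infinitesimal term to the field of a local lift. -/
def LiftData.addField (hU : U.U ≤ U₁) (hU' : U₁ ≤ U.U)
    (t : EndGr L.toGradedBundle (-1) U.U ⊗[Γ(P.pair.Y, U.U)] Om U)
    (ht : ∀ e, TensorProduct.map (L.φ U.U hU) (Om.red U)
      (evalMap (EndGr.toLin L.toGradedBundle (-1) U.U) t e) = 0) : LiftData E U₁ :=
  { L with
    θ := fun V hV => L.θ V hV + TensorProduct.map (EndGr.res L.toGradedBundle (-1) (hV.trans hU'))
      (Om.res (show V ≤ U from hV.trans hU')) t
    θ_res := fun V W hV h => by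
      rw [map_add, L.θ_res]
      exact congrArg (_ + ·) (map_res_map_res L.toGradedBundle h (show V ≤ U from hV.trans hU') t)
    φ_θ := fun V hV e => by
      have hVU : V ≤ U := hV.trans hU'
      have h0 : TensorProduct.map (L.φ V.U hV) (Om.red V) (evalMap (EndGr.toLin L.toGradedBundle (-1)
          V.U) (TensorProduct.map (EndGr.res L.toGradedBundle (-1) (hV.trans hU'))
            (Om.res hVU) t) e) = 0 := by
        obtain ⟨D⟩ := L.toGradedBundle.nonempty_dualBasis U.isAffine hU
        rw [← D.sum_eq V.U hVU e, map_sum, map_sum]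
        refine Finset.sum_eq_zero fun k _ => ?_
        rw [map_smul, map_smulₛₗ]
        refine (congrArg (_ • ·) ?_).trans (smul_zero _)
        refine (congrArg _ (evalMap_res L.toGradedBundle hVU t _)).trans ?_
        exact (L.map_φ_tres hU hVU _).trans ((congrArg _ (ht _)).trans (map_zero _))
      refine Eq.trans ?_ (L.φ_θ V hV e)
      refine (congrArg (fun f => TensorProduct.map (L.φ V.U hV) (Om.red V) (f e))
        (map_add (evalMap (EndGr.toLin L.toGradedBundle (-1) V.U)) (L.θ V hV) _)).trans ?_
      exact (map_add (TensorProduct.map (L.φ V.U hV) (Om.red V)) _ _).trans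
        ((congrArg (_ + ·) h0).trans (add_zero _)) }

theorem exists_addField (hU : U.U ≤ U₁) (hU' : U₁ ≤ U.U) (b : DRTerm E 1 U) :
    ∃ (L' : LiftData E U₁) (g : GrIso L L' U₁ le_rfl le_rfl),
      iota L L' 1 U hU hU b = higgsDefect L L' U hU hU (HomSec.res hU g.hom) := by
  obtain ⟨t, ht⟩ := exists_evalMap_eq_iota L hU b
  have h0 (e) : TensorProduct.map (L.φ U.U hU) (Om.red U)
      (evalMap (EndGr.toLin L.toGradedBundle (-1) U.U) t e) = 0 := by
    have h1 := φForm_iota L L 1 hU hU b e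
    rw [← ht] at h1
    have h2 := (L.φForm_oneForm hU _).symm.trans h1
    exact ((exteriorPower.oneEquiv Γ(P.red.Y, U.pre.U) (Om U.pre)).symm.lTensor
      Γ(E.M, U.pre.U)).injective (h2.trans (map_zero _).symm)
  let L' := L.addField hU hU' t h0
  refine ⟨L', { hom := HomSec.id _ _
                inv := HomSec.id _ _
                hom_inv := rfl
                inv_hom := rfl
                hom_mem := id_mem_homGr (L := L) U₁
                inv_mem := id_mem_homGr (L := L) U₁
                φ_hom := fun _ _ _ => rfl }, ?_⟩
  refine (show iota L L' 1 U hU hU b = iota L L 1 U hU hU b from rfl).trans (ht.symm.trans ?_)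
  have hθ : evalMap (EndGr.toLin L.toGradedBundle (-1) U.U) (L'.θ U hU) =
      L.lin U hU + evalMap (EndGr.toLin L.toGradedBundle (-1) U.U) t := by
    refine (map_add (evalMap (EndGr.toLin L.toGradedBundle (-1) U.U)) (L.θ U hU) _).trans ?_
    exact congrArg (fun z => _ + evalMap (EndGr.toLin L.toGradedBundle (-1) U.U) z)
      (map_res_self L.toGradedBundle t)
  refine LinearMap.ext fun e => congrArg ((oneForm U).lTensor _) ?_
  let A : Γ(L.M, U.U) ⊗[Γ(P.pair.Y, U.U)] Om U := L'.lin U hU e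
  have h1 : A = L.lin U hU e + evalMap (EndGr.toLin L.toGradedBundle (-1) U.U) t e :=
    LinearMap.congr_fun hθ e
  have h2 : evalMap (EndGr.toLin L.toGradedBundle (-1) U.U) t e =
      A - LinearMap.id.rTensor (Om U) (L.lin U hU e) := by
    rw [h1, LinearMap.rTensor_id, LinearMap.id_apply, add_sub_cancel_left]
  exact h2

end PerturbField

section Perturb

variable {P : Thickening.{u}} [SemiSeparated P.pair.Y] {E : GradedField P.red ⊤} {𝔘 : Cover P}

/-- The cochain `w` measures the difference between two systems of local data with respect to
isomorphisms `g x` of the underlying graded bundles. -/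
structure GluingData.Differ (𝔇 𝔇' : GluingData E 𝔘)
    (g : ∀ x, GrIso (𝔇.lift x) (𝔇'.lift x) (𝔘.U x).U le_rfl le_rfl) (w : Cochain E 𝔘 1) : Prop where
  comp₁₀ : ∀ s : Fin 2 → P.pair.Y, iota (𝔇.lift (s 0)) (𝔇'.lift (s 1)) 0 (𝔘.inter s)
    (𝔘.inter_le s 0) (𝔘.inter_le s 1) (w ⟨(1, 0), rfl⟩ s) =
    toForm₀ ((HomSec.res (𝔘.inter_le s 1) (g (s 1)).hom).comp (𝔇.hom s 0 1) -
      (𝔇'.hom s 0 1).comp (HomSec.res (𝔘.inter_le s 0) (g (s 0)).hom))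
  comp₀₁ : ∀ s : Fin 1 → P.pair.Y, iota (𝔇.lift (s 0)) (𝔇'.lift (s 0)) 1 (𝔘.inter s)
    (𝔘.inter_le s 0) (𝔘.inter_le s 0) (w ⟨(0, 1), rfl⟩ s) =
    higgsDefect (𝔇.lift (s 0)) (𝔇'.lift (s 0)) (𝔘.inter s) (𝔘.inter_le s 0) (𝔘.inter_le s 0)
      (HomSec.res (𝔘.inter_le s 0) (g (s 0)).hom)

theorem GluingData.exists_differ (𝔇 𝔇' : GluingData E 𝔘)
    (g : ∀ x, GrIso (𝔇.lift x) (𝔇'.lift x) (𝔘.U x).U le_rfl le_rfl) : ∃ w, 𝔇.Differ 𝔇' g w := by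
  have hr {r : ℕ} (s : Fin (r + 1) → P.pair.Y) (i : Fin (r + 1)) :
      ReducesToId (𝔇.lift (s i)) (𝔇'.lift (s i)) (𝔘.inter_le s i) (𝔘.inter_le s i)
        (HomSec.res (𝔘.inter_le s i) (g (s i)).hom) :=
    fun V h => (g (s i)).φ_hom V (h.trans (𝔘.inter_le s i))
  have hm {r : ℕ} (s : Fin (r + 1) → P.pair.Y) (i : Fin (r + 1)) :
      HomSec.res (𝔘.inter_le s i) (g (s i)).hom ∈ HomGr (𝔇.lift (s i)).toGradedBundle
        (𝔇'.lift (s i)).toGradedBundle 0 (𝔘.inter s).U :=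
    fun m V h => (g (s i)).hom_mem m V (h.trans (𝔘.inter_le s i))
  have h10 (s : Fin 2 → P.pair.Y) := exists_iota_eq (𝔇.lift (s 0)) (𝔇'.lift (s 1)) 0
    (𝔘.inter_le s 0) (𝔘.inter_le s 1) _ (isGradedForm_toForm₀ (𝔘.inter_le s 1)
      (sub_mem (comp_mem_homGr _ (hm s 1) (𝔇.hom_mem s 0 1))
        (comp_mem_homGr _ (𝔇'.hom_mem s 0 1) (hm s 0)))) fun e =>
      φForm_toForm₀_sub (𝔘.inter_le s 0) (𝔘.inter_le s 1)
        (ReducesToId.comp (hr s 1) (𝔇.hom_reduces s 0 1))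
        (ReducesToId.comp (𝔇'.hom_reduces s 0 1) (hr s 0)) e
  have h01 (s : Fin 1 → P.pair.Y) := exists_iota_eq (𝔇.lift (s 0)) (𝔇'.lift (s 0)) 1
    (𝔘.inter_le s 0) (𝔘.inter_le s 0) _ (isGradedForm_higgsDefect (𝔘.inter_le s 0)
      (𝔘.inter_le s 0) (hm s 0)) fun e => φForm_higgsDefect (𝔘.inter_le s 0) (𝔘.inter_le s 0)
      (hr s 0) e
  choose a ha using h10
  choose b hb using h01
  exact ⟨Cochain.one a b, ha, hb⟩

theorem Cover.le_inter_one (𝔘 : Cover P) (x : P.pair.Y) :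
    𝔘.U x ≤ 𝔘.inter (p := 0) fun _ => x := Finset.le_inf' _ _ fun _ _ => le_rfl

theorem Cover.le_inter_two (𝔘 : Cover P) (x y : P.pair.Y) :
    𝔘.U x ⊓ 𝔘.U y ≤ 𝔘.inter (p := 1) ![x, y] :=
  Finset.le_inf' _ _ fun t _ => by
    fin_cases t
    exacts [inf_le_left, inf_le_right]

/-- Every cochain of degree `1` is the difference of a given system of local data and another
one. -/
theorem GluingData.exists_perturb (𝔇 : GluingData E 𝔘) (w : Cochain E 𝔘 1) :
    ∃ (𝔇' : GluingData E 𝔘) (g : _), 𝔇.Differ 𝔇' g w := by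
  choose L' g hg using fun x => exists_addField (𝔇.lift x) (U := 𝔘.inter (p := 0) fun _ => x)
    (𝔘.inter_le (p := 0) (fun _ => x) 0) (𝔘.le_inter_one x) (w ⟨(0, 1), rfl⟩ fun _ => x)
  have hf (s : Fin 2 → P.pair.Y) : ∃ f : GrIso (L' (s 0)) (L' (s 1)) (𝔘.inter s).U
      (𝔘.inter_le s 0) (𝔘.inter_le s 1), iota (𝔇.lift (s 0)) (L' (s 1)) 0 (𝔘.inter s)
      (𝔘.inter_le s 0) (𝔘.inter_le s 1) (w ⟨(1, 0), rfl⟩ s) =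
      toForm₀ ((HomSec.res (𝔘.inter_le s 1) (g (s 1)).hom).comp (𝔇.hom s 0 1) -
        f.hom.comp (HomSec.res (𝔘.inter_le s 0) (g (s 0)).hom)) := by
    obtain ⟨ε, hε, hε0, hw⟩ := exists_toForm₀_eq_iota (L := L' (s 0)) (L' := L' (s 1))
      (𝔘.inter_le s 0) (𝔘.inter_le s 1) (w ⟨(1, 0), rfl⟩ s)
    let f₀ : GrIso (𝔇.lift (s 0)) (𝔇.lift (s 1)) (𝔘.inter s).U (𝔘.inter_le s 0)
      (𝔘.inter_le s 1) := (𝔇.f (s 0) (s 1)).res (le_inf (𝔘.inter_le s 0) (𝔘.inter_le s 1))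
    let g₀ := (g (s 0)).res (𝔘.inter_le s 0)
    let g₁ := (g (s 1)).res (𝔘.inter_le s 1)
    have hr : ReducesToId (L' (s 0)) (L' (s 1)) (𝔘.inter_le s 0) (𝔘.inter_le s 1)
        ((g₁.hom.comp (f₀.hom.comp g₀.inv)) - ε) := fun V h e => by
      have h1 : (𝔇.lift (s 0)).φ V (h.trans (𝔘.inter_le s 0)) (g₀.inv.app V h e) =
          (L' (s 0)).φ V (h.trans (𝔘.inter_le s 0)) e := by
        refine (g₀.φ_hom V h _).symm.trans ?_
        exact congrArg _ (congrArg (fun u : HomSec _ _ _ => u.app V h e) g₀.hom_inv)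
      rw [HomSec.sub_app, LinearMap.sub_apply, map_sub, hε0 V h e, sub_zero]
      exact (g₁.φ_hom V h _).trans ((f₀.φ_hom V h _).trans h1)
    obtain ⟨f, hf⟩ := exists_grIso (𝔘.inter s) (𝔘.inter_le s 0) (𝔘.inter_le s 1) hr
      (sub_mem (comp_mem_homGr _ g₁.hom_mem (comp_mem_homGr _ f₀.hom_mem g₀.inv_mem)) hε)
    refine ⟨f, (iota_comp_toForm₀ (𝔘.inter_le s 0) (𝔘.inter_le s 0) (𝔘.inter_le s 1)
      g₀.φ_hom hw).trans (congrArg toForm₀ (HomSec.ext' fun V h e => ?_))⟩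
    have h2 : g₀.inv.app V h (g₀.hom.app V h e) = e :=
      congrArg (fun u : HomSec _ _ _ => u.app V h e) g₀.inv_hom
    rw [hf]
    change ε.app V h (g₀.hom.app V h e) = (g₁.hom.comp f₀.hom - (g₁.hom.comp (f₀.hom.comp g₀.inv) -
      ε).comp g₀.hom).app V h e
    simp only [HomSec.comp, HomSec.sub_app, LinearMap.sub_apply, LinearMap.comp_apply, h2]
    abel
  choose f hf using hf
  refine ⟨⟨L', fun x y => (f ![x, y]).res (𝔘.le_inter_two x y)⟩, g, fun s => ?_, fun s => ?_⟩
  · obtain ⟨x, y, rfl⟩ : ∃ x y, s = ![x, y] :=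
      ⟨s 0, s 1, funext fun t => by fin_cases t <;> rfl⟩
    exact hf ![x, y]
  · obtain ⟨x, rfl⟩ : ∃ x, s = fun _ => x :=
      ⟨s 0, funext fun t => by fin_cases t; rfl⟩
    exact hg x

end Perturb



section Descent

variable {Y : Scheme.{u}} {ι : Type u}

/-- A descent datum for graded bundles with respect to a family of open sets. -/
structure DescentDatum (U : ι → Y.Opens) where
  B : ∀ x, GradedBundle Y (U x)
  f : ∀ x y, HomSec (B x).M (B y).M (U x ⊓ U y)
  f_mem : ∀ x y, f x y ∈ HomGr (B x) (B y) 0 (U x ⊓ U y)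
  f_self : ∀ x V h e, (f x x).app V h e = e
  f_comp : ∀ x y z V h h' h'' e, (f y z).app V h' ((f x y).app V h e) = (f x z).app V h'' e

namespace DescentDatum

variable {U : ι → Y.Opens} (𝔇 : DescentDatum U) {V W : Y.Opens}

/-- Sections of the glued module. -/
def sections (V : Y.Opens) :
    AddSubgroup (∀ i : {i : ι × Y.Opens // i.2 ≤ V ∧ i.2 ≤ U i.1}, Γ((𝔇.B i.1.1).M, i.1.2)) where
  carrier := {m | ∀ x y W W' (h : W' ≤ W) hV hx hV' hy,
    (𝔇.f x y).app W' (le_inf (h.trans hx) hy) (mres _ h (m ⟨(x, W), hV, hx⟩ : Γ((𝔇.B x).M, W))) =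
      m ⟨(y, W'), hV', hy⟩}
  zero_mem' x y W W' h hV hx hV' hy := by simp
  add_mem' hm hn x y W W' h hV hx hV' hy := by
    simp only [Pi.add_apply, map_add, hm x y W W' h hV hx hV' hy, hn x y W W' h hV hx hV' hy]
  neg_mem' hm x y W W' h hV hx hV' hy := by
    simp only [Pi.neg_apply, map_neg, hm x y W W' h hV hx hV' hy]

variable {𝔇}

/-- The local components of a section of the glued module. -/
def sec (m : 𝔇.sections V) (x : ι) (W : Y.Opens) (hV : W ≤ V) (hx : W ≤ U x) : Γ((𝔇.B x).M, W) :=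
  m.1 ⟨(x, W), hV, hx⟩

theorem sections_ext {m n : 𝔇.sections V} (h : ∀ x W hV hx, sec m x W hV hx = sec n x W hV hx) :
    m = n :=
  Subtype.ext (funext fun i => h i.1.1 i.1.2 i.2.1 i.2.2)

theorem mres_sections (m : 𝔇.sections V) (x : ι) {W W' : Y.Opens} (h : W' ≤ W) (hV : W ≤ V)
    (hx : W ≤ U x) : mres _ h (sec m x W hV hx) = sec m x W' (h.trans hV) (h.trans hx) :=
  (𝔇.f_self x W' (le_inf (h.trans hx) (h.trans hx)) _).symm.trans
    (m.2 x x W W' h hV hx (h.trans hV) (h.trans hx))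

theorem f_sections (m : 𝔇.sections V) (x y : ι) {W : Y.Opens} (hV : W ≤ V) (hx : W ≤ U x)
    (hy : W ≤ U y) : (𝔇.f x y).app W (le_inf hx hy) (sec m x W hV hx) = sec m y W hV hy := by
  have := m.2 x y W W le_rfl hV hx hV hy
  rwa [mres_self] at this

instance : SMul Γ(Y, V) (𝔇.sections V) :=
  ⟨fun r m => ⟨fun i => rres i.2.1 r • sec m i.1.1 i.1.2 i.2.1 i.2.2, fun x y W W' h hV hx hV' hy => by
    rw [map_smulₛₗ, map_smul, rres_rres]
    exact congrArg (rres _ r • ·) (m.2 x y W W' h hV hx hV' hy)⟩⟩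

theorem smul_sections (r : Γ(Y, V)) (m : 𝔇.sections V) (x W hV hx) :
    sec (r • m) x W hV hx = rres hV r • sec m x W hV hx := rfl

instance : Module Γ(Y, V) (𝔇.sections V) where
  one_smul m := sections_ext fun x W hV hx => by rw [smul_sections, map_one, one_smul]
  mul_smul r s m := sections_ext fun x W hV hx => by
    simp only [smul_sections, map_mul, mul_smul]
  smul_zero r := sections_ext fun x W hV hx => smul_zero _
  smul_add r m n := sections_ext fun x W hV hx => smul_add _ _ _
  add_smul r s m := sections_ext fun x W hV hx => by
    rw [smul_sections, map_add, add_smul]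
    rfl
  zero_smul m := sections_ext fun x W hV hx => by
    rw [smul_sections, map_zero, zero_smul]
    rfl

variable (𝔇)

/-- The glued sheaf of modules. -/
def sheafData : SheafData Y where
  obj V := 𝔇.sections V
  res h :=
    { toFun := fun m => ⟨fun i => sec m i.1.1 i.1.2 (i.2.1.trans h) i.2.2,
        fun x y W W' h' hV hx hV' hy => m.2 x y W W' h' (hV.trans h) hx (hV'.trans h) hy⟩
      map_add' := fun m n => rfl
      map_smul' := fun r m => sections_ext fun x W hV hx => by
        exact congrArg (· • sec m x W (hV.trans h) hx) (rres_rres hV h r).symm }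
  res_self m := rfl
  res_res _ _ m := rfl
  ext {V} m n H := sections_ext fun x W hV hx => mres_eq_of_locally_eq _ fun p hp => by
    obtain ⟨V', h, hp', e⟩ := H p (hV hp)
    refine ⟨W ⊓ V', inf_le_left, ⟨hp, hp'⟩, ?_⟩
    rw [mres_sections, mres_sections]
    exact congrArg (fun k : 𝔇.sections V' => sec k x (W ⊓ V') inf_le_right (inf_le_left.trans hx)) e
  glue {V κ} V' hV' hc s hs := by
    have hs' (i j : κ) (x W hi hj hx) : sec (s i) x W hi hx = sec (s j) x W hj hx :=
      congrArg (fun k : 𝔇.sections (V' i ⊓ V' j) => sec k x W (le_inf hi hj) hx) (hs i j)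
    have key (x : ι) (W : Y.Opens) (hV : W ≤ V) (hx : W ≤ U x) : ∃ t : Γ((𝔇.B x).M, W), ∀ i,
        mres _ (inf_le_left : W ⊓ V' i ≤ W) t =
          sec (s i) x (W ⊓ V' i) inf_le_right (inf_le_left.trans hx) :=
      exists_mres_eq _ (fun i => W ⊓ V' i) (fun i => inf_le_left)
        (fun p hp => (hc p (hV hp)).imp fun i hi => ⟨hp, hi⟩) _ fun i j => by
          rw [mres_sections, mres_sections]
          exact hs' i j x _ _ _ _
    choose t ht using key
    have ht' (x W hV hx i) (W' : Y.Opens) (h : W' ≤ W) (hi : W' ≤ V' i) :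
        mres _ h (t x W hV hx) = sec (s i) x W' hi (h.trans hx) := by
      rw [← mres_mres _ (le_inf h hi) inf_le_left, ht, mres_sections]
    refine ⟨⟨fun i => t i.1.1 i.1.2 i.2.1 i.2.2, fun x y W W' h hV hx hV'' hy =>
      mres_eq_of_locally_eq _ fun p hp => ?_⟩,
      fun i => sections_ext fun x W hW hx => ?_⟩
    · obtain ⟨i, hi⟩ := hc p (hV'' hp)
      refine ⟨W' ⊓ V' i, inf_le_left, ⟨hp, hi⟩, ?_⟩
      rw [(𝔇.f x y).naturality, mres_mres, ht' _ _ _ _ i _ _ inf_le_right,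
        ht' _ _ _ _ i _ _ inf_le_right, f_sections]
    · change t x W _ hx = _
      rw [← mres_self _ (t x W _ hx), ht' _ _ _ _ i _ _ hW]

/-- The glued module. -/
def glued : Y.Modules := 𝔇.sheafData.toModules

/-- The sections of the glued module. -/
def gluedEquiv (V : Y.Opens) : Γ(𝔇.glued, V) ≃ₗ[Γ(Y, V)] 𝔇.sections V := 𝔇.sheafData.equiv V

/-- The local isomorphisms of the glued module. -/
def toLocal (x : ι) : HomSec 𝔇.glued (𝔇.B x).M (U x) where
  app V h :=
    { toFun := fun m => sec (𝔇.gluedEquiv V m) x V le_rfl h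
      map_add' := fun _ _ => rfl
      map_smul' := fun r m => by
        rw [map_smul]
        exact (smul_sections _ _ _ _ _ _).trans (by rw [rres_self]; rfl) }
  naturality V W hV h m := mres_sections (𝔇.gluedEquiv _ m) x h le_rfl hV

/-- The inverses of the local isomorphisms. -/
def ofLocal (x : ι) : HomSec (𝔇.B x).M 𝔇.glued (U x) where
  app V h :=
    { toFun := fun e => (𝔇.gluedEquiv V).symm
        ⟨fun i => (𝔇.f x i.1.1).app i.1.2 (le_inf (i.2.1.trans h) i.2.2) (mres _ i.2.1 e),
          fun y z W W' h' hV hy hV' hz => by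
            rw [(𝔇.f x y).naturality, mres_mres]
            exact 𝔇.f_comp x y z W' _ _ _ _⟩
      map_add' := fun e e' => (𝔇.gluedEquiv V).injective
        (sections_ext fun y W hV hy => (congrArg ((𝔇.f x y).app W (le_inf (hV.trans h) hy))
          (map_add (mres _ hV) e e')).trans (map_add ((𝔇.f x y).app W (le_inf (hV.trans h) hy)) _ _))
      map_smul' := fun r e => (𝔇.gluedEquiv V).injective
        (sections_ext fun y W hV hy => (congrArg ((𝔇.f x y).app W (le_inf (hV.trans h) hy))
          ((mres _ hV).map_smulₛₗ r e)).trans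
            (map_smul ((𝔇.f x y).app W (le_inf (hV.trans h) hy)) _ _)) }
  naturality V W hV h e := (𝔇.gluedEquiv _).injective (sections_ext fun y W' hV' hy =>
    (congrArg ((𝔇.f x y).app W' _) (mres_mres _ hV' h e)).symm)

theorem toLocal_ofLocal (x : ι) (V : Y.Opens) (h : V ≤ U x) (e : Γ((𝔇.B x).M, V)) :
    (𝔇.toLocal x).app V h ((𝔇.ofLocal x).app V h e) = e :=
  (𝔇.f_self x V _ _).trans (mres_self _ e)

theorem ofLocal_toLocal (x : ι) (V : Y.Opens) (h : V ≤ U x) (m : Γ(𝔇.glued, V)) :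
    (𝔇.ofLocal x).app V h ((𝔇.toLocal x).app V h m) = m :=
  (𝔇.gluedEquiv V).injective
    (sections_ext fun y W hV hy => (𝔇.gluedEquiv V m).2 x y V W hV le_rfl h hV hy)

theorem f_toLocal (x y : ι) (V : Y.Opens) (hx : V ≤ U x) (hy : V ≤ U y) (m : Γ(𝔇.glued, V)) :
    (𝔇.f x y).app V (le_inf hx hy) ((𝔇.toLocal x).app V hx m) = (𝔇.toLocal y).app V hy m :=
  f_sections (𝔇.gluedEquiv V m) x y le_rfl hx hy

/-- The glued grading. -/
def gluedGr (ℓ : ℤ) (V : Y.Opens) : Submodule Γ(Y, V) Γ(𝔇.glued, V) where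
  carrier := {m | ∀ x W hV hx, sec (𝔇.gluedEquiv V m) x W hV hx ∈ (𝔇.B x).Gr ℓ W}
  zero_mem' _ _ _ _ := zero_mem _
  add_mem' hm hn x W hV hx := add_mem (hm x W hV hx) (hn x W hV hx)
  smul_mem' _ _ hm x W hV hx := Submodule.smul_mem _ _ (hm x W hV hx)

theorem toLocal_mem {x : ι} {ℓ : ℤ} {V : Y.Opens} (h : V ≤ U x) {m : Γ(𝔇.glued, V)}
    (hm : m ∈ 𝔇.gluedGr ℓ V) : (𝔇.toLocal x).app V h m ∈ (𝔇.B x).Gr ℓ V := hm x V le_rfl h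

theorem ofLocal_mem {x : ι} {ℓ : ℤ} {V : Y.Opens} (h : V ≤ U x) {e : Γ((𝔇.B x).M, V)}
    (he : e ∈ (𝔇.B x).Gr ℓ V) : (𝔇.ofLocal x).app V h e ∈ 𝔇.gluedGr ℓ V := fun y W hV hy => by
  have := 𝔇.f_mem x y ℓ W (le_inf (hV.trans h) hy) _ ((𝔇.B x).res_mem ℓ V W hV h e he)
  rwa [add_zero] at this

/-- The glued graded bundle. -/
def bundle (hU : ∀ p : Y, ∃ x, p ∈ U x) : GradedBundle Y ⊤ where
  M := 𝔇.glued
  Gr := 𝔇.gluedGr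
  res_mem ℓ V W h _ m hm x W' hV hx := hm x W' (hV.trans h) hx
  of_locally_mem ℓ V _ m H x W hV hx := (𝔇.B x).of_locally_mem ℓ W hx _ fun p hp => by
    obtain ⟨V', h, hp', hm⟩ := H p (hV hp)
    refine ⟨W ⊓ V', inf_le_left, ⟨hp, hp'⟩, ?_⟩
    rw [mres_sections]
    exact hm x (W ⊓ V') inf_le_right (inf_le_left.trans hx)
  locally_basis p _ := by
    obtain ⟨x, hx⟩ := hU p
    obtain ⟨V, hp, hV, n, b, deg, hb⟩ := (𝔇.B x).locally_basis p hx
    refine ⟨V, hp, le_top, n, fun k => (𝔇.ofLocal x).app V hV (b k), deg, fun W h => ⟨?_, fun ℓ => ?_⟩⟩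
    · let ψ : Γ((𝔇.B x).M, W) ≃ₗ[Γ(Y, W)] Γ(𝔇.glued, W) :=
        LinearEquiv.ofLinearMap ((𝔇.ofLocal x).app W (h.trans hV)) ((𝔇.toLocal x).app W (h.trans hV))
          (LinearMap.ext fun m => 𝔇.ofLocal_toLocal x W (h.trans hV) m)
          (LinearMap.ext fun m => 𝔇.toLocal_ofLocal x W (h.trans hV) m)
      refine Eq.mp (congrArg Function.Bijective (funext fun c => ?_))
        (ψ.bijective.comp (hb W h).1)
      refine (map_sum ψ _ _).trans (Finset.sum_congr rfl fun k _ => ?_)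
      rw [map_smul, (𝔇.ofLocal x).naturality]
      rfl
    · have e1 (k) : (𝔇.ofLocal x).app W (h.trans hV) (mres _ h (b k)) =
          mres _ h ((𝔇.ofLocal x).app V hV (b k)) := ((𝔇.ofLocal x).naturality _ _ _ _ _).symm
      refine le_antisymm (fun m hm => ?_) (Submodule.span_le.mpr ?_)
      · have h1 := 𝔇.toLocal_mem (h.trans hV) hm
        rw [(hb W h).2 ℓ] at h1
        rw [← 𝔇.ofLocal_toLocal x W (h.trans hV) m]
        refine Submodule.span_induction (p := fun e _ => (𝔇.ofLocal x).app W (h.trans hV) e ∈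
          Submodule.span Γ(Y, W) {e | ∃ k, deg k = ℓ ∧
            e = mres 𝔇.glued h ((𝔇.ofLocal x).app V hV (b k))}) ?_ ?_ ?_ ?_ h1
        · rintro _ ⟨k, hk, rfl⟩
          exact Submodule.subset_span ⟨k, hk, e1 k⟩
        · rw [map_zero]; exact zero_mem _
        · intro y z _ _ hy hz
          rw [map_add]; exact add_mem hy hz
        · intro r y _ hy
          rw [map_smul]; exact Submodule.smul_mem _ _ hy
      · rintro _ ⟨k, hk, rfl⟩
        rw [← e1]
        refine 𝔇.ofLocal_mem (h.trans hV) ?_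
        rw [(hb W h).2 ℓ]
        exact Submodule.subset_span ⟨k, hk, rfl⟩

end DescentDatum

end Descent



section EndomorphismSheaf

variable {Y : Scheme.{u}} (B : GradedBundle Y ⊤)

/-- The sheaf of homogeneous endomorphisms. -/
def GradedBundle.endData (ℓ : ℤ) : SheafData Y where
  obj V := EndGr B ℓ V
  res h := EndGr.res B ℓ h
  res_self _ := rfl
  res_res _ _ _ := rfl
  ext s t H := Subtype.ext (HomSec.eq_of_locally_eq fun x hx => by
    obtain ⟨W, hW, hxW, e⟩ := H x hx
    exact ⟨W, hW, hxW, congrArg Subtype.val e⟩)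
  glue {V κ} W hW hc s hs := by
    obtain ⟨g, hg⟩ := HomSec.exists_res_eq W hW hc (fun i => (s i).1)
      fun i j => congrArg Subtype.val (hs i j)
    refine ⟨⟨g, fun m V' h e he => B.of_locally_mem _ V' le_top _ fun x hx => ?_⟩,
      fun i => Subtype.ext (hg i)⟩
    obtain ⟨i, hi⟩ := hc x (h hx)
    refine ⟨V' ⊓ W i, inf_le_left, ⟨hx, hi⟩, ?_⟩
    rw [g.naturality]
    have := (s i).2 m (V' ⊓ W i) inf_le_right _ (B.res_mem m V' _ inf_le_left le_top e he)
    rwa [← hg i] at this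

variable {B} {U₁ U : Y.Opens} {B' : GradedBundle Y U₁}

/-- Transport of endomorphisms along an isomorphism. -/
def EndGr.conj {f : HomSec B.M B'.M U} {g : HomSec B'.M B.M U} (hf : f ∈ HomGr B B' 0 U)
    (hg : g ∈ HomGr B' B 0 U) (ℓ : ℤ) {V : Y.Opens} (h : V ≤ U) :
    EndGr B' ℓ V →ₗ[Γ(Y, V)] EndGr B ℓ V where
  toFun k := ⟨(HomSec.res h g).comp (k.1.comp (HomSec.res h f)), fun m W hW e he => by
    have h1 := k.2 _ W hW _ (hf m W (hW.trans h) e he)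
    have h2 := hg _ W (hW.trans h) _ h1
    rwa [add_zero, add_zero] at h2⟩
  map_add' k k' := Subtype.ext (HomSec.ext' fun W hW e => map_add (g.app W (hW.trans h)) _ _)
  map_smul' r k := Subtype.ext (HomSec.ext' fun W hW e => map_smul (g.app W (hW.trans h)) _ _)

theorem EndGr.evalMap_conj {f : HomSec B.M B'.M U} {g : HomSec B'.M B.M U}
    (hf : f ∈ HomGr B B' 0 U) (hg : g ∈ HomGr B' B 0 U) (ℓ : ℤ) {V : Y.Opens} (h : V ≤ U)
    {W : Type u} [AddCommGroup W] [Module Γ(Y, V) W] (t : EndGr B' ℓ V ⊗[Γ(Y, V)] W)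
    (e : Γ(B.M, V)) :
    evalMap (EndGr.toLin B ℓ V) ((EndGr.conj hf hg ℓ h).rTensor W t) e =
      (g.app V h).rTensor W (evalMap (EndGr.toLin B' ℓ V) t (f.app V h e)) := by
  induction t using TensorProduct.induction_on with
  | zero => simp
  | add x y hx hy => simp only [map_add, LinearMap.add_apply, hx, hy]
  | tmul k w => rfl

end EndomorphismSheaf

section GlueFields

variable {P : LogPair.{u}} {B : GradedBundle P.Y ⊤}

theorem EndGr.map_res_conj {U₁ U₂ : P.Y.Opens} {B' : GradedBundle P.Y U₁}
    {f : HomSec B.M B'.M U₂} {g : HomSec B'.M B.M U₂} (hf : f ∈ HomGr B B' 0 U₂)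
    (hg : g ∈ HomGr B' B 0 U₂) {U V : AOpen P} (h : U ≤ V) (hV : V.U ≤ U₂)
    (t : EndGr B' (-1) V.U ⊗[Γ(P.Y, V.U)] Om V) :
    TensorProduct.map (EndGr.res B (-1) (U := U.U) (V := V.U) h) (Om.res h)
        ((EndGr.conj hf hg (-1) hV).rTensor (Om V) t) =
      (EndGr.conj hf hg (-1) (le_trans (b := V.U) h hV)).rTensor (Om U)
        (TensorProduct.map (EndGr.res B' (-1) (U := U.U) (V := V.U) h) (Om.res h) t) := by
  induction t using TensorProduct.induction_on with
  | zero => simp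
  | add x y hx hy => simp only [map_add, hx, hy]
  | tmul k w => rfl

variable [SemiSeparated P.Y] (B)

theorem GradedBundle.exists_field (hP : P.IsSmoothPair) {ι : Type u} (U : ι → AOpen P)
    (hU : ∀ p : P.Y, ∃ x, p ∈ (U x).U)
    (θ : ∀ (x : ι) (V : AOpen P), V ≤ U x → EndGr B (-1) V.U ⊗[Γ(P.Y, V.U)] Om V)
    (hθ : ∀ (x : ι) (V W : AOpen P) (hV : V ≤ U x) (h : W ≤ V),
      TensorProduct.map (EndGr.res B (-1) (U := W.U) (V := V.U) h) (Om.res h) (θ x V hV) =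
        θ x W (h.trans hV))
    (hxy : ∀ (x y : ι) (V : AOpen P) (hx : V ≤ U x) (hy : V ≤ U y), θ x V hx = θ y V hy) :
    ∃ F : ∀ V : AOpen P, EndGr B (-1) V.U ⊗[Γ(P.Y, V.U)] Om V,
      (∀ (V W : AOpen P) (h : W ≤ V), TensorProduct.map
        (EndGr.res B (-1) (U := W.U) (V := V.U) h) (Om.res h) (F V) = F W) ∧
      ∀ x V hV, F V = θ x V hV := by
  have key (V : AOpen P) : ∃ t : EndGr B (-1) V.U ⊗[Γ(P.Y, V.U)] Om V, ∀ x,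
      TensorProduct.map (EndGr.res B (-1) (U := (V ⊓ U x).U) (V := V.U) inf_le_left)
        (Om.res (inf_le_left : V ⊓ U x ≤ V)) t = θ x (V ⊓ U x) inf_le_right := by
    obtain ⟨C⟩ := hP.om_coords V
    exact C.exists_tres_eq (M := (B.endData (-1)).toModules) (fun x => V ⊓ U x)
      (fun x => inf_le_left) (fun p hp => (hU p).imp fun x hx => ⟨hp, hx⟩)
      (fun x => θ x (V ⊓ U x) inf_le_right) fun x y =>
        (hθ x _ _ _ _).trans ((hxy x y _ _ _).trans (hθ y _ _ _ _).symm)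
  choose F hF using key
  have hF' (V W : AOpen P) (h : W ≤ V) (x : ι) (hx : W ≤ U x) : TensorProduct.map
      (EndGr.res B (-1) (U := W.U) (V := V.U) h) (Om.res h) (F V) = θ x W hx :=
    (map_res_map_res B (le_inf h hx : W ≤ V ⊓ U x) inf_le_left (F V)).symm.trans
      ((congrArg _ (hF V x)).trans (hθ x _ _ _ _))
  have ext {V : AOpen P} {s t : EndGr B (-1) V.U ⊗[Γ(P.Y, V.U)] Om V}
      (H : ∀ x, TensorProduct.map (EndGr.res B (-1) (U := (V ⊓ U x).U) (V := V.U) inf_le_left)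
        (Om.res (inf_le_left : V ⊓ U x ≤ V)) s =
        TensorProduct.map (EndGr.res B (-1) (U := (V ⊓ U x).U) (V := V.U) inf_le_left)
        (Om.res (inf_le_left : V ⊓ U x ≤ V)) t) : s = t := by
    obtain ⟨C⟩ := hP.om_coords V
    refine C.tres_eq_of_locally_eq (M := (B.endData (-1)).toModules) fun p hp => ?_
    obtain ⟨x, hx⟩ := hU p
    exact ⟨V ⊓ U x, inf_le_left, ⟨hp, hx⟩, H x⟩
  refine ⟨F, fun V W h => ext fun x => ?_, fun x V hV => ext fun y => ?_⟩
  · exact (map_res_map_res B inf_le_left h (F V)).trans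
      ((hF' V _ _ x inf_le_right).trans (hF W x).symm)
  · exact (hF V y).trans ((hxy y x _ _ (inf_le_left.trans hV)).trans (hθ x _ _ _ _).symm)

end GlueFields

section GlueReduction

variable {P : Thickening.{u}} (M : P.pair.Y.Modules) (N : P.red.Y.Modules)

theorem exists_reduction {ι : Type u} (U : ι → P.pair.Y.Opens) (hU : ∀ p, ∃ x, p ∈ U x)
    (φ : ∀ (x : ι) (V : P.pair.Y.Opens), V ≤ U x → (Γ(M, V) →ₛₗ[P.redHom V] Γ(N, P.inv V)))
    (hφ : ∀ (x : ι) (V W : P.pair.Y.Opens) (hV : V ≤ U x) (h : W ≤ V) (e : Γ(M, V)),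
      mres N (inv_mono h) (φ x V hV e) = φ x W (h.trans hV) (mres M h e))
    (hxy : ∀ (x y : ι) (V : P.pair.Y.Opens) (hx : V ≤ U x) (hy : V ≤ U y) (e : Γ(M, V)),
      φ x V hx e = φ y V hy e) :
    ∃ Φ : ∀ V : P.pair.Y.Opens, Γ(M, V) →ₛₗ[P.redHom V] Γ(N, P.inv V),
      (∀ (V W : P.pair.Y.Opens) (h : W ≤ V) (e : Γ(M, V)),
        mres N (inv_mono h) (Φ V e) = Φ W (mres M h e)) ∧
      ∀ x V hV e, Φ V e = φ x V hV e := by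
  have ext {V : P.pair.Y.Opens} {s t : Γ(N, P.inv V)}
      (H : ∀ x, mres N (inv_mono (inf_le_left : V ⊓ U x ≤ V)) s =
        mres N (inv_mono (inf_le_left : V ⊓ U x ≤ V)) t) : s = t :=
    mres_eq_of_locally_eq N fun p hp => by
      obtain ⟨x, hx⟩ := hU (P.i p)
      exact ⟨P.inv (V ⊓ U x), inv_mono inf_le_left, ⟨hp, hx⟩, H x⟩
  have key (V : P.pair.Y.Opens) (e : Γ(M, V)) : ∃ t : Γ(N, P.inv V), ∀ x,
      mres N (inv_mono (inf_le_left : V ⊓ U x ≤ V)) t =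
        φ x (V ⊓ U x) inf_le_right (mres M inf_le_left e) :=
    exists_mres_eq N (fun x => P.inv (V ⊓ U x)) (fun x => inv_mono inf_le_left)
      (fun p hp => (hU (P.i p)).imp fun x hx => ⟨hp, hx⟩) _ fun x y => by
        have h1 := hφ x (V ⊓ U x) (V ⊓ U x ⊓ (V ⊓ U y)) inf_le_right inf_le_left (mres M inf_le_left e)
        have h2 := hφ y (V ⊓ U y) (V ⊓ U x ⊓ (V ⊓ U y)) inf_le_right inf_le_right (mres M inf_le_left e)
        rw [mres_mres] at h1 h2
        exact h1.trans ((hxy x y _ _ _ _).trans h2.symm)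
  choose Φ hΦ using key
  let Φ' (V : P.pair.Y.Opens) : Γ(M, V) →ₛₗ[P.redHom V] Γ(N, P.inv V) :=
    { toFun := Φ V
      map_add' := fun e e' => ext fun x => by
        rw [hΦ, map_add, map_add, map_add, hΦ, hΦ]
      map_smul' := fun r e => ext fun x => by
        rw [hΦ, LinearMap.map_smulₛₗ, LinearMap.map_smulₛₗ, LinearMap.map_smulₛₗ, hΦ, redHom_rres] }
  refine ⟨Φ', fun V W h e => ext fun x => ?_, fun x V hV e => ext fun y => ?_⟩
  · have h1 : mres N (inv_mono (inf_le_inf_right (U x) h)) (mres N (inv_mono inf_le_left) (Φ V e)) =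
        φ x (W ⊓ U x) inf_le_right (mres M (inf_le_left.trans h) e) := by
      rw [hΦ, hφ x _ _ _ (inf_le_inf_right (U x) h), mres_mres]
    change mres N _ (mres N _ (Φ V e)) = mres N _ (Φ W _)
    rw [hΦ, mres_mres, mres_mres M, ← h1, mres_mres]
  · change mres N _ (Φ V e) = _
    rw [hΦ, hφ]
    exact hxy y x _ _ _ _

end GlueReduction

section GlueLifts

variable {P : Thickening.{u}} {E : GradedField P.red ⊤} {𝔘 : Cover P}
  (𝔇 : GluingData E 𝔘)

/-- The local data satisfy the cocycle condition, are compatible with the fields, and the fields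
are integrable. -/
structure GluingData.IsStrict : Prop where
  comp : ∀ x y z V (hx : V ≤ (𝔘.U x).U) (hy : V ≤ (𝔘.U y).U) (hz : V ≤ (𝔘.U z).U) e,
    (𝔇.f y z).hom.app V (le_inf hy hz) ((𝔇.f x y).hom.app V (le_inf hx hy) e) =
      (𝔇.f x z).hom.app V (le_inf hx hz) e
  commutes : ∀ x y (V : AOpen P.pair) (hx : V.U ≤ (𝔘.U x).U) (hy : V.U ≤ (𝔘.U y).U),
    Commutes (𝔇.lift x).toGradedField (𝔇.lift y).toGradedField V hx hy
      ((𝔇.f x y).hom.app V.U (le_inf hx hy))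
  square : ∀ x (V : AOpen P.pair) (h : V.U ≤ (𝔘.U x).U), higgsSquare (𝔇.lift x) V h = 0

namespace GluingData.IsStrict

variable {𝔇}

theorem f_self (h𝔇 : 𝔇.IsStrict) (x V) (h : V ≤ (𝔘.U x).U ⊓ (𝔘.U x).U) (e) :
    (𝔇.f x x).hom.app V h e = e := by
  have hi (e) : (𝔇.f x x).inv.app V h ((𝔇.f x x).hom.app V h e) = e :=
    congrArg (fun k : HomSec _ _ _ => k.app V h e) (𝔇.f x x).inv_hom
  have h1 := congrArg ((𝔇.f x x).inv.app V h)
    (h𝔇.comp x x x V (h.trans inf_le_left) (h.trans inf_le_left) (h.trans inf_le_left) e)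
  exact (hi _).symm.trans (h1.trans (hi e))

/-- The descent datum of the underlying graded bundles. -/
def descent (h𝔇 : 𝔇.IsStrict) : DescentDatum (fun x => (𝔘.U x).U) where
  B x := (𝔇.lift x).toGradedBundle
  f x y := (𝔇.f x y).hom
  f_mem x y := (𝔇.f x y).hom_mem
  f_self x V h e := h𝔇.f_self x V h e
  f_comp x y z V h h' _ e := h𝔇.comp x y z V (h.trans inf_le_left) (h.trans inf_le_right)
    (h'.trans inf_le_right) e

variable [SemiSeparated P.pair.Y]

theorem exists_glue_field (h𝔇 : 𝔇.IsStrict) :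
    ∃ (F : GradedField P.pair ⊤) (ψ : ∀ x, HomSec F.M (𝔇.lift x).M (𝔘.U x).U)
    (ψ' : ∀ x, HomSec (𝔇.lift x).M F.M (𝔘.U x).U),
    (∀ x, (ψ x).comp (ψ' x) = HomSec.id _ _) ∧ (∀ x, (ψ' x).comp (ψ x) = HomSec.id _ _) ∧
    (∀ x, ψ x ∈ HomGr F.toGradedBundle (𝔇.lift x).toGradedBundle 0 (𝔘.U x).U) ∧
    (∀ x, ψ' x ∈ HomGr (𝔇.lift x).toGradedBundle F.toGradedBundle 0 (𝔘.U x).U) ∧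
    (∀ x y V (hx : V ≤ (𝔘.U x).U) (hy : V ≤ (𝔘.U y).U) e,
      (𝔇.f x y).hom.app V (le_inf hx hy) ((ψ x).app V hx e) = (ψ y).app V hy e) ∧
    ∀ x (V : AOpen P.pair) (h : V.U ≤ (𝔘.U x).U) e, F.lin V le_top e =
      ((ψ' x).app V.U h).rTensor (Om V) ((𝔇.lift x).lin V h ((ψ x).app V.U h e)) := by
  let D := h𝔇.descent
  let B := D.bundle fun p => ⟨p, 𝔘.mem p⟩
  have hm x : D.toLocal x ∈ HomGr B (𝔇.lift x).toGradedBundle 0 (𝔘.U x).U := fun ℓ V h e he => by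
    rw [add_zero]
    exact D.toLocal_mem h he
  have hm' x : D.ofLocal x ∈ HomGr (𝔇.lift x).toGradedBundle B 0 (𝔘.U x).U := fun ℓ V h e he => by
    rw [add_zero]
    exact D.ofLocal_mem h he
  have hev x (V : AOpen P.pair) (h : V.U ≤ (𝔘.U x).U) (e : Γ(B.M, V.U)) :
      evalMap (EndGr.toLin B (-1) V.U) ((EndGr.conj (hm x) (hm' x) (-1) h).rTensor (Om V)
        ((𝔇.lift x).θ V h)) e =
      ((D.ofLocal x).app V.U h).rTensor (Om V) ((𝔇.lift x).lin V h ((D.toLocal x).app V.U h e)) :=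
    EndGr.evalMap_conj (hm x) (hm' x) (-1) h _ e
  obtain ⟨F, hF, hFx⟩ := B.exists_field P.smoothPair 𝔘.U (fun p => ⟨p, 𝔘.mem p⟩)
    (fun x V h => (EndGr.conj (hm x) (hm' x) (-1) h).rTensor (Om V) ((𝔇.lift x).θ V h))
    (fun x V W hV h => (EndGr.map_res_conj (hm x) (hm' x) h hV _).trans
      (congrArg _ ((𝔇.lift x).θ_res V W hV h)))
    (fun x y V hx hy => B.evalMap_injective V.isAffine le_top (-1) <| LinearMap.ext fun e => by
      refine (hev x V hx e).trans (Eq.trans ?_ (hev y V hy e).symm)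
      have h1 : (D.toLocal y).app V.U hy e =
          (𝔇.f x y).hom.app V.U (le_inf hx hy) ((D.toLocal x).app V.U hx e) :=
        (D.f_toLocal x y V.U hx hy e).symm
      have h2 : (D.ofLocal y).app V.U hy ∘ₗ (𝔇.f x y).hom.app V.U (le_inf hx hy) =
          (D.ofLocal x).app V.U hx := LinearMap.ext fun m => by
        have h3 := (congrArg ((𝔇.f x y).hom.app V.U (le_inf hx hy))
          (D.toLocal_ofLocal x V.U hx m)).symm.trans
            (D.f_toLocal x y V.U hx hy ((D.ofLocal x).app V.U hx m))
        exact (congrArg ((D.ofLocal y).app V.U hy) h3).trans (D.ofLocal_toLocal y V.U hy _)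
      have h3 := LinearMap.congr_fun (h𝔇.commutes x y V hx hy) ((D.toLocal x).app V.U hx e)
      rw [h1]
      exact ((congrArg (fun k => LinearMap.rTensor (Om V) k _) h2).symm.trans
        (LinearMap.rTensor_comp_apply _ _ _ _)).trans (congrArg _ h3.symm))
  refine ⟨{ B with θ := fun V _ => F V, θ_res := fun V W _ h => hF V W h }, D.toLocal, D.ofLocal,
    fun x => HomSec.ext' fun V h e => D.toLocal_ofLocal x V h e,
    fun x => HomSec.ext' fun V h e => D.ofLocal_toLocal x V h e, hm, hm',
    fun x y V hx hy e => D.f_toLocal x y V hx hy e, fun x V h e => ?_⟩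
  exact (LinearMap.congr_fun (congrArg (evalMap (EndGr.toLin B (-1) V.U)) (hFx x V h)) e).trans
    (hev x V h e)

theorem exists_glue_liftData (h𝔇 : 𝔇.IsStrict) : ∃ (L : LiftData E ⊤)
    (ψ : ∀ x, GrIso L (𝔇.lift x) (𝔘.U x).U le_top le_rfl),
    (∀ x y V (hx : V ≤ (𝔘.U x).U) (hy : V ≤ (𝔘.U y).U) e,
      (𝔇.f x y).hom.app V (le_inf hx hy) ((ψ x).hom.app V hx e) = (ψ y).hom.app V hy e) ∧
    ∀ x (V : AOpen P.pair) (h : V ≤ 𝔘.U x),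
      higgsDefect L (𝔇.lift x) V le_top h (HomSec.res h (ψ x).hom) = 0 := by
  obtain ⟨F, ψ, ψ', h1, h2, hm, hm', hf, hlin⟩ := h𝔇.exists_glue_field
  have h1' x V (h : V ≤ (𝔘.U x).U) (e) : (ψ x).app V h ((ψ' x).app V h e) = e :=
    congrArg (fun k : HomSec _ _ _ => k.app V h e) (h1 x)
  have h2' x V (h : V ≤ (𝔘.U x).U) (e) : (ψ' x).app V h ((ψ x).app V h e) = e :=
    congrArg (fun k : HomSec _ _ _ => k.app V h e) (h2 x)
  have hlin' (x) (V : AOpen P.pair) (h : V.U ≤ (𝔘.U x).U) (e) :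
      ((ψ x).app V.U h).rTensor (Om V) (F.lin V le_top e) =
        (𝔇.lift x).lin V h ((ψ x).app V.U h e) := by
    refine (congrArg _ (hlin x V h e)).trans ?_
    refine (LinearMap.rTensor_comp_apply _ _ _ _).symm.trans ?_
    have : (ψ x).app V.U h ∘ₗ (ψ' x).app V.U h = LinearMap.id := LinearMap.ext (h1' x V.U h)
    rw [this]
    exact LinearMap.rTensor_id_apply _ _ _
  obtain ⟨φ, hφ, hφx⟩ := exists_reduction F.M E.M (fun x => (𝔘.U x).U) (fun p => ⟨p, 𝔘.mem p⟩)
    (fun x V h => (((𝔇.lift x).φ V h).comp ((ψ x).app V h) : Γ(F.M, V) →ₛₗ[P.redHom V] _))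
    (fun x V W hV h e => ((𝔇.lift x).φ_res V W hV h _).trans
      (congrArg _ ((ψ x).naturality V W hV h e)))
    (fun x y V hx hy e => by
      refine ((𝔇.f x y).φ_hom V (le_inf hx hy) ((ψ x).app V hx e)).symm.trans ?_
      exact congrArg _ (hf x y V hx hy e))
  have hφψ' x V (h : V ≤ (𝔘.U x).U) (e) : φ V ((ψ' x).app V h e) = (𝔇.lift x).φ V h e :=
    (hφx x V h _).trans (congrArg _ (h1' x V h e))
  let L : LiftData E ⊤ :=
    { F with
      φ := fun V _ => φ V
      φ_res := fun V W _ h e => hφ V W h e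
      φ_Gr := fun ℓ V _ e he => E.of_locally_mem ℓ _ le_top _ fun p hp => by
        refine ⟨P.inv (V ⊓ (𝔘.U (P.i p)).U), inv_mono inf_le_left, ⟨hp, 𝔘.mem _⟩, ?_⟩
        rw [hφ, hφx _ _ inf_le_right]
        refine (𝔇.lift _).φ_Gr ℓ _ _ _ ?_
        have := hm (P.i p) ℓ _ inf_le_right _ (F.res_mem ℓ V _ (inf_le_left (b := (𝔘.U (P.i p)).U))
          le_top e he)
        rwa [add_zero] at this
      φ_iso := fun p _ => by
        refine ⟨(𝔘.U p).U, le_top, 𝔘.mem p, fun W h hW => ⟨fun n => ?_, fun e he => ?_⟩⟩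
        · obtain ⟨e, rfl⟩ := (𝔇.lift p).φ_surjective hW h n
          exact ⟨_, hφψ' p W h e⟩
        · rw [hφx p W h] at he
          have h4 := (𝔇.lift p).mem_ker_smul_of_φ_eq_zero hW h he
          rw [← h2' p W h e]
          have h5 := Submodule.mem_map_of_mem (f := (ψ' p).app W h) h4
          rw [Submodule.map_smul''] at h5
          exact Submodule.smul_mono le_rfl le_top h5
      φ_θ := fun V _ e => by
        obtain ⟨C⟩ := P.red_isSmoothPair.om_coords V.pre
        refine C.tres_eq_of_locally_eq fun p hp => ?_
        let x := P.i p
        have hV : (V ⊓ 𝔘.U x) ≤ V := inf_le_left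
        have hx : (V ⊓ 𝔘.U x) ≤ 𝔘.U x := inf_le_right
        refine ⟨(V ⊓ 𝔘.U x).pre, AOpen.pre_mono inf_le_left, ⟨hp, 𝔘.mem _⟩, ?_⟩
        have h3 (t : Γ(F.M, V.U) ⊗[Γ(P.pair.Y, V.U)] Om V) :
            tres Om.res E.M (AOpen.pre_mono hV) (TensorProduct.map (φ V.U) (Om.red V) t) =
            TensorProduct.map (φ (V ⊓ 𝔘.U x).U) (Om.red (V ⊓ 𝔘.U x)) (tres Om.res F.M hV t) := by
          induction t using TensorProduct.induction_on with
          | zero => simp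
          | add a b ha hb => simp only [map_add, ha, hb]
          | tmul m η => exact congrArg₂ (· ⊗ₜ ·) (hφ V.U _ hV m) (Om.red_res hV η).symm
        have h4 (t : Γ((𝔇.lift x).M, (V ⊓ 𝔘.U x).U) ⊗[Γ(P.pair.Y, (V ⊓ 𝔘.U x).U)] Om (V ⊓ 𝔘.U x)) :
            TensorProduct.map (φ (V ⊓ 𝔘.U x).U) (Om.red (V ⊓ 𝔘.U x))
              (((ψ' x).app _ hx).rTensor _ t) =
            TensorProduct.map ((𝔇.lift x).φ (V ⊓ 𝔘.U x).U hx) (Om.red (V ⊓ 𝔘.U x)) t := by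
          induction t using TensorProduct.induction_on with
          | zero => simp
          | add a b ha hb => simp only [map_add, ha, hb]
          | tmul m η => exact congrArg (· ⊗ₜ _) (hφψ' x _ hx m)
        refine (h3 _).trans ?_
        refine (congrArg _ (lin_res F le_top hV e).symm).trans ?_
        refine (congrArg _ (hlin x _ hx _)).trans ((h4 _).trans ?_)
        refine ((𝔇.lift x).φ_θ _ hx _).trans ?_
        refine (congrArg _ ((hφx x _ hx _).symm.trans (hφ V.U _ hV e).symm)).trans ?_
        exact lin_res E le_top (AOpen.pre_mono hV) _ }
  refine ⟨L, fun x => ⟨ψ x, ψ' x, h1 x, h2 x, hm x, hm' x, fun V h e => (hφx x V h e).symm⟩, hf,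
    fun x V h => ?_⟩
  refine LinearMap.ext fun e => (congrArg ((oneForm V).lTensor _) ?_).trans
    (map_zero ((oneForm V).lTensor _))
  exact sub_eq_zero.mpr (hlin' x V h e).symm

theorem exists_glue (h𝔇 : 𝔇.IsStrict) : ∃ (L : Lift E)
    (ψ : ∀ x, GrIso L.toLiftData (𝔇.lift x) (𝔘.U x).U le_top le_rfl),
    (∀ x y V (hx : V ≤ (𝔘.U x).U) (hy : V ≤ (𝔘.U y).U) e,
      (𝔇.f x y).hom.app V (le_inf hx hy) ((ψ x).hom.app V hx e) = (ψ y).hom.app V hy e) ∧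
    ∀ x (V : AOpen P.pair) (h : V ≤ 𝔘.U x),
      higgsDefect L.toLiftData (𝔇.lift x) V le_top h (HomSec.res h (ψ x).hom) = 0 := by
  obtain ⟨L, ψ, hf, hψ⟩ := h𝔇.exists_glue_liftData
  have hloc (x) (V : AOpen P.pair) (h : V ≤ 𝔘.U x) (e) : higgsSquare L V le_top e = 0 := by
    have h1 := dForm_higgsDefect L (𝔇.lift x) le_top h (HomSec.res h (ψ x).hom)
    rw [hψ, h𝔇.square] at h1
    have h2 : dForm L (𝔇.lift x) 1 V le_top h 0 = 0 := by
      have h0 := bracketForm_add (t := L.lin V le_top) (t' := (𝔇.lift x).lin V h) 1 0 0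
      rw [add_zero] at h0
      exact left_eq_add.mp h0
    have h3 := LinearMap.congr_fun (h1.symm.trans h2) e
    have h4 : ((ψ x).hom.app V.U h).rTensor (OmExt 2 V) (higgsSquare L V le_top e) = 0 := by
      have h5 : (0 : Γ((𝔇.lift x).M, V.U) ⊗[Γ(P.pair.Y, V.U)] OmExt 2 V) -
        ((ψ x).hom.app V.U h).rTensor (OmExt 2 V) (higgsSquare L V le_top e) = 0 := h3
      rwa [zero_sub, neg_eq_zero] at h5
    have h5 : (ψ x).inv.app V.U h ∘ₗ (ψ x).hom.app V.U h = LinearMap.id :=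
      LinearMap.ext fun e => congrArg (fun k : HomSec _ _ _ => k.app V.U h e) (ψ x).inv_hom
    have h6 := congrArg (((ψ x).inv.app V.U h).rTensor (OmExt 2 V)) h4
    rw [map_zero, ← LinearMap.rTensor_comp_apply, h5, LinearMap.rTensor_id_apply] at h6
    exact h6
  refine ⟨{ L with integrable := fun V _ => ?_ }, ψ, hf, hψ⟩
  refine L.toGradedBundle.evalMap_injective V.isAffine le_top (-2) ?_
  rw [map_zero]
  refine LinearMap.ext fun e => ?_
  obtain ⟨C⟩ := P.smoothPair.omExt_coords 2 V
  refine C.tres_eq_of_locally_eq fun p hp => ⟨V ⊓ 𝔘.U p, inf_le_left, ⟨hp, 𝔘.mem p⟩, ?_⟩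
  refine (fres_higgsSquare L le_top inf_le_left e).symm.trans ?_
  exact (hloc p _ inf_le_right _).trans (map_zero _).symm

end GluingData.IsStrict

end GlueLifts



section Strict

variable {P : Thickening.{u}} {E : GradedField P.red ⊤} {U₁ U₂ : P.pair.Y.Opens}
  {L : LiftData E U₁} {L' : LiftData E U₂} {U : AOpen P.pair}

theorem toForm₀_injective (h₁ : U.U ≤ U₁) {f g : HomSec L.M L'.M U.U}
    (h : (toForm₀ f : FormHom L L' 0 U) = toForm₀ g) : f = g := by
  refine L.toGradedBundle.hom_ext U.isAffine h₁ (LinearMap.ext fun e => ?_)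
  let ρ := TensorProduct.rid Γ(P.pair.Y, U.U) Γ(L'.M, U.U)
  have h1 := congrArg (fun F : FormHom L L' 0 U => ρ ((exteriorPower.zeroEquiv Γ(P.pair.Y, U.U)
    (Om U)).toLinearMap.lTensor Γ(L'.M, U.U) (F e))) h
  have h2 (k : HomSec L.M L'.M U.U) : ρ ((exteriorPower.zeroEquiv Γ(P.pair.Y, U.U)
      (Om U)).toLinearMap.lTensor Γ(L'.M, U.U) ((toForm₀ k : FormHom L L' 0 U) e)) =
      k.app U.U le_rfl e := by
    change ρ (_ ⊗ₜ (exteriorPower.zeroEquiv Γ(P.pair.Y, U.U) (Om U)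
      ((exteriorPower.zeroEquiv Γ(P.pair.Y, U.U) (Om U)).symm 1))) = _
    rw [LinearEquiv.apply_symm_apply]
    exact (TensorProduct.rid_tmul _ _).trans (one_smul _ _)
  exact (h2 f).symm.trans (h1.trans (h2 g))

theorem commutes_of_higgsDefect_eq_zero (h₁ : U.U ≤ U₁) (h₂ : U.U ≤ U₂)
    {f : HomSec L.M L'.M U.U} (h : higgsDefect L L' U h₁ h₂ f = 0) :
    Commutes L.toGradedField L'.toGradedField U h₁ h₂ (f.app U.U le_rfl) := by
  refine sub_eq_zero.mp (LinearMap.ext fun e => ?_)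
  exact ((exteriorPower.oneEquiv Γ(P.pair.Y, U.U) (Om U)).symm.lTensor Γ(L'.M, U.U)).injective
    ((LinearMap.congr_fun h e).trans (map_zero _).symm)

variable [SemiSeparated P.pair.Y] {𝔘 : Cover P} {𝔇 : GluingData E 𝔘}

theorem GluingData.Represents.isStrict (h : 𝔇.Represents 0) : 𝔇.IsStrict where
  comp x y z V hx hy hz e := by
    have h1 := h.comp₂₀ ![x, y, z]
    have h2 := toForm₀_injective (𝔘.inter_le _ 0)
      ((map_zero (iota _ _ 0 (𝔘.inter ![x, y, z]) _ _)).symm.trans h1 |>.symm.trans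
        toForm₀_zero.symm)
    have h3 := sub_eq_zero.mp (neg_eq_zero.mp h2)
    have hV : 𝔘.U x ⊓ 𝔘.U y ⊓ 𝔘.U z ≤ 𝔘.inter ![x, y, z] := Finset.le_inf' _ _ fun t _ => by
      fin_cases t
      exacts [inf_le_left.trans inf_le_left, inf_le_left.trans inf_le_right, inf_le_right]
    exact congrArg (fun k : HomSec (𝔇.lift x).M (𝔇.lift z).M (𝔘.inter ![x, y, z]).U => k.app V
      ((le_inf (le_inf hx hy) hz).trans hV) e) h3
  commutes x y V hx hy := by
    have hV : V ≤ 𝔘.inter ![x, y] := (le_inf hx hy : V ≤ 𝔘.U x ⊓ 𝔘.U y).trans (𝔘.le_inter_two x y)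
    have h1 := iota_res_higgsDefect _ _ hV (h.comp₁₁ ![x, y])
    refine commutes_of_higgsDefect_eq_zero (f := HomSec.res (le_inf hx hy) (𝔇.f x y).hom) hx hy ?_
    refine h1.symm.trans ?_
    exact (congrArg _ (map_zero (DRTerm.res E 1 hV))).trans (map_zero _)
  square x V hV := by
    have hV' : V ≤ 𝔘.inter (p := 0) fun _ => x := le_trans (b := 𝔘.U x) hV (𝔘.le_inter_one x)
    have h1 := iota_res_higgsSquare _ hV' (h.comp₀₂ fun _ => x)
    exact h1.symm.trans ((congrArg _ (map_zero (DRTerm.res E 2 hV'))).trans (map_zero _))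

end Strict

section LocalExistence

theorem LogPair.IsSmoothPair.exists_aOpen {P : LogPair.{u}} (hP : P.IsSmoothPair) (p : P.Y)
    {W : P.Y.Opens} (hp : p ∈ W) : ∃ U : AOpen P, p ∈ U.U ∧ U.U ≤ W := by
  obtain ⟨U, hpU, n, _, x, c, -, -, h0, h1⟩ := hP.coordinates p
  obtain ⟨V, hV, hpV, -⟩ := exists_isAffineOpen_mem_and_subset (x := P.π p) (U := ⊤) trivial
  obtain ⟨U', hU', hpU', hle⟩ := exists_isAffineOpen_mem_and_subset (x := p)
    (U := U.1 ⊓ P.π ⁻¹ᵁ V ⊓ W) ⟨⟨hpU, hpV⟩, hp⟩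
  refine ⟨⟨U', hU', ⟨V, hV, fun q hq => (hle hq).1.2⟩, fun a => ?_⟩, hpU', fun q hq => (hle hq).2⟩
  have h' : (⟨U', hU'⟩ : P.Y.affineOpens) ≤ U := fun q hq => (hle hq).1.1
  obtain ⟨f, hf⟩ : ∃ f, (P.D a).ideal U = Ideal.span {f} := by
    rcases hc : c a with _ | k
    · exact ⟨1, by rw [h0 a hc, Ideal.span_singleton_one]⟩
    · exact ⟨x k, h1 a k hc⟩
  exact ⟨rres h' f, by rw [← (P.D a).map_ideal h', hf, Ideal.map_span, Set.image_singleton]; rfl⟩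

variable {P : Thickening.{u}}

/-- Around each point of `X'` the bundle has a homogeneous basis. -/
theorem exists_basis_inv (E : GradedBundle P.red.Y ⊤) (p : P.pair.Y) :
    ∃ W : P.pair.Y.Opens, p ∈ W ∧ ∃ (n : ℕ) (b : Fin n → Γ(E.M, P.inv W)) (deg : Fin n → ℤ),
      ∀ (V : P.red.Y.Opens) (h : V ≤ P.inv W),
        Function.Bijective (fun c : Fin n → Γ(P.red.Y, V) => ∑ k, c k • mres E.M h (b k)) ∧
        ∀ ℓ : ℤ, E.Gr ℓ V = Submodule.span Γ(P.red.Y, V) {e | ∃ k, deg k = ℓ ∧ e = mres E.M h (b k)} := by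
  by_cases hp : ∃ q, P.i q = p
  · obtain ⟨q, rfl⟩ := hp
    obtain ⟨V, hqV, -, n, b, deg, hb⟩ := E.locally_basis q trivial
    obtain ⟨W, hW, e⟩ := P.i.isClosedEmbedding.isInducing.isOpen_iff.mp V.2
    have hWV : P.inv ⟨W, hW⟩ = V := Opens.ext e
    have hle : P.inv ⟨W, hW⟩ ≤ V := hWV.le
    refine ⟨⟨W, hW⟩, by change P.i q ∈ W; rw [← Set.mem_preimage, e]; exact hqV, n,
      fun k => mres E.M hle (b k), deg, fun V' h => ?_⟩
    simp only [mres_mres]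
    exact hb V' (h.trans hle)
  · have hemp : P.inv ⟨(Set.range P.i)ᶜ, P.i.isClosedEmbedding.isClosed_range.isOpen_compl⟩ ≤ ⊥ :=
      fun q hq => hq ⟨q, rfl⟩
    have hs {V : P.red.Y.Opens} (h : V ≤ ⊥) (s t : Γ(E.M, V)) : s = t :=
      mres_eq_of_locally_eq E.M fun q hq => (h hq).elim
    refine ⟨⟨(Set.range P.i)ᶜ, _⟩, hp, 0, Fin.elim0, Fin.elim0, fun V h =>
      ⟨⟨fun _ _ _ => Subsingleton.elim _ _, fun e => ⟨0, hs (h.trans hemp) _ _⟩⟩, fun ℓ => ?_⟩⟩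
    refine Submodule.ext fun e => ?_
    rw [hs (h.trans hemp) e 0]
    exact ⟨fun _ => zero_mem _, fun _ => zero_mem _⟩

theorem sum_smul_mres_freeCoord_symm {Y : Scheme.{u}} {n : ℕ} (W : Y.Opens)
    (c : Fin n → Γ(Y, W)) : ∑ k, c k • mres _ (le_top : W ≤ ⊤)
      ((freeCoord (Fin n) ⊤).symm (Pi.single k 1)) = (freeCoord (Fin n) W).symm c := by
  refine (freeCoord (Fin n) W).injective ?_
  rw [map_sum, LinearEquiv.apply_symm_apply]
  funext j
  rw [Finset.sum_apply, Finset.sum_eq_single j]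
  · rw [map_smul, Pi.smul_apply, freeCoord_mres, LinearEquiv.apply_symm_apply, Pi.single_eq_same,
      map_one, smul_eq_mul, mul_one]
  · intro k _ hk
    rw [map_smul, Pi.smul_apply, freeCoord_mres, LinearEquiv.apply_symm_apply,
      Pi.single_eq_of_ne hk.symm, map_zero, smul_zero]
  · simp

/-- The free graded bundle with basis vectors of given degrees. -/
def freeBundle (Y : Scheme.{u}) {n : ℕ} (deg : Fin n → ℤ) : GradedBundle Y ⊤ where
  M := freeMod Y (Fin n)
  Gr ℓ V :=
    { carrier := {e | ∀ k, deg k ≠ ℓ → freeCoord (Fin n) V e k = 0}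
      zero_mem' := fun k _ => rfl
      add_mem' := fun he he' k hk => by
        rw [map_add, Pi.add_apply, he k hk, he' k hk, add_zero]
      smul_mem' := fun r e he k hk => by
        rw [map_smul, Pi.smul_apply, he k hk, smul_zero] }
  res_mem ℓ V W h _ e he k hk := by
    rw [freeCoord_mres, he k hk, map_zero]
  of_locally_mem ℓ V _ e H k hk := rres_eq_of_locally_eq fun x hx => by
    obtain ⟨W, hW, hxW, he⟩ := H x hx
    refine ⟨W, hW, hxW, ?_⟩
    rw [← freeCoord_mres, he k hk, map_zero]
  locally_basis x _ := by
    refine ⟨⊤, trivial, le_rfl, n, fun k => (freeCoord (Fin n) ⊤).symm (Pi.single k 1), deg,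
      fun W h => ⟨?_, fun ℓ => le_antisymm (fun e he => ?_) (Submodule.span_le.mpr ?_)⟩⟩
    · rw [show (fun c : Fin n → Γ(Y, W) => ∑ k, c k • mres _ h ((freeCoord (Fin n) ⊤).symm
        (Pi.single k 1))) = (freeCoord (Fin n) W).symm from
        funext (sum_smul_mres_freeCoord_symm W)]
      exact (freeCoord (Fin n) W).symm.bijective
    · rw [← (freeCoord (Fin n) W).symm_apply_apply e,
        ← sum_smul_mres_freeCoord_symm]
      refine sum_mem fun k _ => ?_
      by_cases hk : deg k = ℓ
      · exact Submodule.smul_mem _ _ (Submodule.subset_span ⟨k, hk, rfl⟩)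
      · rw [he k hk, zero_smul]
        exact zero_mem _
    · rintro _ ⟨k, hk, rfl⟩ j hj
      rw [freeCoord_mres, LinearEquiv.apply_symm_apply, Pi.single_eq_of_ne, map_zero]
      rintro rfl
      exact hj hk

/-- The underlying graded bundle with the zero field. -/
def GradedField.bare {P : LogPair.{u}} {U₀ : P.Y.Opens} (E : GradedField P U₀) :
    GradedField P U₀ :=
  { E.toGradedBundle with
    θ := fun _ _ => 0
    θ_res := fun _ _ _ _ => map_zero _ }

variable {E : GradedField P.red ⊤}

theorem exists_evalMap_lift {U₁ : P.pair.Y.Opens} (L : LiftData E.bare U₁) {U : AOpen P.pair}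
    (hU : U.U ≤ U₁) (t : EndGr E.toGradedBundle (-1) U.pre.U ⊗[Γ(P.red.Y, U.pre.U)] Om U.pre) :
    ∃ t' : EndGr L.toGradedBundle (-1) U.U ⊗[Γ(P.pair.Y, U.U)] Om U, ∀ e,
      TensorProduct.map (L.φ U.U hU) (Om.red U) (evalMap (EndGr.toLin L.toGradedBundle (-1) U.U) t' e) =
        evalMap (EndGr.toLin E.toGradedBundle (-1) U.pre.U) t (L.φ U.U hU e) := by
  induction t using TensorProduct.induction_on with
  | zero => exact ⟨0, fun e => by simp only [map_zero, LinearMap.zero_apply]; rfl⟩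
  | add x y hx hy =>
    obtain ⟨x', hx⟩ := hx
    obtain ⟨y', hy⟩ := hy
    exact ⟨x' + y', fun e => by simp only [map_add, LinearMap.add_apply, hx, hy]; rfl⟩
  | tmul g ω =>
    obtain ⟨g', hg', h⟩ := exists_homSec_lift L L (-1) U.isAffine hU hU g
    obtain ⟨ω', rfl⟩ := Om.red_surjective U ω
    exact ⟨⟨g', hg'⟩ ⊗ₜ ω', fun e => congrArg (· ⊗ₜ _) (h U.U le_rfl e)⟩

theorem nonempty_liftData_of_bare {U : AOpen P.pair} (L : LiftData E.bare U.U) :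
    Nonempty (LiftData E U.U) := by
  obtain ⟨t, ht⟩ := exists_evalMap_lift L le_rfl (E.θ U.pre le_top)
  let F : GradedField P.pair U.U :=
    { L.toGradedBundle with
      θ := fun V hV => TensorProduct.map (EndGr.res L.toGradedBundle (-1) hV)
        (Om.res (show V ≤ U from hV)) t
      θ_res := fun V W hV h => map_res_map_res L.toGradedBundle h hV t }
  refine ⟨{ F with
    φ := L.φ
    φ_res := L.φ_res
    φ_Gr := L.φ_Gr
    φ_iso := L.φ_iso
    φ_θ := fun V hV e => ?_ }⟩
  have hVU : V ≤ U := hV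
  obtain ⟨D⟩ := L.toGradedBundle.nonempty_dualBasis U.isAffine le_rfl
  let A : Γ(L.M, V.U) →ₛₗ[P.redHom V.U] Γ(E.M, V.pre.U) ⊗[Γ(P.red.Y, V.pre.U)] Om V.pre :=
    (TensorProduct.map (L.φ V.U hV) (Om.red V)).comp (F.lin V hV)
  let B : Γ(L.M, V.U) →ₛₗ[P.redHom V.U] Γ(E.M, V.pre.U) ⊗[Γ(P.red.Y, V.pre.U)] Om V.pre :=
    (E.lin V.pre le_top).comp (L.φ V.U hV)
  change A e = B e
  rw [← D.sum_eq V.U hV e, map_sum, map_sum]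
  refine Finset.sum_congr rfl fun k _ => ?_
  rw [map_smulₛₗ, map_smulₛₗ]
  refine congrArg (_ • ·) ?_
  refine (congrArg _ (evalMap_res L.toGradedBundle hVU t _)).trans ?_
  refine (L.map_φ_tres le_rfl hVU _).trans ((congrArg _ (ht _)).trans ?_)
  refine (lin_res E le_top (AOpen.pre_mono hVU) _).symm.trans ?_
  exact congrArg _ (L.φ_res U.U V.U le_rfl hV _)

/-- The semilinear homomorphism from a free module defined by sections. -/
def freeRed {N : P.red.Y.Modules} {n : ℕ} {V : P.pair.Y.Opens} (b : Fin n → Γ(N, P.inv V)) :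
    Γ(freeMod P.pair.Y (Fin n), V) →ₛₗ[P.redHom V] Γ(N, P.inv V) where
  toFun e := ∑ k, P.redHom V (freeCoord (Fin n) V e k) • b k
  map_add' e e' := by simp only [map_add, Pi.add_apply, add_smul, Finset.sum_add_distrib]
  map_smul' r e := by
    simp only [map_smul, Pi.smul_apply, smul_eq_mul, map_mul, mul_smul, Finset.smul_sum]

theorem freeRed_apply {N : P.red.Y.Modules} {n : ℕ} {V : P.pair.Y.Opens}
    (b : Fin n → Γ(N, P.inv V)) (e : Γ(freeMod P.pair.Y (Fin n), V)) :
    freeRed b e = ∑ k, P.redHom V (freeCoord (Fin n) V e k) • b k := rfl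

theorem mres_freeRed {N : P.red.Y.Modules} {n : ℕ} {V W : P.pair.Y.Opens} (h : W ≤ V)
    (b : Fin n → Γ(N, P.inv V)) (e : Γ(freeMod P.pair.Y (Fin n), V)) :
    mres N (inv_mono h) (freeRed b e) = freeRed (fun k => mres N (inv_mono h) (b k)) (mres _ h e) := by
  rw [freeRed_apply, freeRed_apply, map_sum]
  refine Finset.sum_congr rfl fun k _ => ?_
  rw [map_smulₛₗ, freeCoord_mres, redHom_rres]

theorem mem_ker_smul_free {n : ℕ} {V : P.pair.Y.Opens} {e : Γ(freeMod P.pair.Y (Fin n), V)}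
    (h : ∀ k, freeCoord (Fin n) V e k ∈ RingHom.ker (P.redHom V)) :
    e ∈ RingHom.ker (P.redHom V) • (⊤ : Submodule Γ(P.pair.Y, V) Γ(freeMod P.pair.Y (Fin n), V)) := by
  rw [← (freeCoord (Fin n) V).symm_apply_apply e, ← sum_smul_mres_freeCoord_symm]
  exact Submodule.sum_mem _ fun k _ => Submodule.smul_mem_smul (h k) trivial

theorem exists_liftData (E : GradedField P.red ⊤) (p : P.pair.Y) :
    ∃ U : AOpen P.pair, p ∈ U.U ∧ Nonempty (LiftData E U.U) := by
  obtain ⟨W, hpW, n, b, deg, hb⟩ := exists_basis_inv E.toGradedBundle p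
  obtain ⟨U, hpU, hUW⟩ := P.smoothPair.exists_aOpen p hpW
  refine ⟨U, hpU, nonempty_liftData_of_bare
    { (freeBundle P.pair.Y deg).restrict le_top with
      θ := fun _ _ => 0
      θ_res := fun _ _ _ _ => map_zero _
      φ := fun V hV =>
        freeRed fun k => mres E.M (inv_mono (hV.trans hUW)) (b k)
      φ_res := fun V V' hV h e => ?_
      φ_Gr := fun ℓ V hV e he => ?_
      φ_iso := fun x hx => ⟨U.U, le_rfl, hx, fun V h hV => ⟨fun m => ?_, fun e he => ?_⟩⟩
      φ_θ := fun V hV e => ?_ }⟩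
  · refine (mres_freeRed (N := E.M) h _ e).trans ?_
    simp only [mres_mres]
    rfl
  · refine (freeRed_apply (N := E.M) _ _).symm ▸ Submodule.sum_mem (E.Gr ℓ (P.inv V))
      (t := Finset.univ) fun k _ => ?_
    by_cases hk : deg k = ℓ
    · refine Submodule.smul_mem _ _ ?_
      rw [(hb (P.inv V) (inv_mono (hV.trans hUW))).2 ℓ]
      exact Submodule.subset_span ⟨k, hk, rfl⟩
    · rw [he k hk, map_zero, zero_smul]
      exact zero_mem _
  · obtain ⟨c, rfl⟩ := (hb (P.inv V) (inv_mono (h.trans hUW))).1.2 m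
    choose c' hc' using fun k => P.redHom_surjective hV (c k)
    obtain rfl : (fun k => P.redHom V (c' k)) = c := funext hc'
    exact ⟨(freeCoord (Fin n) V).symm c', rfl⟩
  · exact mem_ker_smul_free (congrFun ((hb (P.inv V) (inv_mono (h.trans hUW))).1.1
      (he.trans (Finset.sum_eq_zero fun k _ => zero_smul _ _).symm)))
  · exact (map_zero (TensorProduct.map _ _)).trans
      (LinearMap.congr_fun (map_zero (evalMap (EndGr.toLin E.toGradedBundle (-1) V.pre.U))) _).symm

theorem nonempty_localData [SemiSeparated P.pair.Y] (E : GradedField P.red ⊤) :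
    Nonempty (LocalData E) := by
  choose U hU hL using exists_liftData E
  let L x := (hL x).some
  exact ⟨⟨⟨U, hU⟩, L, fun x y =>
    (nonempty_grIso (L x) (L y) (U x ⊓ U y) inf_le_left inf_le_right).some⟩⟩

end LocalExistence



section Cohomology

variable {P : Thickening.{u}}

theorem OmExt.res_self {P : LogPair.{u}} (hP : P.IsSmoothPair) (k : ℕ) {U : AOpen P}
    (w : OmExt k U) : OmExt.res k (le_refl U) w = w := by
  have hw : w ∈ Submodule.span Γ(P.Y, U.U)
      (Set.range (exteriorPower.ιMulti Γ(P.Y, U.U) k (M := Om U))) := by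
    rw [exteriorPower.ιMulti_span]; trivial
  induction hw using Submodule.span_induction with
  | mem x hx =>
    obtain ⟨v, rfl⟩ := hx
    exact (extMap_ιMulti _ k v).trans (congrArg _ (funext fun t => Om.res_self hP (v t)))
  | zero => exact map_zero _
  | add x y _ _ hx hy => exact (map_add _ x y).trans (congrArg₂ (· + ·) hx hy)
  | smul r x _ hx =>
    exact ((OmExt.res k (le_refl U)).map_smulₛₗ r x).trans
      (congrArg₂ (· • ·) (rres_self (U := U.U) r) hx)

theorem DRTerm.res_self (E : GradedField P.red ⊤) (k : ℕ) {U : AOpen P.pair} (x : DRTerm E k U) :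
    DRTerm.res E k (le_refl U) x = x := by
  induction x using DRTerm.induction with
  | h0 => exact map_zero _
  | ha x y hx hy => exact (map_add _ x y).trans (congrArg₂ (· + ·) hx hy)
  | ht g r ω =>
    have hr : Ideal_I.res (le_refl U) r = r := by
      induction r using KerModule.induction with
      | h0 => exact map_zero _
      | ha x y hx hy => exact (map_add _ x y).trans (congrArg₂ (· + ·) hx hy)
      | hm a r =>
        exact congrArg₂ (KerModule.mk _) (rres_self (U := U.pre.U) a)
          (Subtype.ext (rres_self (U := U.U) r.1))
    rw [DRTerm.res_tmul, hr]
    exact congrArg (DRTerm.tmul _ _) (OmExt.res_self P.red_isSmoothPair k ω)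

variable [SemiSeparated P.pair.Y] (E : GradedField P.red ⊤) {𝔘 𝔙 𝔚 : Cover P}

instance : Nonempty (Cover P) := by
  choose U hU _ using fun p => P.smoothPair.exists_aOpen p (W := ⊤) trivial
  exact ⟨⟨U, hU⟩⟩

instance : IsDirectedOrder (Cover P) :=
  ⟨fun 𝔘 𝔙 => ⟨⟨fun x => 𝔘.U x ⊓ 𝔙.U x, fun x => ⟨𝔘.mem x, 𝔙.mem x⟩⟩,
    fun _ => inf_le_left, fun _ => inf_le_right⟩⟩

theorem refineC_refineC (h : 𝔘 ≤ 𝔙) (h' : 𝔙 ≤ 𝔚) (n : ℕ) (z : Cochain E 𝔘 n) :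
    refineC E h' n (refineC E h n z) = refineC E (h.trans h') n z :=
  funext fun x => funext fun _ => DRTerm.res_res E x.1.2 _ _ _

instance (n : ℕ) : DirectedSystem (fun 𝔘 : Cover P => CechH E 𝔘 n) fun _ _ h => refineH E h n where
  map_self 𝔘 x := by
    obtain ⟨z, rfl⟩ := QuotientAddGroup.mk_surjective x
    exact congrArg QuotientAddGroup.mk (Subtype.ext (funext fun x => funext fun _ =>
      DRTerm.res_self E x.1.2 _))
  map_map _ _ _ h h' x := by
    obtain ⟨z, rfl⟩ := QuotientAddGroup.mk_surjective x
    exact congrArg QuotientAddGroup.mk (Subtype.ext (refineC_refineC E h h' n z.1))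

namespace HypH

open Classical in
/-- The canonical map from the Čech hypercohomology of a covering. -/
def of (𝔘 : Cover P) (n : ℕ) : CechH E 𝔘 n →+ HypH E n :=
  AddCommGroup.DirectLimit.of (fun 𝔘 : Cover P => CechH E 𝔘 n) (fun _ _ h => refineH E h n) 𝔘

variable {E} {n : ℕ}

theorem refineC_mem (h : 𝔘 ≤ 𝔙) {z : Cochain E 𝔘 n} (hz : z ∈ cocycles E 𝔘 n) :
    refineC E h n z ∈ cocycles E 𝔙 n := (refineZ E h n ⟨z, hz⟩).2

theorem cls_refineC (h : 𝔘 ≤ 𝔙) {z : Cochain E 𝔘 n} (hz : z ∈ cocycles E 𝔘 n) :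
    cls E 𝔙 n (refineC E h n z) (refineC_mem h hz) = cls E 𝔘 n z hz := by
  classical
  exact AddCommGroup.DirectLimit.of_f (G := fun 𝔘 : Cover P => CechH E 𝔘 n)
    (f := fun _ _ h => refineH E h n) (hij := h) (x := QuotientAddGroup.mk ⟨z, hz⟩)

theorem cls_add {z z' : Cochain E 𝔘 n} (hz : z ∈ cocycles E 𝔘 n) (hz' : z' ∈ cocycles E 𝔘 n) :
    cls E 𝔘 n (z + z') (add_mem hz hz') = cls E 𝔘 n z hz + cls E 𝔘 n z' hz' :=
  map_add (of E 𝔘 n) (QuotientAddGroup.mk ⟨z, hz⟩ : CechH E 𝔘 n)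
    (QuotientAddGroup.mk ⟨z', hz'⟩)

theorem exists_cls (c : HypH E n) : ∃ 𝔘 z hz, c = cls E 𝔘 n z hz := by
  classical
  induction c using AddCommGroup.DirectLimit.induction_on with
  | ih 𝔘 x =>
    obtain ⟨z, rfl⟩ := QuotientAddGroup.mk_surjective x
    exact ⟨𝔘, z.1, z.2, rfl⟩

theorem exists_refineC_of_cls_eq_zero {z : Cochain E 𝔘 n} {hz : z ∈ cocycles E 𝔘 n}
    (h : cls E 𝔘 n z hz = 0) : ∃ (𝔙 : Cover P) (h : 𝔘 ≤ 𝔙), refineC E h n z ∈ coboundaries E 𝔙 n := by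
  classical
  obtain ⟨𝔙, h, h0⟩ := AddCommGroup.DirectLimit.of.zero_exact _ _ h
  exact ⟨𝔙, h, (QuotientAddGroup.eq_zero_iff (refineZ E h n ⟨z, hz⟩)).1 h0⟩

theorem cls_totalD {z : Cochain E 𝔘 n} (hz : totalD E 𝔘 n z ∈ cocycles E 𝔘 (n + 1)) :
    cls E 𝔘 (n + 1) (totalD E 𝔘 n z) hz = 0 := by
  have h0 : (QuotientAddGroup.mk ⟨totalD E 𝔘 n z, hz⟩ : CechH E 𝔘 (n + 1)) = 0 :=
    (QuotientAddGroup.eq_zero_iff _).2 ⟨z, rfl⟩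
  exact (congrArg (of E 𝔘 (n + 1)) h0).trans (map_zero _)

theorem cls_eq_of_eq_add {z z' w : Cochain E 𝔘 n} (hz : z ∈ cocycles E 𝔘 n)
    (hz' : z' ∈ cocycles E 𝔘 n) (h : z' = z + w) (hw : ∀ hw, cls E 𝔘 n w hw = 0) :
    cls E 𝔘 n z' hz' = cls E 𝔘 n z hz := by
  subst h
  have hw' : w ∈ cocycles E 𝔘 n := (add_mem_cancel_left hz).1 hz'
  rw [cls_add hz hw', hw, add_zero]

/-- Cocycles on two coverings that become cohomologous on a common refinement have the same
class. -/
theorem cls_eq {𝔘' : Cover P} (h : 𝔘 ≤ 𝔙) (h' : 𝔘' ≤ 𝔙) {z : Cochain E 𝔘 (n + 1)}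
    (hz : z ∈ cocycles E 𝔘 (n + 1)) {z' : Cochain E 𝔘' (n + 1)} (hz' : z' ∈ cocycles E 𝔘' (n + 1))
    {w : Cochain E 𝔙 n}
    (hw : refineC E h' (n + 1) z' = refineC E h (n + 1) z + totalD E 𝔙 n w) :
    cls E 𝔘' (n + 1) z' hz' = cls E 𝔘 (n + 1) z hz := by
  rw [← cls_refineC h hz, ← cls_refineC h' hz']
  exact cls_eq_of_eq_add _ _ hw fun _ => cls_totalD _

end HypH

end Cohomology



theorem GluingData.nonempty_forall_grIso {P : Thickening.{u}} {E : GradedField P.red ⊤} {𝔘 : Cover P}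
    (𝔇 𝔇' : GluingData E 𝔘) :
    Nonempty (∀ x, GrIso (𝔇.lift x) (𝔇'.lift x) (𝔘.U x).U le_rfl le_rfl) :=
  ⟨fun x => (nonempty_grIso (𝔇.lift x) (𝔇'.lift x) (𝔘.U x) le_rfl le_rfl).some⟩

section Obstruction

variable {P : Thickening.{u}} [SemiSeparated P.pair.Y] {E : GradedField P.red ⊤}
  {𝔘 𝔘' 𝔙 : Cover P}

theorem HomSec.res_neg_comp_sub {Y : Scheme.{u}} {M N K : Y.Modules} {U V : Y.Opens} (h : U ≤ V)
    (f : HomSec N K V) (g : HomSec M N V) (k : HomSec M K V) :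
    HomSec.res h (-(f.comp g - k)) =
      -((HomSec.res h f).comp (HomSec.res h g) - HomSec.res h k) := rfl

namespace GluingData

/-- The restriction of local data to a finer covering. -/
def refine (𝔇 : GluingData E 𝔘) (h : 𝔘 ≤ 𝔙) : GluingData E 𝔙 where
  lift x := (𝔇.lift x).restrict (h x)
  f x y := { (𝔇.f x y).res (inf_le_inf (h x) (h y)) with }

theorem Represents.refine {𝔇 : GluingData E 𝔘} {z : Cochain E 𝔘 2} (hz : 𝔇.Represents z)
    (h : 𝔘 ≤ 𝔙) : (𝔇.refine h).Represents (refineC E h 2 z) where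
  comp₂₀ s := by
    have h1 := (iota_res_toForm₀ (𝔘.inter_le s 0) (𝔘.inter_le s 2) (Cover.inter_mono h s)
      (hz.comp₂₀ s)).trans (congrArg (toForm₀ (L := 𝔇.lift (s 0)) (L' := 𝔇.lift (s 2)))
        (HomSec.res_neg_comp_sub _ _ _ _))
    exact Eq.trans (by rfl) (h1.trans (by rfl))
  comp₁₁ s := by
    exact iota_res_higgsDefect (𝔘.inter_le s 0) (𝔘.inter_le s 1) (Cover.inter_mono h s) (hz.comp₁₁ s)
  comp₀₂ s := by
    exact iota_res_higgsSquare (𝔘.inter_le s 0) (Cover.inter_mono h s) (hz.comp₀₂ s)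

theorem Represents.cls_eq {𝔇 : GluingData E 𝔘} {𝔇' : GluingData E 𝔘'} {z : Cochain E 𝔘 2}
    {z' : Cochain E 𝔘' 2} (hz : 𝔇.Represents z) (hz' : 𝔇'.Represents z') :
    HypH.cls E 𝔘' 2 z' hz'.mem_cocycles = HypH.cls E 𝔘 2 z hz.mem_cocycles := by
  obtain ⟨𝔙, h, h'⟩ := exists_ge_ge 𝔘 𝔘'
  obtain ⟨g⟩ := nonempty_forall_grIso (𝔇.refine h) (𝔇'.refine h')
  obtain ⟨w, hw⟩ := (𝔇.refine h).exists_differ (𝔇'.refine h') g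
  exact HypH.cls_eq h h' _ _ ((hz.refine h).eq_add_totalD (hz'.refine h') g hw.comp₁₀ hw.comp₀₁)

theorem Represents.exists_lift (hE : E.Integrable) {𝔇 : GluingData E 𝔘} {z : Cochain E 𝔘 2}
    (hz : 𝔇.Represents z) (h0 : HypH.cls E 𝔘 2 z hz.mem_cocycles = 0) : Nonempty (Lift E) := by
  obtain ⟨𝔙, h, w, hw⟩ := HypH.exists_refineC_of_cls_eq_zero h0
  obtain ⟨𝔇', g, hg⟩ := (𝔇.refine h).exists_perturb (-w)
  obtain ⟨z', hz'⟩ := 𝔇'.exists_represents hE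
  have h1 := (hz.refine h).eq_add_totalD hz' g hg.comp₁₀ hg.comp₀₁
  rw [map_neg, hw, add_neg_cancel] at h1
  subst h1
  obtain ⟨L, -⟩ := hz'.isStrict.exists_glue
  exact ⟨L⟩

end GluingData

/-- The local data obtained from a global lift by restriction. -/
def Lift.gluing (L : Lift E) (𝔘 : Cover P) : GluingData E 𝔘 where
  lift _ := L.restrict le_top
  f _ _ := { (LiftIso.refl L).toGrIso.res le_top with }

theorem Lift.gluing_represents (L : Lift E) (𝔘 : Cover P) : (L.gluing 𝔘).Represents 0 where
  comp₂₀ s := (map_zero _).trans (Eq.symm ((congrArg toForm₀ (HomSec.ext' fun V h e =>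
    (by
      change (-((HomSec.id L.M (𝔘.inter s).U).comp (HomSec.id L.M (𝔘.inter s).U) -
        HomSec.id L.M (𝔘.inter s).U)).app V h e = 0
      have : (HomSec.id L.M (𝔘.inter s).U).comp (HomSec.id L.M (𝔘.inter s).U) =
        HomSec.id L.M (𝔘.inter s).U := rfl
      rw [this, sub_self, neg_zero]
      rfl))).trans toForm₀_zero))
  comp₁₁ s := (map_zero _).trans (higgsDefect_id (L := L.toLiftData) (U := 𝔘.inter s) le_top).symm
  comp₀₂ s := (map_zero _).trans (Eq.symm ((congrArg (evalMap
    (EndGr.toLin L.toGradedBundle (-2) (𝔘.inter s).U)) (L.integrable (𝔘.inter s) le_top)).trans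
      (map_zero _)))

/-- A system of local data without its covering. -/
def LocalData.gluing (𝔇 : LocalData E) : GluingData E 𝔇.cover := ⟨𝔇.lift, 𝔇.f⟩

theorem LocalData.represents_iff {𝔇 : LocalData E} {z : Cochain E 𝔇.cover 2} :
    𝔇.Represents z ↔ 𝔇.gluing.Represents z :=
  ⟨fun h => ⟨fun s => (mem_iotaGraph_iff ..).1 (h.comp₂₀ s),
    fun s => (mem_iotaGraph_iff ..).1 (h.comp₁₁ s), fun s => (mem_iotaGraph_iff ..).1 (h.comp₀₂ s)⟩,
  fun h => ⟨fun s => (mem_iotaGraph_iff ..).2 (h.comp₂₀ s),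
    fun s => (mem_iotaGraph_iff ..).2 (h.comp₁₁ s), fun s => (mem_iotaGraph_iff ..).2 (h.comp₀₂ s)⟩⟩

/-- The obstruction class of a graded Higgs bundle. -/
theorem exists_obstruction (hE : E.Integrable) : ∃ ob : HypH E 2,
    (ob = 0 ↔ Nonempty (Lift E)) ∧ Nonempty (LocalData E) ∧
    ∀ 𝔇 : LocalData E, (∃ z, 𝔇.Represents z) ∧ ∀ z, 𝔇.Represents z →
      ∃ hz : z ∈ cocycles E 𝔇.cover 2, ob = HypH.cls E 𝔇.cover 2 z hz := by
  obtain ⟨𝔇₀⟩ := nonempty_localData E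
  obtain ⟨z₀, hz₀⟩ := 𝔇₀.gluing.exists_represents hE
  refine ⟨HypH.cls E 𝔇₀.cover 2 z₀ hz₀.mem_cocycles, ⟨hz₀.exists_lift hE, fun ⟨L⟩ => ?_⟩, ⟨𝔇₀⟩,
    fun 𝔇 => ⟨?_, fun z hz => ?_⟩⟩
  · exact ((L.gluing_represents 𝔇₀.cover).cls_eq hz₀).trans (map_zero (HypH.of E 𝔇₀.cover 2))
  · obtain ⟨z, hz⟩ := 𝔇.gluing.exists_represents hE
    exact ⟨z, LocalData.represents_iff.2 hz⟩
  · have hz' := LocalData.represents_iff.1 hz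
    exact ⟨hz'.mem_cocycles, hz'.cls_eq hz₀⟩

end Obstruction



section Differences

variable {P : Thickening.{u}} {E : GradedField P.red ⊤}

/-- The composition of isomorphisms of graded bundles. -/
def GrIso.comp {U₁ U₂ U₃ U : P.pair.Y.Opens} {L : LiftData E U₁} {L' : LiftData E U₂}
    {L'' : LiftData E U₃} {h₁ : U ≤ U₁} {h₂ : U ≤ U₂} {h₃ : U ≤ U₃} (g : GrIso L' L'' U h₂ h₃)
    (f : GrIso L L' U h₁ h₂) : GrIso L L'' U h₁ h₃ where
  hom := g.hom.comp f.hom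
  inv := f.inv.comp g.inv
  hom_inv := HomSec.ext' fun V h e => by
    have h1 := congrArg (fun k : HomSec L'.M L'.M U => k.app V h (g.inv.app V h e)) f.hom_inv
    have h2 := congrArg (fun k : HomSec L''.M L''.M U => k.app V h e) g.hom_inv
    exact (congrArg (g.hom.app V h) h1).trans h2
  inv_hom := HomSec.ext' fun V h e => by
    have h1 := congrArg (fun k : HomSec L'.M L'.M U => k.app V h (f.hom.app V h e)) g.inv_hom
    have h2 := congrArg (fun k : HomSec L.M L.M U => k.app V h e) f.inv_hom
    exact (congrArg (f.inv.app V h) h1).trans h2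
  hom_mem := comp_mem_homGr L'' g.hom_mem f.hom_mem
  inv_mem := comp_mem_homGr L f.inv_mem g.inv_mem
  φ_hom V h e := (g.φ_hom V h _).trans (f.φ_hom V h e)

section

variable {Y : Scheme.{u}} {U V : Y.Opens} {M N K M' N' : Y.Modules}

theorem HomSec.res_comp_sub_comp (h : U ≤ V) (g : HomSec N N' V) (f : HomSec M N V)
    (f' : HomSec M' N' V) (g' : HomSec M M' V) : HomSec.res h (g.comp f - f'.comp g') =
      (HomSec.res h g).comp (HomSec.res h f) - (HomSec.res h f').comp (HomSec.res h g') := rfl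

theorem HomSec.comp_sub_add_sub_comp {M'' N'' : Y.Modules} (f : HomSec M N U) (f' : HomSec M' N' U)
    (f'' : HomSec M'' N'' U) (a₀ : HomSec M M' U) (a₁ : HomSec N N' U) (b₀ : HomSec M' M'' U)
    (b₁ : HomSec N' N'' U) : (b₁.comp a₁).comp f - f''.comp (b₀.comp a₀) =
      (b₁.comp f' - f''.comp b₀).comp a₀ + b₁.comp (a₁.comp f - f'.comp a₀) :=
  HomSec.ext' fun V h e => by
    simp only [HomSec.comp, HomSec.sub_app, HomSec.add_app, LinearMap.sub_apply,
      LinearMap.add_apply, LinearMap.comp_apply, map_sub]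
    abel

theorem HomSec.comp_sub_comp_eq_add (f : HomSec M N U) (f' : HomSec M' N' U) (a₀ b₀ : HomSec M M' U)
    (a₁ b₁ : HomSec N N' U) : b₁.comp f - f'.comp b₀ =
      a₁.comp f - f'.comp a₀ + ((b₁ - a₁).comp f - f'.comp (b₀ - a₀)) :=
  HomSec.ext' fun V h e => by
    simp only [HomSec.comp, HomSec.sub_app, HomSec.add_app, LinearMap.sub_apply,
      LinearMap.add_apply, LinearMap.comp_apply, map_sub]
    abel

end

variable [SemiSeparated P.pair.Y] {𝔘 𝔙 : Cover P} {𝔇 𝔇' 𝔇'' : GluingData E 𝔘}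
  {g g₂ : ∀ x, GrIso (𝔇.lift x) (𝔇'.lift x) (𝔘.U x).U le_rfl le_rfl}
  {g' : ∀ x, GrIso (𝔇'.lift x) (𝔇''.lift x) (𝔘.U x).U le_rfl le_rfl} {w w₂ w' : Cochain E 𝔘 1}

/-- A cochain of degree `0` given by the differences of local isomorphisms. -/
def GluingData.IsSub (g g₂ : ∀ x,
    GrIso (𝔇.lift x) (𝔇'.lift x) (𝔘.U x).U le_rfl le_rfl)
    (c : Cochain E 𝔘 0) : Prop :=
  ∀ s : Fin 1 → P.pair.Y, iota (𝔇.lift (s 0)) (𝔇'.lift (s 0)) 0 (𝔘.inter s) (𝔘.inter_le s 0)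
    (𝔘.inter_le s 0) (c ⟨(0, 0), rfl⟩ s) =
      toForm₀ (HomSec.res (𝔘.inter_le s 0) (g₂ (s 0)).hom -
        HomSec.res (𝔘.inter_le s 0) (g (s 0)).hom)

namespace GluingData.Differ

theorem comp (h : 𝔇.Differ 𝔇' g w) (h' : 𝔇'.Differ 𝔇'' g' w') :
    𝔇.Differ 𝔇'' (fun x => (g' x).comp (g x)) (w + w') where
  comp₁₀ s := by
    have h1 := iota_toForm₀_comp (L := 𝔇.lift (s 0)) (L' := 𝔇'.lift (s 1)) (L'' := 𝔇''.lift (s 1))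
      (𝔘.inter_le s 0) (𝔘.inter_le s 1) (𝔘.inter_le s 1)
      ((g' (s 1)).res (𝔘.inter_le s 1)).φ_hom (h.comp₁₀ s)
    have h2 := iota_comp_toForm₀ (L := 𝔇.lift (s 0)) (L' := 𝔇'.lift (s 0)) (L'' := 𝔇''.lift (s 1))
      (𝔘.inter_le s 0) (𝔘.inter_le s 0) (𝔘.inter_le s 1)
      ((g (s 0)).res (𝔘.inter_le s 0)).φ_hom (h'.comp₁₀ s)
    refine (map_add _ _ _).trans ((add_comm _ _).trans ?_)
    refine (congrArg₂ (· + ·) h2 h1).trans ((toForm₀_add _ _).symm.trans (congrArg toForm₀ ?_))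
    exact (HomSec.comp_sub_add_sub_comp _ _ _ _ _ _ _).symm
  comp₀₁ s := by
    have h1 := (rTensor_iota (𝔇.lift (s 0)) (𝔇'.lift (s 0)) (𝔇''.lift (s 0)) 1
      (𝔘.inter_le s 0) (𝔘.inter_le s 0) (𝔘.inter_le s 0)
      (((g' (s 0)).res (𝔘.inter_le s 0)).φ_hom _ le_rfl) _).symm.trans
      (congrArg _ (h.comp₀₁ s))
    have h2 := (iota_comp (𝔇.lift (s 0)) (𝔇'.lift (s 0)) (𝔇''.lift (s 0)) 1
      (𝔘.inter_le s 0) (𝔘.inter_le s 0) (𝔘.inter_le s 0)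
      (((g (s 0)).res (𝔘.inter_le s 0)).φ_hom _ le_rfl) _).symm.trans
      (congrArg (· ∘ₗ _) (h'.comp₀₁ s))
    refine (map_add _ _ _).trans ((add_comm _ _).trans ((congrArg₂ (· + ·) h2 h1).trans ?_))
    exact (higgsDefect_comp (𝔇.lift (s 0)) (𝔇'.lift (s 0)) (𝔇''.lift (s 0)) _ _ _ _ _).symm

theorem eq_add_totalD (h : 𝔇.Differ 𝔇' g w) (h₂ : 𝔇.Differ 𝔇' g₂ w₂) {c : Cochain E 𝔘 0}
    (hc : IsSub g g₂ c) : w₂ = w + totalD E 𝔘 0 c := by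
  have face {r : ℕ} (s : Fin (r + 1) → P.pair.Y) (m : Fin 1 → Fin (r + 1)) {i : Fin (r + 1)}
      (hi : m 0 = i) : iota (𝔇.lift (s i)) (𝔇'.lift (s i)) 0 (𝔘.inter s) (𝔘.inter_le s i)
      (𝔘.inter_le s i) (faceRes c (p := 0) 0 rfl s m) =
      toForm₀ (HomSec.res (𝔘.inter_le s i) (g₂ (s i)).hom -
        HomSec.res (𝔘.inter_le s i) (g (s i)).hom) := by
    subst hi
    exact iota_res_toForm₀ _ _ (𝔘.inter_le_inter s m) (hc fun t => s (m t))
  refine Cochain.ext_one (fun s => ?_) (fun s => ?_)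
  · refine iota_injective (𝔇.lift (s 0)) (𝔇'.lift (s 1)) 0 (𝔘.inter s) (𝔘.inter_le s 0)
      (𝔘.inter_le s 1) ?_
    have h1 := iota_comp_toForm₀ (L := 𝔇.lift (s 0)) (L' := 𝔇.lift (s 1)) (L'' := 𝔇'.lift (s 1))
      (𝔘.inter_le s 0) (𝔘.inter_le s 1) (𝔘.inter_le s 1) (𝔇.hom_reduces s 0 1)
      (face s (Fin.succAbove 0) (i := 1) rfl)
    have h2 := iota_toForm₀_comp (L := 𝔇.lift (s 0)) (L' := 𝔇'.lift (s 0)) (L'' := 𝔇'.lift (s 1))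
      (𝔘.inter_le s 0) (𝔘.inter_le s 0) (𝔘.inter_le s 1) (𝔇'.hom_reduces s 0 1)
      (face s (Fin.succAbove 1) (i := 0) rfl)
    refine (h₂.comp₁₀ s).trans ((congrArg toForm₀ (HomSec.comp_sub_comp_eq_add _ _
      (HomSec.res (𝔘.inter_le s 0) (g (s 0)).hom) _
      (HomSec.res (𝔘.inter_le s 1) (g (s 1)).hom) _)).trans ((toForm₀_add _ _).trans (Eq.symm ?_)))
    refine (map_add _ _ _).trans (congrArg₂ (· + ·) (h.comp₁₀ s) ?_)
    refine (congrArg _ (totalD_zero_one_zero c s)).trans ((map_sub _ _ _).trans ?_)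
    exact (congrArg₂ (· - ·) h1 h2).trans (toForm₀_sub _ _).symm
  · refine iota_injective (𝔇.lift (s 0)) (𝔇'.lift (s 0)) 1 (𝔘.inter s) (𝔘.inter_le s 0)
      (𝔘.inter_le s 0) ?_
    refine (h₂.comp₀₁ s).trans (Eq.symm ((map_add _ _ _).trans ?_))
    refine (congrArg₂ (· + ·) (h.comp₀₁ s) ((congrArg _ (totalD_zero_zero_one c s)).trans
      ((iota_thetaEnd_toForm₀ _ _ (hc s)).trans (higgsDefect_sub _ _ _ _ _ _)))).trans ?_
    exact add_sub_cancel _ _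

variable (g g₂) in
theorem exists_isSub : ∃ c, IsSub g g₂ c := by
  choose c hc using fun s : Fin 1 → P.pair.Y => exists_iota_eq (𝔇.lift (s 0)) (𝔇'.lift (s 0)) 0
    (𝔘.inter_le s 0) (𝔘.inter_le s 0) _ (isGradedForm_toForm₀ (𝔘.inter_le s 0)
      (sub_mem ((g₂ (s 0)).res (𝔘.inter_le s 0)).hom_mem ((g (s 0)).res (𝔘.inter_le s 0)).hom_mem))
    fun e => φForm_toForm₀_sub (𝔘.inter_le s 0) (𝔘.inter_le s 0)
      ((g₂ (s 0)).res (𝔘.inter_le s 0)).φ_hom ((g (s 0)).res (𝔘.inter_le s 0)).φ_hom e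
  refine ⟨fun
    | ⟨(0, 0), _⟩, s => c s
    | ⟨(0, _ + 1), h⟩, _ => absurd h (by simp only; omega)
    | ⟨(_ + 1, _), h⟩, _ => absurd h (by simp only; omega), hc⟩

variable (g) in
theorem exists_isSub_of_cochain (c : Cochain E 𝔘 0) : ∃ g₂, IsSub (𝔇' := 𝔇') g g₂ c := by
  have key x : ∃ k : GrIso (𝔇.lift x) (𝔇'.lift x) (𝔘.inter (p := 0) fun _ => x).U
      (𝔘.inter_le (p := 0) (fun _ => x) 0) (𝔘.inter_le (p := 0) (fun _ => x) 0),
      iota (𝔇.lift x) (𝔇'.lift x) 0 (𝔘.inter fun _ => x) (𝔘.inter_le (p := 0) (fun _ => x) 0)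
      (𝔘.inter_le (p := 0) (fun _ => x) 0) (c ⟨(0, 0), rfl⟩ fun _ => x) =
      toForm₀ (k.hom - HomSec.res (𝔘.inter_le (p := 0) (fun _ => x) 0) (g x).hom) := by
    have hx := 𝔘.inter_le (p := 0) (fun _ => x) 0
    obtain ⟨ε, hε, hε0, hc⟩ := exists_toForm₀_eq_iota (L := 𝔇.lift x) (L' := 𝔇'.lift x)
      hx hx (c ⟨(0, 0), rfl⟩ fun _ => x)
    obtain ⟨k, hk⟩ := exists_grIso (L := 𝔇.lift x) (L' := 𝔇'.lift x) (𝔘.inter (p := 0) fun _ => x)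
      hx hx (f := ε + HomSec.res hx (g x).hom)
      (fun V h e => by
        rw [HomSec.add_app, LinearMap.add_apply, map_add, hε0 V h e, zero_add]
        exact (g x).φ_hom V (h.trans hx) e)
      (add_mem hε ((g x).res hx).hom_mem)
    exact ⟨k, hc.trans (congrArg toForm₀ (eq_sub_of_add_eq hk.symm))⟩
  choose k hk using key
  refine ⟨fun x => (k x).res (𝔘.le_inter_one x), fun s => ?_⟩
  obtain ⟨x, rfl⟩ : ∃ x, s = fun _ => x := ⟨s 0, funext fun t => by fin_cases t; rfl⟩
  exact hk x

theorem exists_add_totalD (h : 𝔇.Differ 𝔇' g w) (c : Cochain E 𝔘 0) :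
    ∃ g₂, IsSub g g₂ c ∧ 𝔇.Differ 𝔇' g₂ (w + totalD E 𝔘 0 c) := by
  obtain ⟨g₂, hg⟩ := exists_isSub_of_cochain g c
  obtain ⟨w₂, hw⟩ := 𝔇.exists_differ 𝔇' g₂
  have := h.eq_add_totalD hw hg
  exact ⟨g₂, hg, this ▸ hw⟩

theorem mem_cocycles (h : 𝔇.Differ 𝔇' g w) (h𝔇 : 𝔇.Represents 0) (h𝔇' : 𝔇'.Represents 0) :
    w ∈ cocycles E 𝔘 1 := by
  have := h𝔇.eq_add_totalD h𝔇' g h.comp₁₀ h.comp₀₁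
  rw [zero_add] at this
  exact this.symm

theorem refine (h : 𝔇.Differ 𝔇' g w) (h𝔙 : 𝔘 ≤ 𝔙) :
    (𝔇.refine h𝔙).Differ (𝔇'.refine h𝔙) (fun x => { (g x).res (h𝔙 x) with })
      (refineC E h𝔙 1 w) where
  comp₁₀ s := by
    have h1 := (iota_res_toForm₀ (𝔘.inter_le s 0) (𝔘.inter_le s 1) (Cover.inter_mono h𝔙 s)
      (h.comp₁₀ s)).trans (congrArg (toForm₀ (L := 𝔇.lift (s 0)) (L' := 𝔇'.lift (s 1)))
        (HomSec.res_comp_sub_comp _ _ _ _ _))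
    exact Eq.trans (by rfl) (h1.trans (by rfl))
  comp₀₁ s := by
    exact iota_res_higgsDefect (𝔘.inter_le s 0) (𝔘.inter_le s 0) (Cover.inter_mono h𝔙 s)
      (h.comp₀₁ s)

end GluingData.Differ

end Differences



theorem higgsDefect_eq_zero {P : Thickening.{u}} {E : GradedField P.red ⊤}
    {U₁ U₂ : P.pair.Y.Opens} {L : LiftData E U₁} {L' : LiftData E U₂}
    {U : AOpen P.pair} {h₁ : U.U ≤ U₁} {h₂ : U.U ≤ U₂} {f : HomSec L.M L'.M U.U}
    (h : Commutes L.toGradedField L'.toGradedField U h₁ h₂ (f.app U.U le_rfl)) :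
    higgsDefect L L' U h₁ h₂ f = 0 :=
  (congrArg ((oneForm U).lTensor _ ∘ₗ ·) (sub_eq_zero.2 h)).trans (LinearMap.comp_zero _)

section Torsor

variable {P : Thickening.{u}} [SemiSeparated P.pair.Y] {E : GradedField P.red ⊤}
  {𝔘 𝔘' 𝔙 : Cover P} {L L' L'' : Lift E}

theorem HomSec.eq_of_comp_eq_id {Y : Scheme.{u}} {M N : Y.Modules} {U : Y.Opens} {f : HomSec M N U}
    {a b : HomSec N M U} (ha : a.comp f = HomSec.id M U) (hb : f.comp b = HomSec.id N U) : a = b :=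
  have h1 : a.comp (f.comp b) = a := congrArg a.comp hb
  have h2 : (a.comp f).comp b = b := congrArg (HomSec.comp · b) ha
  h1.symm.trans h2

/-- The restrictions of an isomorphism of lifts to the members of a covering. -/
def LiftIso.localIso (F : LiftIso L L') (𝔘 : Cover P) (x : P.pair.Y) :
    GrIso ((L.gluing 𝔘).lift x) ((L'.gluing 𝔘).lift x) (𝔘.U x).U le_rfl le_rfl :=
  { F.toGrIso.res le_top with }

theorem LiftIso.differ (F : LiftIso L L') (𝔘 : Cover P) :
    (L.gluing 𝔘).Differ (L'.gluing 𝔘) (F.localIso 𝔘) 0 where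
  comp₁₀ _ := (map_zero _).trans ((congrArg toForm₀ (sub_self (HomSec.res le_top F.hom))).trans
    toForm₀_zero).symm
  comp₀₁ s := (map_zero _).trans (higgsDefect_eq_zero (L := L.toLiftData) (L' := L'.toLiftData)
    (f := HomSec.res le_top F.hom) (F.commutes (𝔘.inter s))).symm

variable {g : ∀ x, GrIso ((L.gluing 𝔘).lift x) ((L'.gluing 𝔘).lift x) (𝔘.U x).U le_rfl le_rfl}

theorem GluingData.Differ.exists_liftIso (h : (L.gluing 𝔘).Differ (L'.gluing 𝔘) g 0) :
    ∃ F : LiftIso L L', ∀ x, HomSec.res le_top F.hom = (g x).hom := by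
  have hg x y : HomSec.res (inf_le_left : (𝔘.U x).U ⊓ (𝔘.U y).U ≤ _) (g x).hom =
      HomSec.res inf_le_right (g y).hom := by
    have h1 := toForm₀_injective (L := L.toLiftData) (L' := L'.toLiftData) le_top
      ((h.comp₁₀ ![x, y]).symm.trans ((map_zero _).trans toForm₀_zero.symm))
    exact congrArg (HomSec.res (𝔘.le_inter_two x y)) (sub_eq_zero.1 h1).symm
  have hc (p : P.pair.Y) (_ : p ∈ (⊤ : P.pair.Y.Opens)) : ∃ x, p ∈ (𝔘.U x).U := ⟨p, 𝔘.mem p⟩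
  obtain ⟨f, hf⟩ := HomSec.exists_res_eq (fun x => (𝔘.U x).U) (fun _ => le_top) hc
    (fun x => (g x).hom) hg
  obtain ⟨f', hf'⟩ := HomSec.exists_res_eq (fun x => (𝔘.U x).U) (fun _ => le_top) hc
    (fun x => (g x).inv) fun x y => HomSec.eq_of_comp_eq_id
      (f := HomSec.res inf_le_left (g x).hom) (congrArg (HomSec.res inf_le_left) (g x).inv_hom)
      ((congrArg (HomSec.comp · _) (hg x y)).trans (congrArg (HomSec.res inf_le_right) (g y).hom_inv))
  have hloc (x) (V : P.pair.Y.Opens) (hV : V ≤ (𝔘.U x).U) (e) :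
      f.app V le_top e = (g x).hom.app V hV e := congrArg (fun k : HomSec _ _ _ => k.app V hV e) (hf x)
  have hloc' (x) (V : P.pair.Y.Opens) (hV : V ≤ (𝔘.U x).U) (e) :
      f'.app V le_top e = (g x).inv.app V hV e :=
    congrArg (fun k : HomSec _ _ _ => k.app V hV e) (hf' x)
  have hcomm (x) (V : AOpen P.pair) (hV : V ≤ 𝔘.U x) : Commutes L.toGradedField L'.toGradedField V
      le_top le_top (f.app V.U le_top) := by
    have hV' : V ≤ 𝔘.inter (p := 0) fun _ => x := le_trans (b := 𝔘.U x) hV (𝔘.le_inter_one x)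
    have h1 := iota_res_higgsDefect (L := L.toLiftData) (L' := L'.toLiftData) le_top le_top hV'
      (h.comp₀₁ fun _ => x)
    have h2 := commutes_of_higgsDefect_eq_zero (L := L.toLiftData) (L' := L'.toLiftData) le_top le_top
      (h1.symm.trans ((congrArg _ (map_zero (DRTerm.res E 1 hV'))).trans (map_zero _)))
    exact (LinearMap.ext (hloc x V.U hV) : f.app V.U le_top = (g x).hom.app V.U hV) ▸ h2
  refine ⟨{
    hom := f
    inv := f'
    hom_inv := HomSec.eq_of_locally_eq fun p hp => ⟨(𝔘.U p).U, le_top, 𝔘.mem p, ?_⟩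
    inv_hom := HomSec.eq_of_locally_eq fun p hp => ⟨(𝔘.U p).U, le_top, 𝔘.mem p, ?_⟩
    hom_mem := fun m V h e he => L'.of_locally_mem _ V le_top _ fun p hp =>
      ⟨V ⊓ (𝔘.U p).U, inf_le_left, ⟨hp, 𝔘.mem p⟩, ?_⟩
    inv_mem := fun m V h e he => L.of_locally_mem _ V le_top _ fun p hp =>
      ⟨V ⊓ (𝔘.U p).U, inf_le_left, ⟨hp, 𝔘.mem p⟩, ?_⟩
    φ_hom := fun V hV e => mres_eq_of_locally_eq _ fun p hp =>
      ⟨P.inv (V ⊓ (𝔘.U (P.i p)).U), inv_mono inf_le_left, ⟨hp, 𝔘.mem (P.i p)⟩, ?_⟩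
    commutes := fun V => LinearMap.ext fun e => ?_ }, hf⟩
  · exact (congrArg₂ HomSec.comp (hf p) (hf' p)).trans (g p).hom_inv
  · exact (congrArg₂ HomSec.comp (hf' p) (hf p)).trans (g p).inv_hom
  · rw [f.naturality, hloc p _ inf_le_right]
    exact (g p).hom_mem m _ inf_le_right _ (L.res_mem m V _ inf_le_left le_top e he)
  · rw [f'.naturality, hloc' p _ inf_le_right]
    exact (g p).inv_mem m _ inf_le_right _ (L'.res_mem m V _ inf_le_left le_top e he)
  · rw [L'.φ_res V _ le_top inf_le_left, L.φ_res V _ le_top inf_le_left, f.naturality,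
      hloc (P.i p) _ inf_le_right]
    exact (g (P.i p)).φ_hom _ inf_le_right _
  · obtain ⟨C⟩ := P.smoothPair.om_coords V
    refine C.tres_eq_of_locally_eq fun p hp => ⟨V ⊓ 𝔘.U p, inf_le_left, ⟨hp, 𝔘.mem p⟩, ?_⟩
    have h1 := LinearMap.congr_fun (hcomm p (V ⊓ 𝔘.U p) inf_le_right)
      (mres L.M (U := (V ⊓ 𝔘.U p).U) (V := V.U) inf_le_left e)
    refine (lin_res L'.toGradedField le_top inf_le_left _).symm.trans (Eq.trans ?_ (h1.trans ?_))
    · exact congrArg (L'.lin (V ⊓ 𝔘.U p) le_top) (f.naturality V.U (V ⊓ 𝔘.U p).U le_top inf_le_left e)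
    · exact (congrArg _ (lin_res L.toGradedField le_top inf_le_left e)).trans
        (tres_rTensor Om.res (V := V) inf_le_left le_top f (L.lin V le_top e))

theorem GluingData.Differ.mem_cocycles_lift {w : Cochain E 𝔘 1}
    (h : (L.gluing 𝔘).Differ (L'.gluing 𝔘) g w) : w ∈ cocycles E 𝔘 1 :=
  h.mem_cocycles (L.gluing_represents 𝔘) (L'.gluing_represents 𝔘)

theorem GluingData.Differ.cls_eq
    {g' : ∀ x, GrIso ((L.gluing 𝔘').lift x) ((L'.gluing 𝔘').lift x) (𝔘'.U x).U le_rfl le_rfl}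
    {w : Cochain E 𝔘 1} {w' : Cochain E 𝔘' 1} (h : (L.gluing 𝔘).Differ (L'.gluing 𝔘) g w)
    (h' : (L.gluing 𝔘').Differ (L'.gluing 𝔘') g' w') :
    HypH.cls E 𝔘' 1 w' h'.mem_cocycles_lift = HypH.cls E 𝔘 1 w h.mem_cocycles_lift := by
  obtain ⟨𝔙, i, i'⟩ := exists_ge_ge 𝔘 𝔘'
  have h1 : (L.gluing 𝔙).Differ (L'.gluing 𝔙) _ _ := h.refine i
  have h2 : (L.gluing 𝔙).Differ (L'.gluing 𝔙) _ _ := h'.refine i'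
  obtain ⟨c, hc⟩ := exists_isSub (𝔇 := L.gluing 𝔙) (𝔇' := L'.gluing 𝔙) _ _
  exact HypH.cls_eq i i' _ _ (h1.eq_add_totalD h2 hc)

variable (L L') in
theorem Lift.exists_diff : ∃ c : HypH E 1, ∀ 𝔘 g w
    (h : (L.gluing 𝔘).Differ (L'.gluing 𝔘) g w), c = HypH.cls E 𝔘 1 w h.mem_cocycles_lift := by
  let 𝔘 := Classical.arbitrary (Cover P)
  obtain ⟨g⟩ := (L.gluing 𝔘).nonempty_forall_grIso (L'.gluing 𝔘)
  obtain ⟨w, hw⟩ := (L.gluing 𝔘).exists_differ (L'.gluing 𝔘) g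
  exact ⟨HypH.cls E 𝔘 1 w hw.mem_cocycles_lift, fun _ _ _ h => h.cls_eq hw⟩

/-- The difference of two lifts in hypercohomology. -/
def Lift.diff (L L' : Lift E) : HypH E 1 := (L.exists_diff L').choose

theorem GluingData.Differ.diff_eq {w : Cochain E 𝔘 1} (h : (L.gluing 𝔘).Differ (L'.gluing 𝔘) g w) :
    L.diff L' = HypH.cls E 𝔘 1 w h.mem_cocycles_lift :=
  (L.exists_diff L').choose_spec 𝔘 g w h

namespace Lift

variable (L L' L'') in
theorem diff_add_diff : L.diff L' + L'.diff L'' = L.diff L'' := by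
  let 𝔘 := Classical.arbitrary (Cover P)
  obtain ⟨g⟩ := (L.gluing 𝔘).nonempty_forall_grIso (L'.gluing 𝔘)
  obtain ⟨w, hw⟩ := (L.gluing 𝔘).exists_differ (L'.gluing 𝔘) g
  obtain ⟨g'⟩ := (L'.gluing 𝔘).nonempty_forall_grIso (L''.gluing 𝔘)
  obtain ⟨w', hw'⟩ := (L'.gluing 𝔘).exists_differ (L''.gluing 𝔘) g'
  rw [hw.diff_eq, hw'.diff_eq, (hw.comp hw').diff_eq]
  exact (HypH.cls_add _ _).symm

theorem diff_eq_zero_iff : L.diff L' = 0 ↔ Nonempty (LiftIso L L') := by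
  refine ⟨fun h0 => ?_, fun ⟨F⟩ => (F.differ (Classical.arbitrary (Cover P))).diff_eq.trans
    (map_zero (HypH.of E _ 1))⟩
  let 𝔘 := Classical.arbitrary (Cover P)
  obtain ⟨g⟩ := (L.gluing 𝔘).nonempty_forall_grIso (L'.gluing 𝔘)
  obtain ⟨w, hw⟩ := (L.gluing 𝔘).exists_differ (L'.gluing 𝔘) g
  obtain ⟨𝔙, i, c, hc⟩ := HypH.exists_refineC_of_cls_eq_zero (hw.diff_eq.symm.trans h0)
  have h1 : (L.gluing 𝔙).Differ (L'.gluing 𝔙) _ _ := hw.refine i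
  obtain ⟨g₂, -, h2⟩ := h1.exists_add_totalD (-c)
  rw [map_neg, hc, add_neg_cancel] at h2
  obtain ⟨F, -⟩ := h2.exists_liftIso
  exact ⟨F⟩

variable (L) in
theorem exists_diff_eq (hE : E.Integrable) (c : HypH E 1) : ∃ L', L.diff L' = c := by
  obtain ⟨𝔘, z, hz, rfl⟩ := HypH.exists_cls c
  obtain ⟨𝔇, g, hg⟩ := (L.gluing 𝔘).exists_perturb z
  obtain ⟨z', hz'⟩ := 𝔇.exists_represents hE
  have h0 := (L.gluing_represents 𝔘).eq_add_totalD hz' g hg.comp₁₀ hg.comp₀₁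
  have hz0 : totalD E 𝔘 1 z = 0 := hz
  rw [hz0, add_zero] at h0
  subst h0
  obtain ⟨L', ψ, hψ, hψθ⟩ := hz'.isStrict.exists_glue
  let ψ' x : GrIso ((L'.gluing 𝔘).lift x) (𝔇.lift x) (𝔘.U x).U le_rfl le_rfl := { ψ x with }
  have h1 : (L'.gluing 𝔘).Differ 𝔇 ψ' 0 :=
    ⟨fun s => (map_zero _).trans ((congrArg toForm₀ (sub_eq_zero.2 (HomSec.ext' fun V hV e =>
        (hψ (s 0) (s 1) V (hV.trans (𝔘.inter_le s 0)) (hV.trans (𝔘.inter_le s 1)) e).symm))).trans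
          toForm₀_zero).symm,
      fun s => (map_zero _).trans (hψθ (s 0) (𝔘.inter s) (𝔘.inter_le s 0)).symm⟩
  obtain ⟨g'⟩ := (L.gluing 𝔘).nonempty_forall_grIso (L'.gluing 𝔘)
  obtain ⟨w, hw⟩ := (L.gluing 𝔘).exists_differ (L'.gluing 𝔘) g'
  obtain ⟨c, hc⟩ := GluingData.Differ.exists_isSub g (fun x => (ψ' x).comp (g' x))
  have h2 := hg.eq_add_totalD (hw.comp h1) hc
  rw [add_zero] at h2
  exact ⟨L', hw.diff_eq.trans (HypH.cls_eq_of_eq_add _ _ h2 fun _ => HypH.cls_totalD _)⟩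

end Lift

/-- A torsor from a difference function on representatives. -/
theorem exists_addTorsor {G : Type*} {X : Type*} [AddCommGroup G] [Nonempty X] (r : Setoid X)
    (d : X → X → G) (hadd : ∀ x y z, d x y + d y z = d x z) (h0 : ∀ x y, d x y = 0 ↔ r x y)
    (hs : ∀ x c, ∃ y, d x y = c) :
    ∃ t : AddTorsor G (Quotient r), ∀ x y, t.toVSub.vsub (Quotient.mk r y) (Quotient.mk r x) =
      d x y := by
  have hneg x y : d y x = -d x y := by
    rw [eq_neg_iff_add_eq_zero, hadd]
    exact (h0 y y).2 (r.refl y)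
  have hr {x y} (h : r x y) z : d x z = d y z := by rw [← hadd x y z, (h0 x y).2 h, zero_add]
  have hr' {x y} (h : r x y) z : d z x = d z y := by rw [hneg, hr h, ← hneg]
  choose s hs using hs
  have eq x y z (h : d x y = d x z) : r y z := (h0 y z).1 (by
    rw [← hadd y x z, hneg, h, neg_add_cancel])
  exact ⟨{
    vadd c := Quotient.map (fun x => s x c) fun x y h => eq x _ _ (by rw [hs, hr h, hs])
    vsub := Quotient.lift₂ (fun y x => d x y) fun a b a' b' h h' => by rw [hr h', hr' h]
    zero_vadd := Quotient.ind fun x => Quotient.sound (eq x _ _ (by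
      rw [hs, (h0 x x).2 (r.refl x)]))
    add_vadd c c' := Quotient.ind fun x => Quotient.sound (eq x _ _ (by
      rw [hs, ← hadd x (s x c'), hs, hs, add_comm]))
    nonempty := Nonempty.map (Quotient.mk r) ‹_›
    vsub_vadd' := Quotient.ind₂ fun y x => Quotient.sound (eq x _ _ (hs _ _))
    vadd_vsub' c := Quotient.ind fun x => hs x c }, fun _ _ => rfl⟩

theorem exists_torsor (hE : E.Integrable) (h : Nonempty (Lift E)) :
    ∃ torsor : AddTorsor (HypH E 1) (LiftClass E), ∀ L L' : Lift E,
      Nonempty (LocalIsos L L') ∧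
      ∀ 𝔇 : LocalIsos L L', (∃ z, 𝔇.Represents z) ∧
        ∀ z, 𝔇.Represents z → ∃ hz : z ∈ cocycles E 𝔇.cover 1,
          torsor.toVSub.vsub (Quotient.mk _ L') (Quotient.mk _ L) = HypH.cls E 𝔇.cover 1 z hz := by
  obtain ⟨t, ht⟩ := exists_addTorsor (liftSetoid E) Lift.diff Lift.diff_add_diff
    (fun _ _ => Lift.diff_eq_zero_iff) fun L => L.exists_diff_eq hE
  refine ⟨t, fun L L' => ⟨?_, fun 𝔇 => ?_⟩⟩
  · let 𝔘 := Classical.arbitrary (Cover P)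
    obtain ⟨g⟩ := (L.gluing 𝔘).nonempty_forall_grIso (L'.gluing 𝔘)
    exact ⟨𝔘, fun x => { g x with }⟩
  · have key z : 𝔇.Represents z ↔ (L.gluing 𝔇.cover).Differ (L'.gluing 𝔇.cover)
        (fun x => { 𝔇.f x with }) z :=
      ⟨fun h => ⟨fun s => (mem_iotaGraph_iff ..).1 (h.comp₁₀ s),
          fun s => (mem_iotaGraph_iff ..).1 (h.comp₀₁ s)⟩,
        fun h => ⟨fun s => (mem_iotaGraph_iff ..).2 (h.comp₁₀ s),
          fun s => (mem_iotaGraph_iff ..).2 (h.comp₀₁ s)⟩⟩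
    refine ⟨(GluingData.exists_differ _ _ _).imp fun z => (key z).2, fun z hz => ?_⟩
    have hz' := (key z).1 hz
    exact ⟨hz'.mem_cocycles_lift, (ht L L').trans hz'.diff_eq⟩

end Torsor



section Automorphisms

variable {P : Thickening.{u}} [SemiSeparated P.pair.Y] {E : GradedField P.red ⊤}
  {𝔘 𝔘' 𝔙 : Cover P} {L : Lift E}

theorem isIdAdd_iff {f : LiftIso L L} {z : Cochain E 𝔘 0} :
    IsIdAdd f z ↔ GluingData.IsSub ((1 : LiftIso L L).localIso 𝔘) (f.localIso 𝔘) z :=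
  ⟨fun h s => (mem_iotaGraph_iff ..).1 (h s), fun h s => (mem_iotaGraph_iff ..).2 (h s)⟩

theorem isIdAdd_iff_iota {f : LiftIso L L} {z : Cochain E 𝔘 0} :
    IsIdAdd f z ↔ ∀ s : Fin 1 → P.pair.Y, iota L.toLiftData L.toLiftData 0 (𝔘.inter s) le_top le_top
      (z ⟨(0, 0), rfl⟩ s) = toForm₀ (HomSec.res le_top f.hom - HomSec.id L.M (𝔘.inter s).U) :=
  forall_congr' fun _ => mem_iotaGraph_iff ..

theorem HomSec.res_sub_id {Y : Scheme.{u}} {M : Y.Modules} {U V W : Y.Opens} (h : U ≤ V) (h' : V ≤ W)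
    (f : HomSec M M W) : HomSec.res h (HomSec.res h' f - HomSec.id M V) =
      HomSec.res (h.trans h') f - HomSec.id M U := rfl

theorem HomSec.sub_id_comp_add {Y : Scheme.{u}} {M : Y.Modules} {U : Y.Opens} (f g : HomSec M M U) :
    (f - HomSec.id M U).comp g + (g - HomSec.id M U) = f.comp g - HomSec.id M U :=
  HomSec.ext' fun V h e => by
    simp only [HomSec.comp, HomSec.id, HomSec.sub_app, HomSec.add_app, LinearMap.sub_apply,
      LinearMap.add_apply, LinearMap.comp_apply, LinearMap.id_apply]
    abel

namespace IsIdAdd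

variable {f f' : LiftIso L L} {z z' : Cochain E 𝔘 0}

theorem mem_cocycles (h : IsIdAdd f z) : z ∈ cocycles E 𝔘 0 := by
  have := ((1 : LiftIso L L).differ 𝔘).eq_add_totalD (f.differ 𝔘) (isIdAdd_iff.1 h)
  rw [zero_add] at this
  exact this.symm

variable (f 𝔘) in
theorem exists_cochain : ∃ z : Cochain E 𝔘 0, IsIdAdd f z :=
  (GluingData.Differ.exists_isSub ((1 : LiftIso L L).localIso 𝔘) (f.localIso 𝔘)).imp
    fun _ => isIdAdd_iff.2

variable (L) in
theorem exists_liftIso (hz : z ∈ cocycles E 𝔘 0) : ∃ f : LiftIso L L, IsIdAdd f z := by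
  obtain ⟨g, hg, h⟩ := ((1 : LiftIso L L).differ 𝔘).exists_add_totalD z
  have hz0 : totalD E 𝔘 0 z = 0 := hz
  rw [hz0, add_zero] at h
  obtain ⟨f, hf⟩ := h.exists_liftIso
  refine ⟨f, isIdAdd_iff.2 fun s => (hg s).trans (congrArg toForm₀ (congrArg (· - _) ?_))⟩
  exact (congrArg (HomSec.res (𝔘.inter_le s 0)) (hf (s 0))).symm

theorem liftIso_eq (h : IsIdAdd f z) (h' : IsIdAdd f' z) : f = f' := by
  have hom : f.hom = f'.hom := HomSec.eq_of_locally_eq fun p _ => ⟨(𝔘.U p).U, le_top, 𝔘.mem p, by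
    have h1 := toForm₀_injective (L := L.toLiftData) (L' := L.toLiftData) le_top
      ((isIdAdd_iff.1 h fun _ => p).symm.trans (isIdAdd_iff.1 h' fun _ => p))
    exact congrArg (HomSec.res (𝔘.le_inter_one p)) (sub_left_injective h1)⟩
  exact LiftIso.ext hom (HomSec.eq_of_comp_eq_id f.inv_hom
    ((congrArg (HomSec.comp · f'.inv) hom).trans f'.hom_inv))

theorem refineC (h : IsIdAdd f z) (i : 𝔘 ≤ 𝔙) : IsIdAdd f (refineC E i 0 z) :=
  isIdAdd_iff_iota.2 fun s => (iota_res_toForm₀ (L := L.toLiftData) (L' := L.toLiftData) le_top le_top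
    (Cover.inter_mono i s) (isIdAdd_iff_iota.1 h s)).trans
      (congrArg toForm₀ (HomSec.res_sub_id _ _ f.hom))

theorem unique (h : IsIdAdd f z) (h' : IsIdAdd f z') : z = z' :=
  Cochain.ext_zero fun s => iota_injective L.toLiftData L.toLiftData 0 (𝔘.inter s) le_top le_top
    ((isIdAdd_iff_iota.1 h s).trans (isIdAdd_iff_iota.1 h' s).symm)

theorem one : IsIdAdd (1 : LiftIso L L) (0 : Cochain E 𝔘 0) :=
  isIdAdd_iff.2 fun _ => (map_zero _).trans ((congrArg toForm₀ (sub_self _)).trans toForm₀_zero).symm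

theorem mul (h : IsIdAdd f z) (h' : IsIdAdd f' z') : IsIdAdd (f * f') (z + z') :=
  isIdAdd_iff_iota.2 fun s => by
    have h1 := iota_comp_toForm₀ (L := L.toLiftData) (L' := L.toLiftData) (L'' := L.toLiftData) le_top
      le_top le_top ((f'.toGrIso.res (le_top : (𝔘.inter s).U ≤ ⊤)).φ_hom) (isIdAdd_iff_iota.1 h s)
    exact (map_add _ _ _).trans ((congrArg₂ (· + ·) h1 (isIdAdd_iff_iota.1 h' s)).trans
      ((toForm₀_add _ _).symm.trans (congrArg toForm₀ (HomSec.sub_id_comp_add _ _))))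

theorem cls_eq {z' : Cochain E 𝔘' 0} (h : IsIdAdd f z) (h' : IsIdAdd f z') :
    HypH.cls E 𝔘 0 z h.mem_cocycles = HypH.cls E 𝔘' 0 z' h'.mem_cocycles := by
  obtain ⟨𝔙, i, i'⟩ := exists_ge_ge 𝔘 𝔘'
  rw [← HypH.cls_refineC i, ← HypH.cls_refineC i']
  congr 1
  exact (h.refineC i).unique (h'.refineC i')

end IsIdAdd

variable (L) in
/-- The group of infinitesimal automorphisms of a lift. -/
theorem exists_mulEquiv : ∃ e : Multiplicative (HypH E 0) ≃* LiftIso L L,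
    ∀ (𝔘 : Cover P) (z : Cochain E 𝔘 0) (hz : z ∈ cocycles E 𝔘 0),
      IsIdAdd (e (Multiplicative.ofAdd (HypH.cls E 𝔘 0 z hz))) z := by
  let 𝔘 := Classical.arbitrary (Cover P)
  choose z hz using fun f : LiftIso L L => IsIdAdd.exists_cochain 𝔘 f
  let Ψ : LiftIso L L →* Multiplicative (HypH E 0) :=
    MonoidHom.mk' (G := Multiplicative (HypH E 0)) (fun f =>
      .ofAdd (HypH.cls E 𝔘 0 (z f) (hz f).mem_cocycles)) fun f f' =>
      congrArg Multiplicative.ofAdd (((hz (f * f')).cls_eq ((hz f).mul (hz f'))).trans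
        (HypH.cls_add _ _))
  have hΨ {𝔙 : Cover P} {w : Cochain E 𝔙 0} {f : LiftIso L L} (h : IsIdAdd f w) :
      Ψ f = .ofAdd (HypH.cls E 𝔙 0 w h.mem_cocycles) :=
    congrArg Multiplicative.ofAdd ((hz f).cls_eq h)
  have hb : Function.Bijective Ψ := by
    refine ⟨(injective_iff_map_eq_one Ψ).2 fun f hf => ?_, fun c => ?_⟩
    · obtain ⟨𝔙, i, h0⟩ := HypH.exists_refineC_of_cls_eq_zero (congrArg Multiplicative.toAdd hf)
      have h1 : refineC E i 0 (z f) = 0 := h0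
      exact (h1 ▸ (hz f).refineC i : IsIdAdd f 0).liftIso_eq IsIdAdd.one
    · obtain ⟨𝔙, w, hw, h⟩ := HypH.exists_cls c.toAdd
      obtain ⟨f, hf⟩ := IsIdAdd.exists_liftIso L hw
      exact ⟨f, (hΨ hf).trans (congrArg Multiplicative.ofAdd h.symm)⟩
  refine ⟨(MulEquiv.ofBijective Ψ hb).symm, fun 𝔙 w hw => ?_⟩
  obtain ⟨f, hf⟩ := IsIdAdd.exists_liftIso L hw
  rw [← hΨ hf]
  exact ((MulEquiv.ofBijective Ψ hb).symm_apply_apply f).symm ▸ hf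

end Automorphisms

end

end HiggsDeformation

theorem mainTheorem3 (P : Thickening.{u}) [AlgebraicGeometry.IsNoetherian P.S]
    [SemiSeparated P.pair.Y] (E : GradedField P.red ⊤) (hE : E.Integrable) :
    (∃ ob : HypH E 2,
      (ob = 0 ↔ Nonempty (Lift E)) ∧
      Nonempty (LocalData E) ∧
      ∀ 𝔇 : LocalData E, (∃ z, 𝔇.Represents z) ∧
        ∀ z, 𝔇.Represents z → ∃ hz : z ∈ cocycles E 𝔇.cover 2, ob = HypH.cls E 𝔇.cover 2 z hz) ∧
    (Nonempty (Lift E) →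
      ∃ torsor : AddTorsor (HypH E 1) (LiftClass E), ∀ L L' : Lift E,
        Nonempty (LocalIsos L L') ∧
        ∀ 𝔇 : LocalIsos L L', (∃ z, 𝔇.Represents z) ∧
          ∀ z, 𝔇.Represents z → ∃ hz : z ∈ cocycles E 𝔇.cover 1,
            torsor.toVSub.vsub (Quotient.mk _ L') (Quotient.mk _ L) =
              HypH.cls E 𝔇.cover 1 z hz) ∧
    (∀ L : Lift E, ∃ e : Multiplicative (HypH E 0) ≃* LiftIso L L,
      ∀ (𝔘 : Cover P) (z : Cochain E 𝔘 0) (hz : z ∈ cocycles E 𝔘 0),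
        IsIdAdd (e (Multiplicative.ofAdd (HypH.cls E 𝔘 0 z hz))) z) :=
  ⟨exists_obstruction hE, exists_torsor hE, fun L => exists_mulEquiv L⟩
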